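/- **Setting.** Let $\Omega=(a,b)$ be a bounded interval, $T>0$, $f\in C^k([0,\infty);\mathbb R)$ with an integer $k\ge 3$, $m_0\ge 2$ an integer, $\alpha\in[0,2)$. For $\varepsilon\in(0,1]$ let $\psi=\psi^\varepsilon$ solve on $[0,T]$ the nonlinear Schrödinger equation with wave operator $$i\partial_t\psi-\varepsilon^2\partial_{tt}\psi+\partial_{xx}\psi+f(|\psi|^2)\psi=0\ \text{ in }\Omega,\qquad \psi|_{\partial\Omega}=0,\qquad \psi(0)=\psi_0,\quad \partial_t\psi(0)=\psi_1^\varepsilon:=i\big(\psi_0''+f(|\psi_0|^2)\psi_0\big)+\varepsilon^\alpha\omega^\varepsilon,$$ and let $\psi^s$ solve on $[0,T]$ the equation $i\partial_t\psi^s+\partial_{xx}\psi^s+f(|\psi^s|^2)\psi^s=0$ with $\psi^s|_{\partial\Omega}=0$, $\psi^s(0)=\psi_0$. Let $\mu_l=\pi l/(b-a)$, let $\hat\phi_l=\frac2{b-a}\int_a^b\phi(x)\sin(\mu_l(x-a))\,dx$, and let $H^m_s=\{\phi\in H^m(\Omega):\partial_x^{2j}\phi(a)=\partial_x^{2j}\phi(b)=0,\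 0\le 2j<m\}$ with $\|\phi\|_{H^m_s}^2=\sum_{l\ge1}\mu_l^{2m}|\hat\phi_l|^2$. Here $A\lesssim B$ means $A\le CB$ with $C$ independent of $\varepsilon\in(0,1]$ and of the discretization parameters. Assume (A) $1\lesssim\|\omega^\varepsilon\|_{H^{m_0}_s}\lesssim 1$ and $\psi_0\in H^{m_0+2}_s$; (B) $\|\psi\|_{L^\infty([0,T];L^\infty\cap H^{m_0}\cap H^1_0)}+\|\partial_t\psi\|_{L^\infty([0,T];H^1)}+\|\psi^s\|_{L^\infty([0,T];L^\infty\cap H^{m_0}\cap H^1_0)}\lesssim 1$, $\ \|\partial_{tt}\psi\|_{L^\infty([0,T];H^1)}\lesssim\varepsilon^{-(2-\alpha)}$, $\ \|\partial_t^j\psi^s\|_{L^\infty([0,T];H^1)}\lesssim1$ for $j=1,2$, and $\|\psi-\psi^s\|_{L^\infty([0,T];H^1)}\lesssim\varepsilon^2$. Put $M_1=\max\{\sup_{0<\varepsilon\le1}\|\psi^\varepsilon\|_{L^\infty([0,T]\times\Omega)},\ \|\psi^s\|_{L^\infty([0,T]\times\Omega)}\}$. **Scheme (EWI-SP).** For an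 integer $M\ge1$ put $h=(b-a)/M$ and $x_j=a+jh$; let $\tau>0$ and $t_n=n\tau$. For $u=(u_0,\dots,u_M)$ with $u_0=u_M=0$ put $\tilde u_l=\frac2M\sum_{j=1}^{M-1}u_j\sin(jl\pi/M)$, $(I_Mu)(x)=\sum_{l=1}^{M-1}\tilde u_l\sin(\mu_l(x-a))$ and $\|u\|_{l^\infty}=\max_{1\le j\le M-1}|u_j|$. Put $\beta_l^\pm=\frac{1\pm\sqrt{1+4\varepsilon^2\mu_l^2}}{2\varepsilon^2}$, $\delta_l=\beta_l^+-\beta_l^-$, $\mathrm{sinc}(s)=\sin(s)/s$ (with $\mathrm{sinc}(0)=1$), $\sigma_l^\pm=e^{i\tau\beta_l^\pm/2}\,\mathrm{sinc}(\tau\beta_l^\pm/2)$, and $$c_l^0=\frac{\beta_l^+e^{i\tau\beta_l^-}-\beta_l^-e^{i\tau\beta_l^+}}{\delta_l},\quad d_l^0=\tau e^{\frac{i\tau}{2\varepsilon^2}}\mathrm{sinc}\Big(\frac{\tau\delta_l}2\Big),\quad c_l=-e^{\frac{i\tau}{\varepsilon^2}},\quad d_l=2e^{\frac{i\tau}{2\varepsilon^2}}\cos\Big(\frac{\tau\delta_l}2\Big),$$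 $$p_l=\frac{-i\tau}{\varepsilon^2\delta_l}(\sigma_l^+-\sigma_l^-),\qquad q_l=\frac{\tau}{\varepsilon^2\delta_l}\Big(\frac{1-\sigma_l^+}{\beta_l^+}-\frac{1-\sigma_l^-}{\beta_l^-}\Big),$$ $$p_l^*=\frac{-i\tau e^{i\tau/\varepsilon^2}}{\varepsilon^2\delta_l}\big(\overline{\sigma_l^+}-\overline{\sigma_l^-}\big),\qquad q_l^*=\frac{\tau e^{i\tau/\varepsilon^2}}{\varepsilon^2\delta_l}\Big(\frac{1-\sigma_l^+}{e^{i\tau\beta_l^+}\beta_l^+}-\frac{1-\sigma_l^-}{e^{i\tau\beta_l^-}\beta_l^-}\Big).$$ Let $F(z)=f(|z|^2)z$, let $D^0=\big(f(|\psi_0|^2)+f'(|\psi_0|^2)|\psi_0|^2\big)\psi_1^\varepsilon+f'(|\psi_0|^2)\psi_0^2\,\overline{\psi_1^\varepsilon}$ on the grid, and $D^n=(F(\psi^n)-F(\psi^{n-1}))/\tau$ for $n\ge1$. The numerical solution $\psi^n=(\psi^n_0,\dots,\psi^n_M)$ with $\psi^n_0=\psi^n_M=0$ is given by $\psi^0_j=\psi_0(x_j)$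 and $\psi^{n+1}_j=\sum_{l=1}^{M-1}(\widetilde{\psi^{n+1}})_l\sin(jl\pi/M)$ for $1\le j\le M-1$, where $$(\widetilde{\psi^1})_l=c_l^0(\widetilde{\psi^0})_l+d_l^0(\widetilde{\psi_1^\varepsilon})_l+p_l\widetilde{F(\psi^0)}_l+q_l(\widetilde{D^0})_l,$$ $$(\widetilde{\psi^{n+1}})_l=c_l(\widetilde{\psi^{n-1}})_l+d_l(\widetilde{\psi^n})_l+p_l\widetilde{F(\psi^n)}_l+q_l(\widetilde{D^n})_l-p_l^*\widetilde{F(\psi^{n-1})}_l-q_l^*(\widetilde{D^{n-1}})_l\qquad(n\ge1).$$ **Theorem (ill-prepared initial data).** Let $m=\min\{m_0,k\}$ and $\psi^n_I=I_M(\psi^n)$. There are constants $0<\tau_0\le1$, $0<h_0\le\pi$ and $C>0$, independent of $\varepsilon$, $\tau$, $h$ and $n$, such that for all $\varepsilon\in(0,1]$, $0<h\le h_0$, $0<\tau\le\tau_0$ and all integers $0\le n\le T/\tau$: $$\|\psi(\cdot,t_n)-\psi^n_I\|_{L^2}\le C\Big(h^m+\frac{\tau^2}{\varepsilon^{2-\alpha}}\Big),\qquad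 \|\nabla(\psi(\cdot,t_n)-\psi^n_I)\|_{L^2}\le C\Big(h^{m-1}+\frac{\tau^2}{\varepsilon^{2-\alpha}}\Big),$$ $$\|\psi(\cdot,t_n)-\psi^n_I\|_{L^2}\le C(h^m+\tau^2+\varepsilon^2),\qquad \|\nabla(\psi(\cdot,t_n)-\psi^n_I)\|_{L^2}\le C(h^{m-1}+\tau^2+\varepsilon^2),$$ $$\|\psi^n\|_{l^\infty}\le M_1+1,$$ and consequently, uniformly in $\varepsilon$, $$\|\psi(\cdot,t_n)-\psi^n_I\|_{L^2}\le C\big(h^m+\tau^{4/(4-\alpha)}\big),\qquad \|\nabla(\psi(\cdot,t_n)-\psi^n_I)\|_{L^2}\le C\big(h^{m-1}+\tau^{4/(4-\alpha)}\big);$$ in particular the temporal error is $O(\tau)$ uniformly in $\varepsilon$ for $\alpha=0$. -/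

import Mathlib

open MeasureTheory Set

namespace EWISP

/-! ### Sobolev spaces on the bounded interval `(a, b)` -/

/-- `v` is the weak derivative of order `j` of `u` on the open interval `(a, b)`. -/
def IsWeakDeriv (a b : ℝ) (j : ℕ) (u v : ℝ → ℂ) : Prop :=
  LocallyIntegrableOn u (Ioo a b) ∧ LocallyIntegrableOn v (Ioo a b) ∧
    ∀ φ : ℝ → ℝ, ContDiff ℝ (⊤ : ℕ∞) φ → HasCompactSupport φ → tsupport φ ⊆ Ioo a b →
      ∫ x in Ioo a b, ((iteratedDeriv j φ x : ℝ) : ℂ) * u x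
        = (-1) ^ j * ∫ x in Ioo a b, ((φ x : ℝ) : ℂ) * v x

/-- The `L²(a, b)` norm. -/
noncomputable def l2Norm (a b : ℝ) (u : ℝ → ℂ) : ENNReal :=
  eLpNorm u 2 (volume.restrict (Ioo a b))

/-- The `L²(a, b)` norm of the weak derivative of order `j` of `u`; it is `∞` if there is no
weak derivative of order `j` (weak derivatives are unique almost everywhere, so the infimum is
taken over equal numbers). For `j = 1` this is the semi-`H¹` norm `‖∇u‖_{L²}`. -/
noncomputable def semiNorm (a b : ℝ) (j : ℕ) (u : ℝ → ℂ) : ENNReal :=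
  ⨅ (v : ℝ → ℂ) (_ : IsWeakDeriv a b j u v), l2Norm a b v

/-- The norm of `H^m(a, b)`; it is finite exactly on `H^m(a, b)`. -/
noncomputable def sobolevNorm (a b : ℝ) (m : ℕ) (u : ℝ → ℂ) : ENNReal :=
  (∑ j ∈ Finset.range (m + 1), semiNorm a b j u ^ 2) ^ (1 / 2 : ℝ)

/-- Membership in `H_s^m(a, b) = {u ∈ H^m : ∂ₓ^{2k} u = 0 at a and b for 0 ≤ 2k < m}`, for `m ≥ 1`.
Elements are identified with their continuous representative; the trace of the weak derivative of
order `2k` is the boundary value of its continuous representative. -/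
def MemHs (a b : ℝ) (m : ℕ) (u : ℝ → ℂ) : Prop :=
  ContinuousOn u (Icc a b) ∧ sobolevNorm a b m u < ⊤ ∧
    ∀ k : ℕ, 2 * k < m → ∃ v : ℝ → ℂ,
      IsWeakDeriv a b (2 * k) u v ∧ ContinuousOn v (Icc a b) ∧ v a = 0 ∧ v b = 0

/-- The frequency `μ_l = π l / (b - a)`. -/
noncomputable def mu (a b : ℝ) (l : ℕ) : ℝ := Real.pi * l / (b - a)

/-- The sine coefficient `2 / (b - a) * ∫_a^b u(x) sin(μ_l (x - a)) dx`. -/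
noncomputable def sineCoeff (a b : ℝ) (u : ℝ → ℂ) (l : ℕ) : ℂ :=
  ((2 / (b - a) : ℝ) : ℂ) * ∫ x in Ioo a b, u x * ((Real.sin (mu a b l * (x - a)) : ℝ) : ℂ)

/-- The norm `(∑_{l ≥ 1} μ_l^{2m} |û_l|²)^{1/2}` of `H_s^m(a, b)`. -/
noncomputable def hsNorm (a b : ℝ) (m : ℕ) (u : ℝ → ℂ) : ENNReal :=
  (∑' l : ℕ, ENNReal.ofReal (mu a b (l + 1) ^ (2 * m) * ‖sineCoeff a b u (l + 1)‖ ^ 2))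
    ^ (1 / 2 : ℝ)

/-- The norm of `L^∞([0, T]; X)` of a function `u` with `N t = ‖u(t)‖_X`. -/
noncomputable def timeSup (T : ℝ) (N : ℝ → ENNReal) : ENNReal :=
  essSup N (volume.restrict (Icc 0 T))

/-! ### The equations -/

/-- The nonlinear term `f(|z|²) z`. -/
noncomputable def nonlin (f : ℝ → ℝ) (z : ℂ) : ℂ := ((f (‖z‖ ^ 2) : ℝ) : ℂ) * z

/-- `v = ∂ₜ u` on `[0, T] × [a, b]`, where `u` is absolutely continuous in time. For `v` bounded
with values in `H¹(a, b)` this says `u ∈ W^{1,∞}(0, T; H¹)` with weak time derivative `v`, both being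
represented by functions that are continuous in `x`. Functions are written `u t x`. -/
structure IsTimeDeriv (a b T : ℝ) (u v : ℝ → ℝ → ℂ) : Prop where
  measurable : AEStronglyMeasurable (fun p : ℝ × ℝ => v p.1 p.2)
    (volume.restrict (Icc 0 T ×ˢ Icc a b))
  continuousOn : ∀ᵐ t ∂(volume.restrict (Icc 0 T)), ContinuousOn (v t) (Icc a b)
  integrable : ∀ x ∈ Icc a b, IntervalIntegrable (fun s => v s x) volume 0 T
  eq_integral : ∀ x ∈ Icc a b, ∀ t ∈ Icc 0 T, u t x = u 0 x + ∫ s in (0 : ℝ)..t, v s x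

/-- `ψ`, with time derivatives `ψt` and `ψtt`, solves on `[0, T]` the nonlinear Schrödinger equation
with wave operator `i ψ_t - ε² ψ_tt + ψ_xx + f(|ψ|²) ψ = 0` in `(a, b)` with zero boundary values and
initial data `ψ(0) = ψ₀`, `ψ_t(0) = ψ₁`. -/
structure IsNLSWSolution (a b T : ℝ) (f : ℝ → ℝ) (ε : ℝ) (ψ₀ ψ₁ : ℝ → ℂ)
    (ψ ψt ψtt : ℝ → ℝ → ℂ) : Prop where
  continuousOn : ∀ t ∈ Icc 0 T, ContinuousOn (ψ t) (Icc a b)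
  continuousOn_deriv : ∀ t ∈ Icc 0 T, ContinuousOn (ψt t) (Icc a b)
  timeDeriv : IsTimeDeriv a b T ψ ψt
  timeDeriv_two : IsTimeDeriv a b T ψt ψtt
  equation : ∀ᵐ t ∂(volume.restrict (Icc 0 T)), ∃ ψxx : ℝ → ℂ, IsWeakDeriv a b 2 (ψ t) ψxx ∧
    ∀ᵐ x ∂(volume.restrict (Ioo a b)),
      Complex.I * ψt t x - (ε : ℂ) ^ 2 * ψtt t x + ψxx x + nonlin f (ψ t x) = 0
  boundary : ∀ t ∈ Icc 0 T, ψ t a = 0 ∧ ψ t b = 0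
  initial : ∀ x ∈ Icc a b, ψ 0 x = ψ₀ x
  initial_deriv : ∀ x ∈ Ioo a b, ψt 0 x = ψ₁ x

/-- `ψ`, with time derivative `ψt`, solves on `[0, T]` the nonlinear Schrödinger equation
`i ψ_t + ψ_xx + f(|ψ|²) ψ = 0` in `(a, b)` with zero boundary values and `ψ(0) = ψ₀`. -/
structure IsNLSSolution (a b T : ℝ) (f : ℝ → ℝ) (ψ₀ : ℝ → ℂ) (ψ ψt : ℝ → ℝ → ℂ) : Prop where
  continuousOn : ∀ t ∈ Icc 0 T, ContinuousOn (ψ t) (Icc a b)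
  timeDeriv : IsTimeDeriv a b T ψ ψt
  equation : ∀ᵐ t ∂(volume.restrict (Icc 0 T)), ∃ ψxx : ℝ → ℂ, IsWeakDeriv a b 2 (ψ t) ψxx ∧
    ∀ᵐ x ∂(volume.restrict (Ioo a b)),
      Complex.I * ψt t x + ψxx x + nonlin f (ψ t x) = 0
  boundary : ∀ t ∈ Icc 0 T, ψ t a = 0 ∧ ψ t b = 0
  initial : ∀ x ∈ Icc a b, ψ 0 x = ψ₀ x

/-- The initial velocity `ψ₁^ε = i (ψ₀'' + f(|ψ₀|²) ψ₀) + ε^α ω^ε` on `(a, b)`. -/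
noncomputable def initVelocity (f : ℝ → ℝ) (α ε : ℝ) (ψ₀ ω : ℝ → ℂ) (x : ℝ) : ℂ :=
  Complex.I * (iteratedDeriv 2 ψ₀ x + nonlin f (ψ₀ x)) + ((ε ^ α : ℝ) : ℂ) * ω x

/-- Assumption (A) on the initial data: `1 ≲ ‖ω^ε‖_{H_s^{m₀}} ≲ 1` and `ψ₀ ∈ H_s^{m₀+2}`. -/
structure AssumptionA (a b : ℝ) (m₀ : ℕ) (ψ₀ : ℝ → ℂ) (ω : ℝ → ℝ → ℂ) : Prop where
  mem_init : MemHs a b (m₀ + 2) ψ₀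
  mem_pert : ∀ ε ∈ Ioc (0 : ℝ) 1, MemHs a b m₀ (ω ε)
  bounds : ∃ c C : ℝ, 0 < c ∧ ∀ ε ∈ Ioc (0 : ℝ) 1,
    ENNReal.ofReal c ≤ hsNorm a b m₀ (ω ε) ∧ hsNorm a b m₀ (ω ε) ≤ ENNReal.ofReal C

/-- The norm of `L^∞(a, b)`. -/
noncomputable def supNorm (a b : ℝ) (u : ℝ → ℂ) : ENNReal :=
  eLpNorm u ⊤ (volume.restrict (Ioo a b))

/-- Assumption (B) on the solutions `ψ ε` of the equation with wave operator and on the solution `ψs`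
of the limiting equation. Membership of `ψ ε t` and `ψs t` in `H_0^1` is the boundary condition in
the definition of a solution. -/
structure AssumptionB (a b T α : ℝ) (m₀ : ℕ) (ψ ψt ψtt : ℝ → ℝ → ℝ → ℂ)
    (ψs ψst ψstt : ℝ → ℝ → ℂ) : Prop where
  bounds : ∃ C : ℝ, ∀ ε ∈ Ioc (0 : ℝ) 1,
    timeSup T (fun t => supNorm a b (ψ ε t) + sobolevNorm a b m₀ (ψ ε t)) ≤ ENNReal.ofReal C ∧
    timeSup T (fun t => sobolevNorm a b 1 (ψt ε t)) ≤ ENNReal.ofReal C ∧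
    timeSup T (fun t => sobolevNorm a b 1 (ψtt ε t))
      ≤ ENNReal.ofReal (C / ε ^ (2 - min α 2)) ∧
    timeSup T (fun t => sobolevNorm a b 1 (fun x => ψ ε t x - ψs t x))
      ≤ ENNReal.ofReal (C * ε ^ 2)
  bounds_limit : ∃ C : ℝ,
    timeSup T (fun t => supNorm a b (ψs t) + sobolevNorm a b m₀ (ψs t)) ≤ ENNReal.ofReal C ∧
    timeSup T (fun t => sobolevNorm a b 1 (ψst t)) ≤ ENNReal.ofReal C ∧
    timeSup T (fun t => sobolevNorm a b 1 (ψstt t)) ≤ ENNReal.ofReal C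

/-- `M₁ = max {sup_{0 < ε ≤ 1} ‖ψ^ε‖_{L^∞([0,T]×Ω)}, ‖ψ^s‖_{L^∞([0,T]×Ω)}}`. -/
noncomputable def M₁ (a b T : ℝ) (ψ : ℝ → ℝ → ℝ → ℂ) (ψs : ℝ → ℝ → ℂ) : ENNReal :=
  max
    (⨆ ε ∈ Ioc (0 : ℝ) 1, eLpNorm (fun p : ℝ × ℝ => ψ ε p.1 p.2) ⊤
      (volume.restrict (Icc 0 T ×ˢ Ioo a b)))
    (eLpNorm (fun p : ℝ × ℝ => ψs p.1 p.2) ⊤ (volume.restrict (Icc 0 T ×ˢ Ioo a b)))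

/-! ### The exponential wave integrator sine pseudospectral scheme -/

/-- The mesh size `h = (b - a) / M`. -/
noncomputable def mesh (a b : ℝ) (M : ℕ) : ℝ := (b - a) / M

/-- The grid point `x_j = a + j h`. -/
noncomputable def grid (a b : ℝ) (M j : ℕ) : ℝ := a + j * mesh a b M

/-- The discrete sine coefficient `(2 / M) ∑_{j=1}^{M-1} u_j sin(j l π / M)`. Grid functions
`(u_0, …, u_M)` are functions of `j : ℕ` of which only the values for `j ≤ M` matter. -/
noncomputable def dst (M : ℕ) (u : ℕ → ℂ) (l : ℕ) : ℂ :=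
  ((2 / (M : ℝ) : ℝ) : ℂ) *
    ∑ j ∈ Finset.Ioo 0 M, u j * ((Real.sin (j * l * Real.pi / M) : ℝ) : ℂ)

/-- The sine interpolation `I_M u` of a grid function. -/
noncomputable def interp (a b : ℝ) (M : ℕ) (u : ℕ → ℂ) (x : ℝ) : ℂ :=
  ∑ l ∈ Finset.Ioo 0 M, dst M u l * ((Real.sin (mu a b l * (x - a)) : ℝ) : ℂ)

/-- `‖u‖_{l^∞} = max_{1 ≤ j ≤ M-1} |u_j|`. -/
noncomputable def linfNorm (M : ℕ) (u : ℕ → ℂ) : NNReal :=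
  (Finset.Ioo 0 M).sup fun j => ‖u j‖₊

section Coefficients

/-- `√(1 + 4 ε² μ²)`. -/
noncomputable def root (ε μ : ℝ) : ℝ := Real.sqrt (1 + 4 * ε ^ 2 * μ ^ 2)

noncomputable def betaPlus (ε μ : ℝ) : ℝ := (1 + root ε μ) / (2 * ε ^ 2)

noncomputable def betaMinus (ε μ : ℝ) : ℝ := (1 - root ε μ) / (2 * ε ^ 2)

/-- `δ = β⁺ - β⁻`. -/
noncomputable def gap (ε μ : ℝ) : ℝ := betaPlus ε μ - betaMinus ε μ

/-- `e^{iθ}`. -/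
noncomputable def cis (θ : ℝ) : ℂ := Complex.exp (Complex.I * θ)

/-- `σ(s) = e^{i s β / 2} sinc(s β / 2)` for `β = β⁺` or `β = β⁻`. -/
noncomputable def sigma (β s : ℝ) : ℂ := cis (s * β / 2) * (Real.sinc (s * β / 2) : ℝ)

noncomputable def c0 (ε τ μ : ℝ) : ℂ :=
  (betaPlus ε μ * cis (τ * betaMinus ε μ) - betaMinus ε μ * cis (τ * betaPlus ε μ)) / gap ε μ

noncomputable def d0 (ε τ μ : ℝ) : ℂ :=
  τ * cis (τ / (2 * ε ^ 2)) * (Real.sinc (τ * gap ε μ / 2) : ℝ)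

noncomputable def cc (ε τ : ℝ) : ℂ := -cis (τ / ε ^ 2)

noncomputable def dd (ε τ μ : ℝ) : ℂ :=
  2 * cis (τ / (2 * ε ^ 2)) * (Real.cos (τ * gap ε μ / 2) : ℝ)

noncomputable def pp (ε τ μ : ℝ) : ℂ :=
  -Complex.I * τ / (ε ^ 2 * gap ε μ) * (sigma (betaPlus ε μ) τ - sigma (betaMinus ε μ) τ)

noncomputable def qq (ε τ μ : ℝ) : ℂ :=
  τ / (ε ^ 2 * gap ε μ) *
    ((1 - sigma (betaPlus ε μ) τ) / betaPlus ε μ - (1 - sigma (betaMinus ε μ) τ) / betaMinus ε μ)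

noncomputable def ppStar (ε τ μ : ℝ) : ℂ :=
  -Complex.I * τ * cis (τ / ε ^ 2) / (ε ^ 2 * gap ε μ) *
    ((starRingEnd ℂ) (sigma (betaPlus ε μ) τ) - (starRingEnd ℂ) (sigma (betaMinus ε μ) τ))

noncomputable def qqStar (ε τ μ : ℝ) : ℂ :=
  τ * cis (τ / ε ^ 2) / (ε ^ 2 * gap ε μ) *
    ((1 - sigma (betaPlus ε μ) τ) / (cis (τ * betaPlus ε μ) * betaPlus ε μ)
      - (1 - sigma (betaMinus ε μ) τ) / (cis (τ * betaMinus ε μ) * betaMinus ε μ))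

end Coefficients

/-- The derivative at time `0` of the nonlinear term, `G(z) v + H(z) v̄` with
`G(z) = f(|z|²) + f'(|z|²) |z|²` and `H(z) = f'(|z|²) z²`. -/
noncomputable def nonlinDeriv (f : ℝ → ℝ) (z v : ℂ) : ℂ :=
  ((f (‖z‖ ^ 2) + derivWithin f (Ici 0) (‖z‖ ^ 2) * ‖z‖ ^ 2 : ℝ) : ℂ) * v
    + ((derivWithin f (Ici 0) (‖z‖ ^ 2) : ℝ) : ℂ) * z ^ 2 * (starRingEnd ℂ) v

/-- The grid function approximating the time derivative of the nonlinear term at time `t_n`: the exact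
derivative for `n = 0`, and the backward difference quotient of `f(|ψ^n|²) ψ^n` for `n ≥ 1`. -/
noncomputable def nonlinRate (a b : ℝ) (f : ℝ → ℝ) (τ : ℝ) (M : ℕ) (ψ₀ ψ₁ : ℝ → ℂ)
    (Ψ : ℕ → ℕ → ℂ) : ℕ → ℕ → ℂ
  | 0 => fun j => nonlinDeriv f (ψ₀ (grid a b M j)) (ψ₁ (grid a b M j))
  | n + 1 => fun j => (nonlin f (Ψ (n + 1) j) - nonlin f (Ψ n j)) / τ

/-- `Ψ n = ψ^n` (`n = 0, 1, 2, …`) are the grid functions computed by the exponential wave integrator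
sine pseudospectral scheme with `M` subintervals and time step `τ`, from the initial value `ψ₀` and
the initial velocity `ψ₁`. -/
structure IsEWISP (a b : ℝ) (f : ℝ → ℝ) (ε τ : ℝ) (M : ℕ) (ψ₀ ψ₁ : ℝ → ℂ)
    (Ψ : ℕ → ℕ → ℂ) : Prop where
  boundary : ∀ n, Ψ n 0 = 0 ∧ Ψ n M = 0
  init : ∀ j ∈ Finset.Ioo 0 M, Ψ 0 j = ψ₀ (grid a b M j)
  first : ∀ j ∈ Finset.Ioo 0 M, Ψ 1 j =
    ∑ l ∈ Finset.Ioo 0 M,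
      (c0 ε τ (mu a b l) * dst M (Ψ 0) l
        + d0 ε τ (mu a b l) * dst M (fun i => ψ₁ (grid a b M i)) l
        + pp ε τ (mu a b l) * dst M (fun i => nonlin f (Ψ 0 i)) l
        + qq ε τ (mu a b l) * dst M (nonlinRate a b f τ M ψ₀ ψ₁ Ψ 0) l)
      * ((Real.sin (j * l * Real.pi / M) : ℝ) : ℂ)
  step : ∀ n, 1 ≤ n → ∀ j ∈ Finset.Ioo 0 M, Ψ (n + 1) j =
    ∑ l ∈ Finset.Ioo 0 M,
      (cc ε τ * dst M (Ψ (n - 1)) l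
        + dd ε τ (mu a b l) * dst M (Ψ n) l
        + pp ε τ (mu a b l) * dst M (fun i => nonlin f (Ψ n i)) l
        + qq ε τ (mu a b l) * dst M (nonlinRate a b f τ M ψ₀ ψ₁ Ψ n) l
        - ppStar ε τ (mu a b l) * dst M (fun i => nonlin f (Ψ (n - 1) i)) l
        - qqStar ε τ (mu a b l) * dst M (nonlinRate a b f τ M ψ₀ ψ₁ Ψ (n - 1)) l)
      * ((Real.sin (j * l * Real.pi / M) : ℝ) : ℂ)

/-- The `L²` error `‖ψ(·, t) - I_M u‖_{L²}`. -/
noncomputable def errL2 (a b : ℝ) (M : ℕ) (φ : ℝ → ℂ) (u : ℕ → ℂ) : ENNReal :=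
  l2Norm a b (fun x => φ x - interp a b M u x)

/-- The semi-`H¹` error `‖∇(ψ(·, t) - I_M u)‖_{L²}`. -/
noncomputable def errH1 (a b : ℝ) (M : ℕ) (φ : ℝ → ℂ) (u : ℕ → ℂ) : ENNReal :=
  semiNorm a b 1 (fun x => φ x - interp a b M u x)

end EWISP

/-! Everything is done on sine coefficients. The coefficient `p` of frequency `μ` of the solution
obeys a linear second order equation in time, forced by the coefficient `g` of `F(ψ) = f(|ψ|²)ψ`.
Its characteristic roots satisfy `ε²β² - β - μ² = 0`. The pair `(p, p')` splits into two components
(`mode`), each of which obeys `w' = iβw + γg` with `|γ| = 1/(ε²|β⁺ - β⁻|) ≤ 1`. After the rotation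
`e^{iβt}` is filtered out, only the forcing moves a component, with a factor bounded uniformly in
`ε` and `μ` (`IsRootPair.hasDerivWithinAt_filtered`, `IsRootPair.norm_gain_le`). The scheme has the
same structure: its two-step recursion is the sum of two one-step exponential integrators
(`eq_numMode_add_numMode`), each exact for a forcing that is affine in time on the step. So the
error of a component grows in one step by at most `τ` times the defect of the forcing, without any
amplification (`IsModalSolution.l2_mode_sub_numMode_succ_le`). This is done in `ℓ²` with weights
`μ^s`; `s = 0` gives the `L²` error and `s = 1` the `H¹` error.

The defect has three parts: the aliasing error of the sine transform, of order `h^(m-s)`; a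
Lipschitz constant times the errors at the last two time levels; and the error of linear
extrapolation of `F(ψ)` in time. The last part is bounded in two ways
(`exists_gridH1_second_difference_le`). Directly, `∂ₜψ` has Lipschitz constant of order
`ε^{-(2-α)}`, which gives `τ²/ε^{2-α}`. By comparison with the limit `ψs`, which has bounded second
time derivative and is `ε²`-close to `ψ`, it is of order `τ² + ε²`. The first step, where only one
time level exists, has a defect of order `τ` in the worst case; this is harmless because it is
multiplied by `τ` only once.

A discrete Gronwall argument (`exists_convergence`) closes the estimate. The nonlinearity is
Lipschitz only on bounded sets, so the induction carries a maximum norm bound for the numerical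
solution. It comes from the discrete Sobolev inequality `norm_le_gridH1` and from the fact that the
smaller of the two temporal bounds is at most `2τ` whatever `ε` is. Taking the minimum of the two
bounds and separating the cases `ε ≥ τ^{2/(4-α)}` and `ε ≤ τ^{2/(4-α)}` gives the uniform rate.

The spatial order needs decay of the sine coefficients of `ψ`, that is, bounds in `H_s^m`, whereas
the assumed bounds in `H^{m₀}` say nothing about the traces of higher even derivatives. Only their
`H¹` part is used. The bounds in `H_s^m` are propagated from the initial data through the equation
for the modes, one derivative at a time (`exists_hsBound_succ`), with a tame estimate for `F ∘ u` in
which the highest norm enters linearly (`exists_hsBound_comp`). Oddness of `F` is what keeps `F ∘ u`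
in `H_s^m`. -/

namespace EWISP
/-! ### Finite `ℓ²` norms -/

section FiniteL2

variable {ι E F : Type*} [NormedAddCommGroup E] [NormedAddCommGroup F]

/-- The `ℓ²` norm of a finite family of vectors. -/
noncomputable def l2 (s : Finset ι) (w : ι → E) : ℝ := √(∑ i ∈ s, ‖w i‖ ^ 2)

theorem l2_nonneg (s : Finset ι) (w : ι → E) : 0 ≤ l2 s w := Real.sqrt_nonneg _

theorem l2_sq (s : Finset ι) (w : ι → E) : l2 s w ^ 2 = ∑ i ∈ s, ‖w i‖ ^ 2 :=
  Real.sq_sqrt (Finset.sum_nonneg fun _ _ => by positivity)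

/-- The space `PiLp 2` supplies the triangle inequality, the mean value inequality and the norm
bound for integrals; each is pulled back to `l2` through this identity. -/
theorem l2_eq_norm (s : Finset ι) (w : ι → E) :
    l2 s w = ‖(WithLp.toLp 2 (fun i : s => w i) : PiLp 2 (fun _ : s => E))‖ := by
  rw [PiLp.norm_eq_of_L2, l2, ← Finset.sum_coe_sort]

theorem l2_add_le (s : Finset ι) (v w : ι → E) : l2 s (fun i => v i + w i) ≤ l2 s v + l2 s w := by
  have h := norm_add_le (WithLp.toLp 2 (fun i : s => v i) : PiLp 2 (fun _ : s => E))
    (WithLp.toLp 2 (fun i : s => w i))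
  rw [← WithLp.toLp_add, ← l2_eq_norm, ← l2_eq_norm] at h
  rw [l2_eq_norm]
  exact h

theorem l2_sub_le (s : Finset ι) (v w : ι → E) : l2 s (fun i => v i - w i) ≤ l2 s v + l2 s w := by
  have h := norm_sub_le (WithLp.toLp 2 (fun i : s => v i) : PiLp 2 (fun _ : s => E))
    (WithLp.toLp 2 (fun i : s => w i))
  rw [← WithLp.toLp_sub, ← l2_eq_norm, ← l2_eq_norm] at h
  rw [l2_eq_norm]
  exact h

theorem l2_le_of_sum_le {s : Finset ι} {w : ι → E} {R : ℝ} (hR : 0 ≤ R)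
    (h : ∑ i ∈ s, ‖w i‖ ^ 2 ≤ R ^ 2) : l2 s w ≤ R :=
  Real.sqrt_le_iff.2 ⟨hR, h⟩

theorem l2_mono {s : Finset ι} {v : ι → E} {w : ι → F} (h : ∀ i ∈ s, ‖v i‖ ≤ ‖w i‖) :
    l2 s v ≤ l2 s w :=
  Real.sqrt_le_sqrt (Finset.sum_le_sum fun i hi => by gcongr; exact h i hi)

theorem l2_congr {s : Finset ι} {v : ι → E} {w : ι → F} (h : ∀ i ∈ s, ‖v i‖ = ‖w i‖) :
    l2 s v = l2 s w :=
  le_antisymm (l2_mono fun i hi => (h i hi).le) (l2_mono fun i hi => (h i hi).ge)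

theorem l2_le_mul {s : Finset ι} {v : ι → E} {w : ι → F} {c : ℝ} (hc : 0 ≤ c)
    (h : ∀ i ∈ s, ‖v i‖ ≤ c * ‖w i‖) : l2 s v ≤ c * l2 s w := by
  refine l2_le_of_sum_le (mul_nonneg hc (l2_nonneg _ _)) ?_
  rw [mul_pow, l2_sq, Finset.mul_sum]
  refine Finset.sum_le_sum fun i hi => ?_
  rw [← mul_pow]
  gcongr
  exact h i hi

theorem l2_mul_eq {s : Finset ι} {v : ι → E} {w : ι → F} {c : ℝ} (hc : 0 ≤ c)
    (h : ∀ i ∈ s, ‖v i‖ = c * ‖w i‖) : l2 s v = c * l2 s w := by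
  refine le_antisymm (l2_le_mul hc fun i hi => (h i hi).le) ?_
  rcases hc.eq_or_lt with rfl | hc'
  · simpa using l2_nonneg s v
  · rw [← le_div_iff₀' hc', div_eq_inv_mul]
    refine l2_le_mul (by positivity) fun i hi => ?_
    rw [h i hi, inv_mul_cancel_left₀ hc'.ne']

theorem l2_zero (s : Finset ι) : l2 s (fun _ => (0 : E)) = 0 := by simp [l2]

theorem continuousOn_l2 {X : Type*} [TopologicalSpace X] {K : Set X} (s : Finset ι) {w : X → ι → E}
    (h : ∀ i ∈ s, ContinuousOn (fun x => w x i) K) : ContinuousOn (fun x => l2 s (w x)) K :=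
  (continuousOn_finsetSum s fun i hi => ((h i hi).norm.pow 2)).sqrt

variable [NormedSpace ℝ E]

theorem hasDerivWithinAt_toLp {s : Finset ι} {V V' : ℝ → ι → E} {K : Set ℝ} {t : ℝ}
    (h : ∀ i ∈ s, HasDerivWithinAt (fun r => V r i) (V' t i) K t) :
    HasDerivWithinAt (fun r => (WithLp.toLp 2 (fun i : s => V r i) : PiLp 2 (fun _ : s => E)))
      (WithLp.toLp 2 (fun i : s => V' t i)) K t := by
  have h1 : HasDerivWithinAt (fun r => fun i : s => V r i) (fun i : s => V' t i) K t :=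
    hasDerivWithinAt_pi.2 fun i => h i i.2
  exact (PiLp.continuousLinearEquiv 2 ℝ (fun _ : s => E)).symm.toContinuousLinearMap.hasFDerivAt
    |>.comp_hasDerivWithinAt t h1

/-- Treating the family as one curve in a normed space keeps the constant independent of the number
of indices; estimating each coordinate separately would lose the dimension. -/
theorem l2_sub_le_of_hasDerivWithinAt {s : Finset ι} {V V' : ℝ → ι → E} {K : Set ℝ}
    (hK : Convex ℝ K) {C : ℝ}
    (h : ∀ t ∈ K, ∀ i ∈ s, HasDerivWithinAt (fun r => V r i) (V' t i) K t)
    (hC : ∀ t ∈ K, l2 s (V' t) ≤ C) {x y : ℝ} (hx : x ∈ K) (hy : y ∈ K) :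
    l2 s (fun i => V y i - V x i) ≤ C * |y - x| := by
  have := hK.norm_image_sub_le_of_norm_hasDerivWithin_le (𝕜 := ℝ)
    (fun t ht => hasDerivWithinAt_toLp (h t ht)) (C := C)
    (fun t ht => by rw [← l2_eq_norm]; exact hC t ht) hx hy
  rw [l2_eq_norm]
  exact this

/-- Minkowski's integral inequality: the coordinates of the vector valued integral are the integrals
of the coordinates, and the norm passes under the integral. -/
theorem l2_integral_le [CompleteSpace E] {s : Finset ι} {g : ℝ → ι → E} {x y C : ℝ}
    (hg : ∀ i ∈ s, IntervalIntegrable (fun r => g r i) volume x y)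
    (hC : ∀ᵐ r, r ∈ Set.uIoc x y → l2 s (g r) ≤ C) :
    l2 s (fun i => ∫ r in x..y, g r i) ≤ C * |y - x| := by
  let L := (PiLp.continuousLinearEquiv 2 ℝ (fun _ : s => E)).symm.toContinuousLinearMap
  have h1 : l2 s (fun i => ∫ r in x..y, g r i)
      = ‖∫ r in x..y, (WithLp.toLp 2 (fun i : s => g r i) : PiLp 2 (fun _ : s => E))‖ := by
    rw [l2_eq_norm]
    congr 1
    have hint : ∀ i : s, IntervalIntegrable (fun r => g r i) volume x y := fun i => hg i i.2
    have hpi : IntervalIntegrable (fun r => fun i : s => g r i) volume x y := by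
      constructor
      · exact Integrable.of_eval fun i => (hint i).1
      · exact Integrable.of_eval fun i => (hint i).2
    have h2 := L.intervalIntegral_comp_comm hpi
    have h3 : (∫ r in x..y, (fun i : s => g r i)) = fun i : s => ∫ r in x..y, g r i := by
      ext i
      have := (ContinuousLinearMap.proj (R := ℝ) (φ := fun _ : s => E) i).intervalIntegral_comp_comm
        hpi
      simpa using this.symm
    rw [h3] at h2
    exact h2.symm
  rw [h1]
  refine intervalIntegral.norm_integral_le_of_norm_le_const_ae ?_
  filter_upwards [hC] with r hr hr'
  rw [← l2_eq_norm]
  exact hr hr'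

/-- A mean value inequality with a variable bound. -/
theorem l2_le_of_hasDerivWithinAt {s : Finset ι} {V V' : ℝ → ι → E} {T : ℝ} {B B' : ℝ → ℝ}
    (h : ∀ t ∈ Icc 0 T, ∀ i ∈ s, HasDerivWithinAt (fun r => V r i) (V' t i) (Icc 0 T) t)
    (hB : ∀ t, HasDerivAt B (B' t) t) (h0 : l2 s (V 0) ≤ B 0)
    (hC : ∀ t ∈ Icc 0 T, l2 s (V' t) ≤ B' t) : ∀ t ∈ Icc 0 T, l2 s (V t) ≤ B t := by
  have hd : ∀ t ∈ Icc 0 T, HasDerivWithinAt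
      (fun r => (WithLp.toLp 2 (fun i : s => V r i) : PiLp 2 (fun _ : s => E)))
      (WithLp.toLp 2 (fun i : s => V' t i)) (Icc 0 T) t :=
    fun t ht => hasDerivWithinAt_toLp (h t ht)
  intro t ht
  rw [l2_eq_norm]
  refine image_norm_le_of_norm_deriv_right_le_deriv_boundary (a := 0) (b := T)
    (fun x hx => (hd x hx).continuousWithinAt) (f' := fun t => WithLp.toLp 2 (fun i : s => V' t i))
    (fun x hx => ?_) (by rw [← l2_eq_norm]; exact h0) hB
    (fun x hx => by rw [← l2_eq_norm]; exact hC x ⟨hx.1, hx.2.le⟩) ht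
  exact (hd x ⟨hx.1, hx.2.le⟩).mono_of_mem_nhdsWithin (Icc_mem_nhdsGE_of_mem hx)

end FiniteL2

/-! ### The discrete sine transform -/

section Discrete

/-- Multiplication by `2 sin φ` turns each cosine into a difference of consecutive sines, and the
sum telescopes. -/
theorem sum_cos_mul_sin (M : ℕ) (φ x : ℝ) :
    (∑ j ∈ Finset.range M, Real.cos (j * (2 * φ) + x)) * (2 * Real.sin φ)
      = Real.sin (M * (2 * φ) + x - φ) - Real.sin (x - φ) := by
  induction M with
  | zero => simp
  | succ n ih =>
    rw [Finset.sum_range_succ, add_mul, ih]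
    have h1 : Real.sin ((n + 1 : ℕ) * (2 * φ) + x - φ)
        = Real.sin ((n * (2 * φ) + x) + φ) := by congr 1; push_cast; ring
    have h2 : Real.sin (n * (2 * φ) + x - φ) = Real.sin ((n * (2 * φ) + x) - φ) := rfl
    rw [h1, h2, Real.sin_add, Real.sin_sub]
    ring

/-- The angle is nonzero and lies strictly between `-π` and `π`. The range of `k` covers all sums
and differences of two frequencies below `M`. -/
theorem sin_half_ne_zero {M : ℕ} (hM : 0 < M) {k : ℤ} (hk : k ≠ 0) (h1 : -(2 * M : ℤ) < k)
    (h2 : k < 2 * M) : Real.sin (k * Real.pi / (2 * M)) ≠ 0 := by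
  have hM' : (0 : ℝ) < M := by exact_mod_cast hM
  have h1' : -(2 * M : ℝ) < k := by exact_mod_cast h1
  have h2' : (k : ℝ) < 2 * M := by exact_mod_cast h2
  have hpi := Real.pi_pos
  rw [Ne, Real.sin_eq_zero_iff_of_lt_of_lt]
  · have : (k : ℝ) ≠ 0 := by exact_mod_cast hk
    positivity
  · rw [lt_div_iff₀ (by positivity)]; nlinarith
  · rw [div_lt_iff₀ (by positivity)]; nlinarith

theorem sum_cos_int {M : ℕ} (hM : 0 < M) {k : ℤ} (hk : k ≠ 0) (h1 : -(2 * M : ℤ) < k)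
    (h2 : k < 2 * M) :
    ∑ j ∈ Finset.range M, Real.cos (j * (k * Real.pi / M))
      = (1 - Real.cos (k * Real.pi)) / 2 := by
  have hs := sin_half_ne_zero hM hk h1 h2
  have hM' : (M : ℝ) ≠ 0 := by exact_mod_cast hM.ne'
  have h := sum_cos_mul_sin M (k * Real.pi / (2 * M)) 0
  have e1 : (M : ℝ) * (2 * (k * Real.pi / (2 * M))) + 0 - k * Real.pi / (2 * M)
      = k * Real.pi - k * Real.pi / (2 * M) := by field_simp; ring
  rw [e1, Real.sin_sub, Real.sin_int_mul_pi, zero_sub, Real.sin_neg] at h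
  have e2 : ∀ j : ℕ, (j : ℝ) * (2 * (k * Real.pi / (2 * M))) + 0 = j * (k * Real.pi / M) := by
    intro j; field_simp; ring
  simp only [e2] at h
  refine mul_right_cancel₀ (mul_ne_zero two_ne_zero hs) ?_
  rw [h]; ring

theorem sum_cos_half_int {M : ℕ} (hM : 0 < M) {k : ℤ} (hk : k ≠ 0) (h1 : -(2 * M : ℤ) < k)
    (h2 : k < 2 * M) :
    ∑ j ∈ Finset.range M, Real.cos ((j + 1 / 2) * (k * Real.pi / M)) = 0 := by
  have hs := sin_half_ne_zero hM hk h1 h2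
  have hM' : (M : ℝ) ≠ 0 := by exact_mod_cast hM.ne'
  have h := sum_cos_mul_sin M (k * Real.pi / (2 * M)) (k * Real.pi / (2 * M))
  have e1 : (M : ℝ) * (2 * (k * Real.pi / (2 * M))) + k * Real.pi / (2 * M) - k * Real.pi / (2 * M)
      = k * Real.pi := by field_simp; ring
  rw [e1, Real.sin_int_mul_pi, sub_self, Real.sin_zero, sub_zero] at h
  have e2 : ∀ j : ℕ, (j : ℝ) * (2 * (k * Real.pi / (2 * M))) + k * Real.pi / (2 * M)
      = (j + 1 / 2) * (k * Real.pi / M) := by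
    intro j; field_simp
  simp only [e2] at h
  exact (mul_eq_zero.1 h).resolve_right (mul_ne_zero two_ne_zero hs)

theorem sum_Ioo_eq_range {E : Type*} [AddCommMonoid E] {M : ℕ} (g : ℕ → E) (h0 : g 0 = 0) :
    ∑ j ∈ Finset.Ioo 0 M, g j = ∑ j ∈ Finset.range M, g j := by
  refine Finset.sum_subset (fun j hj => by simp at hj ⊢; exact hj.2) fun j hj hj' => ?_
  have : j = 0 := by simp at hj hj'; omega
  rw [this, h0]

theorem sum_sin_mul_sin {M l l' : ℕ} (hl : l ∈ Finset.Ioo 0 M) (hl' : l' ∈ Finset.Ioo 0 M) :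
    ∑ j ∈ Finset.Ioo 0 M, Real.sin (j * l * Real.pi / M) * Real.sin (j * l' * Real.pi / M)
      = if l = l' then (M : ℝ) / 2 else 0 := by
  obtain ⟨hl0, hlM⟩ := Finset.mem_Ioo.1 hl
  obtain ⟨hl0', hlM'⟩ := Finset.mem_Ioo.1 hl'
  have hM : 0 < M := by omega
  rw [sum_Ioo_eq_range _ (by simp)]
  have key : ∀ j : ℕ, Real.sin (j * l * Real.pi / M) * Real.sin (j * l' * Real.pi / M)
      = (Real.cos (j * (((l - l' : ℤ) : ℤ) * Real.pi / M))
        - Real.cos (j * (((l + l' : ℤ) : ℤ) * Real.pi / M))) / 2 := by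
    intro j
    have e1 : (j : ℝ) * (((l - l' : ℤ) : ℤ) * Real.pi / M)
        = j * l * Real.pi / M - j * l' * Real.pi / M := by push_cast; ring
    have e2 : (j : ℝ) * (((l + l' : ℤ) : ℤ) * Real.pi / M)
        = j * l * Real.pi / M + j * l' * Real.pi / M := by push_cast; ring
    rw [e1, e2, Real.cos_sub, Real.cos_add]; ring
  simp only [key]
  rw [← Finset.sum_div, Finset.sum_sub_distrib,
    sum_cos_int hM (k := (l + l' : ℤ)) (by omega) (by omega) (by omega)]
  -- `l + l'` and `l - l'` have the same parity, so the terms that remain in the two cosine sums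
  -- cancel.
  have hc : Real.cos (((l + l' : ℤ) : ℝ) * Real.pi) = Real.cos (((l - l' : ℤ) : ℝ) * Real.pi) := by
    rw [← Real.cos_sub_int_mul_two_pi _ l']
    congr 1; push_cast; ring
  split_ifs with h
  · subst h
    rw [hc]; simp
  · rw [sum_cos_int hM (k := (l - l' : ℤ)) (by omega) (by omega) (by omega), hc]
    simp

/-- Differences of neighbouring grid values of sines are cosines at cell midpoints, so this
orthogonality is what diagonalizes the discrete `H¹` norm. -/
theorem sum_cos_half_mul_cos_half {M l l' : ℕ} (hl : l ∈ Finset.Ioo 0 M)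
    (hl' : l' ∈ Finset.Ioo 0 M) :
    ∑ j ∈ Finset.range M, Real.cos ((j + 1 / 2) * (l * Real.pi / M))
        * Real.cos ((j + 1 / 2) * (l' * Real.pi / M))
      = if l = l' then (M : ℝ) / 2 else 0 := by
  obtain ⟨hl0, hlM⟩ := Finset.mem_Ioo.1 hl
  obtain ⟨hl0', hlM'⟩ := Finset.mem_Ioo.1 hl'
  have hM : 0 < M := by omega
  have key : ∀ j : ℕ, Real.cos ((j + 1 / 2) * (l * Real.pi / M))
        * Real.cos ((j + 1 / 2) * (l' * Real.pi / M))
      = (Real.cos ((j + 1 / 2) * (((l - l' : ℤ) : ℤ) * Real.pi / M))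
        + Real.cos ((j + 1 / 2) * (((l + l' : ℤ) : ℤ) * Real.pi / M))) / 2 := by
    intro j
    have e1 : ((j : ℝ) + 1 / 2) * (((l - l' : ℤ) : ℤ) * Real.pi / M)
        = (j + 1 / 2) * (l * Real.pi / M) - (j + 1 / 2) * (l' * Real.pi / M) := by push_cast; ring
    have e2 : ((j : ℝ) + 1 / 2) * (((l + l' : ℤ) : ℤ) * Real.pi / M)
        = (j + 1 / 2) * (l * Real.pi / M) + (j + 1 / 2) * (l' * Real.pi / M) := by push_cast; ring
    rw [e1, e2, Real.cos_sub, Real.cos_add]; ring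
  simp only [key]
  rw [← Finset.sum_div, Finset.sum_add_distrib,
    sum_cos_half_int hM (k := (l + l' : ℤ)) (by omega) (by omega) (by omega)]
  split_ifs with h
  · subst h; simp
  · rw [sum_cos_half_int hM (k := (l - l' : ℤ)) (by omega) (by omega) (by omega)]
    simp

theorem norm_sq_sum_mul_ofReal {ι : Type*} (s : Finset ι) (c : ι → ℂ) (T : ι → ℝ) :
    ‖∑ l ∈ s, c l * (T l : ℂ)‖ ^ 2
      = ∑ l ∈ s, ∑ l' ∈ s, (c l * (starRingEnd ℂ) (c l')).re * (T l * T l') := by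
  have h : ((‖∑ l ∈ s, c l * (T l : ℂ)‖ ^ 2 : ℝ) : ℂ)
      = ∑ l ∈ s, ∑ l' ∈ s, (c l * (starRingEnd ℂ) (c l')) * ((T l * T l' : ℝ) : ℂ) := by
    rw [Complex.ofReal_pow, ← Complex.mul_conj', map_sum, Finset.sum_mul_sum]
    refine Finset.sum_congr rfl fun l _ => Finset.sum_congr rfl fun l' _ => ?_
    simp only [map_mul, Complex.conj_ofReal, Complex.ofReal_mul]; ring
  have h2 := congrArg Complex.re h
  rw [Complex.ofReal_re] at h2
  rw [h2, Complex.re_sum]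
  refine Finset.sum_congr rfl fun l _ => ?_
  rw [Complex.re_sum]
  refine Finset.sum_congr rfl fun l' _ => ?_
  rw [Complex.re_mul_ofReal]

theorem sum_orthogonal {ι : Type*} [DecidableEq ι] (s : Finset ι) (c : ι → ℂ) (κ : ℝ) :
    ∑ l ∈ s, ∑ l' ∈ s, (c l * (starRingEnd ℂ) (c l')).re * (if l = l' then κ else 0)
      = κ * ∑ l ∈ s, ‖c l‖ ^ 2 := by
  rw [Finset.mul_sum]
  refine Finset.sum_congr rfl fun l hl => ?_
  simp only [mul_ite, mul_zero, Finset.sum_ite_eq, hl, if_true]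
  rw [Complex.mul_conj', mul_comm]
  norm_cast

theorem sum_norm_sq_of_orthogonal {ι J : Type*} [DecidableEq ι] (s : Finset ι) (t : Finset J)
    (c : ι → ℂ) (T : ι → J → ℝ) (κ : ℝ)
    (h : ∀ l ∈ s, ∀ l' ∈ s, ∑ j ∈ t, T l j * T l' j = if l = l' then κ else 0) :
    ∑ j ∈ t, ‖∑ l ∈ s, c l * (T l j : ℂ)‖ ^ 2 = κ * ∑ l ∈ s, ‖c l‖ ^ 2 := by
  simp only [norm_sq_sum_mul_ofReal]
  rw [← sum_orthogonal, Finset.sum_comm]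
  refine Finset.sum_congr rfl fun l hl => ?_
  rw [Finset.sum_comm]
  refine Finset.sum_congr rfl fun l' hl' => ?_
  rw [← Finset.mul_sum, h l hl l' hl']

variable {M : ℕ}

theorem dst_sum_sin (X : ℕ → ℂ) {l : ℕ} (hl : l ∈ Finset.Ioo 0 M) :
    dst M (fun j => ∑ l' ∈ Finset.Ioo 0 M, X l' * ((Real.sin (j * l' * Real.pi / M) : ℝ) : ℂ)) l
      = X l := by
  have hM : (M : ℝ) ≠ 0 := by
    have := Finset.mem_Ioo.1 hl
    exact_mod_cast (by omega : M ≠ 0)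
  unfold dst
  simp only [Finset.sum_mul]
  rw [Finset.sum_comm]
  have h : ∀ l' ∈ Finset.Ioo 0 M, ∑ j ∈ Finset.Ioo 0 M,
      X l' * ((Real.sin (j * l' * Real.pi / M) : ℝ) : ℂ) * ((Real.sin (j * l * Real.pi / M) : ℝ) : ℂ)
      = if l' = l then X l' * ((M / 2 : ℝ) : ℂ) else 0 := by
    intro l' hl'
    have := sum_sin_mul_sin hl' hl
    simp only [mul_assoc, ← Finset.mul_sum, ← Complex.ofReal_mul, ← Complex.ofReal_sum] at this ⊢
    rw [this]
    split_ifs <;> simp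
  rw [Finset.sum_congr rfl h, Finset.sum_ite_eq' _ l, if_pos hl]
  have hM' : (M : ℂ) ≠ 0 := by exact_mod_cast hM
  push_cast
  field_simp

/-- The kernel is symmetric in the position and the frequency, so up to normalization the transform
is its own inverse and `dst_sum_sin` applies with the roles exchanged. -/
theorem sum_dst_sin (u : ℕ → ℂ) {j : ℕ} (hj : j ∈ Finset.Ioo 0 M) :
    ∑ l ∈ Finset.Ioo 0 M, dst M u l * ((Real.sin (j * l * Real.pi / M) : ℝ) : ℂ) = u j := by
  have h := dst_sum_sin u hj
  unfold dst at h ⊢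
  rw [← h, Finset.mul_sum]
  refine Finset.sum_congr rfl fun l _ => ?_
  rw [mul_assoc]
  congr 2
  · refine Finset.sum_congr rfl fun i _ => ?_
    rw [mul_comm (i : ℝ) l]
  · rw [mul_comm (j : ℝ) l]

theorem sum_dst_sin_of_le (u : ℕ → ℂ) (h0 : u 0 = 0) (hM : u M = 0) {j : ℕ} (hj : j ≤ M) :
    ∑ l ∈ Finset.Ioo 0 M, dst M u l * ((Real.sin (j * l * Real.pi / M) : ℝ) : ℂ) = u j := by
  rcases Nat.eq_zero_or_pos j with rfl | hj0
  · simp [h0]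
  rcases hj.eq_or_lt with rfl | hj'
  · rw [hM]
    refine Finset.sum_eq_zero fun l _ => ?_
    have hj : (j : ℝ) ≠ 0 := by exact_mod_cast hj0.ne'
    rw [mul_assoc, mul_div_cancel_left₀ _ hj, Real.sin_nat_mul_pi]; simp
  · exact sum_dst_sin u (Finset.mem_Ioo.2 ⟨hj0, hj'⟩)

theorem dst_congr {u v : ℕ → ℂ} (h : ∀ j ∈ Finset.Ioo 0 M, u j = v j) (l : ℕ) :
    dst M u l = dst M v l := by
  unfold dst
  rw [Finset.sum_congr rfl fun j hj => by rw [h j hj]]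

theorem dst_add (u v : ℕ → ℂ) (l : ℕ) : dst M (fun j => u j + v j) l = dst M u l + dst M v l := by
  simp only [dst, add_mul, Finset.sum_add_distrib, mul_add]

theorem dst_sub (u v : ℕ → ℂ) (l : ℕ) : dst M (fun j => u j - v j) l = dst M u l - dst M v l := by
  simp only [dst, sub_mul, Finset.sum_sub_distrib, mul_sub]

theorem dst_const_mul (c : ℂ) (u : ℕ → ℂ) (l : ℕ) :
    dst M (fun j => c * u j) l = c * dst M u l := by
  simp only [dst, Finset.mul_sum]
  exact Finset.sum_congr rfl fun j _ => by ring

theorem sum_norm_sq_eq_dst (u : ℕ → ℂ) :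
    ∑ j ∈ Finset.Ioo 0 M, ‖u j‖ ^ 2 = M / 2 * ∑ l ∈ Finset.Ioo 0 M, ‖dst M u l‖ ^ 2 := by
  rw [← sum_norm_sq_of_orthogonal (Finset.Ioo 0 M) (Finset.Ioo 0 M) (dst M u)
    (fun l j => Real.sin (j * l * Real.pi / M)) (M / 2) fun l hl l' hl' => sum_sin_mul_sin hl hl']
  refine Finset.sum_congr rfl fun j hj => ?_
  rw [sum_dst_sin u hj]

/-- Subtracting two neighbouring sines produces `2 sin(lπ/(2M))` times a midpoint cosine; the rest
is Parseval. The boundary values must vanish so that the expansion also holds at both end points. -/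
theorem sum_norm_sq_diff_eq_dst (u : ℕ → ℂ) (h0 : u 0 = 0) (hM : u M = 0) :
    ∑ j ∈ Finset.range M, ‖u (j + 1) - u j‖ ^ 2
      = M / 2 * ∑ l ∈ Finset.Ioo 0 M,
        (2 * Real.sin (l * Real.pi / (2 * M))) ^ 2 * ‖dst M u l‖ ^ 2 := by
  rcases Nat.eq_zero_or_pos M with rfl | hMpos
  · simp
  have hM' : (M : ℝ) ≠ 0 := by exact_mod_cast hMpos.ne'
  have e : ∀ l : ℕ, (2 * Real.sin (l * Real.pi / (2 * M))) ^ 2 * ‖dst M u l‖ ^ 2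
      = ‖dst M u l * ((2 * Real.sin (l * Real.pi / (2 * M)) : ℝ) : ℂ)‖ ^ 2 := by
    intro l
    rw [norm_mul, mul_pow (‖dst M u l‖), Complex.norm_real, Real.norm_eq_abs, sq_abs, mul_comm]
  simp only [e]
  rw [← sum_norm_sq_of_orthogonal (Finset.Ioo 0 M) (Finset.range M)
    (fun l => dst M u l * ((2 * Real.sin (l * Real.pi / (2 * M)) : ℝ) : ℂ))
    (fun l j => Real.cos ((j + 1 / 2) * (l * Real.pi / M))) (M / 2)
    fun l hl l' hl' => sum_cos_half_mul_cos_half hl hl']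
  refine Finset.sum_congr rfl fun j hj => ?_
  have hj' : j + 1 ≤ M := by simpa [Nat.succ_le_iff] using hj
  rw [← sum_dst_sin_of_le u h0 hM hj', ← sum_dst_sin_of_le u h0 hM (Nat.le_of_succ_le hj'),
    ← Finset.sum_sub_distrib]
  congr 2
  refine Finset.sum_congr rfl fun l _ => ?_
  rw [mul_assoc (dst M u l), ← mul_sub, ← Complex.ofReal_mul, ← Complex.ofReal_sub]
  congr 2
  have a1 : ((j + 1 : ℕ) : ℝ) * l * Real.pi / M
      = (j + 1 / 2) * (l * Real.pi / M) + l * Real.pi / (2 * M) := by push_cast; field_simp; ring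
  have a2 : (j : ℝ) * l * Real.pi / M
      = (j + 1 / 2) * (l * Real.pi / M) - l * Real.pi / (2 * M) := by field_simp; ring
  rw [a1, a2, Real.sin_add, Real.sin_sub]; ring

end Discrete

/-! ### Discrete Sobolev norms of grid functions -/

section DiscreteSobolev

variable {E : Type*} [NormedAddCommGroup E] {a b : ℝ} {M : ℕ}

/-- The discrete semi-`H¹` norm of a grid function. -/
noncomputable def gridH1 (a b : ℝ) (M : ℕ) (w : ℕ → E) : ℝ :=
  (√(mesh a b M))⁻¹ * l2 (Finset.range M) (fun j => w (j + 1) - w j)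

theorem mesh_pos (hab : a < b) (hM : 1 ≤ M) : 0 < mesh a b M :=
  div_pos (sub_pos.2 hab) (by exact_mod_cast hM)

theorem mul_mesh (hM : 1 ≤ M) : M * mesh a b M = b - a := by
  have : (M : ℝ) ≠ 0 := by exact_mod_cast (by omega : M ≠ 0)
  unfold mesh; field_simp

theorem gridH1_nonneg (w : ℕ → E) : 0 ≤ gridH1 a b M w :=
  mul_nonneg (inv_nonneg.2 (Real.sqrt_nonneg _)) (l2_nonneg _ _)

theorem gridH1_sq (w : ℕ → E) :
    gridH1 a b M w ^ 2 = (√(mesh a b M))⁻¹ ^ 2 * ∑ j ∈ Finset.range M, ‖w (j + 1) - w j‖ ^ 2 := by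
  rw [gridH1, mul_pow, l2_sq]

theorem gridH1_add_le (v w : ℕ → E) :
    gridH1 a b M (fun j => v j + w j) ≤ gridH1 a b M v + gridH1 a b M w := by
  unfold gridH1
  rw [← mul_add]
  refine mul_le_mul_of_nonneg_left ?_ (inv_nonneg.2 (Real.sqrt_nonneg _))
  refine le_trans (le_of_eq ?_) (l2_add_le _ _ _)
  exact l2_congr fun i _ => congrArg _ (add_sub_add_comm _ _ _ _)

theorem gridH1_sub_le (v w : ℕ → E) :
    gridH1 a b M (fun j => v j - w j) ≤ gridH1 a b M v + gridH1 a b M w := by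
  unfold gridH1
  rw [← mul_add]
  refine mul_le_mul_of_nonneg_left ?_ (inv_nonneg.2 (Real.sqrt_nonneg _))
  refine le_trans (le_of_eq ?_) (l2_sub_le _ _ _)
  exact l2_congr fun i _ => congrArg _ (sub_sub_sub_comm _ _ _ _)

theorem gridH1_congr {v w : ℕ → E} (h : ∀ j ≤ M, v j = w j) :
    gridH1 a b M v = gridH1 a b M w := by
  unfold gridH1
  congr 1
  refine l2_congr fun j hj => ?_
  have hj : j < M := by simpa using hj
  rw [h j hj.le, h (j + 1) hj]

theorem gridH1_smul [NormedSpace ℝ E] (c : ℝ) (w : ℕ → E) :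
    gridH1 a b M (fun j => c • w j) = |c| * gridH1 a b M w := by
  unfold gridH1
  rw [l2_mul_eq (w := fun j => w (j + 1) - w j) (abs_nonneg c)
    (fun i _ => by rw [← smul_sub, norm_smul, Real.norm_eq_abs])]
  ring

/-- The discrete Sobolev inequality. -/
theorem norm_le_gridH1 (hab : a < b) {w : ℕ → E} (h0 : w 0 = 0) {j : ℕ} (hj : j ≤ M) :
    ‖w j‖ ≤ √(b - a) * gridH1 a b M w := by
  rcases Nat.eq_zero_or_pos M with rfl | hM
  · have : j = 0 := by omega
    rw [this, h0, norm_zero]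
    exact mul_nonneg (Real.sqrt_nonneg _) (gridH1_nonneg _)
  have hh : 0 < mesh a b M := mesh_pos hab hM
  have h1 : ‖w j‖ ≤ ∑ i ∈ Finset.range M, ‖w (i + 1) - w i‖ := by
    have : w j = ∑ i ∈ Finset.range j, (w (i + 1) - w i) := by
      rw [Finset.sum_range_sub, h0, sub_zero]
    rw [this]
    refine (norm_sum_le _ _).trans ?_
    exact Finset.sum_le_sum_of_subset_of_nonneg (Finset.range_mono hj) fun _ _ _ => norm_nonneg _
  -- Cauchy-Schwarz over the `M` cells costs a factor `M`, which the weight `1/h` in the squared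
  -- norm absorbs because `M h = b - a`.
  refine h1.trans (abs_le_of_sq_le_sq' ?_ (mul_nonneg (Real.sqrt_nonneg _) (gridH1_nonneg _))).2
  rw [mul_pow, gridH1_sq, Real.sq_sqrt (sub_nonneg.2 hab.le), inv_pow, Real.sq_sqrt hh.le]
  refine (sq_sum_le_card_mul_sum_sq).trans (le_of_eq ?_)
  rw [Finset.card_range, ← mul_assoc, ← mul_mesh (a := a) (b := b) hM]
  field_simp

theorem mu_mul_mesh {l : ℕ} (hab : a < b) (hM : 1 ≤ M) :
    mu a b l * mesh a b M = Real.pi * l / M := by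
  have : (M : ℝ) ≠ 0 := by exact_mod_cast (by omega : M ≠ 0)
  have : b - a ≠ 0 := (sub_pos.2 hab).ne'
  unfold mu mesh; field_simp

theorem mu_nonneg (hab : a < b) (l : ℕ) : 0 ≤ mu a b l := by
  have := sub_pos.2 hab
  unfold mu; positivity

theorem mu_pos (hab : a < b) {l : ℕ} (hl : 0 < l) : 0 < mu a b l := by
  have := sub_pos.2 hab
  have : (0 : ℝ) < l := by exact_mod_cast hl
  unfold mu; positivity

theorem l2_dst (hM : 1 ≤ M) (u : ℕ → ℂ) :
    l2 (Finset.Ioo 0 M) (dst M u) = √(2 / M) * l2 (Finset.Ioo 0 M) u := by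
  have hM' : (0 : ℝ) < M := by exact_mod_cast hM
  rw [l2, l2, ← Real.sqrt_mul (by positivity), sum_norm_sq_eq_dst u]
  congr 1
  field_simp

theorem gridH1_sq_eq (hab : a < b) (hM : 1 ≤ M) (u : ℕ → ℂ) (h0 : u 0 = 0) (hu : u M = 0) :
    gridH1 a b M u ^ 2 = (b - a) / 2 * ∑ l ∈ Finset.Ioo 0 M,
      (2 * Real.sin (l * Real.pi / (2 * M)) / mesh a b M) ^ 2 * ‖dst M u l‖ ^ 2 := by
  have hh : 0 < mesh a b M := mesh_pos hab hM
  rw [gridH1_sq, inv_pow, Real.sq_sqrt hh.le, sum_norm_sq_diff_eq_dst u h0 hu,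
    ← mul_mesh (a := a) (b := b) hM, Finset.mul_sum, Finset.mul_sum, Finset.mul_sum]
  refine Finset.sum_congr rfl fun l _ => ?_
  field_simp

/-- The symbol of the difference quotient is `2 sin(μh/2)/h`, at most `μ` by `sin x ≤ x`. Together
with the converse below, this makes the finite difference and the spectral `H¹` norms equivalent
uniformly in `M`. -/
theorem gridH1_le_mu_dst (hab : a < b) (hM : 1 ≤ M) (u : ℕ → ℂ) (h0 : u 0 = 0) (hu : u M = 0) :
    gridH1 a b M u ≤ √((b - a) / 2) * l2 (Finset.Ioo 0 M) (fun l => mu a b l • dst M u l) := by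
  have hh : 0 < mesh a b M := mesh_pos hab hM
  have hba := sub_pos.2 hab
  have hM' : (0 : ℝ) < M := by exact_mod_cast hM
  refine (abs_le_of_sq_le_sq' ?_ (mul_nonneg (Real.sqrt_nonneg _) (l2_nonneg _ _))).2
  rw [gridH1_sq_eq hab hM u h0 hu, mul_pow, Real.sq_sqrt (by positivity), l2_sq]
  gcongr with l hl
  rw [norm_smul, mul_pow]
  gcongr
  have hsin : 0 ≤ Real.sin (l * Real.pi / (2 * M)) := by
    refine Real.sin_nonneg_of_nonneg_of_le_pi (by positivity) ?_
    have hl' : (l : ℝ) ≤ M := by exact_mod_cast (Finset.mem_Ioo.1 hl).2.le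
    rw [div_le_iff₀ (by positivity)]
    nlinarith [Real.pi_pos]
  · positivity
  · rw [Real.norm_eq_abs, abs_of_nonneg (mu_nonneg hab l), div_le_iff₀ hh, mu_mul_mesh hab hM]
    have := Real.sin_le (x := l * Real.pi / (2 * M)) (by positivity)
    calc 2 * Real.sin (l * Real.pi / (2 * M)) ≤ 2 * (l * Real.pi / (2 * M)) := by gcongr
      _ = Real.pi * l / M := by field_simp

/-- Frequencies below `M` stay in the first quarter period of the symbol, where Jordan's inequality
`sin x ≥ 2x/π` bounds it from below by `2μ/π`. -/
theorem mu_dst_le_gridH1 (hab : a < b) (hM : 1 ≤ M) (u : ℕ → ℂ) (h0 : u 0 = 0) (hu : u M = 0) :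
    l2 (Finset.Ioo 0 M) (fun l => mu a b l • dst M u l)
      ≤ Real.pi / 2 * √(2 / (b - a)) * gridH1 a b M u := by
  have hh : 0 < mesh a b M := mesh_pos hab hM
  have hba := sub_pos.2 hab
  have hM' : (0 : ℝ) < M := by exact_mod_cast hM
  refine l2_le_of_sum_le (by have := gridH1_nonneg (a := a) (b := b) (M := M) u; positivity) ?_
  rw [mul_pow, gridH1_sq_eq hab hM u h0 hu, mul_pow, Real.sq_sqrt (by positivity), ← mul_assoc,
    Finset.mul_sum]
  refine Finset.sum_le_sum fun l hl => ?_
  rw [norm_smul, mul_pow]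
  have hl' : (l : ℝ) ≤ M := by exact_mod_cast (Finset.mem_Ioo.1 hl).2.le
  have h1 : ‖mu a b l‖ ^ 2
      ≤ (Real.pi / 2) ^ 2 * (2 * Real.sin (l * Real.pi / (2 * M)) / mesh a b M) ^ 2 := by
    rw [← mul_pow, Real.norm_eq_abs, abs_of_nonneg (mu_nonneg hab l)]
    have := mu_nonneg hab l
    gcongr
    rw [← mul_div_assoc, le_div_iff₀ hh, mu_mul_mesh hab hM]
    have := Real.mul_le_sin (x := l * Real.pi / (2 * M)) (by positivity) (by
      rw [div_le_div_iff₀ (by positivity) two_pos]; nlinarith [Real.pi_pos])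
    calc Real.pi * l / M = Real.pi / 2 * (2 * (2 / Real.pi * (l * Real.pi / (2 * M)))) := by
          have := Real.pi_pos.ne'
          field_simp
      _ ≤ _ := by gcongr
  calc ‖mu a b l‖ ^ 2 * ‖dst M u l‖ ^ 2
      ≤ (Real.pi / 2) ^ 2 * (2 * Real.sin (l * Real.pi / (2 * M)) / mesh a b M) ^ 2
        * ‖dst M u l‖ ^ 2 := by gcongr
    _ = _ := by field_simp

end DiscreteSobolev

/-! ### Weak derivatives on an interval -/

section WeakDeriv

variable {a b : ℝ}

theorem intervalIntegrable_of_Ioo (hab : a ≤ b) {g : ℝ → ℂ} (hg : IntegrableOn g (Ioo a b)) :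
    IntervalIntegrable g volume a b :=
  (intervalIntegrable_iff_integrableOn_Ioo_of_le hab).2 hg

theorem integral_Ioo_eq (hab : a ≤ b) {E : Type*} [NormedAddCommGroup E] [NormedSpace ℝ E]
    (g : ℝ → E) : ∫ x in Ioo a b, g x = ∫ x in a..b, g x := by
  rw [intervalIntegral.integral_of_le hab, integral_Ioc_eq_integral_Ioo]

theorem memLp_two_subset {v : ℝ → ℂ} {s t : Set ℝ} (hv : MemLp v 2 (volume.restrict t))
    (h : s ⊆ t) : MemLp v 2 (volume.restrict s) :=
  hv.mono_measure (Measure.restrict_mono h le_rfl)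

theorem integrableOn_of_memLp_two {v : ℝ → ℂ} (hv : MemLp v 2 (volume.restrict (Ioo a b))) :
    IntegrableOn v (Ioo a b) :=
  hv.integrable (by norm_num)

theorem integrableOn_norm_sq {v : ℝ → ℂ} (hv : MemLp v 2 (volume.restrict (Ioo a b))) :
    IntegrableOn (fun x => ‖v x‖ ^ 2) (Ioo a b) :=
  (memLp_two_iff_integrable_sq_norm hv.1).1 hv

/-- The Cauchy-Schwarz inequality against a constant. -/
theorem norm_integral_sq_le (hab : a ≤ b) {v : ℝ → ℂ}
    (hv : MemLp v 2 (volume.restrict (Ioo a b))) :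
    ‖∫ x in a..b, v x‖ ^ 2 ≤ (b - a) * ∫ x in a..b, ‖v x‖ ^ 2 := by
  rcases hab.eq_or_lt with rfl | hlt
  · simp
  have hba := sub_pos.2 hlt
  have hi1 : IntervalIntegrable (fun x => ‖v x‖) volume a b :=
    (intervalIntegrable_of_Ioo hab (integrableOn_of_memLp_two hv)).norm
  have hi2 : IntervalIntegrable (fun x => ‖v x‖ ^ 2) volume a b :=
    (intervalIntegrable_iff_integrableOn_Ioo_of_le hab).2 (integrableOn_norm_sq hv)
  -- With `m` the mean of `‖v‖`, nonnegativity of the variance is the inequality sought.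
  set m : ℝ := (∫ x in a..b, ‖v x‖) / (b - a) with hm
  have h0 : 0 ≤ ∫ x in a..b, (‖v x‖ - m) ^ 2 :=
    intervalIntegral.integral_nonneg hab fun x _ => sq_nonneg _
  have h1 : ∫ x in a..b, (‖v x‖ - m) ^ 2
      = (∫ x in a..b, ‖v x‖ ^ 2) - 2 * m * (∫ x in a..b, ‖v x‖) + m ^ 2 * (b - a) := by
    have e : ∀ x, (‖v x‖ - m) ^ 2 = ‖v x‖ ^ 2 - 2 * m * ‖v x‖ + m ^ 2 := fun x => by ring
    simp only [e]
    rw [intervalIntegral.integral_add (hi2.sub (hi1.const_mul _)) (by simp),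
      intervalIntegral.integral_sub hi2 (hi1.const_mul _), intervalIntegral.integral_const_mul]
    simp; ring
  have h2 : (∫ x in a..b, ‖v x‖) = m * (b - a) := by rw [hm]; field_simp
  rw [h1, h2] at h0
  calc ‖∫ x in a..b, v x‖ ^ 2 ≤ (∫ x in a..b, ‖v x‖) ^ 2 := by
        gcongr; exact intervalIntegral.norm_integral_le_integral_norm hab
    _ = (b - a) * (m ^ 2 * (b - a)) := by rw [h2]; ring
    _ ≤ _ := by gcongr; nlinarith

/-- Integration by parts against a primitive of an integrable function. -/
theorem integral_primitive_mul (hab : a ≤ b) {w g g' : ℝ → ℂ} (hw : IntervalIntegrable w volume a b)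
    (hg : ∀ x, HasDerivAt g (g' x) x) (hg' : Continuous g') :
    ∫ x in a..b, (∫ y in a..x, w y) * g' x = (∫ y in a..b, w y) * g b - ∫ y in a..b, w y * g y := by
  have hgc : Continuous g := continuous_iff_continuousAt.2 fun x => (hg x).continuousAt
  -- The indicator encodes `y ≤ x`, so the double integral runs over a triangle. Fubini moves the
  -- `x` integration inside, where `g'` integrates exactly, and integrability of `w` is enough.
  let Φ : ℝ → ℝ → ℂ := fun x y => (Iic x).indicator w y * g' x
  have h1 : ∀ x ∈ uIcc a b, (∫ y in a..x, w y) * g' x = ∫ y in a..b, Φ x y := by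
    intro x hx
    rw [uIcc_of_le hab] at hx
    simp only [Φ]
    rw [intervalIntegral.integral_mul_const]
    congr 1
    rw [intervalIntegral.integral_of_le hx.1, intervalIntegral.integral_of_le hab,
      setIntegral_indicator measurableSet_Iic]
    congr 2
    ext y; simp only [mem_Ioc, mem_inter_iff, mem_Iic]
    exact ⟨fun h => ⟨⟨h.1, h.2.trans hx.2⟩, h.2⟩, fun h => ⟨h.1.1, h.2⟩⟩
  have h2 : ∀ y ∈ uIcc a b, ∫ x in a..b, Φ x y = w y * (g b - g y) := by
    intro y hy
    rw [uIcc_of_le hab] at hy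
    have e : ∀ x, Φ x y = (Ici y).indicator (fun x => w y * g' x) x := by
      intro x
      simp only [Φ, indicator_apply, mem_Iic, mem_Ici]
      split_ifs <;> simp
    rw [intervalIntegral.integral_congr (fun x _ => e x),
      intervalIntegral.integral_of_le hab, setIntegral_indicator measurableSet_Ici,
      ← intervalIntegral.integral_eq_sub_of_hasDerivAt (fun x _ => hg x)
        (hg'.intervalIntegrable _ _), intervalIntegral.integral_of_le hy.2, ← integral_const_mul,
      ← integral_Icc_eq_integral_Ioc (x := y)]
    refine setIntegral_congr_set ?_
    have : (Ioc a b ∩ Ici y : Set ℝ) =ᵐ[volume] (Icc a b ∩ Ici y : Set ℝ) :=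
      (Ioc_ae_eq_Icc (α := ℝ)).inter (Filter.EventuallyEq.refl _ _)
    have hs : (Icc a b ∩ Ici y : Set ℝ) = Icc y b := by
      ext x; simp only [mem_Icc, mem_inter_iff, mem_Ici]
      exact ⟨fun h => ⟨h.2, h.1.2⟩, fun h => ⟨⟨hy.1.trans h.1, h.2⟩, h.1⟩⟩
    rwa [hs] at this
  rw [intervalIntegral.integral_congr h1, intervalIntegral_intervalIntegral_swap,
    intervalIntegral.integral_congr h2]
  · have e : ∀ y, w y * (g b - g y) = w y * g b - w y * g y := fun y => by ring
    simp only [e]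
    rw [intervalIntegral.integral_sub (hw.mul_const _) (hw.mul_continuousOn hgc.continuousOn),
      intervalIntegral.integral_mul_const]
  · have hsub : IntegrableOn (fun p : ℝ × ℝ => g' p.1 * w p.2) (uIoc a b ×ˢ uIoc a b) := by
      rw [IntegrableOn, Measure.volume_eq_prod, ← Measure.prod_restrict]
      refine Integrable.mul_prod (f := g') (g := w) ?_ ?_
      · rw [uIoc_of_le hab]; exact (hg'.intervalIntegrable a b).1
      · rw [uIoc_of_le hab]; exact hw.1
    have hset : MeasurableSet {p : ℝ × ℝ | p.2 ≤ p.1} :=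
      measurableSet_le measurable_snd measurable_fst
    refine (Integrable.indicator hsub hset).congr (ae_of_all _ fun p => ?_)
    simp only [Function.uncurry, Φ, indicator_apply, mem_ofPred_eq, mem_Iic]
    split_ifs
    · ring
    · simp

/-- Test functions on `(a, b)`. -/
def IsTest (a b : ℝ) (φ : ℝ → ℝ) : Prop :=
  ContDiff ℝ (⊤ : ℕ∞) φ ∧ HasCompactSupport φ ∧ tsupport φ ⊆ Ioo a b

theorem exists_isTest_integral_eq_one (hab : a < b) :
    ∃ ρ : ℝ → ℝ, IsTest a b ρ ∧ ∫ x, ρ x = 1 := by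
  let B : ContDiffBump ((a + b) / 2) := ⟨(b - a) / 8, (b - a) / 4, by linarith, by linarith⟩
  refine ⟨B.normed volume, ⟨B.contDiff_normed, B.hasCompactSupport_normed, ?_⟩, B.integral_normed⟩
  rw [B.tsupport_normed_eq, Real.closedBall_eq_Icc]
  refine Icc_subset_Ioo ?_ ?_ <;> simp only [B] <;> linarith

theorem IsTest.eq_zero {φ : ℝ → ℝ} (h : IsTest a b φ) {x : ℝ} (hx : x ∉ Ioo a b) : φ x = 0 :=
  image_eq_zero_of_notMem_tsupport fun h' => hx (h.2.2 h')

theorem IsTest.exists_Icc {φ : ℝ → ℝ} (hab : a < b) (h : IsTest a b φ) :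
    ∃ p q, a < p ∧ p < q ∧ q < b ∧ ∀ x, x ∉ Icc p q → φ x = 0 := by
  rcases (tsupport φ).eq_empty_or_nonempty with he | hne
  · refine ⟨a + (b - a) / 4, a + (b - a) / 2, by linarith, by linarith, by linarith, fun x _ => ?_⟩
    exact image_eq_zero_of_notMem_tsupport (by rw [he]; simp)
  · have hc : IsCompact (tsupport φ) := h.2.1
    obtain ⟨p, hp, hp'⟩ := hc.exists_isLeast hne
    obtain ⟨q, hq, hq'⟩ := hc.exists_isGreatest hne
    have h1 := h.2.2 hp
    have h2 := h.2.2 hq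
    refine ⟨p, (q + b) / 2, h1.1, ?_, ?_, fun x hx => ?_⟩
    · have := hp' hq; have := h2.2; linarith
    · have := h2.2; linarith
    · refine image_eq_zero_of_notMem_tsupport fun hx' => hx ⟨hp' hx', ?_⟩
      have := hq' hx'; have := h2.2; linarith

/-- To the left of the support the primitive is zero trivially; to the right of it, it equals the
full integral, which is why the mean must vanish. -/
theorem IsTest.primitive {η : ℝ → ℝ} (hab : a < b) (h : IsTest a b η) (h0 : ∫ x in a..b, η x = 0) :
    IsTest a b (fun x => ∫ y in a..x, η y) := by
  have hd : ∀ x, HasDerivAt (fun x => ∫ y in a..x, η y) (η x) x := fun x =>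
    intervalIntegral.integral_hasDerivAt_right (h.1.continuous.intervalIntegrable _ _)
      (h.1.continuous.stronglyMeasurableAtFilter _ _) h.1.continuous.continuousAt
  obtain ⟨p, q, hp, hpq, hq, hz⟩ := h.exists_Icc hab
  have hsupp : Function.support (fun x => ∫ y in a..x, η y) ⊆ Icc p q := by
    intro x hx
    by_contra hx'
    refine hx ?_
    rcases lt_or_ge x p with hxp | hxp
    · refine intervalIntegral.integral_zero_ae (ae_of_all _ fun y hy => hz y fun hy' => ?_)
      rcases le_total a x with hax | hax
      · rw [uIoc_of_le hax] at hy; exact absurd (hy'.1.trans hy.2) (not_le.2 hxp)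
      · rw [uIoc_of_ge hax] at hy; exact absurd (hy'.1.trans hy.2) (not_le.2 hp)
    · have hxq : q < x := by
        by_contra hc; exact hx' ⟨hxp, not_lt.1 hc⟩
      have h1 : (∫ y in a..x, η y) = (∫ y in a..b, η y) - ∫ y in x..b, η y := by
        rw [eq_sub_iff_add_eq, intervalIntegral.integral_add_adjacent_intervals] <;>
          exact h.1.continuous.intervalIntegrable _ _
      show (∫ y in a..x, η y) = 0
      rw [h1, h0, zero_sub, neg_eq_zero]
      refine intervalIntegral.integral_zero_ae (ae_of_all _ fun y hy => hz y fun hy' => ?_)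
      rcases le_total x b with hxb | hxb
      · rw [uIoc_of_le hxb] at hy; exact absurd (hy.1.trans_le hy'.2) (not_lt.2 hxq.le)
      · rw [uIoc_of_ge hxb] at hy; exact absurd (hy.1.trans_le hy'.2) (not_lt.2 hq.le)
  have hts : tsupport (fun x => ∫ y in a..x, η y) ⊆ Icc p q :=
    closure_minimal hsupp isClosed_Icc
  refine ⟨?_, isCompact_Icc.of_isClosed_subset (isClosed_tsupport _) hts,
    hts.trans (Icc_subset_Ioo hp hq)⟩
  refine contDiff_infty_iff_deriv.2 ⟨fun x => (hd x).differentiableAt, ?_⟩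
  have : deriv (fun x => ∫ y in a..x, η y) = η := funext fun x => (hd x).deriv
  rw [this]
  exact h.1

theorem IsTest.integrable_mul {φ : ℝ → ℝ} (hφ : Continuous φ) {d : ℝ → ℂ} (hab : a ≤ b)
    (hd : IntegrableOn d (Ioo a b)) : IntegrableOn (fun x => (φ x : ℂ) * d x) (Ioo a b) := by
  have h1 := (intervalIntegrable_of_Ioo hab hd).continuousOn_mul
    (Complex.continuous_ofReal.comp hφ).continuousOn
  exact (intervalIntegrable_iff_integrableOn_Ioo_of_le hab).1 h1

/-- The lemma of du Bois-Reymond. -/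
theorem ae_eq_const_of_weakDeriv_zero (hab : a < b) {d : ℝ → ℂ} (hd : IntegrableOn d (Ioo a b))
    (h : ∀ φ, IsTest a b φ → ∫ x in Ioo a b, ((deriv φ x : ℝ) : ℂ) * d x = 0) :
    ∃ c : ℂ, ∀ᵐ x ∂volume.restrict (Ioo a b), d x = c := by
  obtain ⟨ρ, hρ, hρ1⟩ := exists_isTest_integral_eq_one hab
  set c : ℂ := ∫ x in Ioo a b, (ρ x : ℂ) * d x with hc
  refine ⟨c, ?_⟩
  have hdc : IntegrableOn (fun x => d x - c) (Ioo a b) :=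
    hd.sub (integrableOn_const (by simp))
  have key := isOpen_Ioo.ae_eq_zero_of_integral_contDiff_smul_eq_zero (μ := volume)
    (f := fun x => d x - c) hdc.locallyIntegrableOn ?_
  · rw [ae_restrict_iff' measurableSet_Ioo]
    filter_upwards [key] with x hx hx'
    exact sub_eq_zero.1 (hx hx')
  intro η h1 h2 h3
  have hη : IsTest a b η := ⟨h1, h2, h3⟩
  have full : ∀ φ, IsTest a b φ → ∫ x in a..b, φ x = ∫ x, φ x := by
    intro φ hφ
    rw [← integral_Ioo_eq hab.le]
    exact setIntegral_eq_integral_of_forall_compl_eq_zero fun x hx => hφ.eq_zero hx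
  set I : ℝ := ∫ x in a..b, η x with hI
  -- Subtracting a multiple of the fixed bump `ρ` gives mean zero, so `ζ` is the derivative of a
  -- test function and the hypothesis applies to it. The multiple of `ρ` accounts for the constant
  -- `c`.
  let ζ : ℝ → ℝ := fun x => η x - I * ρ x
  have hζ : IsTest a b ζ := by
    refine ⟨h1.sub (contDiff_const.mul hρ.1), ?_, ?_⟩
    · exact HasCompactSupport.sub h2 (hρ.2.1.mul_left)
    · refine (tsupport_sub _ _).trans (union_subset h3 ?_)
      exact (tsupport_mul_subset_right).trans hρ.2.2
  have hζ0 : ∫ x in a..b, ζ x = 0 := by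
    simp only [ζ]
    rw [intervalIntegral.integral_sub (h1.continuous.intervalIntegrable _ _)
      ((hρ.1.continuous.intervalIntegrable _ _).const_mul _), intervalIntegral.integral_const_mul,
      full ρ hρ, hρ1]
    simp [I]
  have h4 := h _ (hζ.primitive hab hζ0)
  have hder : ∀ x, deriv (fun x => ∫ y in a..x, ζ y) x = ζ x := fun x =>
    (intervalIntegral.integral_hasDerivAt_right (hζ.1.continuous.intervalIntegrable _ _)
      (hζ.1.continuous.stronglyMeasurableAtFilter _ _) hζ.1.continuous.continuousAt).deriv
  simp only [hder] at h4
  have e1 : ∀ x, ((ζ x : ℝ) : ℂ) * d x = (η x : ℂ) * d x - I * ((ρ x : ℂ) * d x) := by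
    intro x; simp only [ζ]; push_cast; ring
  simp only [e1] at h4
  rw [integral_sub (IsTest.integrable_mul h1.continuous hab.le hd)
    ((IsTest.integrable_mul hρ.1.continuous hab.le hd).const_mul _), integral_const_mul, ← hc] at h4
  have h5 : ∫ x, η x • (d x - c) = ∫ x in Ioo a b, η x • (d x - c) := by
    symm
    refine setIntegral_eq_integral_of_forall_compl_eq_zero fun x hx => ?_
    rw [hη.eq_zero hx, zero_smul]
  rw [h5]
  have e2 : ∀ x, η x • (d x - c) = (η x : ℂ) * d x - (η x : ℂ) * c := by
    intro x; rw [Complex.real_smul]; ring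
  simp only [e2]
  rw [integral_sub (IsTest.integrable_mul h1.continuous hab.le hd)
    (IsTest.integrable_mul h1.continuous hab.le (integrableOn_const (by simp))),
    integral_mul_const, integral_complex_ofReal, integral_Ioo_eq hab.le η, ← hI]
  exact h4

/-- The difference of `u` and the primitive of `v` has weak derivative zero, hence is constant by du
Bois-Reymond. -/
theorem weakDeriv_one_repr (hab : a < b) {u v : ℝ → ℂ} (hu : IntegrableOn u (Ioo a b))
    (hv : IntegrableOn v (Ioo a b)) (h : IsWeakDeriv a b 1 u v) :
    ∃ c : ℂ, ∀ᵐ x ∂volume.restrict (Ioo a b), u x = c + ∫ y in a..x, v y := by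
  have hv' := intervalIntegrable_of_Ioo hab.le hv
  have hVc : ContinuousOn (fun x => ∫ y in a..x, v y) (Icc a b) := by
    have := intervalIntegral.continuousOn_primitive_interval' hv' left_mem_uIcc
    rwa [uIcc_of_le hab.le] at this
  have hVi : IntegrableOn (fun x => ∫ y in a..x, v y) (Ioo a b) :=
    (hVc.integrableOn_Icc).mono_set Ioo_subset_Icc_self
  have key : ∀ φ, IsTest a b φ →
      ∫ x in Ioo a b, ((deriv φ x : ℝ) : ℂ) * (u x - ∫ y in a..x, v y) = 0 := by
    intro φ hφ
    have hφ' : Continuous (deriv φ) := hφ.1.continuous_deriv (by norm_num)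
    have h1 := h.2.2 φ hφ.1 hφ.2.1 hφ.2.2
    rw [iteratedDeriv_one, pow_one] at h1
    have e : ∀ x, ((deriv φ x : ℝ) : ℂ) * (u x - ∫ y in a..x, v y)
        = ((deriv φ x : ℝ) : ℂ) * u x - (∫ y in a..x, v y) * ((deriv φ x : ℝ) : ℂ) := fun x => by ring
    simp only [e]
    have hVi' := IsTest.integrable_mul hφ' hab.le hVi
    rw [integral_sub (IsTest.integrable_mul hφ' hab.le hu)
      (hVi'.congr (ae_of_all _ fun x => mul_comm _ _)), h1, integral_Ioo_eq hab.le,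
      integral_Ioo_eq hab.le, integral_primitive_mul hab.le hv' (g := fun x => (φ x : ℂ))
        (g' := fun x => ((deriv φ x : ℝ) : ℂ)) (fun x => ?_) (Complex.continuous_ofReal.comp hφ')]
    · rw [hφ.eq_zero (x := b) (by simp)]
      simp [mul_comm]
    · exact ((hφ.1.differentiable (by norm_num)) x).hasDerivAt.ofReal_comp
  obtain ⟨c, hc⟩ := ae_eq_const_of_weakDeriv_zero hab (hu.sub hVi) key
  refine ⟨c, ?_⟩
  filter_upwards [hc] with x hx
  rw [← hx]
  exact (sub_add_cancel _ _).symm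

theorem weakDeriv_one_repr_of_continuousOn (hab : a < b) {u v : ℝ → ℂ}
    (hu : ContinuousOn u (Icc a b)) (hv : IntegrableOn v (Ioo a b)) (h : IsWeakDeriv a b 1 u v) :
    ∀ x ∈ Icc a b, u x = u a + ∫ y in a..x, v y := by
  obtain ⟨c, hc⟩ := weakDeriv_one_repr hab ((hu.integrableOn_Icc).mono_set Ioo_subset_Icc_self) hv h
  have hVc : ContinuousOn (fun x => ∫ y in a..x, v y) (Icc a b) := by
    have := intervalIntegral.continuousOn_primitive_interval'
      (intervalIntegrable_of_Ioo hab.le hv) left_mem_uIcc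
    rwa [uIcc_of_le hab.le] at this
  have h1 : EqOn u (fun x => c + ∫ y in a..x, v y) (Icc a b) := by
    refine Measure.eqOn_Icc_of_ae_eq volume hab.ne ?_ hu (continuousOn_const.add hVc)
    rw [← Measure.restrict_congr_set (Ioo_ae_eq_Icc (μ := (volume : Measure ℝ)))]
    exact hc
  have h2 : u a = c := by simpa using h1 (left_mem_Icc.2 hab.le)
  intro x hx
  rw [h2]; exact h1 hx

theorem IsTest.deriv {φ : ℝ → ℝ} (h : IsTest a b φ) : IsTest a b (_root_.deriv φ) :=
  ⟨(contDiff_infty_iff_deriv.1 h.1).2, h.2.1.deriv, (tsupport_deriv_subset).trans h.2.2⟩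

theorem IsTest.iteratedDeriv {φ : ℝ → ℝ} (h : IsTest a b φ) (j : ℕ) :
    IsTest a b (_root_.iteratedDeriv j φ) := by
  induction j with
  | zero => rwa [iteratedDeriv_zero]
  | succ n ih => rw [iteratedDeriv_succ]; exact ih.deriv

/-- A weak derivative of order `j + i` is a weak derivative of order `i` of the weak derivative of
order `j`. -/
theorem IsWeakDeriv.of_add {u v w : ℝ → ℂ} {i j : ℕ} (hv : IsWeakDeriv a b j u v)
    (hw : IsWeakDeriv a b (j + i) u w) : IsWeakDeriv a b i v w := by
  refine ⟨hv.2.1, hw.2.1, fun φ h1 h2 h3 => ?_⟩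
  have hφ : IsTest a b φ := ⟨h1, h2, h3⟩
  have hφ' := hφ.iteratedDeriv i
  have e1 := hv.2.2 _ hφ'.1 hφ'.2.1 hφ'.2.2
  have e2 := hw.2.2 φ h1 h2 h3
  have e3 : iteratedDeriv j (iteratedDeriv i φ) = iteratedDeriv (j + i) φ := by
    simp only [iteratedDeriv_eq_iterate, Function.iterate_add_apply]
  rw [e3, e2, pow_add, mul_assoc] at e1
  have : ((-1 : ℂ) ^ j) ≠ 0 := by simp
  exact (mul_left_cancel₀ this e1).symm

end WeakDeriv

/-! ### Sine and cosine coefficients -/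

section Trig

variable {a b : ℝ}

/-- The sine mode of frequency `μ_l`. -/
noncomputable def sn (a b : ℝ) (l : ℕ) (x : ℝ) : ℝ := Real.sin (mu a b l * (x - a))

/-- The cosine mode of frequency `μ_l`. -/
noncomputable def cs (a b : ℝ) (l : ℕ) (x : ℝ) : ℝ := Real.cos (mu a b l * (x - a))

theorem hasDerivAt_sn (l : ℕ) (x : ℝ) : HasDerivAt (sn a b l) (mu a b l * cs a b l x) x := by
  have h : HasDerivAt (fun x => mu a b l * (x - a)) (mu a b l) x := by
    simpa using ((hasDerivAt_id x).sub_const a).const_mul (mu a b l)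
  have := h.sin
  rwa [mul_comm] at this

theorem hasDerivAt_cs (l : ℕ) (x : ℝ) : HasDerivAt (cs a b l) (-(mu a b l * sn a b l x)) x := by
  have h : HasDerivAt (fun x => mu a b l * (x - a)) (mu a b l) x := by
    simpa using ((hasDerivAt_id x).sub_const a).const_mul (mu a b l)
  have := h.cos
  rwa [neg_mul, mul_comm] at this

theorem continuous_sn (l : ℕ) : Continuous (sn a b l) :=
  continuous_iff_continuousAt.2 fun x => (hasDerivAt_sn l x).continuousAt

theorem continuous_cs (l : ℕ) : Continuous (cs a b l) :=
  continuous_iff_continuousAt.2 fun x => (hasDerivAt_cs l x).continuousAt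

theorem abs_sn_le (l : ℕ) (x : ℝ) : |sn a b l x| ≤ 1 := Real.abs_sin_le_one _

theorem abs_cs_le (l : ℕ) (x : ℝ) : |cs a b l x| ≤ 1 := Real.abs_cos_le_one _

theorem sn_left (l : ℕ) : sn a b l a = 0 := by simp [sn]

theorem mu_mul_sub (hab : a < b) (l : ℕ) : mu a b l * (b - a) = l * Real.pi := by
  have := (sub_pos.2 hab).ne'
  unfold mu; field_simp

theorem sn_right (hab : a < b) (l : ℕ) : sn a b l b = 0 := by
  rw [sn, mu_mul_sub hab, Real.sin_nat_mul_pi]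

theorem integral_cos_int (hab : a < b) {k : ℤ} (hk : k ≠ 0) :
    ∫ x in a..b, Real.cos (Real.pi * k / (b - a) * (x - a)) = 0 := by
  have hba := (sub_pos.2 hab).ne'
  have hk' : (k : ℝ) ≠ 0 := by exact_mod_cast hk
  have hc : Real.pi * k / (b - a) ≠ 0 := div_ne_zero (mul_ne_zero Real.pi_ne_zero hk') hba
  have hd : ∀ x ∈ uIcc a b, HasDerivAt
      (fun x => Real.sin (Real.pi * k / (b - a) * (x - a)) / (Real.pi * k / (b - a)))
      (Real.cos (Real.pi * k / (b - a) * (x - a))) x := by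
    intro x _
    have h : HasDerivAt (fun x => Real.pi * k / (b - a) * (x - a)) (Real.pi * k / (b - a)) x := by
      simpa using ((hasDerivAt_id x).sub_const a).const_mul (Real.pi * k / (b - a))
    have := h.sin.div_const (Real.pi * k / (b - a))
    rwa [mul_div_cancel_right₀ _ hc] at this
  rw [intervalIntegral.integral_eq_sub_of_hasDerivAt hd
    (Continuous.intervalIntegrable (by fun_prop) _ _), div_mul_cancel₀ _ hba, mul_comm Real.pi,
    Real.sin_int_mul_pi]
  simp

theorem integral_sn_mul_sn (hab : a < b) {l l' : ℕ} (hl : 0 < l) :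
    ∫ x in a..b, sn a b l x * sn a b l' x = if l = l' then (b - a) / 2 else 0 := by
  have key : ∀ x, sn a b l x * sn a b l' x
      = (Real.cos (Real.pi * ((l - l' : ℤ) : ℤ) / (b - a) * (x - a))
        - Real.cos (Real.pi * ((l + l' : ℤ) : ℤ) / (b - a) * (x - a))) / 2 := by
    intro x
    have e1 : Real.pi * ((l - l' : ℤ) : ℤ) / (b - a) * (x - a)
        = mu a b l * (x - a) - mu a b l' * (x - a) := by unfold mu; push_cast; ring
    have e2 : Real.pi * ((l + l' : ℤ) : ℤ) / (b - a) * (x - a)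
        = mu a b l * (x - a) + mu a b l' * (x - a) := by unfold mu; push_cast; ring
    rw [e1, e2, Real.cos_sub, Real.cos_add, sn, sn]; ring
  simp only [key]
  rw [intervalIntegral.integral_div, intervalIntegral.integral_sub
    (Continuous.intervalIntegrable (by fun_prop) _ _)
    (Continuous.intervalIntegrable (by fun_prop) _ _),
    integral_cos_int hab (k := (l + l' : ℤ)) (by omega)]
  split_ifs with h
  · subst h; simp
  · rw [integral_cos_int hab (k := (l - l' : ℤ)) (by omega)]; simp

theorem integral_cs_mul_cs (hab : a < b) {l l' : ℕ} (hl : 0 < l) :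
    ∫ x in a..b, cs a b l x * cs a b l' x = if l = l' then (b - a) / 2 else 0 := by
  have key : ∀ x, cs a b l x * cs a b l' x
      = (Real.cos (Real.pi * ((l - l' : ℤ) : ℤ) / (b - a) * (x - a))
        + Real.cos (Real.pi * ((l + l' : ℤ) : ℤ) / (b - a) * (x - a))) / 2 := by
    intro x
    have e1 : Real.pi * ((l - l' : ℤ) : ℤ) / (b - a) * (x - a)
        = mu a b l * (x - a) - mu a b l' * (x - a) := by unfold mu; push_cast; ring
    have e2 : Real.pi * ((l + l' : ℤ) : ℤ) / (b - a) * (x - a)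
        = mu a b l * (x - a) + mu a b l' * (x - a) := by unfold mu; push_cast; ring
    rw [e1, e2, Real.cos_sub, Real.cos_add, cs, cs]; ring
  simp only [key]
  rw [intervalIntegral.integral_div, intervalIntegral.integral_add
    (Continuous.intervalIntegrable (by fun_prop) _ _)
    (Continuous.intervalIntegrable (by fun_prop) _ _),
    integral_cos_int hab (k := (l + l' : ℤ)) (by omega)]
  split_ifs with h
  · subst h; simp
  · rw [integral_cos_int hab (k := (l - l' : ℤ)) (by omega)]; simp

theorem integral_norm_sq_of_orthogonal (s : Finset ℕ) (c : ℕ → ℂ) {T : ℕ → ℝ → ℝ}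
    (hT : ∀ l, Continuous (T l)) {κ : ℝ}
    (h : ∀ l ∈ s, ∀ l' ∈ s, ∫ x in a..b, T l x * T l' x = if l = l' then κ else 0) :
    ∫ x in a..b, ‖∑ l ∈ s, c l * (T l x : ℂ)‖ ^ 2 = κ * ∑ l ∈ s, ‖c l‖ ^ 2 := by
  simp only [norm_sq_sum_mul_ofReal s c fun l => T l _]
  rw [← sum_orthogonal, intervalIntegral.integral_finsetSum]
  · refine Finset.sum_congr rfl fun l hl => ?_
    rw [intervalIntegral.integral_finsetSum]
    · refine Finset.sum_congr rfl fun l' hl' => ?_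
      rw [intervalIntegral.integral_const_mul, h l hl l' hl']
    · exact fun l' _ => Continuous.intervalIntegrable
        (continuous_const.mul ((hT l).mul (hT l'))) _ _
  · exact fun l _ => Continuous.intervalIntegrable
      (continuous_finsetSum _ fun l' _ => continuous_const.mul ((hT l).mul (hT l'))) _ _

/-- Bessel's inequality. -/
theorem bessel (hab : a ≤ b) (s : Finset ℕ) {T : ℕ → ℝ → ℝ} (hT : ∀ l, Continuous (T l)) {κ : ℝ}
    (hκ : 0 < κ) (h : ∀ l ∈ s, ∀ l' ∈ s, ∫ x in a..b, T l x * T l' x = if l = l' then κ else 0)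
    {v : ℝ → ℂ} (hv : MemLp v 2 (volume.restrict (Ioo a b))) :
    κ * ∑ l ∈ s, ‖((κ⁻¹ : ℝ) : ℂ) * ∫ x in a..b, v x * (T l x : ℂ)‖ ^ 2
      ≤ ∫ x in a..b, ‖v x‖ ^ 2 := by
  set c : ℕ → ℂ := fun l => ((κ⁻¹ : ℝ) : ℂ) * ∫ x in a..b, v x * (T l x : ℂ) with hc
  have hvi := intervalIntegrable_of_Ioo hab (integrableOn_of_memLp_two hv)
  have hvi2 : IntervalIntegrable (fun x => ‖v x‖ ^ 2) volume a b :=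
    (intervalIntegrable_iff_integrableOn_Ioo_of_le hab).2 (integrableOn_norm_sq hv)
  have hTc : ∀ l, Continuous fun x => (T l x : ℂ) := fun l =>
    Complex.continuous_ofReal.comp (hT l)
  let S : ℝ → ℂ := fun x => ∑ l ∈ s, c l * (T l x : ℂ)
  have hS : Continuous S := continuous_finsetSum _ fun l _ => continuous_const.mul (hTc l)
  have hcross : IntervalIntegrable (fun x => v x * (starRingEnd ℂ) (S x)) volume a b :=
    hvi.mul_continuousOn (Complex.continuous_conj.comp hS).continuousOn
  have hvT : ∀ l, IntervalIntegrable (fun x => v x * (T l x : ℂ)) volume a b := fun l =>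
    hvi.mul_continuousOn (hTc l).continuousOn
  have e1 : ∫ x in a..b, v x * (starRingEnd ℂ) (S x)
      = ((κ * ∑ l ∈ s, ‖c l‖ ^ 2 : ℝ) : ℂ) := by
    have : ∀ x, v x * (starRingEnd ℂ) (S x)
        = ∑ l ∈ s, (starRingEnd ℂ) (c l) * (v x * (T l x : ℂ)) := by
      intro x
      simp only [S, map_sum, map_mul, Complex.conj_ofReal, Finset.mul_sum]
      exact Finset.sum_congr rfl fun l _ => by ring
    simp only [this]
    rw [intervalIntegral.integral_finsetSum fun l _ => (hvT l).const_mul _]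
    push_cast
    rw [Finset.mul_sum]
    refine Finset.sum_congr rfl fun l _ => ?_
    rw [intervalIntegral.integral_const_mul, ← Complex.mul_conj']
    have : ∫ x in a..b, v x * (T l x : ℂ) = κ * c l := by
      rw [hc]; push_cast
      rw [← mul_assoc, mul_inv_cancel₀ (by exact_mod_cast hκ.ne'), one_mul]
    rw [this]; ring
  have e2 := integral_norm_sq_of_orthogonal s c hT h
  have e3 : ∀ x, ‖v x - S x‖ ^ 2
      = ‖v x‖ ^ 2 - 2 * (v x * (starRingEnd ℂ) (S x)).re + ‖S x‖ ^ 2 := by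
    intro x
    rw [Complex.sq_norm, Complex.sq_norm, Complex.sq_norm, Complex.normSq_sub]; ring
  have hre : IntervalIntegrable (fun x => (v x * (starRingEnd ℂ) (S x)).re) volume a b :=
    ⟨hcross.1.re, hcross.2.re⟩
  have e4 : ∫ x in a..b, (v x * (starRingEnd ℂ) (S x)).re = κ * ∑ l ∈ s, ‖c l‖ ^ 2 := by
    have := Complex.reCLM.intervalIntegral_comp_comm hcross
    simp only [Complex.reCLM_apply] at this
    rw [this, e1, Complex.ofReal_re]
  have hS2 : IntervalIntegrable (fun x => ‖S x‖ ^ 2) volume a b :=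
    (hS.norm.pow 2).intervalIntegrable _ _
  -- Bessel's inequality is the nonnegativity of the squared distance from `v` to its partial
  -- expansion `S`.
  have h0 : 0 ≤ ∫ x in a..b, ‖v x - S x‖ ^ 2 :=
    intervalIntegral.integral_nonneg hab fun x _ => sq_nonneg _
  simp only [e3] at h0
  rw [intervalIntegral.integral_add (hvi2.sub (hre.const_mul _)) hS2, intervalIntegral.integral_sub hvi2 (hre.const_mul _),
    intervalIntegral.integral_const_mul, e4, e2] at h0
  linarith

theorem sineCoeff_eq (hab : a ≤ b) (u : ℝ → ℂ) (l : ℕ) :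
    sineCoeff a b u l = ((2 / (b - a) : ℝ) : ℂ) * ∫ x in a..b, u x * (sn a b l x : ℂ) := by
  rw [sineCoeff, integral_Ioo_eq hab]; rfl

theorem sineCoeff_congr {u v : ℝ → ℂ} (h : ∀ x ∈ Ioo a b, u x = v x) (l : ℕ) :
    sineCoeff a b u l = sineCoeff a b v l := by
  unfold sineCoeff
  rw [setIntegral_congr_fun measurableSet_Ioo fun x hx => by rw [h x hx]]

theorem sineCoeff_congr_ae {u v : ℝ → ℂ} (h : ∀ᵐ x ∂volume.restrict (Ioo a b), u x = v x) (l : ℕ) :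
    sineCoeff a b u l = sineCoeff a b v l := by
  unfold sineCoeff
  congr 1
  refine integral_congr_ae (h.mono fun x hx => ?_)
  simp only [hx]

/-- The sine coefficients `c` have norm at most `R` in `H_s^r`. -/
def HsBound (a b : ℝ) (r : ℕ) (c : ℕ → ℂ) (R : ℝ) : Prop :=
  ∀ N, l2 (Finset.Ioo 0 N) (fun l => mu a b l ^ r • c l) ≤ R

theorem bessel_sn (hab : a < b) (N : ℕ) {v : ℝ → ℂ} {K : ℝ} (hK : 0 ≤ K)
    (hv : MemLp v 2 (volume.restrict (Ioo a b))) (hvK : ∫ x in a..b, ‖v x‖ ^ 2 ≤ K ^ 2) :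
    l2 (Finset.Ioo 0 N) (fun l => ((2 / (b - a) : ℝ) : ℂ) * ∫ x in a..b, v x * (sn a b l x : ℂ))
      ≤ √(2 / (b - a)) * K := by
  have hba := sub_pos.2 hab
  have h := bessel hab.le (Finset.Ioo 0 N) continuous_sn (half_pos hba)
    (fun l hl l' _ => integral_sn_mul_sn hab (Finset.mem_Ioo.1 hl).1) hv
  refine l2_le_of_sum_le (by positivity) ?_
  rw [mul_pow, Real.sq_sqrt (by positivity), div_mul_eq_mul_div, le_div_iff₀ hba]
  simp only [inv_div] at h
  linarith

theorem bessel_cs (hab : a < b) (N : ℕ) {v : ℝ → ℂ} {K : ℝ} (hK : 0 ≤ K)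
    (hv : MemLp v 2 (volume.restrict (Ioo a b))) (hvK : ∫ x in a..b, ‖v x‖ ^ 2 ≤ K ^ 2) :
    l2 (Finset.Ioo 0 N) (fun l => ((2 / (b - a) : ℝ) : ℂ) * ∫ x in a..b, v x * (cs a b l x : ℂ))
      ≤ √(2 / (b - a)) * K := by
  have hba := sub_pos.2 hab
  have h := bessel hab.le (Finset.Ioo 0 N) continuous_cs (half_pos hba)
    (fun l hl l' _ => integral_cs_mul_cs hab (Finset.mem_Ioo.1 hl).1) hv
  refine l2_le_of_sum_le (by positivity) ?_
  rw [mul_pow, Real.sq_sqrt (by positivity), div_mul_eq_mul_div, le_div_iff₀ hba]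
  simp only [inv_div] at h
  linarith

/-- Integration by parts. The cosine does not vanish at `b`, so the boundary term disappears only
because `v` has mean zero. -/
theorem mu_mul_integral_primitive_mul_sn (hab : a < b) {v : ℝ → ℂ}
    (hv : IntervalIntegrable v volume a b) (h0 : ∫ x in a..b, v x = 0) (l : ℕ) :
    (mu a b l : ℂ) * ∫ x in a..b, (∫ y in a..x, v y) * (sn a b l x : ℂ)
      = ∫ x in a..b, v x * (cs a b l x : ℂ) := by
  have h := integral_primitive_mul hab.le hv (g := fun x => (cs a b l x : ℂ))
    (g' := fun x => ((-(mu a b l * sn a b l x) : ℝ) : ℂ))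
    (fun x => (hasDerivAt_cs l x).ofReal_comp)
    (Complex.continuous_ofReal.comp (continuous_const.mul (continuous_sn l)).neg)
  rw [h0, zero_mul, zero_sub] at h
  rw [← neg_inj, ← h, ← intervalIntegral.integral_const_mul, ← intervalIntegral.integral_neg]
  refine intervalIntegral.integral_congr fun x _ => ?_
  push_cast; ring

/-- Integration by parts in which the sine kills both boundary terms, so the additive constant `c`
is arbitrary. -/
theorem mu_mul_integral_primitive_mul_cs (hab : a < b) {w : ℝ → ℂ} (c : ℂ)
    (hw : IntervalIntegrable w volume a b) (l : ℕ) :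
    (mu a b l : ℂ) * ∫ x in a..b, (c + ∫ y in a..x, w y) * (cs a b l x : ℂ)
      = -∫ x in a..b, w x * (sn a b l x : ℂ) := by
  have hcs : Continuous fun x => (mu a b l * cs a b l x : ℝ) :=
    continuous_const.mul (continuous_cs l)
  have h := integral_primitive_mul hab.le hw (g := fun x => (sn a b l x : ℂ))
    (g' := fun x => ((mu a b l * cs a b l x : ℝ) : ℂ))
    (fun x => (hasDerivAt_sn l x).ofReal_comp) (Complex.continuous_ofReal.comp hcs)
  rw [sn_right hab, Complex.ofReal_zero, mul_zero, zero_sub] at h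
  have h2 : ∫ x in a..b, ((mu a b l * cs a b l x : ℝ) : ℂ) = 0 := by
    rw [intervalIntegral.integral_ofReal, intervalIntegral.integral_eq_sub_of_hasDerivAt
      (fun x _ => hasDerivAt_sn l x) (hcs.intervalIntegrable _ _), sn_right hab, sn_left]
    simp
  have hW : ContinuousOn (fun x => ∫ y in a..x, w y) (uIcc a b) :=
    intervalIntegral.continuousOn_primitive_interval' hw left_mem_uIcc
  have e : ∀ x, (mu a b l : ℂ) * ((c + ∫ y in a..x, w y) * (cs a b l x : ℂ))
      = c * ((mu a b l * cs a b l x : ℝ) : ℂ)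
        + (∫ y in a..x, w y) * ((mu a b l * cs a b l x : ℝ) : ℂ) := by
    intro x; push_cast; ring
  rw [← h, ← intervalIntegral.integral_const_mul]
  simp only [e]
  rw [intervalIntegral.integral_add, intervalIntegral.integral_const_mul, h2, mul_zero, zero_add]
  · exact (continuous_const.mul (Complex.continuous_ofReal.comp hcs)).intervalIntegrable _ _
  · exact (hW.mul (Complex.continuous_ofReal.comp hcs).continuousOn).intervalIntegrable

/-- The sine coefficients of a second weak derivative. -/
theorem sineCoeff_weakDeriv_two (hab : a < b) {u v w : ℝ → ℂ} (hu : ContinuousOn u (Icc a b))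
    (ha : u a = 0) (hb : u b = 0) (hv : IntegrableOn v (Ioo a b)) (hw : IntegrableOn w (Ioo a b))
    (huv : IsWeakDeriv a b 1 u v) (huw : IsWeakDeriv a b 2 u w) (l : ℕ) :
    sineCoeff a b w l = -(mu a b l : ℂ) ^ 2 * sineCoeff a b u l := by
  have hvw : IsWeakDeriv a b 1 v w := huv.of_add huw
  obtain ⟨c, hc⟩ := weakDeriv_one_repr hab hv hw hvw
  have hu' := weakDeriv_one_repr_of_continuousOn hab hu hv huv
  have hvi := intervalIntegrable_of_Ioo hab.le hv
  have hwi := intervalIntegrable_of_Ioo hab.le hw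
  -- The boundary values of `u` enter here: they give the first derivative mean zero. The second
  -- integration by parts then needs no condition on `v`.
  have h0 : ∫ x in a..b, v x = 0 := by
    have := hu' b (right_mem_Icc.2 hab.le)
    rw [ha, hb, zero_add] at this
    exact this.symm
  have h1 := mu_mul_integral_primitive_mul_sn hab hvi h0 l
  have h2 := mu_mul_integral_primitive_mul_cs hab c hwi l
  have h3 : ∫ x in a..b, u x * (sn a b l x : ℂ)
      = ∫ x in a..b, (∫ y in a..x, v y) * (sn a b l x : ℂ) := by
    refine intervalIntegral.integral_congr fun x hx => ?_
    rw [uIcc_of_le hab.le] at hx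
    rw [hu' x hx, ha, zero_add]
  have h4 : ∫ x in a..b, v x * (cs a b l x : ℂ)
      = ∫ x in a..b, (c + ∫ y in a..x, w y) * (cs a b l x : ℂ) := by
    rw [← integral_Ioo_eq hab.le, ← integral_Ioo_eq hab.le]
    refine integral_congr_ae ?_
    filter_upwards [hc] with x hx
    rw [hx]
  rw [sineCoeff_eq hab.le, sineCoeff_eq hab.le]
  rw [h4] at h1
  rw [← h1, ← h3] at h2
  rw [neg_eq_iff_eq_neg.1 h2.symm]
  ring

/-- A second weak derivative that is continuous is a classical one. -/
theorem iteratedDeriv_two_eq (hab : a < b) {u v w : ℝ → ℂ} (hu : ContinuousOn u (Icc a b))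
    (hv : IntegrableOn v (Ioo a b)) (hw : ContinuousOn w (Icc a b))
    (huv : IsWeakDeriv a b 1 u v) (huw : IsWeakDeriv a b 2 u w) {x : ℝ} (hx : x ∈ Ioo a b) :
    iteratedDeriv 2 u x = w x := by
  have hvw : IsWeakDeriv a b 1 v w := huv.of_add huw
  have hwi : IntegrableOn w (Ioo a b) := hw.integrableOn_Icc.mono_set Ioo_subset_Icc_self
  obtain ⟨c, hc⟩ := weakDeriv_one_repr hab hv hwi hvw
  have hu' := weakDeriv_one_repr_of_continuousOn hab hu hv huv
  have hwI := intervalIntegrable_of_Ioo hab.le hwi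
  let W : ℝ → ℂ := fun x => c + ∫ y in a..x, w y
  have hW : ContinuousOn W (Icc a b) := by
    have := intervalIntegral.continuousOn_primitive_interval' hwI left_mem_uIcc
    rw [uIcc_of_le hab.le] at this
    exact continuousOn_const.add this
  have prim : ∀ g : ℝ → ℂ, ContinuousOn g (Icc a b) → ∀ y ∈ Ioo a b,
      HasDerivAt (fun x => ∫ z in a..x, g z) (g y) y := by
    intro g hg y hy
    refine intervalIntegral.integral_hasDerivAt_right ?_ ?_ ?_
    · refine ContinuousOn.intervalIntegrable (hg.mono ?_)
      rw [uIcc_of_le hy.1.le]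
      exact Icc_subset_Icc_right hy.2.le
    · exact (hg.mono Ioo_subset_Icc_self).stronglyMeasurableAtFilter isOpen_Ioo y hy
    · exact hg.continuousAt (Icc_mem_nhds hy.1 hy.2)
  have hu2 : ∀ y ∈ Icc a b, u y = u a + ∫ z in a..y, W z := by
    intro y hy
    rw [hu' y hy]
    congr 1
    refine intervalIntegral.integral_congr_ae_restrict ?_
    rw [uIoc_of_le hy.1]
    have : ∀ᵐ x ∂volume.restrict (Ioc a y), x ∈ Ioo a b → v x = W x :=
      ae_restrict_of_ae ((ae_restrict_iff' measurableSet_Ioo).1 hc)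
    have hne : ∀ᵐ x ∂volume.restrict (Ioc a y), x ≠ b := by
      refine ae_restrict_of_ae ?_
      exact Measure.ae_ne volume b
    filter_upwards [this, hne, ae_restrict_mem measurableSet_Ioc] with x h1 h2 h3
    exact h1 ⟨h3.1, lt_of_le_of_ne (h3.2.trans hy.2) h2⟩
  have hd1 : ∀ y ∈ Ioo a b, deriv u y = W y := by
    intro y hy
    have h1 : HasDerivAt (fun x => u a + ∫ z in a..x, W z) (W y) y :=
      (prim W hW y hy).const_add _
    refine (h1.congr_of_eventuallyEq ?_).deriv
    filter_upwards [Icc_mem_nhds hy.1 hy.2] with z hz using hu2 z hz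
  rw [iteratedDeriv_succ, iteratedDeriv_one]
  have h2 : HasDerivAt W (w x) x := (prim w hw x hx).const_add _
  refine (h2.congr_of_eventuallyEq ?_).deriv
  filter_upwards [Ioo_mem_nhds hx.1 hx.2] with z hz using hd1 z hz

end Trig

/-! ### Functions with a square integrable derivative -/

section FirstOrder

variable {a b : ℝ}

/-- `u` is on `[a, b]` the primitive of a function with `L²` norm at most `K`. -/
def IsH1 (a b : ℝ) (u : ℝ → ℂ) (K : ℝ) : Prop :=
  ∃ v : ℝ → ℂ, MemLp v 2 (volume.restrict (Ioo a b)) ∧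
    (∀ x ∈ Icc a b, u x = u a + ∫ y in a..x, v y) ∧ ∫ x in a..b, ‖v x‖ ^ 2 ≤ K ^ 2

theorem l2Norm_eq (hab : a ≤ b) {v : ℝ → ℂ} (hv : MemLp v 2 (volume.restrict (Ioo a b))) :
    l2Norm a b v = ENNReal.ofReal √(∫ x in a..b, ‖v x‖ ^ 2) := by
  rw [l2Norm, hv.eLpNorm_eq_integral_rpow_norm (by norm_num) (by norm_num), ← integral_Ioo_eq hab,
    Real.sqrt_eq_rpow]
  simp

theorem l2Norm_le (hab : a ≤ b) {v : ℝ → ℂ} (hv : MemLp v 2 (volume.restrict (Ioo a b))) {K : ℝ}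
    (hK : 0 ≤ K) (h : ∫ x in a..b, ‖v x‖ ^ 2 ≤ K ^ 2) : l2Norm a b v ≤ ENNReal.ofReal K := by
  rw [l2Norm_eq hab hv]
  exact ENNReal.ofReal_le_ofReal (Real.sqrt_le_iff.2 ⟨hK, h⟩)

theorem memLp_of_isWeakDeriv {u v : ℝ → ℂ} {j : ℕ} (h : IsWeakDeriv a b j u v)
    (hv : l2Norm a b v < ⊤) : MemLp v 2 (volume.restrict (Ioo a b)) :=
  ⟨h.2.1.aestronglyMeasurable, hv⟩

theorem exists_isWeakDeriv_of_semiNorm_lt {u : ℝ → ℂ} {j : ℕ} {K : ENNReal}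
    (h : semiNorm a b j u < K) : ∃ v, IsWeakDeriv a b j u v ∧
      MemLp v 2 (volume.restrict (Ioo a b)) ∧ l2Norm a b v < K := by
  simp only [semiNorm, iInf_lt_iff] at h
  obtain ⟨v, hv, hK⟩ := h
  exact ⟨v, hv, memLp_of_isWeakDeriv hv (hK.trans_le le_top), hK⟩

/-- The seminorm is an infimum over weak derivatives; the strict inequality is what allows one of
them to be selected. -/
theorem isH1_of_semiNorm_lt (hab : a < b) {u : ℝ → ℂ} {K : ℝ} (hu : ContinuousOn u (Icc a b))
    (h : semiNorm a b 1 u < ENNReal.ofReal K) : IsH1 a b u K := by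
  obtain ⟨v, hv, hv2, hK⟩ := exists_isWeakDeriv_of_semiNorm_lt h
  refine ⟨v, hv2, weakDeriv_one_repr_of_continuousOn hab hu (integrableOn_of_memLp_two hv2) hv, ?_⟩
  rw [l2Norm_eq hab.le hv2] at hK
  have hK0 : 0 < K := by
    by_contra hn
    rw [ENNReal.ofReal_of_nonpos (not_lt.1 hn)] at hK
    exact absurd hK not_lt_zero
  have := (ENNReal.ofReal_lt_ofReal_iff hK0).1 hK
  have h0 : 0 ≤ ∫ x in a..b, ‖v x‖ ^ 2 :=
    intervalIntegral.integral_nonneg hab.le fun x _ => sq_nonneg _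
  exact ((Real.sqrt_lt' hK0).1 this).le

theorem semiNorm_le_sobolevNorm {m j : ℕ} (hj : j ≤ m) (u : ℝ → ℂ) :
    semiNorm a b j u ≤ sobolevNorm a b m u := by
  have h1 : semiNorm a b j u ^ 2 ≤ ∑ i ∈ Finset.range (m + 1), semiNorm a b i u ^ 2 :=
    Finset.single_le_sum (f := fun i => semiNorm a b i u ^ 2) (fun _ _ => zero_le)
      (Finset.mem_range.2 (Nat.lt_succ_of_le hj))
  have h2 := ENNReal.rpow_le_rpow h1 (by norm_num : (0 : ℝ) ≤ 1 / 2)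
  rwa [← ENNReal.rpow_natCast, ← ENNReal.rpow_mul, Nat.cast_ofNat, mul_one_div_cancel two_ne_zero,
    ENNReal.rpow_one] at h2

theorem isH1_of_sobolevNorm_le (hab : a < b) {u : ℝ → ℂ} {K K' : ℝ} {m : ℕ} (hm : 1 ≤ m)
    (hu : ContinuousOn u (Icc a b)) (h : sobolevNorm a b m u ≤ ENNReal.ofReal K) (hK : K < K')
    (hK' : 0 < K') : IsH1 a b u K' := by
  refine isH1_of_semiNorm_lt hab hu (((semiNorm_le_sobolevNorm hm u).trans h).trans_lt ?_)
  exact (ENNReal.ofReal_lt_ofReal_iff hK').2 hK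

theorem IsH1.sub_eq {u : ℝ → ℂ} (hab : a < b) {v : ℝ → ℂ}
    (hv : MemLp v 2 (volume.restrict (Ioo a b)))
    (h : ∀ x ∈ Icc a b, u x = u a + ∫ y in a..x, v y) {x y : ℝ} (hx : x ∈ Icc a b)
    (hy : y ∈ Icc a b) : u y - u x = ∫ z in x..y, v z := by
  have hvi := intervalIntegrable_of_Ioo hab.le (integrableOn_of_memLp_two hv)
  have sub : ∀ z ∈ Icc a b, IntervalIntegrable v volume a z := by
    intro z hz
    refine hvi.mono_set ?_
    rw [uIcc_of_le hz.1, uIcc_of_le hab.le]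
    exact Icc_subset_Icc_right hz.2
  rw [h x hx, h y hy, ← intervalIntegral.integral_interval_sub_left (sub y hy) (sub x hx)]
  ring

theorem grid_mem_Icc (hab : a < b) {M j : ℕ} (hM : 1 ≤ M) (hj : j ≤ M) :
    grid a b M j ∈ Icc a b := by
  have hh := mesh_pos hab hM
  have hj' : (j : ℝ) ≤ M := by exact_mod_cast hj
  have := mul_mesh (a := a) (b := b) hM
  constructor
  · unfold grid; nlinarith [Nat.cast_nonneg (α := ℝ) j]
  · unfold grid; nlinarith

theorem grid_mem_Ioo (hab : a < b) {M j : ℕ} (hj : j ∈ Finset.Ioo 0 M) :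
    grid a b M j ∈ Ioo a b := by
  obtain ⟨h0, h1⟩ := Finset.mem_Ioo.1 hj
  have hM : 1 ≤ M := by omega
  have hh := mesh_pos hab hM
  have hj' : (j : ℝ) < M := by exact_mod_cast h1
  have hj0 : (0 : ℝ) < j := by exact_mod_cast h0
  have := mul_mesh (a := a) (b := b) hM
  constructor
  · unfold grid; nlinarith
  · unfold grid; nlinarith

theorem grid_zero (M : ℕ) : grid a b M 0 = a := by simp [grid]

theorem grid_last {M : ℕ} (hM : 1 ≤ M) : grid a b M M = b := by
  rw [grid, mul_mesh hM]; ring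

theorem grid_succ_sub (M j : ℕ) : grid a b M (j + 1) - grid a b M j = mesh a b M := by
  unfold grid; push_cast; ring

/-- Integrals over the cells of the grid add up. -/
theorem sum_integral_grid (hab : a < b) {M : ℕ} (hM : 1 ≤ M) {g : ℝ → ℝ}
    (hg : IntervalIntegrable g volume a b) :
    ∑ j ∈ Finset.range M, ∫ x in grid a b M j..grid a b M (j + 1), g x = ∫ x in a..b, g x := by
  rw [intervalIntegral.sum_integral_adjacent_intervals, grid_zero, grid_last hM]
  intro k hk
  refine hg.mono_set ?_
  rw [uIcc_of_le hab.le]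
  exact uIcc_subset_Icc (grid_mem_Icc hab hM hk.le) (grid_mem_Icc hab hM hk)

/-- Each difference of grid values is the integral of the derivative over one cell, and
Cauchy-Schwarz there contributes exactly the factor `h` that the discrete norm divides by. The bound
is therefore the same for every `M`. -/
theorem IsH1.gridH1_le {u : ℝ → ℂ} {K : ℝ} (hab : a < b) (hu : IsH1 a b u K) (hK : 0 ≤ K) {M : ℕ}
    (hM : 1 ≤ M) : gridH1 a b M (fun j => u (grid a b M j)) ≤ K := by
  obtain ⟨v, hv, huv, hvK⟩ := hu
  have hh := mesh_pos hab hM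
  refine (abs_le_of_sq_le_sq' (le_trans ?_ hvK) hK).2
  have hi2 : IntervalIntegrable (fun x => ‖v x‖ ^ 2) volume a b :=
    (intervalIntegrable_iff_integrableOn_Ioo_of_le hab.le).2 (integrableOn_norm_sq hv)
  rw [gridH1_sq, inv_pow, Real.sq_sqrt hh.le, ← sum_integral_grid hab hM hi2, Finset.mul_sum]
  refine Finset.sum_le_sum fun j hj => ?_
  have hj' : j < M := by simpa using hj
  have hx := grid_mem_Icc hab hM hj'.le
  have hy := grid_mem_Icc hab hM (Nat.succ_le_of_lt hj')
  have hsub := grid_succ_sub (a := a) (b := b) M j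
  rw [IsH1.sub_eq hab hv huv hx hy, inv_mul_le_iff₀ hh]
  have := norm_integral_sq_le (a := grid a b M j) (b := grid a b M (j + 1)) (by linarith)
    (memLp_two_subset hv (Ioo_subset_Ioo hx.1 hy.2))
  rwa [hsub] at this

theorem IsH1.norm_le {u : ℝ → ℂ} {K : ℝ} (hab : a < b) (hu : IsH1 a b u K) (hK : 0 ≤ K)
    (ha : u a = 0) {x : ℝ} (hx : x ∈ Icc a b) : ‖u x‖ ≤ √(b - a) * K := by
  obtain ⟨v, hv, huv, hvK⟩ := hu
  refine (abs_le_of_sq_le_sq' ?_ (by positivity)).2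
  have hba := sub_pos.2 hab
  rw [huv x hx, ha, zero_add, mul_pow, Real.sq_sqrt hba.le]
  refine (norm_integral_sq_le hx.1 (memLp_two_subset hv (Ioo_subset_Ioo_right hx.2))).trans ?_
  have hi2 : IntervalIntegrable (fun x => ‖v x‖ ^ 2) volume a b :=
    (intervalIntegrable_iff_integrableOn_Ioo_of_le hab.le).2 (integrableOn_norm_sq hv)
  have h1 : ∫ x in a..x, ‖v x‖ ^ 2 ≤ ∫ x in a..b, ‖v x‖ ^ 2 :=
    intervalIntegral.integral_mono_interval le_rfl hx.1 hx.2
      (ae_of_all _ fun _ => sq_nonneg _) hi2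
  have h2 : 0 ≤ ∫ x in a..x, ‖v x‖ ^ 2 :=
    intervalIntegral.integral_nonneg hx.1 fun x _ => sq_nonneg _
  have := hx.2
  have := hx.1
  gcongr
  exact h1.trans hvK

/-- Since `u` vanishes at both ends, `μ_l` times its sine coefficient is the cosine coefficient of
its derivative, and Bessel's inequality applies. -/
theorem IsH1.hsBound {u : ℝ → ℂ} {K : ℝ} (hab : a < b) (hu : IsH1 a b u K) (hK : 0 ≤ K)
    (ha : u a = 0) (hb : u b = 0) : HsBound a b 1 (sineCoeff a b u) (√(2 / (b - a)) * K) := by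
  obtain ⟨v, hv, huv, hvK⟩ := hu
  intro N
  refine le_trans (le_of_eq ?_) (bessel_cs hab N hK hv hvK)
  have hvi := intervalIntegrable_of_Ioo hab.le (integrableOn_of_memLp_two hv)
  have h0 : ∫ x in a..b, v x = 0 := by
    have := huv b (right_mem_Icc.2 hab.le)
    rw [ha, hb, zero_add] at this
    exact this.symm
  refine l2_congr fun l _ => ?_
  rw [← mu_mul_integral_primitive_mul_sn hab hvi h0 l, sineCoeff_eq hab.le, pow_one,
    Complex.real_smul]
  have h3 : ∫ x in a..b, u x * (sn a b l x : ℂ)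
      = ∫ x in a..b, (∫ y in a..x, v y) * (sn a b l x : ℂ) := by
    refine intervalIntegral.integral_congr fun x hx => ?_
    rw [uIcc_of_le hab.le] at hx
    rw [huv x hx, ha, zero_add]
  rw [h3]
  congr 1
  ring

end FirstOrder

/-! ### Sine series -/

section SineSeries

variable {a b : ℝ}

theorem sineCoeff_zero (u : ℝ → ℂ) : sineCoeff a b u 0 = 0 := by
  simp [sineCoeff, mu]

/-- A continuous function vanishing at the ends of the interval whose sine coefficients are
absolutely summable is the sum of its sine series. -/
theorem hasSum_sineCoeff (hab : a < b) {u : ℝ → ℂ} (hu : ContinuousOn u (Icc a b)) (ha : u a = 0)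
    (hb : u b = 0) (hs : Summable fun l => ‖sineCoeff a b u l‖) {x : ℝ} (hx : x ∈ Icc a b) :
    HasSum (fun l => sineCoeff a b u l * (sn a b l x : ℂ)) (u x) := by
  set L : ℝ := b - a with hL
  have hLpos : 0 < L := sub_pos.2 hab
  have : Fact (0 < 2 * L) := ⟨by linarith⟩
  -- Clamping at zero extends `u(a + ·)` by its value `u a = 0` to negative arguments, so `g` is the
  -- odd extension to `[-L, L]`. It closes up to a continuous function on the circle of length `2L`
  -- because `u b = 0`.
  let A : ℝ → ℂ := fun y => u (a + max y 0)
  let g : ℝ → ℂ := fun y => A y - A (-y)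
  have hmap : ∀ y ≤ L, a + max y 0 ∈ Icc a b := by
    intro y hy
    constructor
    · linarith [le_max_right y 0]
    · have : max y 0 ≤ L := max_le hy hLpos.le
      linarith
  have hA : ContinuousOn A (Icc (-L) L) := by
    refine hu.comp (by fun_prop) fun y hy => hmap y hy.2
  have hA' : ContinuousOn (fun y => A (-y)) (Icc (-L) L) :=
    hA.comp continuousOn_neg fun y hy => ⟨by linarith [hy.2], by linarith [hy.1]⟩
  have hA0 : ∀ y ≤ 0, A y = 0 := by
    intro y hy
    simp only [A, max_eq_right hy, add_zero, ha]
  have hend : -L + 2 * L = L := by ring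
  have hg : ContinuousOn g (Icc (-L) (-L + 2 * L)) := by
    rw [hend]; exact hA.sub hA'
  have hAL : A L = 0 := by
    simp only [A, max_eq_left hLpos.le]
    rw [hL, add_sub_cancel, hb]
  have hper : g (-L) = g (-L + 2 * L) := by
    rw [hend]
    simp only [g, neg_neg, hAL, hA0 (-L) (by linarith)]
  let G : C(AddCircle (2 * L), ℂ) := ⟨AddCircle.liftIco (2 * L) (-L) g,
    AddCircle.liftIco_continuous hper hg⟩
  have hfou : ∀ (n : ℤ) (y : ℝ), fourier n (y : AddCircle (2 * L))
      = Complex.exp (((Real.pi * n / L * y : ℝ) : ℂ) * Complex.I) := by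
    intro n y
    rw [fourier_coe_apply]
    congr 1
    have : (L : ℂ) ≠ 0 := by exact_mod_cast hLpos.ne'
    push_cast
    field_simp
  -- By oddness the Fourier coefficients reduce to sine integrals over `[a, b]`, so summability of
  -- the sine coefficients is summability of the Fourier coefficients, and pointwise convergence of
  -- the Fourier series can be used.
  have hcoeff : ∀ n : ℤ, fourierCoeff G n
      = -(Complex.I / L) * ∫ y in a..b, u y * ((Real.sin (Real.pi * n / L * (y - a)) : ℝ) : ℂ) := by
    intro n
    change fourierCoeff (AddCircle.liftIco (2 * L) (-L) g) n = _
    rw [fourierCoeff_liftIco_eq, fourierCoeffOn_eq_integral]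
    have e0 : -L + 2 * L - -L = 2 * L := by ring
    rw [e0, hend]
    let e : ℝ → ℂ := fun y => fourier (-n) (y : AddCircle (2 * L))
    have hec : Continuous e := (map_continuous (fourier (-n))).comp (AddCircle.continuous_mk' _)
    have huIcc : uIcc (-L) L = Icc (-L) L := uIcc_of_le (by linarith)
    have i1 : IntervalIntegrable (fun y => e y * A y) volume (-L) L :=
      ContinuousOn.intervalIntegrable (by rw [huIcc]; exact hec.continuousOn.mul hA)
    have i2 : IntervalIntegrable (fun y => e y * A (-y)) volume (-L) L :=
      ContinuousOn.intervalIntegrable (by rw [huIcc]; exact hec.continuousOn.mul hA')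
    have hec' : Continuous fun y => e (-y) := hec.comp continuous_neg
    have i3 : IntervalIntegrable (fun y => e (-y) * A y) volume (-L) L :=
      ContinuousOn.intervalIntegrable (by rw [huIcc]; exact hec'.continuousOn.mul hA)
    have s1 : ∫ y in -L..L, e y • g y = ∫ y in -L..L, (e y - e (-y)) * A y := by
      have : ∫ y in -L..L, e y * A (-y) = ∫ y in -L..L, e (-y) * A y := by
        have := intervalIntegral.integral_comp_neg (a := -L) (b := L) (fun y => e (-y) * A y)
        simpa using this
      simp only [smul_eq_mul, g, mul_sub, sub_mul]
      rw [intervalIntegral.integral_sub i1 i2, intervalIntegral.integral_sub i1 i3, this]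
    have s2 : ∀ y, e y - e (-y) = -(2 * Complex.I) * ((Real.sin (Real.pi * n / L * y) : ℝ) : ℂ) := by
      intro y
      simp only [e, hfou]
      have a1 : Real.pi * (-n : ℤ) / L * y = -(Real.pi * n / L * y) := by push_cast; ring
      have a2 : Real.pi * (-n : ℤ) / L * -y = Real.pi * n / L * y := by push_cast; ring
      rw [a1, a2, Complex.ofReal_neg, Complex.ofReal_sin, Complex.sin]
      linear_combination ((Complex.exp (-((Real.pi * n / L * y : ℝ) : ℂ) * Complex.I)
        - Complex.exp (((Real.pi * n / L * y : ℝ) : ℂ) * Complex.I))) * Complex.I_sq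
    have i4 : ∀ p q, -L ≤ p → p ≤ q → q ≤ L →
        IntervalIntegrable (fun y => (e y - e (-y)) * A y) volume p q := by
      intro p q hp hpq hq
      refine ContinuousOn.intervalIntegrable ?_
      rw [uIcc_of_le hpq]
      exact ((hec.sub hec').continuousOn.mul hA).mono (Icc_subset_Icc hp hq)
    have s3 : ∫ y in -L..L, (e y - e (-y)) * A y = ∫ y in (0 : ℝ)..L, (e y - e (-y)) * A y := by
      rw [← intervalIntegral.integral_add_adjacent_intervals (b := 0)
        (i4 _ _ le_rfl (by linarith) hLpos.le) (i4 _ _ (by linarith) hLpos.le le_rfl)]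
      rw [add_eq_right]
      refine intervalIntegral.integral_zero_ae (ae_of_all _ fun y hy => ?_)
      rw [uIoc_of_le (by linarith)] at hy
      rw [hA0 y hy.2, mul_zero]
    have s4 : ∫ y in (0 : ℝ)..L, (e y - e (-y)) * A y
        = -(2 * Complex.I) * ∫ y in a..b, u y * ((Real.sin (Real.pi * n / L * (y - a)) : ℝ) : ℂ) := by
      have := intervalIntegral.integral_comp_add_left (a := 0) (b := L)
        (fun y => u y * ((Real.sin (Real.pi * n / L * (y - a)) : ℝ) : ℂ)) a
      rw [add_zero, hL, add_sub_cancel] at this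
      rw [hL, ← this, ← intervalIntegral.integral_const_mul]
      refine intervalIntegral.integral_congr fun y hy => ?_
      rw [← hL] at hy ⊢
      rw [uIcc_of_le hLpos.le] at hy
      simp only [s2, A, max_eq_left hy.1, add_sub_cancel_left]
      ring
    change (1 / (2 * L)) • (∫ y in -L..L, e y • g y) = _
    rw [s1, s3, s4, Complex.real_smul]
    push_cast
    have : (L : ℂ) ≠ 0 := by exact_mod_cast hLpos.ne'
    field_simp
  have hpos : ∀ l : ℕ, fourierCoeff G (l : ℤ) = -(Complex.I / 2) * sineCoeff a b u l := by
    intro l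
    have hmu : Real.pi * l / L = mu a b l := rfl
    rw [hcoeff, sineCoeff_eq hab.le]
    push_cast
    simp only [← hmu, sn, hL]
    push_cast
    ring
  have hneg : ∀ l : ℕ, fourierCoeff G (-(l : ℤ)) = (Complex.I / 2) * sineCoeff a b u l := by
    intro l
    have h1 : fourierCoeff G (-(l : ℤ)) = -fourierCoeff G (l : ℤ) := by
      rw [hcoeff, hcoeff, ← mul_neg, ← intervalIntegral.integral_neg]
      congr 1
      refine intervalIntegral.integral_congr fun y _ => ?_
      have : Real.pi * ((-(l : ℤ) : ℤ) : ℝ) / L * (y - a)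
          = -(Real.pi * ((l : ℤ) : ℝ) / L * (y - a)) := by push_cast; ring
      simp only [this, Real.sin_neg]
      push_cast; ring
    rw [h1, hpos]; ring
  have hsum : Summable (fourierCoeff G) := by
    refine Summable.of_nat_of_neg ?_ ?_
    · simp only [hpos]; exact (hs.of_norm).mul_left _
    · simp only [hneg]; exact (hs.of_norm).mul_left _
  have hx' : x - a ∈ Icc 0 L := ⟨by linarith [hx.1], by linarith [hx.2]⟩
  have hgx : g (x - a) = u x := by
    simp only [g, A, max_eq_left hx'.1]
    rw [max_eq_right (by linarith [hx'.1] : -(x - a) ≤ 0), add_sub_cancel, add_zero, ha, sub_zero]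
  have hGx : G ((x - a : ℝ) : AddCircle (2 * L)) = u x := by
    rw [← hgx]
    rcases hx'.2.lt_or_eq with hlt | heq
    · exact AddCircle.liftIco_coe_apply (p := 2 * L) (a := -L) (f := g)
        ⟨by linarith [hx'.1], by linarith⟩
    -- At `x = b` the point `L` lies outside the fundamental interval `[-L, L)` and has to be
    -- identified with `-L`, where the extension takes the same value.
    · have e1 : ((x - a : ℝ) : AddCircle (2 * L)) = ((-L : ℝ) : AddCircle (2 * L)) := by
        rw [heq]
        have := AddCircle.coe_add_period (2 * L) (-L)
        rw [hend] at this
        exact this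
      rw [e1, heq]
      have e2 : G ((-L : ℝ) : AddCircle (2 * L)) = g (-L) :=
        AddCircle.liftIco_coe_apply (p := 2 * L) (a := -L) (f := g) ⟨le_rfl, by linarith⟩
      rw [e2, hper, hend]
  have hpt := (has_pointwise_sum_fourier_series_of_summable hsum
    ((x - a : ℝ) : AddCircle (2 * L))).nat_add_neg
  rw [hGx] at hpt
  have h0 : fourierCoeff G 0 = 0 := by
    have := hpos 0
    rw [sineCoeff_zero, mul_zero] at this
    exact_mod_cast this
  rw [h0, zero_smul, add_zero] at hpt
  refine hpt.congr_fun fun l => ?_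
  rw [hpos, hneg, hfou, hfou]
  have a1 : Real.pi * ((l : ℤ) : ℝ) / L * (x - a) = mu a b l * (x - a) := by
    push_cast; rfl
  have a2 : Real.pi * ((-(l : ℤ) : ℤ) : ℝ) / L * (x - a) = -(mu a b l * (x - a)) := by
    unfold mu; push_cast; ring
  rw [a1, a2, sn, Complex.ofReal_neg, Complex.ofReal_sin, Complex.sin]
  simp only [smul_eq_mul]
  ring

/-- The constant in the Sobolev embedding for sine series. -/
noncomputable def embConst (a b : ℝ) : ℝ := √2 * (b - a) / Real.pi

theorem embConst_pos (hab : a < b) : 0 < embConst a b := by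
  have := sub_pos.2 hab
  have := Real.pi_pos
  unfold embConst; positivity

theorem l2_inv_mu_le (hab : a < b) (N : ℕ) :
    l2 (Finset.Ioo 0 N) (fun l => (mu a b l)⁻¹) ≤ embConst a b := by
  refine l2_le_of_sum_le (embConst_pos hab).le ?_
  have h := sum_Ioo_inv_sq_le (α := ℝ) 0 N
  have h2 : ∀ l ∈ Finset.Ioo 0 N, ‖(mu a b l)⁻¹‖ ^ 2 = ((b - a) / Real.pi) ^ 2 * ((l : ℝ) ^ 2)⁻¹ := by
    intro l _
    rw [Real.norm_eq_abs, sq_abs, mu]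
    have := Real.pi_ne_zero
    field_simp
  rw [Finset.sum_congr rfl h2, ← Finset.mul_sum]
  have h3 : embConst a b ^ 2 = ((b - a) / Real.pi) ^ 2 * 2 := by
    unfold embConst
    rw [div_pow, mul_pow, Real.sq_sqrt two_pos.le]; ring
  rw [h3]
  gcongr
  simpa using h

theorem HsBound.nonneg {r : ℕ} {c : ℕ → ℂ} {R : ℝ} (h : HsBound a b r c R) : 0 ≤ R :=
  (l2_nonneg _ _).trans (h 0)

theorem HsBound.mono {r : ℕ} {c : ℕ → ℂ} {R R' : ℝ} (h : HsBound a b r c R) (hR : R ≤ R') :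
    HsBound a b r c R' := fun N => (h N).trans hR

theorem HsBound.congr {r : ℕ} {c d : ℕ → ℂ} {R : ℝ} (h : HsBound a b r c R) (hcd : ∀ l, c l = d l) :
    HsBound a b r d R := by
  have : c = d := funext hcd
  rwa [← this]

theorem HsBound.add {r : ℕ} {c d : ℕ → ℂ} {R R' : ℝ} (h : HsBound a b r c R)
    (h' : HsBound a b r d R') : HsBound a b r (fun l => c l + d l) (R + R') := by
  intro N
  refine le_trans (le_of_eq ?_) ((l2_add_le _ _ _).trans (add_le_add (h N) (h' N)))
  exact l2_congr fun l _ => by rw [smul_add]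

theorem HsBound.of_norm_le {r : ℕ} {c d : ℕ → ℂ} {R k : ℝ} (h : HsBound a b r c R)
    (hk : 0 ≤ k) (hcd : ∀ l, ‖d l‖ ≤ k * ‖c l‖) : HsBound a b r d (k * R) := by
  intro N
  refine (l2_le_mul hk (w := fun l => mu a b l ^ r • c l) fun l _ => ?_).trans
    (mul_le_mul_of_nonneg_left (h N) hk)
  rw [norm_smul, norm_smul, mul_left_comm]
  gcongr
  exact hcd l

theorem mu_one_le (hab : a < b) {l : ℕ} (hl : 0 < l) : mu a b 1 ≤ mu a b l := by
  have := sub_pos.2 hab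
  have h1 : (1 : ℝ) ≤ l := by exact_mod_cast hl
  unfold mu
  have := Real.pi_pos
  push_cast
  gcongr

/-- A Poincaré inequality: every frequency is at least `μ_1`, so lowering the order costs only a
power of `μ_1`. -/
theorem HsBound.of_le (hab : a < b) {r s : ℕ} {c : ℕ → ℂ} {R : ℝ} (h : HsBound a b r c R)
    (hs : s ≤ r) : HsBound a b s c ((mu a b 1 ^ (r - s))⁻¹ * R) := by
  intro N
  have h1 : 0 < mu a b 1 := mu_pos hab one_pos
  refine (l2_le_mul (by positivity) (w := fun l => mu a b l ^ r • c l) fun l hl => ?_).trans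
    (mul_le_mul_of_nonneg_left (h N) (by positivity))
  have hl0 := (Finset.mem_Ioo.1 hl).1
  have h2 := mu_pos hab hl0
  rw [norm_smul, norm_smul, ← mul_assoc, norm_pow, norm_pow, Real.norm_of_nonneg h2.le]
  gcongr
  rw [← div_eq_inv_mul, le_div_iff₀ (by positivity)]
  calc mu a b l ^ s * mu a b 1 ^ (r - s) ≤ mu a b l ^ s * mu a b l ^ (r - s) := by
        gcongr; exact mu_one_le hab hl0
    _ = mu a b l ^ r := by rw [← pow_add, Nat.add_sub_cancel' hs]

/-- The one dimensional Sobolev embedding: one extra power of `μ` in `ℓ²` gives absolute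
summability, by Cauchy-Schwarz against the square summable sequence `1/μ_l`. -/
theorem HsBound.sum_le (hab : a < b) {r : ℕ} {c : ℕ → ℂ} {R : ℝ} (h : HsBound a b (r + 1) c R)
    (N : ℕ) : ∑ l ∈ Finset.Ioo 0 N, mu a b l ^ r * ‖c l‖ ≤ embConst a b * R := by
  have h1 := Real.sum_mul_le_sqrt_mul_sqrt (Finset.Ioo 0 N) (fun l => (mu a b l)⁻¹)
    (fun l => ‖mu a b l ^ (r + 1) • c l‖)
  have h2 : √(∑ l ∈ Finset.Ioo 0 N, (mu a b l)⁻¹ ^ 2) ≤ embConst a b := by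
    refine le_trans (le_of_eq ?_) (l2_inv_mu_le hab N)
    unfold l2
    congr 1
    exact Finset.sum_congr rfl fun l _ => by rw [Real.norm_eq_abs, sq_abs]
  refine le_trans (le_of_eq ?_) (h1.trans (mul_le_mul h2 (h N) (l2_nonneg _ _)
    (embConst_pos hab).le))
  refine Finset.sum_congr rfl fun l hl => ?_
  have h3 := mu_pos hab (Finset.mem_Ioo.1 hl).1
  rw [norm_smul, norm_pow, Real.norm_of_nonneg h3.le, pow_succ]
  field_simp

theorem HsBound.sum_range_le (hab : a < b) {r : ℕ} {c : ℕ → ℂ} {R : ℝ}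
    (h : HsBound a b (r + 1) c R) (h0 : c 0 = 0) (N : ℕ) :
    ∑ l ∈ Finset.range N, mu a b l ^ r * ‖c l‖ ≤ embConst a b * R := by
  rw [← sum_Ioo_eq_range _ (by simp [h0])]
  exact h.sum_le hab N

theorem HsBound.summable (hab : a < b) {r : ℕ} {c : ℕ → ℂ} {R : ℝ} (h : HsBound a b (r + 1) c R)
    (h0 : c 0 = 0) : Summable fun l => mu a b l ^ r * ‖c l‖ :=
  summable_of_sum_range_le (fun l => mul_nonneg (pow_nonneg (mu_nonneg hab l) _) (norm_nonneg _))
    (h.sum_range_le hab h0)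

theorem HsBound.summable_norm (hab : a < b) {r : ℕ} (hr : 1 ≤ r) {c : ℕ → ℂ} {R : ℝ}
    (h : HsBound a b r c R) (h0 : c 0 = 0) : Summable fun l => ‖c l‖ := by
  simpa using (HsBound.of_le hab h (s := 0 + 1) (by omega)).summable hab h0

/-- The limit of a Parseval identity for finite sums. -/
theorem integral_norm_sq_tsum_le {T : ℕ → ℝ → ℝ} (hT : ∀ l, Continuous (T l))
    (hT1 : ∀ l x, |T l x| ≤ 1) {κ : ℝ} (hκ : 0 ≤ κ)
    (h : ∀ l l', 0 < l → ∫ x in a..b, T l x * T l' x = if l = l' then κ else 0)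
    {c : ℕ → ℂ} (h0 : c 0 = 0) (hc : Summable fun l => ‖c l‖) {R : ℝ}
    (hR : ∀ N, l2 (Finset.Ioo 0 N) c ≤ R) :
    ∫ x in a..b, ‖∑' l, c l * (T l x : ℂ)‖ ^ 2 ≤ κ * R ^ 2 := by
  have hb : ∀ l x, ‖c l * (T l x : ℂ)‖ ≤ ‖c l‖ := by
    intro l x
    rw [norm_mul, Complex.norm_real, Real.norm_eq_abs]
    exact mul_le_of_le_one_right (norm_nonneg _) (hT1 l x)
  have hsum : ∀ x, Summable fun l => c l * (T l x : ℂ) := fun x =>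
    Summable.of_norm_bounded hc fun l => hb l x
  have hlim : Filter.Tendsto (fun N : ℕ => ∫ x in a..b, ‖∑ l ∈ Finset.range N, c l * (T l x : ℂ)‖ ^ 2)
      Filter.atTop (nhds (∫ x in a..b, ‖∑' l, c l * (T l x : ℂ)‖ ^ 2)) := by
    -- Absolute summability bounds all partial sums by one constant, which serves as the dominating
    -- function on the bounded interval.
    refine intervalIntegral.tendsto_integral_filter_of_dominated_convergence
      (fun _ => (∑' l, ‖c l‖) ^ 2) ?_ ?_ (by simp) ?_
    · refine Filter.Eventually.of_forall fun N => Continuous.aestronglyMeasurable ?_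
      exact ((continuous_finsetSum _ fun l _ => continuous_const.mul
        (Complex.continuous_ofReal.comp (hT l))).norm.pow 2)
    · refine Filter.Eventually.of_forall fun N => ae_of_all _ fun x _ => ?_
      rw [norm_pow, norm_norm]
      gcongr
      refine (norm_sum_le _ _).trans ((Finset.sum_le_sum fun l _ => hb l x).trans ?_)
      exact hc.sum_le_tsum _ fun l _ => norm_nonneg _
    · refine ae_of_all _ fun x _ => ?_
      exact ((hsum x).hasSum.tendsto_sum_nat.norm.pow 2)
  refine le_of_tendsto' hlim fun N => ?_
  have e : ∀ x, ∑ l ∈ Finset.range N, c l * (T l x : ℂ)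
      = ∑ l ∈ Finset.Ioo 0 N, c l * (T l x : ℂ) := fun x =>
    (sum_Ioo_eq_range _ (by simp [h0])).symm
  simp only [e]
  rw [integral_norm_sq_of_orthogonal (κ := κ) _ c hT
    (fun l hl l' _ => h l l' (Finset.mem_Ioo.1 hl).1), ← l2_sq]
  gcongr
  · exact l2_nonneg _ _
  · exact hR N

/-- The sum of the sine series with coefficients `c`. -/
noncomputable def sineSeries (a b : ℝ) (c : ℕ → ℂ) (x : ℝ) : ℂ := ∑' l, c l * (sn a b l x : ℂ)

/-- The formal derivative of the sine series with coefficients `c`. -/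
noncomputable def cosSeries (a b : ℝ) (c : ℕ → ℂ) (x : ℝ) : ℂ :=
  ∑' l, (mu a b l * c l) * (cs a b l x : ℂ)

theorem hasDerivAt_sineSeries (hab : a < b) {c : ℕ → ℂ} {R : ℝ} (h : HsBound a b 2 c R)
    (h0 : c 0 = 0) (x : ℝ) : HasDerivAt (sineSeries a b c) (cosSeries a b c x) x := by
  have hs : Summable fun l => mu a b l * ‖c l‖ := by simpa using h.summable hab h0 (r := 1)
  refine hasDerivAt_tsum hs (y₀ := a) (g := fun l y => c l * (sn a b l y : ℂ))
    (g' := fun l y => (mu a b l * c l) * (cs a b l y : ℂ)) (fun l y => ?_) (fun l y => ?_) ?_ x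
  · have := (hasDerivAt_sn (a := a) (b := b) l y).ofReal_comp.const_mul (c l)
    exact this.congr_deriv (by push_cast; ring)
  · rw [norm_mul, norm_mul, Complex.norm_real, Complex.norm_real, Real.norm_of_nonneg
      (mu_nonneg hab l), Real.norm_eq_abs]
    exact mul_le_of_le_one_right (mul_nonneg (mu_nonneg hab l) (norm_nonneg _)) (abs_cs_le l y)
  · simp [sn_left]

theorem continuous_cosSeries (hab : a < b) {c : ℕ → ℂ} {R : ℝ} (h : HsBound a b 2 c R)
    (h0 : c 0 = 0) : Continuous (cosSeries a b c) := by
  have hs : Summable fun l => mu a b l * ‖c l‖ := by simpa using h.summable hab h0 (r := 1)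
  refine continuous_tsum (fun l => continuous_const.mul
    (Complex.continuous_ofReal.comp (continuous_cs l))) hs fun l y => ?_
  rw [norm_mul, norm_mul, Complex.norm_real, Complex.norm_real, Real.norm_of_nonneg
    (mu_nonneg hab l), Real.norm_eq_abs]
  exact mul_le_of_le_one_right (mul_nonneg (mu_nonneg hab l) (norm_nonneg _)) (abs_cs_le l y)

theorem sineSeries_left (c : ℕ → ℂ) : sineSeries a b c a = 0 := by
  simp [sineSeries, sn_left]

theorem sineSeries_right (hab : a < b) (c : ℕ → ℂ) : sineSeries a b c b = 0 := by
  simp [sineSeries, sn_right hab]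

theorem integral_sineSeries_le (hab : a < b) {c : ℕ → ℂ} (h0 : c 0 = 0)
    (hc : Summable fun l => ‖c l‖) {R : ℝ} (h : HsBound a b 0 c R) :
    ∫ x in a..b, ‖sineSeries a b c x‖ ^ 2 ≤ (b - a) / 2 * R ^ 2 := by
  have hba := sub_pos.2 hab
  exact integral_norm_sq_tsum_le continuous_sn abs_sn_le (half_pos hba).le
    (fun l l' hl => integral_sn_mul_sn hab hl) h0 hc fun N => by simpa using h N

theorem integral_cosSeries_le (hab : a < b) {c : ℕ → ℂ} (h0 : c 0 = 0)
    (hc : Summable fun l => mu a b l * ‖c l‖) {R : ℝ} (h : HsBound a b 1 c R) :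
    ∫ x in a..b, ‖cosSeries a b c x‖ ^ 2 ≤ (b - a) / 2 * R ^ 2 := by
  have hba := sub_pos.2 hab
  refine integral_norm_sq_tsum_le continuous_cs abs_cs_le (half_pos hba).le
    (fun l l' hl => integral_cs_mul_cs hab hl) (by simp [h0]) (hc.congr fun l => ?_) fun N => ?_
  · rw [norm_mul, Complex.norm_real, Real.norm_of_nonneg (mu_nonneg hab l)]
  · refine le_trans (le_of_eq (l2_congr fun l _ => ?_)) (h N)
    rw [pow_one, Complex.real_smul]

theorem sineSeries_sineCoeff (hab : a < b) {u : ℝ → ℂ} (hu : ContinuousOn u (Icc a b))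
    (ha : u a = 0) (hb : u b = 0) {R : ℝ} {r : ℕ} (hr : 1 ≤ r)
    (h : HsBound a b r (sineCoeff a b u) R) {x : ℝ} (hx : x ∈ Icc a b) :
    sineSeries a b (sineCoeff a b u) x = u x :=
  (hasSum_sineCoeff hab hu ha hb (h.summable_norm hab hr (sineCoeff_zero u)) hx).tsum_eq

theorem isWeakDeriv_sineSeries (hab : a < b) {c : ℕ → ℂ} {R : ℝ} (h : HsBound a b 2 c R)
    (h0 : c 0 = 0) : IsWeakDeriv a b 1 (sineSeries a b c) (cosSeries a b c) := by
  have hd := hasDerivAt_sineSeries hab h h0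
  have hc : Continuous (sineSeries a b c) :=
    continuous_iff_continuousAt.2 fun x => (hd x).continuousAt
  have hc' := continuous_cosSeries hab h h0
  refine ⟨hc.locallyIntegrable.locallyIntegrableOn _, hc'.locallyIntegrable.locallyIntegrableOn _,
    fun φ h1 h2 h3 => ?_⟩
  have hφ : IsTest a b φ := ⟨h1, h2, h3⟩
  have hφ' : Continuous (deriv φ) := hφ.1.continuous_deriv (by norm_num)
  rw [iteratedDeriv_one, integral_Ioo_eq hab.le, integral_Ioo_eq hab.le]
  have := intervalIntegral.integral_deriv_mul_eq_sub (a := a) (b := b)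
    (u := fun x => (φ x : ℂ)) (u' := fun x => ((deriv φ x : ℝ) : ℂ)) (v := sineSeries a b c)
    (v' := cosSeries a b c)
    (fun x _ => ((hφ.1.differentiable (by norm_num)) x).hasDerivAt.ofReal_comp) (fun x _ => hd x)
    ((Complex.continuous_ofReal.comp hφ').intervalIntegrable _ _) (hc'.intervalIntegrable _ _)
  rw [sineSeries_left, sineSeries_right hab, mul_zero, mul_zero, sub_zero,
    intervalIntegral.integral_add] at this
  · rw [pow_one, neg_one_mul]; exact eq_neg_of_add_eq_zero_left this
  · exact ((Complex.continuous_ofReal.comp hφ').mul hc).intervalIntegrable _ _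
  · exact ((Complex.continuous_ofReal.comp h1.continuous).mul hc').intervalIntegrable _ _

end SineSeries

/-! ### Interpolation errors -/

section Interpolation

variable {a b : ℝ}

theorem memLp_two_of_continuousOn {r : ℝ → ℂ} (hr : ContinuousOn r (Icc a b)) :
    MemLp r 2 (volume.restrict (Ioo a b)) := by
  have h1 : IntegrableOn r (Ioo a b) := hr.integrableOn_Icc.mono_set Ioo_subset_Icc_self
  have h2 : IntegrableOn (fun x => ‖r x‖ ^ 2) (Ioo a b) :=
    (hr.norm.pow 2).integrableOn_Icc.mono_set Ioo_subset_Icc_self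
  exact (memLp_two_iff_integrable_sq_norm h1.1).2 h2

/-- The value at the left end differs from the value at any point of the cell by an integral of the
derivative; Cauchy-Schwarz and averaging over the cell give the bound. -/
theorem mul_norm_sq_left_le {p q : ℝ} (hpq : p ≤ q) {r r' : ℝ → ℂ}
    (hr : ∀ x, HasDerivAt r (r' x) x) (hr' : Continuous r') :
    (q - p) * ‖r p‖ ^ 2
      ≤ 2 * (∫ x in p..q, ‖r x‖ ^ 2) + 2 * (q - p) ^ 2 * ∫ x in p..q, ‖r' x‖ ^ 2 := by
  have hrc : Continuous r := continuous_iff_continuousAt.2 fun x => (hr x).continuousAt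
  set J : ℝ := ∫ x in p..q, ‖r' x‖ ^ 2 with hJ
  have hpt : ∀ x ∈ Icc p q, ‖r p‖ ^ 2 ≤ 2 * ‖r x‖ ^ 2 + 2 * (q - p) * J := by
    intro x hx
    have h1 : r x - r p = ∫ y in p..x, r' y :=
      (intervalIntegral.integral_eq_sub_of_hasDerivAt (fun y _ => hr y)
        (hr'.intervalIntegrable _ _)).symm
    have hmem : MemLp r' 2 (volume.restrict (Ioo p x)) :=
      memLp_two_of_continuousOn hr'.continuousOn
    have h2 := norm_integral_sq_le hx.1 hmem
    have h3 : ∫ y in p..x, ‖r' y‖ ^ 2 ≤ J :=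
      intervalIntegral.integral_mono_interval le_rfl hx.1 hx.2
        (ae_of_all _ fun _ => sq_nonneg _) ((hr'.norm.pow 2).intervalIntegrable _ _)
    have h4 : 0 ≤ ∫ y in p..x, ‖r' y‖ ^ 2 :=
      intervalIntegral.integral_nonneg hx.1 fun x _ => sq_nonneg _
    have h5 : ‖r x - r p‖ ^ 2 ≤ (q - p) * J := by
      rw [h1]
      refine h2.trans ?_
      have := hx.1
      have := hx.2
      gcongr
    have h6 : ‖r p‖ ≤ ‖r x‖ + ‖r x - r p‖ := by
      have := norm_sub_le (r x) (r x - r p)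
      simpa using this
    have h7 : ‖r p‖ ^ 2 ≤ (‖r x‖ + ‖r x - r p‖) ^ 2 := by gcongr
    nlinarith [sq_nonneg (‖r x‖ - ‖r x - r p‖)]
  have h1 : ∫ _ in p..q, ‖r p‖ ^ 2 ≤ ∫ x in p..q, (2 * ‖r x‖ ^ 2 + 2 * (q - p) * J) :=
    intervalIntegral.integral_mono_on hpq (by simp)
      (Continuous.intervalIntegrable (by fun_prop) _ _) hpt
  rw [intervalIntegral.integral_add (Continuous.intervalIntegrable (by fun_prop) _ _) (by simp),
    intervalIntegral.integral_const_mul, intervalIntegral.integral_const,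
    intervalIntegral.integral_const, smul_eq_mul, smul_eq_mul] at h1
  calc _ ≤ _ := h1
    _ = _ := by ring

/-- A sampling inequality on the grid. -/
theorem mesh_mul_sum_norm_sq_le (hab : a < b) {M : ℕ} (hM : 1 ≤ M) {r r' : ℝ → ℂ}
    (hr : ∀ x, HasDerivAt r (r' x) x) (hr' : Continuous r') :
    mesh a b M * ∑ j ∈ Finset.Ioo 0 M, ‖r (grid a b M j)‖ ^ 2
      ≤ 2 * (∫ x in a..b, ‖r x‖ ^ 2) + 2 * mesh a b M ^ 2 * ∫ x in a..b, ‖r' x‖ ^ 2 := by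
  have hrc : Continuous r := continuous_iff_continuousAt.2 fun x => (hr x).continuousAt
  have hh := mesh_pos hab hM
  have i1 : IntervalIntegrable (fun x => ‖r x‖ ^ 2) volume a b :=
    (hrc.norm.pow 2).intervalIntegrable a b
  have i2 : IntervalIntegrable (fun x => ‖r' x‖ ^ 2) volume a b :=
    (hr'.norm.pow 2).intervalIntegrable a b
  rw [← sum_integral_grid hab hM i1, ← sum_integral_grid hab hM i2, Finset.mul_sum,
    Finset.mul_sum, Finset.mul_sum, ← Finset.sum_add_distrib]
  have hsub : Finset.Ioo 0 M ⊆ Finset.range M := fun j hj => by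
    simp at hj ⊢; exact hj.2
  calc ∑ j ∈ Finset.Ioo 0 M, mesh a b M * ‖r (grid a b M j)‖ ^ 2
      ≤ ∑ j ∈ Finset.range M, mesh a b M * ‖r (grid a b M j)‖ ^ 2 :=
        Finset.sum_le_sum_of_subset_of_nonneg hsub fun _ _ _ => by positivity
    _ ≤ _ := by
        refine Finset.sum_le_sum fun j _ => ?_
        have hs := grid_succ_sub (a := a) (b := b) M j
        have := mul_norm_sq_left_le (p := grid a b M j) (q := grid a b M (j + 1)) (by linarith) hr
          hr'
        rwa [hs] at this

/-- The part of a sequence of coefficients with index at least `M`. -/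
def tail (M : ℕ) (c : ℕ → ℂ) (l : ℕ) : ℂ := if l < M then 0 else c l

theorem mu_last (hab : a < b) {M : ℕ} (hM : 1 ≤ M) : mu a b M = Real.pi / mesh a b M := by
  have : (M : ℝ) ≠ 0 := by exact_mod_cast (by omega : M ≠ 0)
  have : b - a ≠ 0 := (sub_pos.2 hab).ne'
  unfold mu mesh; field_simp

/-- For `l ≥ M` one has `h μ_l ≥ π ≥ 1`, so each missing power of `μ_l` may be paid for by a power
of `h`. -/
theorem HsBound.tail (hab : a < b) {m s M : ℕ} (hM : 1 ≤ M) (hs : s ≤ m) {c : ℕ → ℂ} {R : ℝ}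
    (h : HsBound a b m c R) : HsBound a b s (tail M c) (mesh a b M ^ (m - s) * R) := by
  intro N
  have hh := mesh_pos hab hM
  refine (l2_le_mul (by positivity) (w := fun l => mu a b l ^ m • c l) fun l hl => ?_).trans
    (mul_le_mul_of_nonneg_left (h N) (by positivity))
  have hl0 := (Finset.mem_Ioo.1 hl).1
  have h2 := mu_pos hab hl0
  unfold EWISP.tail
  split_ifs with hlM
  · simp only [smul_zero, norm_zero]; positivity
  · rw [norm_smul, norm_smul, ← mul_assoc, norm_pow, norm_pow, Real.norm_of_nonneg h2.le]
    gcongr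
    have h3 : mu a b M ≤ mu a b l := by
      have hlM' : (M : ℝ) ≤ l := by exact_mod_cast not_lt.1 hlM
      have := sub_pos.2 hab
      have := Real.pi_pos
      unfold mu
      gcongr
    have h4 : 1 ≤ mesh a b M * mu a b l := by
      rw [mu_last hab hM, div_le_iff₀ hh] at h3
      have := Real.pi_gt_three
      linarith
    calc mu a b l ^ s ≤ (mesh a b M * mu a b l) ^ (m - s) * mu a b l ^ s :=
          le_mul_of_one_le_left (by positivity) (one_le_pow₀ h4)
      _ = mesh a b M ^ (m - s) * (mu a b l ^ (m - s) * mu a b l ^ s) := by ring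
      _ = _ := by rw [← pow_add, Nat.sub_add_cancel hs]

theorem tail_zero {M : ℕ} (hM : 1 ≤ M) (c : ℕ → ℂ) : tail M c 0 = 0 := by
  simp [tail]; omega

theorem sn_grid (hab : a < b) {M : ℕ} (hM : 1 ≤ M) (l j : ℕ) :
    sn a b l (grid a b M j) = Real.sin (j * l * Real.pi / M) := by
  have h : mu a b l * (grid a b M j - a) = j * l * Real.pi / M := by
    rw [grid, add_sub_cancel_left, mul_left_comm, mu_mul_mesh hab hM]; ring
  rw [sn, h]

theorem sineSeries_eq_sum_add_tail (hab : a < b) {m M : ℕ} (hM : 1 ≤ M) (hm : 1 ≤ m)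
    {c : ℕ → ℂ} {R : ℝ} (h0 : c 0 = 0) (h : HsBound a b m c R) (x : ℝ) :
    sineSeries a b c x = ∑ l ∈ Finset.Ioo 0 M, c l * (sn a b l x : ℂ)
      + sineSeries a b (tail M c) x := by
  have hs := h.summable_norm hab hm h0
  have ht := (HsBound.tail hab hM le_rfl h).summable_norm hab hm (tail_zero hM c)
  have hb : ∀ (d : ℕ → ℂ), (Summable fun l => ‖d l‖) → Summable fun l => d l * (sn a b l x : ℂ) := by
    intro d hd
    refine Summable.of_norm_bounded hd fun l => ?_
    rw [norm_mul, Complex.norm_real, Real.norm_eq_abs]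
    exact mul_le_of_le_one_right (norm_nonneg _) (abs_sn_le l x)
  have h1 : ∑ l ∈ Finset.Ioo 0 M, c l * (sn a b l x : ℂ)
      = ∑' l, (c l - tail M c l) * (sn a b l x : ℂ) := by
    rw [sum_Ioo_eq_range _ (by simp [h0])]
    rw [tsum_eq_sum (s := Finset.range M)]
    · refine Finset.sum_congr rfl fun l hl => ?_
      simp [tail, Finset.mem_range.1 hl]
    · intro l hl
      have : ¬ l < M := by simpa using hl
      simp [tail, this]
  rw [h1, sineSeries, sineSeries, ← Summable.tsum_add]
  · exact tsum_congr fun l => by ring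
  · simp only [sub_mul]; exact (hb c hs).sub (hb _ ht)
  · exact hb _ ht

/-- The aliasing error of the discrete sine transform. -/
theorem l2_sineCoeff_sub_dst_le (hab : a < b) {m M : ℕ} (hM : 1 ≤ M) (hm : 2 ≤ m) {u : ℝ → ℂ}
    (hu : ContinuousOn u (Icc a b)) (ha : u a = 0) (hb : u b = 0) {R : ℝ}
    (h : HsBound a b m (sineCoeff a b u) R) :
    l2 (Finset.Ioo 0 M) (fun l => sineCoeff a b u l - dst M (fun j => u (grid a b M j)) l)
      ≤ 2 * (mesh a b M ^ m * R) := by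
  set c := sineCoeff a b u with hc
  have h0 : c 0 = 0 := sineCoeff_zero u
  have hR := h.nonneg
  have hh := mesh_pos hab hM
  have hba := sub_pos.2 hab
  have ht0 := HsBound.tail hab hM (by omega : 0 ≤ m) h
  have ht1 := HsBound.tail hab hM (by omega : 1 ≤ m) h
  have ht2 := HsBound.tail hab hM hm h
  have htz := tail_zero hM c
  set r := sineSeries a b (tail M c) with hr
  have hd := hasDerivAt_sineSeries hab ht2 htz
  have hcont := continuous_cosSeries hab ht2 htz
  have hM' : (0 : ℝ) < M := by exact_mod_cast hM
  -- The discrete transform reproduces the modes below `M` exactly, so the aliasing error is the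
  -- transform of the sampled tail `r`. The sampling inequality then replaces any explicit folding
  -- of frequencies.
  have e1 : ∀ l ∈ Finset.Ioo 0 M, ‖c l - dst M (fun j => u (grid a b M j)) l‖
      = ‖dst M (fun j => r (grid a b M j)) l‖ := by
    intro l hl
    have : dst M (fun j => u (grid a b M j)) l
        = dst M (fun j => ∑ l ∈ Finset.Ioo 0 M, c l * ((Real.sin (j * l * Real.pi / M) : ℝ) : ℂ)
          + r (grid a b M j)) l := by
      refine dst_congr (fun j hj => ?_) l
      rw [← sineSeries_sineCoeff hab hu ha hb (by omega : 1 ≤ m) h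
        (Ioo_subset_Icc_self (grid_mem_Ioo hab hj)),
        sineSeries_eq_sum_add_tail hab hM (by omega : 1 ≤ m) h0 h]
      simp only [sn_grid hab hM]
      rfl
    rw [this, dst_add, dst_sum_sin c hl, sub_add_cancel_left, norm_neg]
  rw [l2_congr e1, l2_dst hM]
  have hsamp := mesh_mul_sum_norm_sq_le hab hM hd hcont
  have hi0 := integral_sineSeries_le hab htz (ht2.summable_norm hab (by omega) htz) ht0
  have hi1 := integral_cosSeries_le hab htz (by simpa using ht2.summable hab htz (r := 1)) ht1
  refine (abs_le_of_sq_le_sq' ?_ (by positivity)).2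
  rw [mul_pow, Real.sq_sqrt (by positivity), l2_sq]
  set S := ∑ j ∈ Finset.Ioo 0 M, ‖r (grid a b M j)‖ ^ 2 with hS
  -- The derivative of the tail is larger by a factor `1/h`, which the weight `h²` in the sampling
  -- inequality compensates.
  have e2 : mesh a b M ^ 2 * (mesh a b M ^ (m - 1) * R) ^ 2 = (mesh a b M ^ m * R) ^ 2 := by
    rw [← mul_pow, ← mul_assoc, ← pow_succ', Nat.sub_add_cancel (by omega)]
  have h3 : mesh a b M * S ≤ 2 * (b - a) * (mesh a b M ^ m * R) ^ 2 := by
    refine hsamp.trans ?_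
    rw [Nat.sub_zero] at hi0
    have : 2 * mesh a b M ^ 2 * ∫ x in a..b, ‖cosSeries a b (tail M c) x‖ ^ 2
        ≤ 2 * mesh a b M ^ 2 * ((b - a) / 2 * (mesh a b M ^ (m - 1) * R) ^ 2) := by gcongr
    have e3 : 2 * mesh a b M ^ 2 * ((b - a) / 2 * (mesh a b M ^ (m - 1) * R) ^ 2)
        = (b - a) * (mesh a b M ^ m * R) ^ 2 := by rw [← e2]; ring
    rw [e3] at this
    linarith
  have h4 : 2 / (M : ℝ) * S = 2 / (b - a) * (mesh a b M * S) := by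
    unfold mesh; field_simp
  rw [h4]
  calc 2 / (b - a) * (mesh a b M * S)
      ≤ 2 / (b - a) * (2 * (b - a) * (mesh a b M ^ m * R) ^ 2) := by gcongr
    _ = (2 * (mesh a b M ^ m * R)) ^ 2 := by field_simp

/-- The inverse inequality for coefficients of grid functions. -/
theorem l2_mu_smul_le (hab : a < b) {M : ℕ} (hM : 1 ≤ M) (c : ℕ → ℂ) :
    l2 (Finset.Ioo 0 M) (fun l => mu a b l • c l)
      ≤ Real.pi / mesh a b M * l2 (Finset.Ioo 0 M) c := by
  have hh := mesh_pos hab hM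
  refine l2_le_mul (div_nonneg Real.pi_pos.le hh.le) fun l hl => ?_
  rw [norm_smul, Real.norm_of_nonneg (mu_nonneg hab l), ← mu_last hab hM]
  gcongr
  have hlM : (l : ℝ) ≤ M := by exact_mod_cast (Finset.mem_Ioo.1 hl).2.le
  have := sub_pos.2 hab
  have := Real.pi_pos
  unfold mu
  gcongr

theorem l2_mu_sineCoeff_sub_dst_le (hab : a < b) {m M : ℕ} (hM : 1 ≤ M) (hm : 2 ≤ m) {u : ℝ → ℂ}
    (hu : ContinuousOn u (Icc a b)) (ha : u a = 0) (hb : u b = 0) {R : ℝ}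
    (h : HsBound a b m (sineCoeff a b u) R) :
    l2 (Finset.Ioo 0 M)
      (fun l => mu a b l • (sineCoeff a b u l - dst M (fun j => u (grid a b M j)) l))
      ≤ 2 * Real.pi * (mesh a b M ^ (m - 1) * R) := by
  have hh := mesh_pos hab hM
  have := Real.pi_pos
  refine (l2_mu_smul_le hab hM _).trans ((mul_le_mul_of_nonneg_left
    (l2_sineCoeff_sub_dst_le hab hM hm hu ha hb h) (by positivity)).trans (le_of_eq ?_))
  have : mesh a b M ^ m = mesh a b M ^ (m - 1) * mesh a b M := by
    rw [← pow_succ, Nat.sub_add_cancel (by omega)]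
  rw [this]
  field_simp

/-- The coefficients of the difference of a function and an interpolated grid function. -/
noncomputable def errCoeff (a b : ℝ) (M : ℕ) (u : ℝ → ℂ) (w : ℕ → ℂ) (l : ℕ) : ℂ :=
  (if l ∈ Finset.Ioo 0 M then sineCoeff a b u l - dst M w l else 0) + tail M (sineCoeff a b u) l

theorem errCoeff_zero {M : ℕ} (hM : 1 ≤ M) (u : ℝ → ℂ) (w : ℕ → ℂ) :
    errCoeff a b M u w 0 = 0 := by
  rw [errCoeff, tail_zero hM]; simp

theorem hsBound_ite {s M : ℕ} {d : ℕ → ℂ} {A : ℝ}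
    (h : l2 (Finset.Ioo 0 M) (fun l => mu a b l ^ s • d l) ≤ A) :
    HsBound a b s (fun l => if l ∈ Finset.Ioo 0 M then d l else 0) A := by
  intro N
  refine le_trans ?_ h
  unfold l2
  refine Real.sqrt_le_sqrt ?_
  have h1 : ∑ l ∈ Finset.Ioo 0 M, ‖mu a b l ^ s • d l‖ ^ 2
      = ∑ l ∈ Finset.Ioo 0 M, ‖mu a b l ^ s • (if l ∈ Finset.Ioo 0 M then d l else 0)‖ ^ 2 :=
    Finset.sum_congr rfl fun l hl => by rw [if_pos hl]
  rw [h1, ← Finset.sum_inter_add_sum_sdiff (Finset.Ioo 0 N) (Finset.Ioo 0 M)]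
  have h2 : ∑ l ∈ Finset.Ioo 0 N \ Finset.Ioo 0 M,
      ‖mu a b l ^ s • (if l ∈ Finset.Ioo 0 M then d l else 0)‖ ^ 2 = 0 :=
    Finset.sum_eq_zero fun l hl => by
      rw [if_neg (Finset.mem_sdiff.1 hl).2]; simp
  rw [h2, add_zero]
  exact Finset.sum_le_sum_of_subset_of_nonneg Finset.inter_subset_right fun _ _ _ => by positivity

theorem hsBound_errCoeff (hab : a < b) {m s M : ℕ} (hM : 1 ≤ M) (hs : s ≤ m) {u : ℝ → ℂ}
    {w : ℕ → ℂ} {R A : ℝ} (h : HsBound a b m (sineCoeff a b u) R)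
    (hA : l2 (Finset.Ioo 0 M) (fun l => mu a b l ^ s • (sineCoeff a b u l - dst M w l)) ≤ A) :
    HsBound a b s (errCoeff a b M u w) (A + mesh a b M ^ (m - s) * R) :=
  (hsBound_ite hA).add (HsBound.tail hab hM hs h)

theorem sub_interp_eq (hab : a < b) {m M : ℕ} (hM : 1 ≤ M) (hm : 1 ≤ m) {u : ℝ → ℂ}
    (hu : ContinuousOn u (Icc a b)) (ha : u a = 0) (hb : u b = 0) {w : ℕ → ℂ} {R : ℝ}
    (h : HsBound a b m (sineCoeff a b u) R) {x : ℝ} (hx : x ∈ Icc a b) :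
    u x - interp a b M w x = sineSeries a b (errCoeff a b M u w) x := by
  have hA := hsBound_errCoeff (w := w) hab hM le_rfl h le_rfl
  rw [sineSeries_eq_sum_add_tail hab hM hm (errCoeff_zero hM u w) hA,
    ← sineSeries_sineCoeff hab hu ha hb hm h hx,
    sineSeries_eq_sum_add_tail hab hM hm (sineCoeff_zero u) h]
  have e1 : tail M (errCoeff a b M u w) = tail M (sineCoeff a b u) := by
    funext l
    by_cases hl : l < M
    · simp [tail, hl]
    · simp [tail, hl, errCoeff]
  rw [e1, interp, add_sub_right_comm, ← Finset.sum_sub_distrib]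
  congr 1
  refine Finset.sum_congr rfl fun l hl => ?_
  have : tail M (sineCoeff a b u) l = 0 := by simp [tail, (Finset.mem_Ioo.1 hl).2]
  rw [errCoeff, if_pos hl, this, add_zero, sub_mul]
  rfl

/-- By Parseval the error consists of the coefficient errors below `M`, measured by `A`, and of the
truncated tail. The assumption `m ≥ 2` makes the sine series of the error continuously
differentiable. -/
theorem errL2_le (hab : a < b) {m M : ℕ} (hM : 1 ≤ M) (hm : 2 ≤ m) {u : ℝ → ℂ}
    (hu : ContinuousOn u (Icc a b)) (ha : u a = 0) (hb : u b = 0) {w : ℕ → ℂ} {R A : ℝ}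
    (h : HsBound a b m (sineCoeff a b u) R)
    (hA : l2 (Finset.Ioo 0 M) (fun l => sineCoeff a b u l - dst M w l) ≤ A) :
    errL2 a b M u w ≤ ENNReal.ofReal (√((b - a) / 2) * (A + mesh a b M ^ m * R)) := by
  have hba := sub_pos.2 hab
  have hbd := hsBound_errCoeff (s := 0) hab hM (Nat.zero_le m) h (by simpa using hA)
  have hbd2 := hsBound_errCoeff (w := w) hab hM hm h le_rfl
  have h0 := errCoeff_zero (a := a) (b := b) hM u w
  have hc : Continuous (sineSeries a b (errCoeff a b M u w)) :=
    continuous_iff_continuousAt.2 fun x => (hasDerivAt_sineSeries hab hbd2 h0 x).continuousAt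
  have e : errL2 a b M u w = l2Norm a b (sineSeries a b (errCoeff a b M u w)) := by
    refine eLpNorm_congr_ae ?_
    filter_upwards [ae_restrict_mem measurableSet_Ioo] with x hx
    exact sub_interp_eq hab hM (by omega : 1 ≤ m) hu ha hb h (Ioo_subset_Icc_self hx)
  rw [e]
  refine l2Norm_le hab.le ?_ (mul_nonneg (Real.sqrt_nonneg _) hbd.nonneg) ?_
  · exact memLp_two_of_continuousOn hc.continuousOn
  · rw [mul_pow, Real.sq_sqrt (by positivity)]
    exact integral_sineSeries_le hab h0 (hbd2.summable_norm hab (by omega) h0) hbd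

theorem errH1_le (hab : a < b) {m M : ℕ} (hM : 1 ≤ M) (hm : 2 ≤ m) {u : ℝ → ℂ}
    (hu : ContinuousOn u (Icc a b)) (ha : u a = 0) (hb : u b = 0) {w : ℕ → ℂ} {R A : ℝ}
    (h : HsBound a b m (sineCoeff a b u) R)
    (hA : l2 (Finset.Ioo 0 M) (fun l => mu a b l • (sineCoeff a b u l - dst M w l)) ≤ A) :
    errH1 a b M u w ≤ ENNReal.ofReal (√((b - a) / 2) * (A + mesh a b M ^ (m - 1) * R)) := by
  have hba := sub_pos.2 hab
  have hbd := hsBound_errCoeff (s := 1) hab hM (by omega : 1 ≤ m) h (by simpa using hA)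
  have hbd2 := hsBound_errCoeff (w := w) hab hM hm h le_rfl
  have h0 := errCoeff_zero (a := a) (b := b) hM u w
  have hw := isWeakDeriv_sineSeries hab hbd2 h0
  have heq : ∀ x ∈ Ioo a b, u x - interp a b M w x = sineSeries a b (errCoeff a b M u w) x :=
    fun x hx => sub_interp_eq hab hM (by omega : 1 ≤ m) hu ha hb h (Ioo_subset_Icc_self hx)
  have hw' : IsWeakDeriv a b 1 (fun x => u x - interp a b M w x)
      (cosSeries a b (errCoeff a b M u w)) := by
    have hint : Continuous (interp a b M w) := continuous_finsetSum _ fun l _ =>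
      continuous_const.mul (Complex.continuous_ofReal.comp (continuous_sn l))
    refine ⟨?_, hw.2.1, fun φ h1 h2 h3 => ?_⟩
    · exact ((hu.sub hint.continuousOn).integrableOn_Icc.mono_set
        Ioo_subset_Icc_self).locallyIntegrableOn
    · rw [← hw.2.2 φ h1 h2 h3]
      exact setIntegral_congr_fun measurableSet_Ioo fun x hx => by simp only [heq x hx]
  refine (iInf₂_le (cosSeries a b (errCoeff a b M u w)) hw').trans ?_
  refine l2Norm_le hab.le ?_ (mul_nonneg (Real.sqrt_nonneg _) hbd.nonneg) ?_
  · exact memLp_two_of_continuousOn (continuous_cosSeries hab hbd2 h0).continuousOn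
  · rw [mul_pow, Real.sq_sqrt (by positivity)]
    exact integral_cosSeries_le hab h0 (by simpa using hbd2.summable hab h0 (r := 1)) hbd

end Interpolation

/-! ### Composition with a smooth odd function -/

section Composition

variable {a b : ℝ}

/-- The sine mode with its phase shifted by `i` quarter periods. -/
noncomputable def phase (a b : ℝ) (i l : ℕ) (x : ℝ) : ℝ :=
  Real.sin (mu a b l * (x - a) + i * (Real.pi / 2))

theorem phase_zero (l : ℕ) (x : ℝ) : phase a b 0 l x = sn a b l x := by simp [phase, sn]

theorem hasDerivAt_phase (i l : ℕ) (x : ℝ) :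
    HasDerivAt (phase a b i l) (mu a b l * phase a b (i + 1) l x) x := by
  have h : HasDerivAt (fun x => mu a b l * (x - a) + i * (Real.pi / 2)) (mu a b l) x := by
    simpa using (((hasDerivAt_id x).sub_const a).const_mul (mu a b l)).add_const
      (i * (Real.pi / 2))
  refine h.sin.congr_deriv ?_
  unfold phase
  rw [← Real.sin_add_pi_div_two]
  push_cast
  ring_nf

theorem continuous_phase (i l : ℕ) : Continuous (phase a b i l) := by
  unfold phase; fun_prop

theorem abs_phase_le (i l : ℕ) (x : ℝ) : |phase a b i l x| ≤ 1 := Real.abs_sin_le_one _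

theorem phase_add_two (i l : ℕ) (x : ℝ) : phase a b (i + 2) l x = -phase a b i l x := by
  unfold phase
  rw [← Real.sin_add_pi]
  congr 1
  push_cast; ring

theorem phase_one (l : ℕ) (x : ℝ) : phase a b 1 l x = cs a b l x := by
  unfold phase cs
  rw [← Real.sin_add_pi_div_two]
  simp

theorem integral_phase_mul_phase (hab : a < b) (i : ℕ) {l l' : ℕ} (hl : 0 < l) :
    ∫ x in a..b, phase a b i l x * phase a b i l' x = if l = l' then (b - a) / 2 else 0 := by
  induction i using Nat.twoStepInduction with
  | zero => simpa only [phase_zero] using integral_sn_mul_sn hab hl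
  | one => simpa only [phase_one] using integral_cs_mul_cs hab hl
  | more n ih _ => simpa only [phase_add_two, neg_mul_neg] using ih

/-- The partial sums of the sine series. -/
noncomputable def sinePoly (a b : ℝ) (c : ℕ → ℂ) (N : ℕ) (x : ℝ) : ℂ :=
  ∑ l ∈ Finset.Ioo 0 N, c l * (sn a b l x : ℂ)

theorem contDiff_sinePoly (c : ℕ → ℂ) (N : ℕ) {n : WithTop ℕ∞} :
    ContDiff ℝ n (sinePoly a b c N) := by
  refine ContDiff.sum fun l _ => contDiff_const.mul (Complex.ofRealCLM.contDiff.comp ?_)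
  exact Real.contDiff_sin.comp (contDiff_const.mul (contDiff_id.sub contDiff_const))

theorem iteratedDeriv_sinePoly (c : ℕ → ℂ) (N i : ℕ) :
    iteratedDeriv i (sinePoly a b c N)
      = fun x => ∑ l ∈ Finset.Ioo 0 N, (mu a b l ^ i • c l) * (phase a b i l x : ℂ) := by
  induction i with
  | zero => funext x; simp [sinePoly, phase_zero]
  | succ n ih =>
    rw [iteratedDeriv_succ, ih]
    funext x
    have h : ∀ l ∈ Finset.Ioo 0 N, HasDerivAt
        (fun x => (mu a b l ^ n • c l) * (phase a b n l x : ℂ))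
        ((mu a b l ^ (n + 1) • c l) * (phase a b (n + 1) l x : ℂ)) x := by
      intro l _
      have := (hasDerivAt_phase (a := a) (b := b) n l x).ofReal_comp.const_mul (mu a b l ^ n • c l)
      refine this.congr_deriv ?_
      simp only [Complex.real_smul]
      push_cast; ring
    exact (HasDerivAt.fun_sum h).deriv

theorem norm_iteratedDeriv_sinePoly_le (hab : a < b) {c : ℕ → ℂ} {i : ℕ} {R : ℝ}
    (h : HsBound a b (i + 1) c R) (N : ℕ) (x : ℝ) :
    ‖iteratedDeriv i (sinePoly a b c N) x‖ ≤ embConst a b * R := by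
  rw [iteratedDeriv_sinePoly]
  refine (norm_sum_le _ _).trans ((Finset.sum_le_sum fun l _ => ?_).trans (h.sum_le hab N))
  rw [norm_mul, norm_smul, Complex.norm_real, norm_pow, Real.norm_of_nonneg (mu_nonneg hab l),
    Real.norm_eq_abs]
  exact mul_le_of_le_one_right (mul_nonneg (pow_nonneg (mu_nonneg hab l) _) (norm_nonneg _))
    (abs_phase_le i l x)

theorem integral_iteratedDeriv_sinePoly_le (hab : a < b) {c : ℕ → ℂ} {i : ℕ} {R : ℝ}
    (h : HsBound a b i c R) (N : ℕ) :
    ∫ x in a..b, ‖iteratedDeriv i (sinePoly a b c N) x‖ ^ 2 ≤ (b - a) / 2 * R ^ 2 := by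
  have hba := sub_pos.2 hab
  rw [iteratedDeriv_sinePoly, integral_norm_sq_of_orthogonal (κ := (b - a) / 2) _
    (fun l => mu a b l ^ i • c l) (fun l => continuous_phase i l)
    (fun l hl l' _ => integral_phase_mul_phase hab i (Finset.mem_Ioo.1 hl).1), ← l2_sq]
  gcongr
  · exact l2_nonneg _ _
  · exact h N

theorem sinePoly_reflect_left (c : ℕ → ℂ) (N : ℕ) (x : ℝ) :
    sinePoly a b c N (2 * a - x) = -sinePoly a b c N x := by
  rw [sinePoly, sinePoly, ← Finset.sum_neg_distrib]
  refine Finset.sum_congr rfl fun l _ => ?_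
  have : sn a b l (2 * a - x) = -sn a b l x := by
    rw [sn, sn, ← Real.sin_neg]; congr 1; ring
  rw [this]; push_cast; ring

theorem sinePoly_reflect_right (hab : a < b) (c : ℕ → ℂ) (N : ℕ) (x : ℝ) :
    sinePoly a b c N (2 * b - x) = -sinePoly a b c N x := by
  rw [sinePoly, sinePoly, ← Finset.sum_neg_distrib]
  refine Finset.sum_congr rfl fun l _ => ?_
  have : sn a b l (2 * b - x) = -sn a b l x := by
    rw [sn, sn, ← Real.sin_nat_mul_two_pi_sub _ l]
    congr 1
    have := mu_mul_sub hab l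
    linear_combination 2 * this
  rw [this]; push_cast; ring

/-- The signs produced by differentiating the reflection an even number of times cancel, so the
derivative at the centre equals its own negative. -/
theorem iteratedDeriv_eq_zero_of_reflect {w : ℝ → ℂ} {p : ℝ} (h : ∀ x, w (2 * p - x) = -w x)
    (j : ℕ) : iteratedDeriv (2 * j) w p = 0 := by
  have h1 := congrFun (iteratedDeriv_comp_const_sub (2 * j) w (2 * p)) p
  have h2 : (fun z => w (2 * p - z)) = fun z => -w z := funext h
  have h3 : 2 * p - p = p := by ring
  rw [h2, iteratedDeriv_fun_neg, h3, pow_mul] at h1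
  simp only [neg_one_sq, one_pow, one_smul] at h1
  exact self_eq_neg.1 h1.symm

/-- Sine coefficients of a function whose even derivatives vanish at the ends. -/
theorem norm_pow_mul_integral_sn (hab : a < b) {r : ℕ} {w : ℝ → ℂ} (hw : ContDiff ℝ r w)
    (ha : ∀ j, iteratedDeriv (2 * j) w a = 0) (hb : ∀ j, iteratedDeriv (2 * j) w b = 0) (l : ℕ)
    {i : ℕ} (hi : i ≤ r) :
    ‖(mu a b l : ℂ) ^ i * ∫ x in a..b, w x * (sn a b l x : ℂ)‖
      = ‖∫ x in a..b, iteratedDeriv i w x * ((if Even i then sn a b l x else cs a b l x : ℝ) : ℂ)‖ := by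
  induction i with
  | zero => simp
  | succ n ih =>
    have hc : Continuous (iteratedDeriv (n + 1) w) :=
      hw.continuous_iteratedDeriv _ (by exact_mod_cast hi)
    have hdiff : Differentiable ℝ (iteratedDeriv n w) :=
      hw.differentiable_iteratedDeriv n (by exact_mod_cast Nat.lt_of_succ_le hi)
    have hd : ∀ x, HasDerivAt (iteratedDeriv n w) (iteratedDeriv (n + 1) w x) x := fun x => by
      rw [iteratedDeriv_succ]; exact (hdiff x).hasDerivAt
    have hftc : ∀ x, iteratedDeriv n w x
        = iteratedDeriv n w a + ∫ y in a..x, iteratedDeriv (n + 1) w y := fun x => by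
      rw [intervalIntegral.integral_eq_sub_of_hasDerivAt (fun y _ => hd y)
        (hc.intervalIntegrable _ _)]
      ring
    rw [pow_succ', mul_assoc, norm_mul, ih (Nat.le_of_succ_le hi), ← norm_mul]
    -- At even orders the derivative vanishes at both ends, so the next one has mean zero and a sine
    -- becomes a cosine. At odd orders no condition is needed, because the sine vanishes at the
    -- ends.
    rcases Nat.even_or_odd n with he | ho
    · obtain ⟨j, hj⟩ := even_iff_two_dvd.1 he
      have h0 : iteratedDeriv n w a = 0 := by rw [hj]; exact ha j
      have h1 : ∫ y in a..b, iteratedDeriv (n + 1) w y = 0 := by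
        have := hftc b
        rw [h0, zero_add, hj, hb j] at this
        rw [hj]
        exact this.symm
      have hne : ¬ Even (n + 1) := by simpa [Nat.even_add_one] using he
      simp only [he, hne, if_true, if_false]
      rw [← mu_mul_integral_primitive_mul_sn hab (hc.intervalIntegrable _ _) h1 l]
      congr 2
      refine intervalIntegral.integral_congr fun x _ => ?_
      simp only [hftc x, h0, zero_add]
    · have hne : ¬ Even n := Nat.not_even_iff_odd.2 ho
      have he : Even (n + 1) := by simpa [Nat.even_add_one] using ho
      simp only [he, hne, if_true, if_false]
      have := mu_mul_integral_primitive_mul_cs hab (iteratedDeriv n w a)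
        (hc.intervalIntegrable a b) l
      simp only [← hftc] at this
      rw [this, norm_neg]

/-- Integrating by parts `r` times turns the weighted sine coefficients into sine or cosine
coefficients of the derivative of order `r`, to which Bessel's inequality applies. -/
theorem hsBound_of_contDiff (hab : a < b) {r : ℕ} {w : ℝ → ℂ} (hw : ContDiff ℝ r w)
    (ha : ∀ j, iteratedDeriv (2 * j) w a = 0) (hb : ∀ j, iteratedDeriv (2 * j) w b = 0) {K : ℝ}
    (hK : 0 ≤ K) (h : ∫ x in a..b, ‖iteratedDeriv r w x‖ ^ 2 ≤ K ^ 2) :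
    HsBound a b r (sineCoeff a b w) (√(2 / (b - a)) * K) := by
  intro N
  have hc : Continuous (iteratedDeriv r w) := hw.continuous_iteratedDeriv _ le_rfl
  have hm := memLp_two_of_continuousOn (a := a) (b := b) hc.continuousOn
  have key : ∀ l, ‖mu a b l ^ r • sineCoeff a b w l‖ = ‖((2 / (b - a) : ℝ) : ℂ)
      * ∫ x in a..b, iteratedDeriv r w x * ((if Even r then sn a b l x else cs a b l x : ℝ) : ℂ)‖ := by
    intro l
    rw [norm_mul, ← norm_pow_mul_integral_sn hab hw ha hb l le_rfl, ← norm_mul,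
      sineCoeff_eq hab.le, Complex.real_smul]
    congr 1
    push_cast; ring
  by_cases he : Even r
  · simp only [he, if_true] at key
    exact (l2_congr fun l _ => key l).trans_le (bessel_sn hab N hK hm h)
  · simp only [he, if_false] at key
    exact (l2_congr fun l _ => key l).trans_le (bessel_cs hab N hK hm h)

/-- The bound for derivatives of a composition asks for one `D` with `i`-th derivative at most
`D^i`, and returns a multiple of `D^r`. This `D` makes `D^r` linear in the top derivative. The order
`r - 1` is not bounded by a constant independent of the top norm: it is estimated by `q` in all but
one of its factors, so that `D^r` contains only the product `q * A (r - 1)`. -/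
theorem exists_pow_bound {r : ℕ} (hr : 1 ≤ r) {A : ℕ → ℝ} (hA : ∀ i, 0 ≤ A i) {P q : ℝ}
    (hP : 1 ≤ P) (hq : 1 ≤ q) (h1 : ∀ i, 1 ≤ i → i + 2 ≤ r → A i ≤ P) (h2 : A (r - 1) ≤ q) :
    ∃ D : ℝ, 0 ≤ D ∧ D ^ r = P ^ r * (1 + q * A (r - 1) + A r) ∧ ∀ i, 1 ≤ i → i ≤ r → A i ≤ D ^ i := by
  have hr0 : r ≠ 0 := by omega
  have hA1 := hA (r - 1)
  have hA2 := hA r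
  set X : ℝ := P ^ r * (1 + q * A (r - 1) + A r) with hX
  have hqA : 0 ≤ q * A (r - 1) := by positivity
  have hPr : 1 ≤ P ^ r := one_le_pow₀ hP
  have hXP : P ^ r ≤ X := le_mul_of_one_le_right (by positivity) (by linarith)
  have hXS : 1 + q * A (r - 1) + A r ≤ X := le_mul_of_one_le_left (by positivity) hPr
  have hX0 : 0 ≤ X := by positivity
  have hDr : (X ^ ((r : ℝ)⁻¹)) ^ r = X := Real.rpow_inv_natCast_pow hX0 hr0
  have hD0 : 0 ≤ X ^ ((r : ℝ)⁻¹) := Real.rpow_nonneg hX0 _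
  refine ⟨X ^ ((r : ℝ)⁻¹), hD0, hDr, fun i hi1 hir => ?_⟩
  set D := X ^ ((r : ℝ)⁻¹)
  have hPD : P ≤ D := by
    refine (pow_le_pow_iff_left₀ (by linarith) hD0 hr0).1 ?_
    rw [hDr]; exact hXP
  rcases Nat.lt_or_ge (i + 1) r with hlt | hge
  · calc A i ≤ P := h1 i hi1 hlt
      _ ≤ P ^ i := le_self_pow₀ hP (by omega)
      _ ≤ D ^ i := by gcongr
  rcases Nat.eq_or_lt_of_le hir with rfl | hlt
  · rw [hDr]; linarith
  · have hi : i = r - 1 := by omega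
    subst hi
    refine (pow_le_pow_iff_left₀ (hA _) (by positivity) hr0).1 ?_
    rw [← pow_mul, mul_comm, pow_mul, hDr]
    have e : A (r - 1) ^ r = A (r - 1) * A (r - 1) ^ (r - 1) := by
      rw [← pow_succ', Nat.sub_add_cancel hr]
    calc A (r - 1) ^ r = A (r - 1) * A (r - 1) ^ (r - 1) := e
      _ ≤ q ^ (r - 1) * A (r - 1) ^ (r - 1) := by
          gcongr
          exact h2.trans (le_self_pow₀ hq (by omega))
      _ = (q * A (r - 1)) ^ (r - 1) := (mul_pow _ _ _).symm
      _ ≤ X ^ (r - 1) := by gcongr; linarith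

theorem exists_iteratedFDeriv_bound {r : ℕ} {F : ℂ → ℂ} (hF : ContDiff ℝ r F) (ρ : ℝ) :
    ∃ C : ℝ, 0 ≤ C ∧ ∀ i ≤ r, ∀ z : ℂ, ‖z‖ ≤ ρ → ‖iteratedFDeriv ℝ i F z‖ ≤ C := by
  have h : ∀ i ∈ Finset.range (r + 1), ∃ C : ℝ, ∀ z : ℂ, ‖z‖ ≤ ρ → ‖iteratedFDeriv ℝ i F z‖ ≤ C := by
    intro i hi
    have hi' : i ≤ r := by simpa [Nat.lt_succ_iff] using hi
    have hc : Continuous (iteratedFDeriv ℝ i F) :=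
      hF.continuous_iteratedFDeriv (by exact_mod_cast hi')
    obtain ⟨C, hC⟩ := (isCompact_closedBall (0 : ℂ) ρ).exists_bound_of_continuousOn hc.continuousOn
    exact ⟨C, fun z hz => hC z (by simpa using hz)⟩
  choose! C hC using h
  refine ⟨∑ i ∈ Finset.range (r + 1), |C i|, Finset.sum_nonneg fun _ _ => abs_nonneg _,
    fun i hi z hz => ?_⟩
  have hi' : i ∈ Finset.range (r + 1) := by simpa [Nat.lt_succ_iff] using hi
  exact (hC i hi' z hz).trans ((le_abs_self _).trans
    (Finset.single_le_sum (f := fun i => |C i|) (fun _ _ => abs_nonneg _) hi'))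

/-- A tame estimate: the `H_s^r` norm of `F ∘ u` grows linearly with the `H_s^r` norm of `u`. -/
theorem exists_hsBound_comp_sinePoly (hab : a < b) {r : ℕ} (hr : 1 ≤ r) {F : ℂ → ℂ}
    (hF : ContDiff ℝ r F) (hodd : ∀ z, F (-z) = -F z) (A : ℝ) :
    ∃ C : ℝ, 0 ≤ C ∧ ∀ (c : ℕ → ℂ) (B : ℝ), HsBound a b 1 c A → HsBound a b (r - 1) c A →
      HsBound a b r c B → ∀ N,
      HsBound a b r (sineCoeff a b (fun x => F (sinePoly a b c N x))) (C * (1 + B)) := by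
  have hba := sub_pos.2 hab
  have he := embConst_pos hab
  have hmu1 : 0 < mu a b 1 := mu_pos hab one_pos
  obtain ⟨CF, hCF0, hCF⟩ := exists_iteratedFDeriv_bound hF (embConst a b * A)
  -- The sum dominates the constants of all the embeddings into lower orders, so that one `P` bounds
  -- every derivative of order at most `r - 2`.
  set S : ℝ := ∑ i ∈ Finset.range r, (mu a b 1 ^ i)⁻¹ with hS
  have hS0 : 0 ≤ S := Finset.sum_nonneg fun _ _ => by positivity
  set P : ℝ := 1 + embConst a b * (S * |A|) with hPdef
  have hP : 1 ≤ P := le_add_of_nonneg_right (by positivity)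
  set κ : ℝ := (b - a) / 2 with hκ
  have hκ0 : 0 < κ := half_pos hba
  set G : ℝ := r.factorial * CF * P ^ r with hG
  have hG0 : 0 ≤ G := by positivity
  set Z : ℝ := 2 * κ + κ * A ^ 2 * (1 + embConst a b) ^ 2 + κ with hZ
  have hZ0 : 0 ≤ Z := by positivity
  refine ⟨√(2 / (b - a)) * √(3 * G ^ 2 * Z), by positivity, fun c B h1 hr1 hrB N => ?_⟩
  have hA0 : 0 ≤ A := h1.nonneg
  have hB0 : 0 ≤ B := hrB.nonneg
  set u := sinePoly a b c N with hu
  have hucd : ContDiff ℝ r u := contDiff_sinePoly c N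
  have hw : ContDiff ℝ r (fun x => F (u x)) := hF.comp hucd
  rw [mul_assoc]
  refine hsBound_of_contDiff hab hw ?_ ?_ (by positivity) ?_
  · exact iteratedDeriv_eq_zero_of_reflect fun x => by
      rw [hu, sinePoly_reflect_left, hodd]
  · exact iteratedDeriv_eq_zero_of_reflect fun x => by
      rw [hu, sinePoly_reflect_right hab, hodd]
  have hsup : ∀ x, ‖u x‖ ≤ embConst a b * A := fun x => by
    have := norm_iteratedDeriv_sinePoly_le hab (i := 0) h1 N x
    rwa [iteratedDeriv_zero] at this
  -- `q` bounds the derivative of order `r - 1` pointwise through the highest norm `B`. It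
  -- multiplies that same derivative, whose `L²` norm is controlled by `A` alone, so the final bound
  -- stays linear in `B`.
  set q : ℝ := 1 + embConst a b * B with hq
  have hq1 : 1 ≤ q := le_add_of_nonneg_right (by positivity)
  have hpt : ∀ x, ‖iteratedDeriv r (fun x => F (u x)) x‖
      ≤ G * (1 + q * ‖iteratedDeriv (r - 1) u x‖ + ‖iteratedDeriv r u x‖) := by
    intro x
    have hlow : ∀ i, 1 ≤ i → i + 1 < r → ‖iteratedDeriv i u x‖ ≤ P := by
      intro i _ hi2
      have hb1 := HsBound.of_le hab hr1 (s := i + 1) (by omega)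
      refine (norm_iteratedDeriv_sinePoly_le hab hb1 N x).trans ?_
      have : (mu a b 1 ^ (r - 1 - (i + 1)))⁻¹ ≤ S :=
        Finset.single_le_sum (f := fun i => (mu a b 1 ^ i)⁻¹) (fun _ _ => by positivity)
          (Finset.mem_range.2 (by omega))
      have h5 : embConst a b * ((mu a b 1 ^ (r - 1 - (i + 1)))⁻¹ * A)
          ≤ embConst a b * (S * |A|) := by
        gcongr
        exact le_abs_self A
      linarith
    have hhigh : ‖iteratedDeriv (r - 1) u x‖ ≤ q := by
      have hb1 : HsBound a b (r - 1 + 1) c B := by rwa [Nat.sub_add_cancel hr]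
      exact (norm_iteratedDeriv_sinePoly_le hab hb1 N x).trans (by linarith)
    obtain ⟨D, hD0, hDr, hD⟩ := exists_pow_bound hr (A := fun i => ‖iteratedDeriv i u x‖)
      (fun i => norm_nonneg _) hP hq1 hlow hhigh
    rw [← norm_iteratedFDeriv_eq_norm_iteratedDeriv]
    have := norm_iteratedFDeriv_comp_le (𝕜 := ℝ) hF hucd (n := r) le_rfl x (C := CF) (D := D)
      (fun i hi => hCF i hi _ (hsup x))
      (fun i hi1 hi2 => by rw [norm_iteratedFDeriv_eq_norm_iteratedDeriv]; exact hD i hi1 hi2)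
    refine this.trans (le_of_eq ?_)
    rw [hDr, hG]; ring
  have hc1 : Continuous (iteratedDeriv (r - 1) u) :=
    hucd.continuous_iteratedDeriv _ (by exact_mod_cast Nat.sub_le r 1)
  have hc2 : Continuous (iteratedDeriv r u) := hucd.continuous_iteratedDeriv _ le_rfl
  have hc3 : Continuous (iteratedDeriv r fun x => F (u x)) := hw.continuous_iteratedDeriv _ le_rfl
  have hI1 := integral_iteratedDeriv_sinePoly_le hab hr1 N
  have hI2 := integral_iteratedDeriv_sinePoly_le hab hrB N
  have hint : ∫ x in a..b, ‖iteratedDeriv r (fun x => F (u x)) x‖ ^ 2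
      ≤ ∫ x in a..b, (3 * G ^ 2 + 3 * G ^ 2 * q ^ 2 * ‖iteratedDeriv (r - 1) u x‖ ^ 2
        + 3 * G ^ 2 * ‖iteratedDeriv r u x‖ ^ 2) := by
    refine intervalIntegral.integral_mono_on hab.le (Continuous.intervalIntegrable (by fun_prop) _ _)
      (Continuous.intervalIntegrable (by fun_prop) _ _) fun x _ => ?_
    set p1 := q * ‖iteratedDeriv (r - 1) u x‖ with hp1
    set p2 := ‖iteratedDeriv r u x‖ with hp2
    have h3 : (1 + p1 + p2) ^ 2 ≤ 3 * (1 + p1 ^ 2 + p2 ^ 2) := by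
      nlinarith [sq_nonneg (1 - p1), sq_nonneg (1 - p2), sq_nonneg (p1 - p2)]
    calc ‖iteratedDeriv r (fun x => F (u x)) x‖ ^ 2 ≤ (G * (1 + p1 + p2)) ^ 2 := by
          gcongr; exact hpt x
      _ = G ^ 2 * (1 + p1 + p2) ^ 2 := by ring
      _ ≤ G ^ 2 * (3 * (1 + p1 ^ 2 + p2 ^ 2)) := by gcongr
      _ = _ := by rw [hp1]; ring
  refine hint.trans ?_
  rw [intervalIntegral.integral_add (Continuous.intervalIntegrable (by fun_prop) _ _)
    (Continuous.intervalIntegrable (by fun_prop) _ _),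
    intervalIntegral.integral_add (by simp)
    (Continuous.intervalIntegrable (by fun_prop) _ _), intervalIntegral.integral_const_mul,
    intervalIntegral.integral_const_mul, intervalIntegral.integral_const, smul_eq_mul]
  have hRHS : (√(3 * G ^ 2 * Z) * (1 + B)) ^ 2 = 3 * G ^ 2 * Z * (1 + B) ^ 2 := by
    rw [mul_pow (√(3 * G ^ 2 * Z)), Real.sq_sqrt (by positivity)]
  rw [hRHS]
  have hqB : q ^ 2 ≤ (1 + embConst a b) ^ 2 * (1 + B) ^ 2 := by
    rw [← mul_pow]
    have : q ≤ (1 + embConst a b) * (1 + B) := by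
      rw [hq]; nlinarith
    gcongr
  have hB1 : B ^ 2 ≤ (1 + B) ^ 2 := by gcongr; linarith
  have h11 : 1 ≤ (1 + B) ^ 2 := one_le_pow₀ (by linarith)
  calc _ = (b - a) * (3 * G ^ 2) + 3 * G ^ 2 * q ^ 2 * (∫ x in a..b, ‖iteratedDeriv (r - 1) u x‖ ^ 2)
        + 3 * G ^ 2 * ∫ x in a..b, ‖iteratedDeriv r u x‖ ^ 2 := by
        rw [intervalIntegral.integral_const_mul]; ring
    _ ≤ (b - a) * (3 * G ^ 2) * (1 + B) ^ 2
        + 3 * G ^ 2 * ((1 + embConst a b) ^ 2 * (1 + B) ^ 2) * (κ * A ^ 2)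
        + 3 * G ^ 2 * (κ * (1 + B) ^ 2) := by
        refine add_le_add (add_le_add ?_ ?_) ?_
        · exact le_mul_of_one_le_right (by positivity) h11
        · have : 0 ≤ ∫ x in a..b, ‖iteratedDeriv (r - 1) u x‖ ^ 2 :=
            intervalIntegral.integral_nonneg hab.le fun x _ => sq_nonneg _
          gcongr
        · refine mul_le_mul_of_nonneg_left (hI2.trans ?_) (by positivity)
          gcongr
    _ = 3 * G ^ 2 * Z * (1 + B) ^ 2 := by rw [hZ, hκ]; ring

theorem tendsto_sinePoly (hab : a < b) {u : ℝ → ℂ} (hu : ContinuousOn u (Icc a b)) (ha : u a = 0)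
    (hb : u b = 0) {R : ℝ} (h : HsBound a b 1 (sineCoeff a b u) R) {x : ℝ} (hx : x ∈ Icc a b) :
    Filter.Tendsto (fun N => sinePoly a b (sineCoeff a b u) N x) Filter.atTop (nhds (u x)) := by
  have := (hasSum_sineCoeff hab hu ha hb (h.summable_norm hab le_rfl (sineCoeff_zero u))
    hx).tendsto_sum_nat
  refine this.congr fun N => ?_
  rw [sinePoly, sum_Ioo_eq_range _ (by simp [sineCoeff_zero])]

/-- Dominated convergence: the embedding keeps all partial sums in one ball, on which `F` is
bounded. -/
theorem tendsto_sineCoeff_comp (hab : a < b) {F : ℂ → ℂ} (hF : Continuous F) {u : ℝ → ℂ}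
    (hu : ContinuousOn u (Icc a b)) (ha : u a = 0) (hb : u b = 0) {R : ℝ}
    (h : HsBound a b 1 (sineCoeff a b u) R) (l : ℕ) :
    Filter.Tendsto
      (fun N => sineCoeff a b (fun x => F (sinePoly a b (sineCoeff a b u) N x)) l)
      Filter.atTop (nhds (sineCoeff a b (fun x => F (u x)) l)) := by
  obtain ⟨C, hC⟩ := (isCompact_closedBall (0 : ℂ) (embConst a b * R)).exists_bound_of_continuousOn
    hF.continuousOn
  simp only [sineCoeff_eq hab.le]
  refine Filter.Tendsto.const_mul _ ?_
  refine intervalIntegral.tendsto_integral_filter_of_dominated_convergence (fun _ => C) ?_ ?_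
    (by simp) ?_
  · refine Filter.Eventually.of_forall fun N => Continuous.aestronglyMeasurable ?_
    exact (hF.comp (contDiff_sinePoly (n := 0) _ N).continuous).mul
      (Complex.continuous_ofReal.comp (continuous_sn l))
  · refine Filter.Eventually.of_forall fun N => ae_of_all _ fun x _ => ?_
    rw [norm_mul, Complex.norm_real, Real.norm_eq_abs]
    refine (mul_le_of_le_one_right (norm_nonneg _) (abs_sn_le l x)).trans (hC _ ?_)
    have := norm_iteratedDeriv_sinePoly_le hab (i := 0) h N x
    rw [iteratedDeriv_zero] at this
    simpa using this
  · refine ae_of_all _ fun x hx => ?_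
    rw [uIoc_of_le hab.le] at hx
    exact ((hF.tendsto _).comp (tendsto_sinePoly hab hu ha hb h ⟨hx.1.le, hx.2⟩)).mul_const _

theorem HsBound.of_tendsto {r : ℕ} {c : ℕ → ℕ → ℂ} {d : ℕ → ℂ} {R : ℝ}
    (h : ∀ n, HsBound a b r (c n) R)
    (hlim : ∀ l, Filter.Tendsto (fun n => c n l) Filter.atTop (nhds (d l))) :
    HsBound a b r d R := by
  intro N
  have : Filter.Tendsto (fun n => l2 (Finset.Ioo 0 N) (fun l => mu a b l ^ r • c n l)) Filter.atTop
      (nhds (l2 (Finset.Ioo 0 N) (fun l => mu a b l ^ r • d l))) := by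
    refine (tendsto_finsetSum _ fun l _ => ?_).sqrt
    exact ((hlim l).const_smul _).norm.pow 2
  exact le_of_tendsto' this fun n => h n N

/-- A function with coefficients in `H_s^r` need not have `r` classical derivatives, so the estimate
is proved for its partial sums. It passes to the limit because `HsBound` tests finitely many
coefficients at a time. -/
theorem exists_hsBound_comp (hab : a < b) {r : ℕ} (hr : 1 ≤ r) {F : ℂ → ℂ}
    (hF : ContDiff ℝ r F) (hodd : ∀ z, F (-z) = -F z) (A : ℝ) :
    ∃ C : ℝ, 0 ≤ C ∧ ∀ (u : ℝ → ℂ) (B : ℝ), ContinuousOn u (Icc a b) → u a = 0 → u b = 0 →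
      HsBound a b 1 (sineCoeff a b u) A → HsBound a b (r - 1) (sineCoeff a b u) A →
      HsBound a b r (sineCoeff a b u) B →
      HsBound a b r (sineCoeff a b (fun x => F (u x))) (C * (1 + B)) := by
  obtain ⟨C, hC0, hC⟩ := exists_hsBound_comp_sinePoly hab hr hF hodd A
  refine ⟨C, hC0, fun u B hu ha hb h1 hr1 hrB => ?_⟩
  exact HsBound.of_tendsto (fun N => hC _ B h1 hr1 hrB N)
    (tendsto_sineCoeff_comp hab hF.continuous hu ha hb h1)

end Composition

/-! ### The nonlinear term -/

section Nonlinear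

/-- The map `z ↦ |z|²` is smooth and takes values in `[0, ∞)`, so differentiability of `f` up to the
boundary point `0` suffices even at `z = 0`. -/
theorem contDiff_nonlin {f : ℝ → ℝ} {k : ℕ} (hf : ContDiffOn ℝ k f (Ici 0)) :
    ContDiff ℝ k (nonlin f) := by
  have h1 : ContDiff ℝ k (fun z : ℂ => f (‖z‖ ^ 2)) := by
    rw [← contDiffOn_univ]
    exact hf.comp (contDiff_norm_sq ℝ).contDiffOn fun z _ => mem_Ici.2 (sq_nonneg _)
  exact (Complex.ofRealCLM.contDiff.comp h1).mul contDiff_id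

theorem nonlin_neg (f : ℝ → ℝ) (z : ℂ) : nonlin f (-z) = -nonlin f z := by
  simp [nonlin]

theorem nonlin_zero (f : ℝ → ℝ) : nonlin f 0 = 0 := by simp [nonlin]

/-- Both sides are the derivative at `s = 0` of the nonlinearity along the line `z + s v`. It
identifies the starting slope used by the scheme with the exact time derivative of the forcing. -/
theorem nonlinDeriv_eq_fderiv {f : ℝ → ℝ} {k : ℕ} (hk : 1 ≤ k) (hf : ContDiffOn ℝ k f (Ici 0))
    (z v : ℂ) : nonlinDeriv f z v = fderiv ℝ (nonlin f) z v := by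
  have hk0 : (k : WithTop ℕ∞) ≠ 0 := by exact_mod_cast (by omega : k ≠ 0)
  have hline : HasDerivAt (fun s : ℝ => z + (s : ℂ) * v) v 0 := by
    have := ((Complex.ofRealCLM.hasDerivAt (x := (0 : ℝ))).mul_const v).const_add z
    simpa using this
  have h1 : HasDerivAt (fun s : ℝ => nonlin f (z + (s : ℂ) * v)) (fderiv ℝ (nonlin f) z v) 0 := by
    have hd := ((contDiff_nonlin hf).differentiable hk0 z).hasFDerivAt
    refine HasFDerivAt.comp_hasDerivAt (0 : ℝ) (l := nonlin f) ?_ hline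
    simpa using hd
  have h2 : HasDerivAt (fun s : ℝ => ‖z + (s : ℂ) * v‖ ^ 2) (2 * (z * (starRingEnd ℂ) v).re) 0 := by
    have := hline.norm_sq
    refine this.congr_deriv ?_
    simp [Complex.inner, mul_comm]
  have h3 : HasDerivAt (fun s : ℝ => f (‖z + (s : ℂ) * v‖ ^ 2))
      (derivWithin f (Ici 0) (‖z‖ ^ 2) * (2 * (z * (starRingEnd ℂ) v).re)) 0 := by
    have hfd : HasDerivWithinAt f (derivWithin f (Ici 0) (‖z‖ ^ 2)) (Ici 0)
        ((fun s : ℝ => ‖z + (s : ℂ) * v‖ ^ 2) 0) := by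
      have := ((hf.differentiableOn hk0) (‖z‖ ^ 2) (sq_nonneg ‖z‖)).hasDerivWithinAt
      simpa using this
    have := HasDerivWithinAt.comp (0 : ℝ) (s := univ) hfd h2.hasDerivWithinAt
      (fun s _ => sq_nonneg ‖z + (s : ℂ) * v‖)
    exact hasDerivWithinAt_univ.1 this
  have h4 : HasDerivAt (fun s : ℝ => nonlin f (z + (s : ℂ) * v)) _ 0 := (h3.ofReal_comp).mul hline
  rw [← h4.unique h1]
  have hre : ((2 * (z * (starRingEnd ℂ) v).re : ℝ) : ℂ)
      = z * (starRingEnd ℂ) v + (starRingEnd ℂ) z * v := by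
    have := Complex.add_conj (z * (starRingEnd ℂ) v)
    rw [← this]; simp
  have hn : ((‖z‖ ^ 2 : ℝ) : ℂ) = z * (starRingEnd ℂ) z := by
    rw [Complex.mul_conj, Complex.normSq_eq_norm_sq]
  rw [Complex.ofReal_mul, hre]
  unfold nonlinDeriv
  simp only [Complex.ofReal_add, Complex.ofReal_mul, hn, Complex.ofReal_zero, zero_mul, add_zero]
  ring

end Nonlinear

/-! ### Differences of compositions with a smooth function -/

section Composition

variable {E V : Type*} [NormedAddCommGroup E] [NormedSpace ℝ E] [NormedAddCommGroup V]
  [NormedSpace ℝ V]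

/-- A common bound on a ball for the first derivative of `G` and its Lipschitz constant. -/
theorem exists_fderiv_bound [ProperSpace E] {G : E → V} (hG : ContDiff ℝ 2 G) (R : ℝ) :
    ∃ L : ℝ, 0 ≤ L ∧ (∀ z, ‖z‖ ≤ R → ‖fderiv ℝ G z‖ ≤ L) ∧
      ∀ z w, ‖z‖ ≤ R → ‖w‖ ≤ R → ‖fderiv ℝ G z - fderiv ℝ G w‖ ≤ L * ‖z - w‖ := by
  have h1 : ContDiff ℝ 1 (fderiv ℝ G) := hG.fderiv_right (by norm_num)
  obtain ⟨L1, hL1⟩ := (isCompact_closedBall (0 : E) R).exists_bound_of_continuousOn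
    h1.continuous.continuousOn
  obtain ⟨L2, hL2⟩ := (isCompact_closedBall (0 : E) R).exists_bound_of_continuousOn
    (h1.continuous_fderiv (by norm_num)).continuousOn
  refine ⟨max (max L1 L2) 0, le_max_right _ _, fun z hz => ?_, fun z w hz hw => ?_⟩
  · exact (hL1 z (by simpa using hz)).trans ((le_max_left _ _).trans (le_max_left _ _))
  · refine (convex_closedBall (0 : E) R).norm_image_sub_le_of_norm_fderiv_le (𝕜 := ℝ)
      (fun x _ => h1.differentiable (by norm_num) x)
      (fun x hx => (hL2 x hx).trans ((le_max_right L1 L2).trans (le_max_left _ _)))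
      (by simpa using hw) (by simpa using hz)

theorem norm_comp_sub_le {G : E → V} (hG : Differentiable ℝ G) {R L : ℝ}
    (hL : ∀ z, ‖z‖ ≤ R → ‖fderiv ℝ G z‖ ≤ L) {z w : E} (hz : ‖z‖ ≤ R) (hw : ‖w‖ ≤ R) :
    ‖G z - G w‖ ≤ L * ‖z - w‖ :=
  (convex_closedBall (0 : E) R).norm_image_sub_le_of_norm_fderiv_le (𝕜 := ℝ)
    (fun x _ => hG x) (fun x hx => hL x (by simpa using hx))
    (by simpa using hw) (by simpa using hz)

/-- The double difference estimate. -/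
theorem norm_comp_sub_sub_le {G : E → V} (hG : Differentiable ℝ G) {R L : ℝ} (hL0 : 0 ≤ L)
    (hL : ∀ z, ‖z‖ ≤ R → ‖fderiv ℝ G z‖ ≤ L)
    (hL' : ∀ z w, ‖z‖ ≤ R → ‖w‖ ≤ R → ‖fderiv ℝ G z - fderiv ℝ G w‖ ≤ L * ‖z - w‖)
    {u v u' v' : E} (hu : ‖u‖ ≤ R) (hv : ‖v‖ ≤ R) (hu' : ‖u'‖ ≤ R) (hv' : ‖v'‖ ≤ R) :
    ‖(G u' - G v') - (G u - G v)‖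
      ≤ L * (1 + 2 * R) * ‖(u' - v') - (u - v)‖ + L * ‖u - v‖ * ‖v' - v‖ := by
  have hline : ∀ p q : E, ∀ s : ℝ,
      HasDerivAt (fun s : ℝ => p + s • (q - p)) (q - p) s := fun p q s => by
    simpa using ((hasDerivAt_id s).smul_const (q - p)).const_add p
  have hmem : ∀ p q : E, ‖p‖ ≤ R → ‖q‖ ≤ R → ∀ s ∈ Icc (0 : ℝ) 1, ‖p + s • (q - p)‖ ≤ R := by
    intro p q hp hq s hs
    have := (convex_closedBall (0 : E) R).add_smul_sub_mem (x := p) (y := q) (by simpa using hp)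
      (by simpa using hq) hs
    simpa using this
  have hd : ∀ s ∈ Icc (0 : ℝ) 1, HasDerivWithinAt
      (fun s : ℝ => G (v' + s • (u' - v')) - G (v + s • (u - v)))
      (fderiv ℝ G (v' + s • (u' - v')) (u' - v') - fderiv ℝ G (v + s • (u - v)) (u - v))
      (Icc 0 1) s := fun s _ =>
    (((hG _).hasFDerivAt.comp_hasDerivAt s (hline v' u' s)).sub
      ((hG _).hasFDerivAt.comp_hasDerivAt s (hline v u s))).hasDerivWithinAt
  have hb : ∀ s ∈ Icc (0 : ℝ) 1,
      ‖fderiv ℝ G (v' + s • (u' - v')) (u' - v') - fderiv ℝ G (v + s • (u - v)) (u - v)‖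
        ≤ L * (1 + 2 * R) * ‖(u' - v') - (u - v)‖ + L * ‖u - v‖ * ‖v' - v‖ := by
    intro s hs
    set A := fderiv ℝ G (v' + s • (u' - v'))
    set B := fderiv ℝ G (v + s • (u - v))
    set w := u - v
    set w' := u' - v'
    -- The change of the increment is met by boundedness of the derivative, and the change of base
    -- point by its Lipschitz bound; only the latter brings in `‖u - v‖ ‖v' - v‖`.
    have h1 : A w' - B w = A (w' - w) + (A - B) w := by
      simp only [map_sub, sub_apply]; abel
    have hA : ‖A‖ ≤ L := hL _ (hmem v' u' hv' hu' s hs)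
    have hAB : ‖A - B‖ ≤ L * (‖v' - v‖ + ‖w' - w‖) := by
      refine (hL' _ _ (hmem v' u' hv' hu' s hs) (hmem v u hv hu s hs)).trans ?_
      gcongr
      have : v' + s • w' - (v + s • w) = (v' - v) + s • (w' - w) := by
        rw [smul_sub s w' w, add_sub_add_comm]
      rw [this]
      refine (norm_add_le _ _).trans (add_le_add_right ?_ _)
      rw [norm_smul, Real.norm_of_nonneg hs.1]
      exact mul_le_of_le_one_left (norm_nonneg _) hs.2
    have hw : ‖w‖ ≤ 2 * R := (norm_sub_le _ _).trans (by linarith)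
    rw [h1]
    calc ‖A (w' - w) + (A - B) w‖ ≤ ‖A‖ * ‖w' - w‖ + ‖A - B‖ * ‖w‖ :=
          (norm_add_le _ _).trans (add_le_add (A.le_opNorm _) ((A - B).le_opNorm _))
      _ ≤ L * ‖w' - w‖ + L * (‖v' - v‖ + ‖w' - w‖) * ‖w‖ := by gcongr
      _ = L * ‖w' - w‖ + L * ‖w' - w‖ * ‖w‖ + L * ‖w‖ * ‖v' - v‖ := by ring
      _ ≤ L * ‖w' - w‖ + L * ‖w' - w‖ * (2 * R) + L * ‖w‖ * ‖v' - v‖ := by gcongr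
      _ = _ := by ring
  have := (convex_Icc (0 : ℝ) 1).norm_image_sub_le_of_norm_hasDerivWithin_le hd hb
    (left_mem_Icc.2 zero_le_one) (right_mem_Icc.2 zero_le_one)
  simpa [sub_sub_sub_comm] using this

/-- Composition with a smooth function is Lipschitz in the discrete `H¹` norm. -/
theorem exists_gridH1_comp_sub_le [ProperSpace E] {a b : ℝ} (hab : a < b) {G : E → V}
    (hG : ContDiff ℝ 2 G) (R K : ℝ) :
    ∃ C : ℝ, 0 ≤ C ∧ ∀ (M : ℕ) (u v : ℕ → E), (∀ j ≤ M, ‖u j‖ ≤ R) → (∀ j ≤ M, ‖v j‖ ≤ R) →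
      gridH1 a b M v ≤ K → u 0 = v 0 →
      gridH1 a b M (fun j => G (u j) - G (v j)) ≤ C * gridH1 a b M (fun j => u j - v j) := by
  obtain ⟨L, hL0, hL, hL'⟩ := exists_fderiv_bound hG |R|
  refine ⟨L * (1 + 2 * |R|) + L * √(b - a) * |K|, by positivity, fun M u v hu hv hvK h0 => ?_⟩
  set w : ℕ → E := fun j => u j - v j with hw
  set W := gridH1 a b M w with hW
  have hW0 : 0 ≤ W := gridH1_nonneg _
  have hR := le_abs_self R
  have hpt : ∀ j ∈ Finset.range M, ‖(G (u (j + 1)) - G (v (j + 1))) - (G (u j) - G (v j))‖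
      ≤ ‖L * (1 + 2 * |R|) * ‖w (j + 1) - w j‖ + L * (√(b - a) * W) * ‖v (j + 1) - v j‖‖ := by
    intro j hj
    have hj1 := Finset.mem_range.1 hj
    rw [Real.norm_of_nonneg (by positivity)]
    refine (norm_comp_sub_sub_le (hG.differentiable (by norm_num)) hL0 hL hL'
      ((hu j hj1.le).trans hR) ((hv j hj1.le).trans hR) ((hu _ hj1).trans hR)
      ((hv _ hj1).trans hR)).trans ?_
    -- The product term is handled by taking `u - v` in the maximum norm, by the discrete Sobolev
    -- inequality, and the differences of `v` in `ℓ²`. Therefore only `v` needs a discrete `H¹`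
    -- bound.
    have : ‖u j - v j‖ ≤ √(b - a) * W :=
      norm_le_gridH1 hab (w := w) (by simp [hw, h0]) hj1.le
    gcongr
  have hsplit : l2 (Finset.range M) (fun j =>
      (G (u (j + 1)) - G (v (j + 1))) - (G (u j) - G (v j)))
      ≤ L * (1 + 2 * |R|) * l2 (Finset.range M) (fun j => w (j + 1) - w j)
        + L * (√(b - a) * W) * l2 (Finset.range M) (fun j => v (j + 1) - v j) := by
    refine (l2_mono hpt).trans ((l2_add_le _ _ _).trans (add_le_add ?_ ?_))
    · refine l2_le_mul (by positivity) fun i _ => le_of_eq ?_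
      rw [norm_mul, norm_norm, Real.norm_of_nonneg (by positivity)]
    · refine l2_le_mul (by positivity) fun i _ => le_of_eq ?_
      rw [norm_mul, norm_norm, Real.norm_of_nonneg (by positivity)]
  have hinv : 0 ≤ (√(mesh a b M))⁻¹ := by positivity
  calc gridH1 a b M (fun j => G (u j) - G (v j))
      ≤ (√(mesh a b M))⁻¹ * (L * (1 + 2 * |R|) * l2 (Finset.range M) (fun j => w (j + 1) - w j)
        + L * (√(b - a) * W) * l2 (Finset.range M) (fun j => v (j + 1) - v j)) :=
        mul_le_mul_of_nonneg_left hsplit hinv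
    _ = L * (1 + 2 * |R|) * W + L * (√(b - a) * W) * gridH1 a b M v := by
        rw [hW]; unfold gridH1; ring
    _ ≤ L * (1 + 2 * |R|) * W + L * (√(b - a) * W) * |K| := by
        gcongr; exact hvK.trans (le_abs_self K)
    _ = _ := by ring

theorem exists_norm_comp_sub_le [ProperSpace E] {G : E → V} (hG : ContDiff ℝ 2 G) (R : ℝ) :
    ∃ C : ℝ, 0 ≤ C ∧ ∀ z w, ‖z‖ ≤ R → ‖w‖ ≤ R → ‖G z - G w‖ ≤ C * ‖z - w‖ := by
  obtain ⟨L, hL0, hL, -⟩ := exists_fderiv_bound hG R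
  exact ⟨L, hL0, fun z w hz hw => norm_comp_sub_le (hG.differentiable (by norm_num)) hL hz hw⟩

/-- The discrete `H¹` norm of a pair is controlled by those of its components. -/
theorem gridH1_prodMk_le {X Y : Type*} [NormedAddCommGroup X] [NormedAddCommGroup Y] {a b : ℝ}
    {M : ℕ} (u : ℕ → X) (v : ℕ → Y) :
    gridH1 a b M (fun j => (u j, v j)) ≤ gridH1 a b M u + gridH1 a b M v := by
  have : l2 (Finset.range M) (fun j => ((u (j + 1), v (j + 1)) : X × Y) - (u j, v j))
      ≤ l2 (Finset.range M) (fun j => u (j + 1) - u j)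
        + l2 (Finset.range M) (fun j => v (j + 1) - v j) := by
    calc _ ≤ l2 (Finset.range M) (fun j => ‖u (j + 1) - u j‖ + ‖v (j + 1) - v j‖) := by
          refine l2_mono fun i _ => ?_
          rw [Real.norm_of_nonneg (by positivity), Prod.mk_sub_mk, Prod.norm_mk]
          exact max_le_add_of_nonneg (norm_nonneg _) (norm_nonneg _)
      _ ≤ _ := (l2_add_le _ _ _).trans (add_le_add
          (l2_mono fun i _ => by rw [norm_norm]) (l2_mono fun i _ => by rw [norm_norm]))
  unfold gridH1
  rw [← mul_add]
  exact mul_le_mul_of_nonneg_left this (by positivity)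

/-- The Lipschitz estimate in the discrete `H¹` norm needs two derivatives, and it is applied to the
first derivative of `F`; hence three derivatives of `F` are required. -/
theorem contDiff_fderiv_apply {k : ℕ} (hk : 3 ≤ k) {F : E → V} (hF : ContDiff ℝ k F) :
    ContDiff ℝ 2 (fun p : E × E => fderiv ℝ F p.1 p.2) := by
  have h : ContDiff ℝ 2 (fderiv ℝ F) := hF.fderiv_right (by norm_cast)
  exact (h.comp contDiff_fst).clm_apply contDiff_snd

end Composition

/-! ### Regularity in time -/

section Time

variable {a b T : ℝ}

theorem ae_uIoc_of_ae_restrict {P : ℝ → Prop} (h : ∀ᵐ t ∂volume.restrict (Icc 0 T), P t) {x y : ℝ}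
    (hx : x ∈ Icc 0 T) (hy : y ∈ Icc 0 T) : ∀ᵐ t, t ∈ uIoc x y → P t := by
  filter_upwards [(ae_restrict_iff' measurableSet_Icc).1 h] with t ht ht'
  exact ht (uIcc_subset_Icc hx hy (uIoc_subset_uIcc ht'))

theorem ae_of_timeSup_le {N : ℝ → ENNReal} {X : ENNReal} (h : timeSup T N ≤ X) :
    ∀ᵐ t ∂volume.restrict (Icc 0 T), N t ≤ X :=
  (ENNReal.ae_le_essSup N).mono fun _ ht => ht.trans h

/-- The assumed bounds are essential suprema in time, while the scheme is compared with the solution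
at given times; continuity in time closes this gap. -/
theorem le_of_ae_le_of_continuousOn (hT : 0 < T) {g : ℝ → ℝ} {K : ℝ}
    (hg : ContinuousOn g (Icc 0 T)) (h : ∀ᵐ t ∂volume.restrict (Icc 0 T), g t ≤ K) :
    ∀ t ∈ Icc 0 T, g t ≤ K := by
  intro t ht
  have h1 : (fun t => max (g t) K) =ᵐ[volume.restrict (Icc 0 T)] fun _ => K :=
    h.mono fun t ht => max_eq_right ht
  have := Measure.eqOn_Icc_of_ae_eq volume hT.ne h1 (hg.sup continuousOn_const) continuousOn_const ht
  exact (le_max_left _ _).trans this.le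

theorem hasDerivWithinAt_of_eq_integral {u v : ℝ → ℂ} (hT : 0 ≤ T) (hv : ContinuousOn v (Icc 0 T))
    (h : ∀ t ∈ Icc 0 T, u t = u 0 + ∫ s in (0 : ℝ)..t, v s) :
    ∀ t ∈ Icc 0 T, HasDerivWithinAt u (v t) (Icc 0 T) t := by
  intro t ht
  set w : ℝ → ℂ := IccExtend hT (domRestrict (Icc 0 T) v) with hw
  have hwc : Continuous w := (continuousOn_iff_continuous_domRestrict.1 hv).Icc_extend'
  have hwv : ∀ s ∈ Icc 0 T, w s = v s := fun s hs => by
    rw [hw, IccExtend_of_mem hT _ hs]; rfl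
  have hd : HasDerivAt (fun t => u 0 + ∫ s in (0 : ℝ)..t, w s) (w t) t :=
    ((hwc.integral_hasStrictDerivAt 0 t).hasDerivAt).const_add _
  rw [← hwv t ht]
  have heq : ∀ s ∈ Icc 0 T, u s = u 0 + ∫ r in (0 : ℝ)..s, w r := fun s hs => by
    rw [h s hs]
    congr 1
    refine intervalIntegral.integral_congr fun r hr => ?_
    rw [uIcc_of_le hs.1] at hr
    exact (hwv r ⟨hr.1, hr.2.trans hs.2⟩).symm
  exact hd.hasDerivWithinAt.congr heq (heq t ht)

theorem IsTimeDeriv.intervalIntegrable {u v : ℝ → ℝ → ℂ} (hT : 0 ≤ T) (h : IsTimeDeriv a b T u v)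
    {x : ℝ} (hx : x ∈ Icc a b) {s t : ℝ} (hs : s ∈ Icc 0 T) (ht : t ∈ Icc 0 T) :
    IntervalIntegrable (fun r => v r x) volume s t :=
  (h.integrable x hx).mono_set (by rw [uIcc_of_le hT]; exact uIcc_subset_Icc hs ht)

theorem IsTimeDeriv.sub_eq_integral {u v : ℝ → ℝ → ℂ} (hT : 0 ≤ T) (h : IsTimeDeriv a b T u v)
    {x : ℝ} (hx : x ∈ Icc a b) {s t : ℝ} (hs : s ∈ Icc 0 T) (ht : t ∈ Icc 0 T) :
    u t x - u s x = ∫ r in s..t, v r x := by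
  have h0 : (0 : ℝ) ∈ Icc 0 T := left_mem_Icc.2 hT
  rw [h.eq_integral x hx t ht, h.eq_integral x hx s hs, add_sub_add_left_eq_sub,
    intervalIntegral.integral_interval_sub_left (h.intervalIntegrable hT hx h0 ht)
      (h.intervalIntegrable hT hx h0 hs)]

theorem IsTimeDeriv.continuousOn_time {u v : ℝ → ℝ → ℂ} (hT : 0 ≤ T) (h : IsTimeDeriv a b T u v)
    {x : ℝ} (hx : x ∈ Icc a b) : ContinuousOn (fun t => u t x) (Icc 0 T) := by
  have := intervalIntegral.continuousOn_primitive_interval' (h.integrable x hx) left_mem_uIcc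
  rw [uIcc_of_le hT] at this
  exact (continuousOn_const.add this).congr fun t ht => h.eq_integral x hx t ht

theorem IsTimeDeriv.norm_sub_le {u v : ℝ → ℝ → ℂ} (hT : 0 ≤ T) (h : IsTimeDeriv a b T u v) {B : ℝ}
    (hB : ∀ᵐ t ∂volume.restrict (Icc 0 T), ∀ x ∈ Icc a b, ‖v t x‖ ≤ B) {x : ℝ} (hx : x ∈ Icc a b)
    {s t : ℝ} (hs : s ∈ Icc 0 T) (ht : t ∈ Icc 0 T) : ‖u t x - u s x‖ ≤ B * |t - s| := by
  rw [h.sub_eq_integral hT hx hs ht]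
  refine intervalIntegral.norm_integral_le_of_norm_le_const_ae ?_
  filter_upwards [ae_uIoc_of_ae_restrict hB hs ht] with r hr hr'
  exact hr hr' x hx

theorem IsTimeDeriv.gridH1_sub_le {u v : ℝ → ℝ → ℂ} (hab : a < b) (hT : 0 ≤ T)
    (h : IsTimeDeriv a b T u v) {M : ℕ} (hM : 1 ≤ M) {B : ℝ}
    (hB : ∀ᵐ t ∂volume.restrict (Icc 0 T), gridH1 a b M (fun j => v t (grid a b M j)) ≤ B)
    {s t : ℝ} (hs : s ∈ Icc 0 T) (ht : t ∈ Icc 0 T) :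
    gridH1 a b M (fun j => u t (grid a b M j) - u s (grid a b M j)) ≤ B * |t - s| := by
  have hm : 0 < √(mesh a b M) := Real.sqrt_pos.2 (mesh_pos hab hM)
  have hmem : ∀ {j}, j ∈ Finset.range M → grid a b M j ∈ Icc a b ∧ grid a b M (j + 1) ∈ Icc a b :=
    fun hj => ⟨grid_mem_Icc hab hM (Finset.mem_range.1 hj).le,
      grid_mem_Icc hab hM (Finset.mem_range.1 hj)⟩
  have key : l2 (Finset.range M) (fun j =>
      ∫ r in s..t, (v r (grid a b M (j + 1)) - v r (grid a b M j))) ≤ √(mesh a b M) * B * |t - s| := by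
    refine l2_integral_le (fun j hj => (h.intervalIntegrable hT (hmem hj).2 hs ht).sub
      (h.intervalIntegrable hT (hmem hj).1 hs ht)) ?_
    filter_upwards [ae_uIoc_of_ae_restrict hB hs ht] with r hr hr'
    have := hr hr'
    unfold gridH1 at this
    rwa [inv_mul_le_iff₀ hm] at this
  unfold gridH1
  rw [inv_mul_le_iff₀ hm, ← mul_assoc]
  refine le_trans (le_of_eq ?_) key
  refine l2_congr fun j hj => ?_
  rw [intervalIntegral.integral_sub (h.intervalIntegrable hT (hmem hj).2 hs ht)
    (h.intervalIntegrable hT (hmem hj).1 hs ht), ← h.sub_eq_integral hT (hmem hj).1 hs ht,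
    ← h.sub_eq_integral hT (hmem hj).2 hs ht, sub_sub_sub_comm]

theorem continuousOn_gridH1 {u : ℝ → ℕ → ℂ} {M : ℕ} {s : Set ℝ}
    (h : ∀ j ≤ M, ContinuousOn (fun t => u t j) s) : ContinuousOn (fun t => gridH1 a b M (u t)) s :=
  continuousOn_const.mul (continuousOn_l2 _ fun _ hj =>
    (h _ (Finset.mem_range.1 hj)).sub (h _ (Finset.mem_range.1 hj).le))

/-- The time derivative of a function with constant boundary value has zero boundary value. -/
theorem IsTimeDeriv.ae_eq_zero {u v : ℝ → ℝ → ℂ} (hT : 0 ≤ T) (h : IsTimeDeriv a b T u v) {x : ℝ}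
    (hx : x ∈ Icc a b) (hu : ∀ t ∈ Icc 0 T, u t x = 0) :
    ∀ᵐ t ∂volume.restrict (Icc 0 T), v t x = 0 := by
  -- Lebesgue differentiation: the primitive of `v` at `x` vanishes identically, so `v` does almost
  -- everywhere.
  have h1 := (h.integrable x hx).ae_hasDerivAt_integral
  have h0 : (0 : ℝ) ∈ Icc 0 T := left_mem_Icc.2 hT
  rw [← restrict_Ioo_eq_restrict_Icc]
  refine (ae_restrict_iff' measurableSet_Ioo).2 ?_
  filter_upwards [h1] with t ht htm
  have htI := Ioo_subset_Icc_self htm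
  have hd := ht (by rwa [uIcc_of_le hT]) 0 (by rwa [uIcc_of_le hT])
  refine hd.unique ((hasDerivAt_const t (0 : ℂ)).congr_of_eventuallyEq ?_)
  filter_upwards [isOpen_Ioo.mem_nhds htm] with s hs
  have := h.sub_eq_integral hT hx h0 (Ioo_subset_Icc_self hs)
  rw [← this, hu _ (Ioo_subset_Icc_self hs), hu _ h0, sub_zero]

theorem norm_sineCoeff_le (hab : a < b) {u : ℝ → ℂ} {B : ℝ} (h : ∀ x ∈ Icc a b, ‖u x‖ ≤ B) (l : ℕ) :
    ‖sineCoeff a b u l‖ ≤ 2 * B := by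
  have hba := sub_pos.2 hab
  rw [sineCoeff_eq hab.le, norm_mul, Complex.norm_real, Real.norm_of_nonneg (by positivity)]
  have : ‖∫ x in a..b, u x * (sn a b l x : ℂ)‖ ≤ B * |b - a| := by
    refine intervalIntegral.norm_integral_le_of_norm_le_const fun x hx => ?_
    rw [uIoc_of_le hab.le] at hx
    rw [norm_mul, Complex.norm_real, Real.norm_eq_abs]
    exact (mul_le_of_le_one_right (norm_nonneg _) (abs_sn_le l x)).trans (h x ⟨hx.1.le, hx.2⟩)
  rw [abs_of_pos hba] at this
  calc 2 / (b - a) * ‖∫ x in a..b, u x * (sn a b l x : ℂ)‖ ≤ 2 / (b - a) * (B * (b - a)) := by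
        gcongr
    _ = 2 * B := by field_simp

theorem intervalIntegrable_mul_sn (hab : a < b) {u : ℝ → ℂ} (hu : ContinuousOn u (Icc a b)) (l : ℕ) :
    IntervalIntegrable (fun x => u x * (sn a b l x : ℂ)) volume a b := by
  refine ContinuousOn.intervalIntegrable ?_
  rw [uIcc_of_le hab.le]
  exact hu.mul (Complex.continuous_ofReal.comp (continuous_sn l)).continuousOn

theorem sineCoeff_sub (hab : a < b) {u v : ℝ → ℂ} (hu : ContinuousOn u (Icc a b))
    (hv : ContinuousOn v (Icc a b)) (l : ℕ) :
    sineCoeff a b (fun x => u x - v x) l = sineCoeff a b u l - sineCoeff a b v l := by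
  simp only [sineCoeff_eq hab.le]
  rw [← mul_sub, ← intervalIntegral.integral_sub (intervalIntegrable_mul_sn hab hu l)
    (intervalIntegrable_mul_sn hab hv l)]
  simp only [sub_mul]

theorem sineCoeff_add (hab : a < b) {u v : ℝ → ℂ} (hu : ContinuousOn u (Icc a b))
    (hv : ContinuousOn v (Icc a b)) (l : ℕ) :
    sineCoeff a b (fun x => u x + v x) l = sineCoeff a b u l + sineCoeff a b v l := by
  simp only [sineCoeff_eq hab.le]
  rw [← mul_add, ← intervalIntegral.integral_add (intervalIntegrable_mul_sn hab hu l)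
    (intervalIntegrable_mul_sn hab hv l)]
  simp only [add_mul]

theorem sineCoeff_const_mul (c : ℂ) (u : ℝ → ℂ) (l : ℕ) :
    sineCoeff a b (fun x => c * u x) l = c * sineCoeff a b u l := by
  unfold sineCoeff
  simp only [mul_assoc, integral_const_mul]
  ring

theorem continuousOn_sineCoeff (hab : a < b) {g : ℝ → ℝ → ℂ} {L : ℝ}
    (hg : ∀ t ∈ Icc 0 T, ContinuousOn (g t) (Icc a b))
    (hL : ∀ s ∈ Icc 0 T, ∀ t ∈ Icc 0 T, ∀ x ∈ Icc a b, ‖g t x - g s x‖ ≤ L * |t - s|) (l : ℕ) :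
    ContinuousOn (fun t => sineCoeff a b (g t) l) (Icc 0 T) := by
  have hl : ∀ s ∈ Icc 0 T, ∀ t ∈ Icc 0 T,
      ‖sineCoeff a b (g s) l - sineCoeff a b (g t) l‖ ≤ 2 * |L| * ‖s - t‖ := by
    intro s hs t ht
    rw [← sineCoeff_sub hab (hg s hs) (hg t ht)]
    refine (norm_sineCoeff_le hab (fun x hx => hL t ht s hs x hx) l).trans ?_
    rw [Real.norm_eq_abs, mul_assoc]
    gcongr
    exact le_abs_self L
  have : LipschitzOnWith (2 * |L|).toNNReal (fun t => sineCoeff a b (g t) l) (Icc 0 T) :=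
    LipschitzOnWith.of_dist_le_mul fun s hs t ht => by
      rw [dist_eq_norm, dist_eq_norm, Real.coe_toNNReal _ (by positivity)]
      exact hl s hs t ht
  exact this.continuousOn

/-- Fubini exchanges the time integral with the sine integral. Joint measurability, which is part of
`IsTimeDeriv`, and the uniform bound `B` justify it. -/
theorem IsTimeDeriv.sineCoeff_eq_integral {u v : ℝ → ℝ → ℂ} (hab : a < b) (hT : 0 ≤ T)
    (h : IsTimeDeriv a b T u v) {B : ℝ}
    (hB : ∀ᵐ t ∂volume.restrict (Icc 0 T), ∀ x ∈ Icc a b, ‖v t x‖ ≤ B)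
    (hu : ∀ t ∈ Icc 0 T, ContinuousOn (u t) (Icc a b)) (l : ℕ) {t : ℝ} (ht : t ∈ Icc 0 T) :
    sineCoeff a b (u t) l = sineCoeff a b (u 0) l + ∫ s in (0 : ℝ)..t, sineCoeff a b (v s) l := by
  have h0 : (0 : ℝ) ∈ Icc 0 T := left_mem_Icc.2 hT
  rw [← sub_eq_iff_eq_add', ← sineCoeff_sub hab (hu t ht) (hu 0 h0)]
  simp only [sineCoeff_eq hab.le, intervalIntegral.integral_const_mul]
  congr 1
  have hmeas : AEStronglyMeasurable (fun p : ℝ × ℝ => v p.1 p.2 * (sn a b l p.2 : ℂ))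
      ((volume.restrict (uIoc 0 t)).prod (volume.restrict (Ioc a b))) := by
    have h1 : AEStronglyMeasurable (fun p : ℝ × ℝ => v p.1 p.2)
        ((volume.restrict (uIoc 0 t)).prod (volume.restrict (Ioc a b))) := by
      rw [Measure.prod_restrict, ← Measure.volume_eq_prod]
      refine h.measurable.mono_measure (Measure.restrict_mono (prod_mono ?_ Ioc_subset_Icc_self) le_rfl)
      exact uIoc_subset_uIcc.trans (uIcc_subset_Icc h0 ht)
    exact h1.mul (Complex.continuous_ofReal.comp
      ((continuous_sn l).comp continuous_snd)).aestronglyMeasurable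
  have hae : ∀ᵐ s ∂volume.restrict (uIoc 0 t),
      ContinuousOn (v s) (Icc a b) ∧ ∀ x ∈ Icc a b, ‖v s x‖ ≤ B :=
    ae_restrict_of_ae_restrict_of_subset (uIoc_subset_uIcc.trans (uIcc_subset_Icc h0 ht))
      (h.continuousOn.and hB)
  have : IsFiniteMeasure (volume.restrict (uIoc 0 t)) := ⟨by simp [uIoc]⟩
  have hint : Integrable (fun p : ℝ × ℝ => v p.1 p.2 * (sn a b l p.2 : ℂ))
      ((volume.restrict (uIoc 0 t)).prod (volume.restrict (Ioc a b))) := by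
    rw [integrable_prod_iff hmeas]
    refine ⟨?_, ?_⟩
    · filter_upwards [hae] with s hs
      have := intervalIntegrable_mul_sn hab hs.1 l
      rwa [intervalIntegrable_iff_integrableOn_Ioc_of_le hab.le] at this
    · refine Integrable.of_bound (hmeas.norm.integral_prod_right') (B * (b - a)) ?_
      filter_upwards [hae] with s hs
      rw [← intervalIntegral.integral_of_le hab.le, ← abs_of_pos (sub_pos.2 hab)]
      refine intervalIntegral.norm_integral_le_of_norm_le_const fun x hx => ?_
      rw [uIoc_of_le hab.le] at hx
      rw [norm_norm, norm_mul, Complex.norm_real, Real.norm_eq_abs]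
      exact (mul_le_of_le_one_right (norm_nonneg _) (abs_sn_le l x)).trans
        (hs.2 x ⟨hx.1.le, hx.2⟩)
  have hsw := intervalIntegral_integral_swap (a := 0) (b := t) (μ := volume.restrict (Ioc a b))
    (f := fun s x => v s x * (sn a b l x : ℂ)) hint
  simp only [intervalIntegral.integral_of_le hab.le] at hsw ⊢
  rw [hsw]
  refine setIntegral_congr_fun measurableSet_Ioc fun x hx => ?_
  have hxI := Ioc_subset_Icc_self hx
  simp only [h.sub_eq_integral hT hxI h0 ht, intervalIntegral.integral_mul_const]

end Time

/-! ### Bounds at every time and the equation for the sine coefficients -/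

section Regular

variable {a b T K L : ℝ}

/-- `u` is Lipschitz in time with values in `H_0^1`, and so is its time derivative `v`. -/
structure IsRegular (a b T K L : ℝ) (u v : ℝ → ℝ → ℂ) : Prop where
  continuousOn : ∀ t ∈ Icc 0 T, ContinuousOn (u t) (Icc a b)
  boundary : ∀ t ∈ Icc 0 T, u t a = 0 ∧ u t b = 0
  boundary_deriv : ∀ t ∈ Icc 0 T, v t a = 0 ∧ v t b = 0
  hasDeriv : ∀ x ∈ Icc a b, ∀ t ∈ Icc 0 T,
    HasDerivWithinAt (fun s => u s x) (v t x) (Icc 0 T) t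
  gridH1_le : ∀ M, 1 ≤ M → ∀ t ∈ Icc 0 T, gridH1 a b M (fun j => u t (grid a b M j)) ≤ K
  gridH1_deriv_le : ∀ M, 1 ≤ M → ∀ t ∈ Icc 0 T, gridH1 a b M (fun j => v t (grid a b M j)) ≤ K
  gridH1_deriv_sub_le : ∀ M, 1 ≤ M → ∀ s ∈ Icc 0 T, ∀ t ∈ Icc 0 T,
    gridH1 a b M (fun j => v t (grid a b M j) - v s (grid a b M j)) ≤ L * |t - s|
  norm_le : ∀ t ∈ Icc 0 T, ∀ x ∈ Icc a b, ‖u t x‖ ≤ √(b - a) * K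
  norm_deriv_le : ∀ t ∈ Icc 0 T, ∀ x ∈ Icc a b, ‖v t x‖ ≤ √(b - a) * K
  norm_deriv_sub_le : ∀ s ∈ Icc 0 T, ∀ t ∈ Icc 0 T, ∀ x ∈ Icc a b,
    ‖v t x - v s x‖ ≤ √(b - a) * L * |t - s|
  hsBound : ∀ t ∈ Icc 0 T, HsBound a b 1 (sineCoeff a b (u t)) (√(2 / (b - a)) * K)

theorem ae_isH1_of_timeSup_le (hab : a < b) {m : ℕ} (hm : 1 ≤ m) {u : ℝ → ℝ → ℂ} {C : ℝ}
    (h : timeSup T (fun t => sobolevNorm a b m (u t)) ≤ ENNReal.ofReal C) (hC : C < K) (hK : 0 < K)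
    (hu : ∀ᵐ t ∂volume.restrict (Icc 0 T), ContinuousOn (u t) (Icc a b)) :
    ∀ᵐ t ∂volume.restrict (Icc 0 T), IsH1 a b (u t) K := by
  filter_upwards [ae_of_timeSup_le h, hu] with t ht hut
  exact isH1_of_sobolevNorm_le hab hm hut ht hC hK

theorem ae_boundary_eq_zero (hab : a < b) (hT : 0 ≤ T) {v w : ℝ → ℝ → ℂ}
    (h : IsTimeDeriv a b T v w) (hv : ∀ t ∈ Icc 0 T, v t a = 0 ∧ v t b = 0) :
    ∀ᵐ t ∂volume.restrict (Icc 0 T), w t a = 0 ∧ w t b = 0 :=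
  (h.ae_eq_zero hT (left_mem_Icc.2 hab.le) fun t ht => (hv t ht).1).and
    (h.ae_eq_zero hT (right_mem_Icc.2 hab.le) fun t ht => (hv t ht).2)

theorem ae_norm_le (hab : a < b) {w : ℝ → ℝ → ℂ} (hL : 0 ≤ L)
    (hw : ∀ᵐ t ∂volume.restrict (Icc 0 T), IsH1 a b (w t) L)
    (hw0 : ∀ᵐ t ∂volume.restrict (Icc 0 T), w t a = 0 ∧ w t b = 0) :
    ∀ᵐ t ∂volume.restrict (Icc 0 T), ∀ x ∈ Icc a b, ‖w t x‖ ≤ √(b - a) * L := by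
  filter_upwards [hw, hw0] with t ht ht0 x hx
  exact ht.norm_le hab hL ht0.1 hx

/-- Quantities built from `u` and `v` are continuous in time, so their almost everywhere bounds hold
at all times. The second time derivative `w` has only an almost everywhere bound and enters through
its integral, as the Lipschitz constant of `v`. -/
theorem isRegular_of_isTimeDeriv (hab : a < b) (hT : 0 < T) (hK : 0 ≤ K) (hL : 0 ≤ L)
    {u v w : ℝ → ℝ → ℂ} (huc : ∀ t ∈ Icc 0 T, ContinuousOn (u t) (Icc a b))
    (hu0 : ∀ t ∈ Icc 0 T, u t a = 0 ∧ u t b = 0)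
    (huv : IsTimeDeriv a b T u v) (hvw : IsTimeDeriv a b T v w)
    (hu : ∀ᵐ t ∂volume.restrict (Icc 0 T), IsH1 a b (u t) K)
    (hv : ∀ᵐ t ∂volume.restrict (Icc 0 T), IsH1 a b (v t) K)
    (hw : ∀ᵐ t ∂volume.restrict (Icc 0 T), IsH1 a b (w t) L) : IsRegular a b T K L u v := by
  have hT0 := hT.le
  have haI := left_mem_Icc.2 hab.le
  have hbI := right_mem_Icc.2 hab.le
  have hcu : ∀ x ∈ Icc a b, ContinuousOn (fun t => u t x) (Icc 0 T) :=
    fun x hx => huv.continuousOn_time hT0 hx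
  have hcv : ∀ x ∈ Icc a b, ContinuousOn (fun t => v t x) (Icc 0 T) :=
    fun x hx => hvw.continuousOn_time hT0 hx
  -- Zero boundary values pass from `u` to `v`, first almost everywhere and then at all times by
  -- continuity, and from `v` to `w`. They are needed to bound maxima by `H¹` norms.
  have hae := ae_boundary_eq_zero hab hT0 huv hu0
  have hv0 : ∀ t ∈ Icc 0 T, v t a = 0 ∧ v t b = 0 := fun t ht =>
    ⟨Measure.eqOn_Icc_of_ae_eq volume hT.ne (hae.mono fun t ht => ht.1) (hcv a haI)
      continuousOn_const ht,
     Measure.eqOn_Icc_of_ae_eq volume hT.ne (hae.mono fun t ht => ht.2) (hcv b hbI)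
      continuousOn_const ht⟩
  have hw0 := ae_boundary_eq_zero hab hT0 hvw hv0
  have hvB : ∀ t ∈ Icc 0 T, ∀ x ∈ Icc a b, ‖v t x‖ ≤ √(b - a) * K := fun t ht x hx =>
    le_of_ae_le_of_continuousOn hT (hcv x hx).norm
      ((ae_norm_le hab hK hv hae).mono fun t ht => ht x hx) t ht
  have huB : ∀ t ∈ Icc 0 T, ∀ x ∈ Icc a b, ‖u t x‖ ≤ √(b - a) * K := fun t ht x hx => by
    refine le_of_ae_le_of_continuousOn hT (hcu x hx).norm
      ((ae_norm_le hab hK hu ?_).mono fun t ht => ht x hx) t ht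
    exact (ae_restrict_iff' measurableSet_Icc).2 (ae_of_all _ hu0)
  refine ⟨huc, hu0, hv0, fun x hx => hasDerivWithinAt_of_eq_integral hT0 (hcv x hx)
    (huv.eq_integral x hx), fun M hM t ht => ?_, fun M hM t ht => ?_, fun M hM s hs t ht => ?_,
    huB, hvB, fun s hs t ht x hx => ?_, fun t ht N => ?_⟩
  · exact le_of_ae_le_of_continuousOn hT
      (continuousOn_gridH1 fun j hj => hcu _ (grid_mem_Icc hab hM hj))
      (hu.mono fun t ht => ht.gridH1_le hab hK hM) t ht
  · exact le_of_ae_le_of_continuousOn hT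
      (continuousOn_gridH1 fun j hj => hcv _ (grid_mem_Icc hab hM hj))
      (hv.mono fun t ht => ht.gridH1_le hab hK hM) t ht
  · exact hvw.gridH1_sub_le hab hT0 hM (hw.mono fun t ht => ht.gridH1_le hab hL hM) hs ht
  · exact hvw.norm_sub_le hT0 (ae_norm_le hab hL hw hw0) hx hs ht
  · refine le_of_ae_le_of_continuousOn hT (g := fun t =>
      l2 (Finset.Ioo 0 N) (fun l => mu a b l ^ 1 • sineCoeff a b (u t) l)) ?_ ?_ t ht
    · refine continuousOn_l2 _ fun l _ => ?_
      have := continuousOn_sineCoeff hab huc (fun s hs t ht x hx =>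
        huv.norm_sub_le hT0 ((ae_restrict_iff' measurableSet_Icc).2 (ae_of_all _ hvB)) hx hs ht) l
      exact this.const_smul (mu a b l ^ 1)
    · filter_upwards [hu, (ae_restrict_iff' measurableSet_Icc).2 (ae_of_all _ hu0)] with t ht ht0
      exact ht.hsBound hab hK ht0.1 ht0.2 N

theorem IsRegular.norm_sub_le {u v : ℝ → ℝ → ℂ} (h : IsRegular a b T K L u v) {x : ℝ}
    (hx : x ∈ Icc a b) {s t : ℝ} (hs : s ∈ Icc 0 T) (ht : t ∈ Icc 0 T) :
    ‖u t x - u s x‖ ≤ √(b - a) * K * |t - s| := by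
  have := (convex_Icc (0 : ℝ) T).norm_image_sub_le_of_norm_hasDerivWithin_le
    (fun r hr => h.hasDeriv x hx r hr) (fun r hr => h.norm_deriv_le r hr x hx) hs ht
  rwa [Real.norm_eq_abs] at this

/-- The equation for the sine coefficients of a solution. -/
theorem hasDerivWithinAt_sineCoeff (hab : a < b) (hT : 0 < T) (hL : 0 ≤ L) {f : ℝ → ℝ} {k : ℕ}
    (hk : 3 ≤ k) (hf : ContDiffOn ℝ k f (Ici 0)) {ε : ℝ} (hε : ε ≠ 0) {ψ₀ ψ₁ : ℝ → ℂ}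
    {ψ ψt ψtt : ℝ → ℝ → ℂ} (hsol : IsNLSWSolution a b T f ε ψ₀ ψ₁ ψ ψt ψtt)
    (hreg : IsRegular a b T K L ψ ψt)
    (hψ : ∀ᵐ t ∂volume.restrict (Icc 0 T), ∃ v, IsWeakDeriv a b 1 (ψ t) v ∧ IntegrableOn v (Ioo a b))
    (hψtt : ∀ᵐ t ∂volume.restrict (Icc 0 T), IsH1 a b (ψtt t) L) (l : ℕ) {t : ℝ} (ht : t ∈ Icc 0 T) :
    HasDerivWithinAt (fun s => sineCoeff a b (ψ s) l) (sineCoeff a b (ψt t) l) (Icc 0 T) t ∧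
    HasDerivWithinAt (fun s => sineCoeff a b (ψt s) l)
      ((Complex.I * sineCoeff a b (ψt t) l - (mu a b l : ℂ) ^ 2 * sineCoeff a b (ψ t) l
        + sineCoeff a b (fun x => nonlin f (ψ t x)) l) / (ε : ℂ) ^ 2) (Icc 0 T) t := by
  have hT0 := hT.le
  have hk2 : (2 : WithTop ℕ∞) ≤ (k : WithTop ℕ∞) := by exact_mod_cast (by omega : 2 ≤ k)
  have hF := contDiff_nonlin hf
  have hcF : ∀ t ∈ Icc 0 T, ContinuousOn (fun x => nonlin f (ψ t x)) (Icc a b) := fun t ht =>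
    hF.continuous.comp_continuousOn (hsol.continuousOn t ht)
  obtain ⟨CF, hCF0, hCF⟩ := exists_norm_comp_sub_le (hF.of_le hk2) (√(b - a) * K)
  have hc1 := continuousOn_sineCoeff hab hsol.continuousOn_deriv hreg.norm_deriv_sub_le l
  have hc0 := continuousOn_sineCoeff hab hsol.continuousOn
    (fun s hs t ht x hx => hreg.norm_sub_le hx hs ht) l
  have hcFl := continuousOn_sineCoeff (L := CF * (√(b - a) * K)) hab hcF
    (fun s hs t ht x hx => (hCF _ _ (hreg.norm_le t ht x hx) (hreg.norm_le s hs x hx)).trans (by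
      rw [mul_assoc]
      exact mul_le_mul_of_nonneg_left (hreg.norm_sub_le hx hs ht) hCF0)) l
  have hw0 := ae_boundary_eq_zero hab hT0 hsol.timeDeriv_two hreg.boundary_deriv
  have hwB := ae_norm_le hab hL hψtt hw0
  have hvB : ∀ᵐ t ∂volume.restrict (Icc 0 T), ∀ x ∈ Icc a b, ‖ψt t x‖ ≤ √(b - a) * K :=
    (ae_restrict_iff' measurableSet_Icc).2 (ae_of_all _ hreg.norm_deriv_le)
  refine ⟨hasDerivWithinAt_of_eq_integral hT0 hc1
    (fun t ht => hsol.timeDeriv.sineCoeff_eq_integral hab hT0 hvB hsol.continuousOn l ht) t ht, ?_⟩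
  refine hasDerivWithinAt_of_eq_integral hT0
    (v := fun t => (Complex.I * sineCoeff a b (ψt t) l - (mu a b l : ℂ) ^ 2 * sineCoeff a b (ψ t) l
        + sineCoeff a b (fun x => nonlin f (ψ t x)) l) / (ε : ℂ) ^ 2)
    ((((continuousOn_const.mul hc1).sub (continuousOn_const.mul hc0)).add hcFl).div_const _)
    (fun t ht => ?_) t ht
  rw [hsol.timeDeriv_two.sineCoeff_eq_integral hab hT0 hwB hsol.continuousOn_deriv l ht]
  congr 1
  have hmem : ∀ᵐ s ∂volume.restrict (Icc 0 T), s ∈ Icc 0 T := ae_restrict_mem measurableSet_Icc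
  -- The equation holds only for almost every time, but its right-hand side is continuous in time.
  -- Inserting it under the integral gives differentiability at every time.
  have hmodal : ∀ᵐ s ∂volume.restrict (Icc 0 T), sineCoeff a b (ψtt s) l
      = (Complex.I * sineCoeff a b (ψt s) l - (mu a b l : ℂ) ^ 2 * sineCoeff a b (ψ s) l
        + sineCoeff a b (fun x => nonlin f (ψ s x)) l) / (ε : ℂ) ^ 2 := by
    filter_upwards [hmem, hsol.equation, hψ, hsol.timeDeriv_two.continuousOn] with s hs heq hv hw
    obtain ⟨ψxx, hxx, heq⟩ := heq
    obtain ⟨v, hv, hvi⟩ := hv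
    have hcψ := hsol.continuousOn s hs
    have hcψt := hsol.continuousOn_deriv s hs
    -- The equation expresses `ψxx` by continuous functions, which makes the weak second derivative
    -- integrable and its sine coefficients computable.
    set g : ℝ → ℂ := fun x => ((ε : ℂ) ^ 2 * ψtt s x - Complex.I * ψt s x) - nonlin f (ψ s x) with hg
    have hgc1 : ContinuousOn (fun x => (ε : ℂ) ^ 2 * ψtt s x - Complex.I * ψt s x) (Icc a b) :=
      (continuousOn_const.mul hw).sub (continuousOn_const.mul hcψt)
    have hgc : ContinuousOn g (Icc a b) := hgc1.sub (hcF s hs)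
    have hae : ψxx =ᵐ[volume.restrict (Ioo a b)] g := by
      filter_upwards [heq] with x hx
      rw [hg]
      linear_combination hx
    have hxxi : IntegrableOn ψxx (Ioo a b) :=
      ((hgc.integrableOn_Icc).mono_set Ioo_subset_Icc_self).congr hae.symm
    have h2 := sineCoeff_weakDeriv_two hab hcψ (hsol.boundary s hs).1 (hsol.boundary s hs).2 hvi hxxi
      hv hxx l
    rw [sineCoeff_congr_ae hae, hg, sineCoeff_sub hab hgc1 (hcF s hs),
      sineCoeff_sub hab (u := fun x => (ε : ℂ) ^ 2 * ψtt s x) (v := fun x => Complex.I * ψt s x)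
        (continuousOn_const.mul hw) (continuousOn_const.mul hcψt),
      sineCoeff_const_mul, sineCoeff_const_mul] at h2
    have hε2 : (ε : ℂ) ^ 2 ≠ 0 := pow_ne_zero _ (by exact_mod_cast hε)
    rw [eq_div_iff hε2]
    linear_combination h2
  exact intervalIntegral.integral_congr_ae
    (ae_uIoc_of_ae_restrict hmodal (left_mem_Icc.2 hT0) ht)

end Regular

/-! ### Decomposition into the two oscillation frequencies -/

section Modes

/-- `β` and `β'` are, in some order, the two roots of `ε² β² - β - μ² = 0`. -/
structure IsRootPair (ε μ β β' : ℝ) : Prop where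
  add_eq : β + β' = 1 / ε ^ 2
  mul_eq : β * β' = -(μ ^ 2 / ε ^ 2)
  abs_le : |β'| ≤ |β - β'|
  one_le : 1 ≤ ε ^ 2 * |β - β'|
  le_gap : 2 * ε * μ ≤ ε ^ 2 * |β - β'|

theorem one_le_root (ε μ : ℝ) : 1 ≤ root ε μ := by
  unfold root
  rw [Real.one_le_sqrt]
  nlinarith [sq_nonneg (ε * μ)]

theorem root_sq (ε μ : ℝ) : root ε μ ^ 2 = 1 + 4 * ε ^ 2 * μ ^ 2 :=
  Real.sq_sqrt (by positivity)

theorem gap_eq {ε : ℝ} (hε : 0 < ε) (μ : ℝ) : gap ε μ = root ε μ / ε ^ 2 := by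
  unfold gap betaPlus betaMinus
  field_simp
  ring

theorem gap_pos {ε : ℝ} (hε : 0 < ε) (μ : ℝ) : 0 < gap ε μ := by
  rw [gap_eq hε]
  have := one_le_root ε μ
  positivity

theorem betaPlus_add_betaMinus {ε : ℝ} (hε : 0 < ε) (μ : ℝ) :
    betaPlus ε μ + betaMinus ε μ = 1 / ε ^ 2 := by
  unfold betaPlus betaMinus
  field_simp
  ring

theorem betaPlus_mul_betaMinus {ε : ℝ} (hε : 0 < ε) (μ : ℝ) :
    betaPlus ε μ * betaMinus ε μ = -(μ ^ 2 / ε ^ 2) := by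
  unfold betaPlus betaMinus
  have := root_sq ε μ
  field_simp
  linear_combination -this

theorem le_root (ε μ : ℝ) : 2 * ε * μ ≤ root ε μ := by
  refine Real.le_sqrt_of_sq_le ?_
  nlinarith

theorem isRootPair_plus {ε : ℝ} (hε : 0 < ε) (μ : ℝ) :
    IsRootPair ε μ (betaPlus ε μ) (betaMinus ε μ) := by
  have h1 := one_le_root ε μ
  have hg : betaPlus ε μ - betaMinus ε μ = root ε μ / ε ^ 2 := gap_eq hε μ
  have hg2 : |betaPlus ε μ - betaMinus ε μ| = root ε μ / ε ^ 2 := by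
    rw [hg, abs_of_nonneg (by positivity)]
  have he : ε ^ 2 * (root ε μ / ε ^ 2) = root ε μ := by field_simp
  refine ⟨betaPlus_add_betaMinus hε μ, betaPlus_mul_betaMinus hε μ, ?_, ?_, ?_⟩
  · rw [hg2, betaMinus, abs_div, abs_of_pos (by positivity : (0 : ℝ) < 2 * ε ^ 2), abs_sub_comm,
      abs_of_nonneg (by linarith), div_le_div_iff₀ (by positivity) (by positivity)]
    nlinarith [sq_nonneg ε]
  · rwa [hg2, he]
  · rw [hg2, he]; exact le_root ε μ

theorem isRootPair_minus {ε : ℝ} (hε : 0 < ε) (μ : ℝ) :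
    IsRootPair ε μ (betaMinus ε μ) (betaPlus ε μ) := by
  have h1 := one_le_root ε μ
  have h0 : 0 ≤ root ε μ := zero_le_one.trans h1
  have hp := isRootPair_plus hε μ
  have hg : betaPlus ε μ - betaMinus ε μ = root ε μ / ε ^ 2 := gap_eq hε μ
  refine ⟨by rw [add_comm]; exact hp.add_eq, by rw [mul_comm]; exact hp.mul_eq, ?_,
    by rw [abs_sub_comm]; exact hp.one_le, by rw [abs_sub_comm]; exact hp.le_gap⟩
  rw [abs_sub_comm, hg, abs_of_nonneg (by positivity : 0 ≤ root ε μ / ε ^ 2), betaPlus,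
    abs_of_nonneg (by positivity : 0 ≤ (1 + root ε μ) / (2 * ε ^ 2)),
    div_le_div_iff₀ (by positivity) (by positivity)]
  nlinarith [sq_nonneg ε]

variable {ε μ β β' : ℝ}

theorem IsRootPair.sub_ne (h : IsRootPair ε μ β β') : β - β' ≠ 0 := by
  intro h0
  have := h.one_le
  rw [h0] at this
  norm_num at this

theorem IsRootPair.ne_zero (h : IsRootPair ε μ β β') (hε : 0 < ε) (hμ : 0 < μ) : β ≠ 0 := by
  intro h0
  have := h.mul_eq
  rw [h0, zero_mul] at this
  have : 0 < μ ^ 2 / ε ^ 2 := by positivity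
  linarith

/-- The component of frequency `β` of the state with value `p` and velocity `q`. -/
noncomputable def mode (β β' : ℝ) (p q : ℂ) : ℂ := (-Complex.I * q - β' * p) / ((β - β' : ℝ) : ℂ)

/-- The factor with which the forcing enters the component of frequency `β`. -/
noncomputable def gain (ε β β' : ℝ) : ℂ := -Complex.I / ((ε ^ 2 * (β - β') : ℝ) : ℂ)

theorem mode_add_mode (h : β - β' ≠ 0) (p q : ℂ) : mode β β' p q + mode β' β p q = p := by
  have h1 : ((β - β' : ℝ) : ℂ) ≠ 0 := by exact_mod_cast h
  have h2 : ((β' - β : ℝ) : ℂ) = -((β - β' : ℝ) : ℂ) := by push_cast; ring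
  unfold mode
  rw [h2, div_neg, ← sub_eq_add_neg, ← sub_div, div_eq_iff h1]
  push_cast
  ring

theorem mode_sub (p q p' q' : ℂ) :
    mode β β' p q - mode β β' p' q' = mode β β' (p - p') (q - q') := by
  unfold mode; ring

theorem norm_gain_eq : ‖gain ε β β'‖ = 1 / (ε ^ 2 * |β - β'|) := by
  unfold gain
  rw [norm_div, norm_neg, Complex.norm_I, Complex.norm_real, norm_mul, Real.norm_eq_abs,
    Real.norm_eq_abs, abs_of_nonneg (sq_nonneg ε)]

/-- The rescaled gap `ε²|β - β'|` is the square root in the roots and is at least one. This is why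
the forcing acts on each component uniformly in `ε`, despite the division by `ε²` in the equation.
-/
theorem IsRootPair.norm_gain_le (h : IsRootPair ε μ β β') : ‖gain ε β β'‖ ≤ 1 := by
  rw [norm_gain_eq]
  have := h.one_le
  exact (div_le_one (by linarith)).2 this

/-- The other root is at most the gap, and the gap is at least `ε⁻² ≥ 1`, so splitting a state into
components costs nothing as `ε` tends to zero. -/
theorem IsRootPair.norm_mode_le (h : IsRootPair ε μ β β') (hε : 0 < ε) (hε1 : ε ≤ 1) (p q : ℂ) :
    ‖mode β β' p q‖ ≤ ‖p‖ + ‖q‖ := by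
  have hg : 0 < |β - β'| := abs_pos.2 h.sub_ne
  have h1 : 1 ≤ |β - β'| := by
    have := h.one_le
    have h2 : ε ^ 2 ≤ 1 := pow_le_one₀ hε.le hε1
    nlinarith
  unfold mode
  rw [norm_div, Complex.norm_real, Real.norm_eq_abs, div_le_iff₀ hg]
  calc ‖-Complex.I * q - β' * p‖ ≤ ‖q‖ + |β'| * ‖p‖ := by
        refine (norm_sub_le _ _).trans (le_of_eq ?_)
        rw [norm_mul, norm_mul, norm_neg, Complex.norm_I, one_mul, Complex.norm_real,
          Real.norm_eq_abs]
    _ ≤ ‖q‖ * |β - β'| + |β - β'| * ‖p‖ :=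
        add_le_add (le_mul_of_one_le_right (norm_nonneg _) h1)
          (mul_le_mul_of_nonneg_right h.abs_le (norm_nonneg _))
    _ = _ := by ring

theorem norm_cis (θ : ℝ) : ‖cis θ‖ = 1 := by
  rw [cis, mul_comm]; exact Complex.norm_exp_ofReal_mul_I θ

theorem cis_add (θ η : ℝ) : cis (θ + η) = cis θ * cis η := by
  unfold cis
  rw [← Complex.exp_add]; push_cast; ring_nf

theorem cis_zero : cis 0 = 1 := by simp [cis]

theorem cis_ne_zero (θ : ℝ) : cis θ ≠ 0 := Complex.exp_ne_zero _

theorem hasDerivAt_cis_mul (c s : ℝ) :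
    HasDerivAt (fun s : ℝ => cis (c * s)) (Complex.I * c * cis (c * s)) s := by
  have h : HasDerivAt (fun s : ℝ => Complex.I * ((c * s : ℝ) : ℂ)) (Complex.I * c) s := by
    have := (((hasDerivAt_id s).const_mul c).ofReal_comp).const_mul Complex.I
    simpa using this
  have := h.cexp
  unfold cis
  convert this using 1
  ring

/-- The equation for the component of frequency `β`. -/
theorem IsRootPair.hasDerivWithinAt_mode (h : IsRootPair ε μ β β') (hε : ε ≠ 0) {p q : ℝ → ℂ} {g : ℂ}
    {s : Set ℝ} {t : ℝ} (hp : HasDerivWithinAt p (q t) s t)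
    (hq : HasDerivWithinAt q ((Complex.I * q t - (μ : ℂ) ^ 2 * p t + g) / (ε : ℂ) ^ 2) s t) :
    HasDerivWithinAt (fun r => mode β β' (p r) (q r))
      (Complex.I * β * mode β β' (p t) (q t) + gain ε β β' * g) s t := by
  have hd := ((hq.const_mul (-Complex.I)).sub (hp.const_mul (β' : ℂ))).div_const
    ((β - β' : ℝ) : ℂ)
  refine hd.congr_deriv ?_
  have hδ : ((β - β' : ℝ) : ℂ) ≠ 0 := by exact_mod_cast h.sub_ne
  have hεC : (ε : ℂ) ≠ 0 := by exact_mod_cast hε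
  have hadd : (β : ℂ) + β' = 1 / (ε : ℂ) ^ 2 := by exact_mod_cast congrArg (fun x : ℝ => (x : ℂ)) h.add_eq
  have hmul : (β : ℂ) * β' = -((μ : ℂ) ^ 2 / (ε : ℂ) ^ 2) := by
    have := congrArg (fun x : ℝ => (x : ℂ)) h.mul_eq
    push_cast at this
    exact this
  have hg : gain ε β β' * g = (-Complex.I * (g / (ε : ℂ) ^ 2)) / ((β - β' : ℝ) : ℂ) := by
    unfold gain
    rw [Complex.ofReal_mul, Complex.ofReal_pow]
    field_simp
  have hm : Complex.I * β * mode β β' (p t) (q t)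
      = (Complex.I * β * (-Complex.I * q t - β' * p t)) / ((β - β' : ℝ) : ℂ) := by
    unfold mode; ring
  -- By Vieta, `1/ε²` and `-μ²/ε²` are the sum and the product of the roots; the numerator of the
  -- mode then reproduces itself with the factor `iβ`.
  have e1 : (Complex.I * q t - (μ : ℂ) ^ 2 * p t + g) / (ε : ℂ) ^ 2
      = Complex.I * q t * (β + β') + β * β' * p t + g / (ε : ℂ) ^ 2 := by
    rw [hadd, hmul]; ring
  rw [hg, hm, e1, ← add_div]
  congr 1
  linear_combination (-(q t) * β') * Complex.I_sq

/-- Filtering out the oscillation of frequency `β` leaves the forcing only. -/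
theorem IsRootPair.hasDerivWithinAt_filtered (h : IsRootPair ε μ β β') (hε : ε ≠ 0) {p q : ℝ → ℂ}
    {g : ℂ} {s : Set ℝ} {t : ℝ} (hp : HasDerivWithinAt p (q t) s t)
    (hq : HasDerivWithinAt q ((Complex.I * q t - (μ : ℂ) ^ 2 * p t + g) / (ε : ℂ) ^ 2) s t) :
    HasDerivWithinAt (fun r => cis (-β * r) * mode β β' (p r) (q r))
      (cis (-β * t) * gain ε β β' * g) s t := by
  refine ((hasDerivAt_cis_mul (-β) t).hasDerivWithinAt.mul
    (h.hasDerivWithinAt_mode hε hp hq)).congr_deriv ?_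
  push_cast
  ring

end Modes

/-! ### Propagation of regularity -/

section Propagation

variable {a b T : ℝ}

/-- Sine coefficients `p` and their time derivatives `q` which satisfy the equation with wave operator
with the sine coefficients `g` of the forcing. -/
structure IsModalSolution (a b T ε : ℝ) (p q g : ℝ → ℕ → ℂ) : Prop where
  hasDeriv : ∀ l, ∀ t ∈ Icc 0 T, HasDerivWithinAt (fun s => p s l) (q t l) (Icc 0 T) t
  hasDeriv_two : ∀ l, ∀ t ∈ Icc 0 T, HasDerivWithinAt (fun s => q s l)
    ((Complex.I * q t l - (mu a b l : ℂ) ^ 2 * p t l + g t l) / (ε : ℂ) ^ 2) (Icc 0 T) t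

/-- The filtered mode has the same modulus as the mode, and its derivative is the forcing alone, so
the mean value inequality with a variable bound applies. The constant `c` and the two weights `r`,
`s` allow derivatives to be traded against the gain. -/
theorem IsModalSolution.hsBound_mode {ε : ℝ} (hε : ε ≠ 0) {p q g : ℝ → ℕ → ℂ}
    (h : IsModalSolution a b T ε p q g) {β β' : ℕ → ℝ}
    (hβ : ∀ l, 0 < l → IsRootPair ε (mu a b l) (β l) (β' l)) {r s : ℕ} {c : ℝ} {G B : ℝ → ℝ}
    (hc : ∀ l, 0 < l → |mu a b l ^ r| * ‖gain ε (β l) (β' l)‖ ≤ c * |mu a b l ^ s|) (hc0 : 0 ≤ c)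
    (h0 : HsBound a b r (fun l => mode (β l) (β' l) (p 0 l) (q 0 l)) (G 0))
    (hg : ∀ t ∈ Icc 0 T, HsBound a b s (g t) (B t)) (hG : ∀ t, HasDerivAt G (c * B t) t) :
    ∀ t ∈ Icc 0 T, HsBound a b r (fun l => mode (β l) (β' l) (p t l) (q t l)) (G t) := by
  intro t ht N
  set V : ℝ → ℕ → ℂ := fun r' l => mu a b l ^ r • (cis (-β l * r') *
    mode (β l) (β' l) (p r' l) (q r' l)) with hV
  have hnorm : ∀ r' l, ‖V r' l‖ = ‖mu a b l ^ r • mode (β l) (β' l) (p r' l) (q r' l)‖ :=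
    fun r' l => by rw [hV]; simp only [norm_smul, norm_mul, norm_cis, one_mul]
  rw [← l2_congr (v := V t) fun l _ => hnorm t l]
  refine l2_le_of_hasDerivWithinAt (V' := fun t l => mu a b l ^ r •
    (cis (-β l * t) * gain ε (β l) (β' l) * g t l)) (fun t ht l hl => ?_) hG ?_ (fun t ht => ?_) t ht
  · have := (hβ l (Finset.mem_Ioo.1 hl).1).hasDerivWithinAt_filtered hε (p := fun s => p s l)
      (q := fun s => q s l) (g := g t l) (h.hasDeriv l t ht) (h.hasDeriv_two l t ht)
    exact this.const_smul (mu a b l ^ r)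
  · rw [l2_congr (w := fun l => mu a b l ^ r • mode (β l) (β' l) (p 0 l) (q 0 l))
      fun l _ => hnorm 0 l]
    exact h0 N
  · refine (l2_le_mul (w := fun l => mu a b l ^ s • g t l) hc0 fun l hl => ?_).trans
      (mul_le_mul_of_nonneg_left (hg t ht N) hc0)
    rw [norm_smul, norm_mul, norm_mul, norm_cis, one_mul, norm_smul, ← mul_assoc, ← mul_assoc]
    exact mul_le_mul_of_nonneg_right (hc l (Finset.mem_Ioo.1 hl).1) (norm_nonneg _)

theorem IsModalSolution.hsBound {ε : ℝ} (hε : 0 < ε) (hε1 : ε ≤ 1)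
    {p q g : ℝ → ℕ → ℂ} (h : IsModalSolution a b T ε p q g) {r s : ℕ} {c A : ℝ} {G B : ℝ → ℝ}
    (hc : ∀ l, 0 < l → ∀ β β', IsRootPair ε (mu a b l) β β' →
      |mu a b l ^ r| * ‖gain ε β β'‖ ≤ c * |mu a b l ^ s|) (hc0 : 0 ≤ c)
    (hp : HsBound a b r (p 0) A) (hq : HsBound a b r (q 0) A) (hG0 : 2 * A ≤ G 0)
    (hg : ∀ t ∈ Icc 0 T, HsBound a b s (g t) (B t)) (hG : ∀ t, HasDerivAt G (c * B t) t) :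
    ∀ t ∈ Icc 0 T, HsBound a b r (p t) (2 * G t) := by
  have key : ∀ β β' : ℕ → ℝ, (∀ l, 0 < l → IsRootPair ε (mu a b l) (β l) (β' l)) →
      ∀ t ∈ Icc 0 T, HsBound a b r (fun l => mode (β l) (β' l) (p t l) (q t l)) (G t) := by
    intro β β' hβ
    refine h.hsBound_mode hε.ne' hβ (fun l hl => hc l hl _ _ (hβ l hl)) hc0 (fun N => ?_) hg hG
    calc l2 (Finset.Ioo 0 N) (fun l => mu a b l ^ r • mode (β l) (β' l) (p 0 l) (q 0 l))
        ≤ l2 (Finset.Ioo 0 N)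
            (fun l => ‖mu a b l ^ r • p 0 l‖ + ‖mu a b l ^ r • q 0 l‖) := by
          refine l2_mono fun l hl => ?_
          rw [Real.norm_of_nonneg (by positivity), norm_smul, norm_smul, norm_smul, ← mul_add]
          gcongr
          exact (hβ l (Finset.mem_Ioo.1 hl).1).norm_mode_le hε hε1 _ _
      _ ≤ A + A := (l2_add_le _ _ _).trans (add_le_add
          ((l2_congr fun l _ => norm_norm _).trans_le (hp N))
          ((l2_congr fun l _ => norm_norm _).trans_le (hq N)))
      _ ≤ G 0 := by linarith
  intro t ht N
  have h1 := key (fun l => betaPlus ε (mu a b l)) (fun l => betaMinus ε (mu a b l))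
    (fun l hl => isRootPair_plus hε (mu a b l)) t ht
  have h2 := key (fun l => betaMinus ε (mu a b l)) (fun l => betaPlus ε (mu a b l))
    (fun l hl => isRootPair_minus hε (mu a b l)) t ht
  have h3 := (h1.add h2) N
  rw [two_mul]
  refine le_trans (le_of_eq (l2_congr fun l _ => ?_)) h3
  simp only [mode_add_mode (isRootPair_plus hε (mu a b l)).sub_ne]

/-- Uniform bounds in `H_s^{r + 1}` from uniform bounds in `H_s^r`. -/
theorem exists_hsBound_succ (hab : a < b) (hT : 0 < T) {r : ℕ} (hr : 1 ≤ r) {F : ℂ → ℂ}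
    (hF : ContDiff ℝ (r + 1 : ℕ) F) (hodd : ∀ z, F (-z) = -F z) (A K : ℝ) :
    ∃ B : ℝ, ∀ ε ∈ Ioc (0 : ℝ) 1, ∀ u v : ℝ → ℝ → ℂ,
      (∀ t ∈ Icc 0 T, ContinuousOn (u t) (Icc a b)) →
      (∀ t ∈ Icc 0 T, u t a = 0 ∧ u t b = 0) →
      IsModalSolution a b T ε (fun t => sineCoeff a b (u t)) (fun t => sineCoeff a b (v t))
        (fun t => sineCoeff a b (fun x => F (u t x))) →
      HsBound a b (r + 1) (sineCoeff a b (u 0)) A → HsBound a b (r + 1) (sineCoeff a b (v 0)) A →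
      (∀ t ∈ Icc 0 T, HsBound a b r (sineCoeff a b (u t)) K) →
      ∀ t ∈ Icc 0 T, HsBound a b (r + 1) (sineCoeff a b (u t)) B := by
  set K' : ℝ := |K| + (mu a b 1 ^ (r - 1))⁻¹ * |K| + (mu a b 1 ^ (r - (r - 1)))⁻¹ * |K| with hK'
  have hmu1 : 0 < mu a b 1 := mu_pos hab one_pos
  obtain ⟨C, hC0, hC⟩ := exists_hsBound_comp hab hr (hF.of_le (by exact_mod_cast r.le_succ)) hodd K'
  obtain ⟨C', hC'0, hC'⟩ := exists_hsBound_comp hab (Nat.le_add_left 1 r) hF hodd K'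
  -- `D` covers the initial data and the constant part of the forcing. The rate `lam = 4 C' + 1` is
  -- chosen so that the part of the forcing proportional to `B e^{lam t}` integrates to at most a
  -- quarter of that bound.
  set D : ℝ := 2 * (2 * |A| + C' * T) + 1 with hD
  set lam : ℝ := 4 * C' + 1 with hlam
  have hlam0 : 0 < lam := by positivity
  refine ⟨2 * D * Real.exp (lam * T), fun ε hε u v huc hu0 hsol hA hA' hK => ?_⟩
  have hε0 := hε.1
  have hbound1 : ∀ t ∈ Icc 0 T, HsBound a b 1 (sineCoeff a b (u t)) K' := fun t ht => by
    refine (HsBound.of_le hab (hK t ht) hr).mono ?_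
    have := mul_le_mul_of_nonneg_left (le_abs_self K)
      (by positivity : 0 ≤ (mu a b 1 ^ (r - 1))⁻¹)
    have h2 : 0 ≤ (mu a b 1 ^ (r - (r - 1)))⁻¹ * |K| := by positivity
    have h3 := abs_nonneg K
    linarith
  have hboundr : ∀ t ∈ Icc 0 T, HsBound a b r (sineCoeff a b (u t)) K' := fun t ht => by
    refine (hK t ht).mono ?_
    have h1 : 0 ≤ (mu a b 1 ^ (r - 1))⁻¹ * |K| := by positivity
    have h2 : 0 ≤ (mu a b 1 ^ (r - (r - 1)))⁻¹ * |K| := by positivity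
    have h3 := le_abs_self K
    linarith
  have hboundp : ∀ t ∈ Icc 0 T, HsBound a b (r - 1) (sineCoeff a b (u t)) K' := fun t ht => by
    refine (HsBound.of_le hab (hK t ht) (Nat.sub_le r 1)).mono ?_
    have := mul_le_mul_of_nonneg_left (le_abs_self K)
      (by positivity : 0 ≤ (mu a b 1 ^ (r - (r - 1)))⁻¹)
    have h2 : 0 ≤ (mu a b 1 ^ (r - 1))⁻¹ * |K| := by positivity
    have h3 := abs_nonneg K
    linarith
  have hA1 := hA.mono (le_abs_self A)
  have hA2 := hA'.mono (le_abs_self A)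
  set c : ℝ := 1 / (2 * ε) with hc
  have hc0 : 0 ≤ c := by positivity
  -- a bound that depends on `ε`
  have hrough : ∀ t ∈ Icc 0 T, HsBound a b (r + 1) (sineCoeff a b (u t))
      (2 * (2 * |A| + c * (C * (1 + K')) * t)) := by
    refine hsol.hsBound hε0 hε.2 (s := r) (c := c) (B := fun _ => C * (1 + K'))
      (G := fun t => 2 * |A| + c * (C * (1 + K')) * t) (fun l hl β β' hβ => ?_) hc0 hA1 hA2 (by simp)
      (fun t ht => hC _ K' (huc t ht) (hu0 t ht).1 (hu0 t ht).2 (hbound1 t ht) (hboundp t ht)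
        (hboundr t ht)) (fun t => ?_)
    -- From `2εμ ≤ ε²|β - β'|` the gain is at most `1/(2εμ)`: a component has one derivative more
    -- than the forcing, at the price of a factor `1/ε`. This shows finiteness, not yet uniformity.
    · have hm := mu_pos hab hl
      rw [norm_gain_eq, abs_of_pos (pow_pos hm (r + 1)), abs_of_pos (pow_pos hm r), hc,
        mul_one_div, div_mul_eq_mul_div, one_mul, div_le_div_iff₀
          (lt_of_lt_of_le (by positivity) hβ.le_gap) (by positivity)]
      calc mu a b l ^ (r + 1) * (2 * ε) = mu a b l ^ r * (2 * ε * mu a b l) := by ring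
        _ ≤ _ := mul_le_mul_of_nonneg_left hβ.le_gap (by positivity)
    · simpa using ((hasDerivAt_id t).const_mul (c * (C * (1 + K')))).const_add (2 * |A|)
  have hK'0 : 0 ≤ K' := by positivity
  set B₀ : ℝ := 2 * (2 * |A| + c * (C * (1 + K')) * T) with hB₀
  have hB₀0 : 0 ≤ B₀ := by have := hT.le; positivity
  -- Any bound `B e^{lam t}` improves itself to `(D + B/2) e^{lam t}`: the tame estimate is linear
  -- in `B`, each of the two modes contributes at most a quarter of `B`, and neither `D` nor `lam`
  -- depends on `ε`.
  have hgr : ∀ B : ℝ, 0 ≤ B →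
      (∀ t ∈ Icc 0 T, HsBound a b (r + 1) (sineCoeff a b (u t)) (B * Real.exp (lam * t))) →
      ∀ t ∈ Icc 0 T, HsBound a b (r + 1) (sineCoeff a b (u t)) ((D + B / 2) * Real.exp (lam * t)) := by
    intro B hB hh t ht
    have h1 := hsol.hsBound hε0 hε.2 (s := r + 1) (c := 1)
      (B := fun t => C' * (1 + B * Real.exp (lam * t)))
      (G := fun t => 2 * |A| + C' * t + C' * B / lam * Real.exp (lam * t))
      (fun l hl β β' hβ => by
        rw [one_mul]; exact mul_le_of_le_one_right (abs_nonneg _) hβ.norm_gain_le) zero_le_one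
      hA1 hA2 (by
        have : 0 ≤ C' * B / lam * Real.exp (lam * 0) := by positivity
        simp only [mul_zero, add_zero] at this ⊢
        linarith)
      (fun t ht => hC' _ _ (huc t ht) (hu0 t ht).1 (hu0 t ht).2 (hbound1 t ht) (hboundr t ht)
        (hh t ht)) (fun t => by
        have he : HasDerivAt (fun t => Real.exp (lam * t)) (Real.exp (lam * t) * lam) t := by
          simpa using ((hasDerivAt_id t).const_mul lam).exp
        have := (((hasDerivAt_id t).const_mul C').const_add (2 * |A|)).add
          (he.const_mul (C' * B / lam))
        refine this.congr_deriv ?_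
        field_simp) t ht
    refine h1.mono ?_
    have he1 : 1 ≤ Real.exp (lam * t) := Real.one_le_exp (by have := ht.1; positivity)
    have hCl : C' * B / lam ≤ B / 4 := by
      rw [div_le_div_iff₀ hlam0 (by norm_num), hlam]
      nlinarith
    have h5 : C' * t ≤ C' * T := mul_le_mul_of_nonneg_left ht.2 hC'0
    have h6 : 2 * (2 * |A| + C' * t) ≤ D * Real.exp (lam * t) := by
      have hD0 : 0 ≤ D := by have := hT.le; positivity
      calc 2 * (2 * |A| + C' * t) ≤ D := by rw [hD]; linarith
        _ ≤ _ := le_mul_of_one_le_right hD0 he1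
    have h7 : C' * B / lam * Real.exp (lam * t) ≤ B / 4 * Real.exp (lam * t) :=
      mul_le_mul_of_nonneg_right hCl (Real.exp_pos _).le
    calc 2 * (2 * |A| + C' * t + C' * B / lam * Real.exp (lam * t))
        = 2 * (2 * |A| + C' * t) + 2 * (C' * B / lam * Real.exp (lam * t)) := by ring
      _ ≤ D * Real.exp (lam * t) + 2 * (B / 4 * Real.exp (lam * t)) := by gcongr
      _ = _ := by ring
  have hD0 : 0 ≤ D := by have := hT.le; positivity
  -- Iterating the improvement halves the contribution of the `ε`-dependent start `B₀` each time; in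
  -- the limit only `2D` is left.
  have hit : ∀ n : ℕ, ∀ t ∈ Icc 0 T, HsBound a b (r + 1) (sineCoeff a b (u t))
      ((2 * D + B₀ / 2 ^ n) * Real.exp (lam * t)) := by
    intro n
    induction n with
    | zero =>
      intro t ht
      refine (hrough t ht).mono ?_
      have he1 : 1 ≤ Real.exp (lam * t) := Real.one_le_exp (by have := ht.1; positivity)
      have : 2 * (2 * |A| + c * (C * (1 + K')) * t) ≤ B₀ := by
        rw [hB₀]
        have := mul_le_mul_of_nonneg_left ht.2 (by positivity : 0 ≤ c * (C * (1 + K')))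
        linarith
      calc _ ≤ 2 * D + B₀ / 2 ^ 0 := by rw [pow_zero, div_one]; linarith
        _ ≤ _ := le_mul_of_one_le_right (by positivity) he1
    | succ n ih =>
      intro t ht
      refine (hgr _ (by positivity) ih t ht).mono (le_of_eq ?_)
      rw [pow_succ]
      ring
  intro t ht N
  have hlim : Filter.Tendsto (fun n : ℕ => (2 * D + B₀ / 2 ^ n) * Real.exp (lam * t)) Filter.atTop
      (nhds ((2 * D + 0) * Real.exp (lam * t))) := by
    refine (tendsto_const_nhds.add ?_).mul_const _
    have := (tendsto_pow_atTop_nhds_zero_of_lt_one (by norm_num : (0 : ℝ) ≤ 1 / 2)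
      (by norm_num)).const_mul B₀
    rw [mul_zero] at this
    refine this.congr fun n => ?_
    rw [one_div, inv_pow, div_eq_mul_inv]
  refine (ge_of_tendsto' hlim fun n => hit n t ht N).trans ?_
  rw [add_zero]
  have := mul_le_mul_of_nonneg_left ht.2 hlam0.le
  gcongr

/-- Uniform bounds in `H_s^m` on solutions. -/
theorem exists_hsBound_solution (hab : a < b) (hT : 0 < T) {m : ℕ} (hm : 1 ≤ m) {F : ℂ → ℂ}
    (hF : ContDiff ℝ m F) (hodd : ∀ z, F (-z) = -F z) (A K : ℝ) :
    ∃ B : ℝ, ∀ ε ∈ Ioc (0 : ℝ) 1, ∀ u v : ℝ → ℝ → ℂ,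
      (∀ t ∈ Icc 0 T, ContinuousOn (u t) (Icc a b)) →
      (∀ t ∈ Icc 0 T, u t a = 0 ∧ u t b = 0) →
      IsModalSolution a b T ε (fun t => sineCoeff a b (u t)) (fun t => sineCoeff a b (v t))
        (fun t => sineCoeff a b (fun x => F (u t x))) →
      HsBound a b m (sineCoeff a b (u 0)) A → HsBound a b m (sineCoeff a b (v 0)) A →
      (∀ t ∈ Icc 0 T, HsBound a b 1 (sineCoeff a b (u t)) K) →
      ∀ t ∈ Icc 0 T, HsBound a b m (sineCoeff a b (u t)) B := by
  -- The assumed `H¹` bound starts the induction, and each step adds one derivative until the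
  -- regularity of the data and of `F` is used up.
  induction m, hm using Nat.le_induction generalizing A with
  | base => exact ⟨K, fun ε _ u v _ _ _ _ _ h => h⟩
  | succ r hr ih =>
    obtain ⟨B, hB⟩ := ih (hF.of_le (by exact_mod_cast r.le_succ)) ((mu a b 1 ^ (r + 1 - r))⁻¹ * A)
    obtain ⟨B', hB'⟩ := exists_hsBound_succ hab hT hr hF hodd A B
    refine ⟨B', fun ε hε u v huc hu0 hsol hA hA' hK => hB' ε hε u v huc hu0 hsol hA hA' ?_⟩
    exact hB ε hε u v huc hu0 hsol (HsBound.of_le hab hA r.le_succ)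
      (HsBound.of_le hab hA' r.le_succ) hK

end Propagation

/-! ### Initial data -/

section Initial

variable {a b : ℝ}

theorem hsBound_zero_of_memLp (hab : a < b) {v : ℝ → ℂ} (hv : MemLp v 2 (volume.restrict (Ioo a b))) :
    HsBound a b 0 (sineCoeff a b v) (√(2 / (b - a)) * √(∫ x in a..b, ‖v x‖ ^ 2)) := by
  intro N
  have := bessel_sn hab N (Real.sqrt_nonneg (∫ x in a..b, ‖v x‖ ^ 2)) hv (by
    rw [Real.sq_sqrt (intervalIntegral.integral_nonneg hab.le fun x _ => sq_nonneg _)])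
  refine le_trans (le_of_eq (l2_congr fun _ _ => ?_)) this
  rw [pow_zero, one_smul, sineCoeff_eq hab.le]

theorem eqOn_of_isWeakDeriv_zero (hab : a < b) {u v : ℝ → ℂ} (hu : ContinuousOn u (Icc a b))
    (hv : ContinuousOn v (Icc a b)) (h : IsWeakDeriv a b 0 u v) : EqOn u v (Icc a b) := by
  have hui : IntegrableOn u (Ioo a b) := hu.integrableOn_Icc.mono_set Ioo_subset_Icc_self
  have hvi : IntegrableOn v (Ioo a b) := hv.integrableOn_Icc.mono_set Ioo_subset_Icc_self
  have key := isOpen_Ioo.ae_eq_zero_of_integral_contDiff_smul_eq_zero (μ := volume)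
    (f := fun x => u x - v x) (hui.sub hvi).locallyIntegrableOn fun η h1 h2 h3 => by
      have h4 := h.2.2 η h1 h2 h3
      simp only [iteratedDeriv_zero, pow_zero, one_mul] at h4
      have h5 : ∫ x, η x • (u x - v x) = ∫ x in Ioo a b, η x • (u x - v x) := by
        symm
        refine setIntegral_eq_integral_of_forall_compl_eq_zero fun x hx => ?_
        rw [IsTest.eq_zero ⟨h1, h2, h3⟩ hx, zero_smul]
      rw [h5]
      simp only [smul_sub, Complex.real_smul]
      rw [integral_sub (IsTest.integrable_mul h1.continuous hab.le hui)
        (IsTest.integrable_mul h1.continuous hab.le hvi), h4, sub_self]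
  have h0 : u =ᵐ[volume.restrict (Icc a b)] v := by
    rw [← restrict_Ioo_eq_restrict_Icc]
    refine (ae_restrict_iff' measurableSet_Ioo).2 ?_
    filter_upwards [key] with x hx hx'
    exact sub_eq_zero.1 (hx hx')
  exact Measure.eqOn_Icc_of_ae_eq volume hab.ne h0 hu hv

/-- Elements of `H_s^m` have sine coefficients of finite norm. -/
theorem MemHs.exists_hsBound (hab : a < b) {m : ℕ} (hm : 1 ≤ m) {u : ℝ → ℂ} (hu : MemHs a b m u) :
    ∃ R, HsBound a b m (sineCoeff a b u) R := by
  obtain ⟨huc, hfin, htr⟩ := hu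
  have hder : ∀ j ≤ m, ∃ w, IsWeakDeriv a b j u w ∧ MemLp w 2 (volume.restrict (Ioo a b)) := by
    intro j hj
    obtain ⟨w, hw, hw2, -⟩ := exists_isWeakDeriv_of_semiNorm_lt
      ((semiNorm_le_sobolevNorm hj u).trans_lt hfin)
    exact ⟨w, hw, hw2⟩
  have hstep : ∀ k, 2 * (k + 1) ≤ m → ∀ v w : ℝ → ℂ, IsWeakDeriv a b (2 * k) u v →
      ContinuousOn v (Icc a b) → v a = 0 → v b = 0 → IsWeakDeriv a b (2 * (k + 1)) u w →
      IntegrableOn w (Ioo a b) → ∀ l, sineCoeff a b w l = -(mu a b l : ℂ) ^ 2 * sineCoeff a b v l := by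
    intro k hk v w hv hvc hva hvb hw hwi l
    obtain ⟨v', hv', hv'2⟩ := hder (2 * k + 1) (by omega)
    exact sineCoeff_weakDeriv_two hab hvc hva hvb (integrableOn_of_memLp_two hv'2) hwi
      (hv.of_add hv') (hv.of_add (j := 2 * k) (i := 2) hw) l
  -- Two derivatives are gained at a time: the vanishing trace of each even derivative permits the
  -- two integrations by parts that lead to the next one.
  have heven : ∀ k, 2 * k < m → ∃ v, IsWeakDeriv a b (2 * k) u v ∧ ContinuousOn v (Icc a b) ∧
      v a = 0 ∧ v b = 0 ∧ ∀ l, ‖sineCoeff a b v l‖ = mu a b l ^ (2 * k) * ‖sineCoeff a b u l‖ := by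
    intro k
    induction k with
    | zero =>
      intro hk
      obtain ⟨v, hv, hvc, hva, hvb⟩ := htr 0 hk
      refine ⟨v, hv, hvc, hva, hvb, fun l => ?_⟩
      rw [mul_zero, pow_zero, one_mul]
      congr 1
      exact sineCoeff_congr (fun x hx =>
        (eqOn_of_isWeakDeriv_zero hab huc hvc hv (Ioo_subset_Icc_self hx)).symm) l
    | succ k ih =>
      intro hk
      obtain ⟨v, hv, hvc, hva, hvb, hvl⟩ := ih (by omega)
      obtain ⟨w, hw, hwc, hwa, hwb⟩ := htr (k + 1) hk
      refine ⟨w, hw, hwc, hwa, hwb, fun l => ?_⟩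
      rw [hstep k hk.le v w hv hvc hva hvb hw (hwc.integrableOn_Icc.mono_set Ioo_subset_Icc_self) l,
        norm_mul, hvl, norm_neg, norm_pow, Complex.norm_real, Real.norm_of_nonneg (mu_nonneg hab l)]
      ring
  have htop : ∀ (s j : ℕ) (w : ℝ → ℂ) (R : ℝ), HsBound a b s (sineCoeff a b w) R →
      (∀ l, ‖sineCoeff a b w l‖ = mu a b l ^ j * ‖sineCoeff a b u l‖) →
      HsBound a b (s + j) (sineCoeff a b u) R := by
    intro s j w R hR hw N
    refine le_trans (le_of_eq (l2_congr fun l _ => ?_)) (hR N)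
    rw [norm_smul, norm_smul, hw, pow_add, norm_mul,
      Real.norm_of_nonneg (pow_nonneg (mu_nonneg hab l) j)]
    ring
  -- For even `m` the last derivative is merely square integrable and is treated by Bessel's
  -- inequality. For odd `m` the last even derivative has zero boundary values and one more
  -- derivative, so the `H¹` bound applies to it.
  obtain ⟨k, rfl | rfl⟩ := Nat.even_or_odd' m
  · obtain ⟨k, rfl⟩ : ∃ k', k = k' + 1 := ⟨k - 1, by omega⟩
    obtain ⟨v, hv, hvc, hva, hvb, hvl⟩ := heven k (by omega)
    obtain ⟨w, hw, hw2⟩ := hder (2 * (k + 1)) le_rfl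
    refine ⟨√(2 / (b - a)) * √(∫ x in a..b, ‖w x‖ ^ 2), ?_⟩
    rw [← zero_add (2 * (k + 1))]
    refine htop 0 (2 * (k + 1)) w _ (hsBound_zero_of_memLp hab hw2) fun l => ?_
    rw [hstep k le_rfl v w hv hvc hva hvb hw (integrableOn_of_memLp_two hw2) l,
      norm_mul, hvl, norm_neg, norm_pow, Complex.norm_real, Real.norm_of_nonneg (mu_nonneg hab l)]
    ring
  · obtain ⟨v, hv, hvc, hva, hvb, hvl⟩ := heven k (by omega)
    obtain ⟨w, hw, hw2⟩ := hder (2 * k + 1) le_rfl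
    refine ⟨√(2 / (b - a)) * √(∫ x in a..b, ‖w x‖ ^ 2), ?_⟩
    rw [add_comm]
    refine htop 1 (2 * k) v _ ?_ hvl
    refine IsH1.hsBound hab ⟨w, hw2, weakDeriv_one_repr_of_continuousOn hab hvc
      (integrableOn_of_memLp_two hw2) (hv.of_add hw), ?_⟩ (Real.sqrt_nonneg _) hva hvb
    rw [Real.sq_sqrt (intervalIntegral.integral_nonneg hab.le fun x _ => sq_nonneg _)]

theorem hsBound_of_hsNorm_le (hab : a < b) {m : ℕ} {u : ℝ → ℂ} {C : ℝ}
    (h : hsNorm a b m u ≤ ENNReal.ofReal C) : HsBound a b m (sineCoeff a b u) |C| := by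
  intro N
  refine l2_le_of_sum_le (abs_nonneg C) ?_
  have h1 : (∑' l : ℕ, ENNReal.ofReal (mu a b (l + 1) ^ (2 * m) * ‖sineCoeff a b u (l + 1)‖ ^ 2))
      ≤ ENNReal.ofReal (|C| ^ 2) := by
    have h2 : hsNorm a b m u ≤ ENNReal.ofReal |C| :=
      h.trans (ENNReal.ofReal_le_ofReal (le_abs_self C))
    have h3 := ENNReal.rpow_le_rpow h2 (by norm_num : (0 : ℝ) ≤ 2)
    rw [hsNorm, ← ENNReal.rpow_mul] at h3
    norm_num at h3
    rw [ENNReal.ofReal_pow (abs_nonneg C)]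
    exact h3
  have h2 := (ENNReal.sum_le_tsum (Finset.range N)).trans h1
  have hnn : ∀ l : ℕ, 0 ≤ mu a b l ^ (2 * m) * ‖sineCoeff a b u l‖ ^ 2 := fun l =>
    mul_nonneg (pow_nonneg (mu_nonneg hab l) _) (sq_nonneg _)
  rw [← ENNReal.ofReal_sum_of_nonneg fun _ _ => hnn _,
    ENNReal.ofReal_le_ofReal_iff (sq_nonneg _)] at h2
  refine le_trans ?_ h2
  have hterm : ∀ l, ‖mu a b l ^ m • sineCoeff a b u l‖ ^ 2
      = mu a b l ^ (2 * m) * ‖sineCoeff a b u l‖ ^ 2 := fun l => by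
    rw [norm_smul, Real.norm_of_nonneg (pow_nonneg (mu_nonneg hab l) _), mul_pow]
    ring
  simp only [hterm]
  have hsub : Finset.Ioo 0 N ⊆ (Finset.range N).image (· + 1) := fun l hl => by
    have := Finset.mem_Ioo.1 hl
    exact Finset.mem_image.2 ⟨l - 1, Finset.mem_range.2 (by omega), by omega⟩
  calc _ ≤ ∑ l ∈ (Finset.range N).image (· + 1), mu a b l ^ (2 * m) * ‖sineCoeff a b u l‖ ^ 2 :=
        Finset.sum_le_sum_of_subset_of_nonneg hsub fun _ _ _ => hnn _
    _ = _ := Finset.sum_image fun x _ y _ h => Nat.succ_injective h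

theorem HsBound.const_mul {r : ℕ} {c : ℕ → ℂ} {R : ℝ} (h : HsBound a b r c R) (z : ℂ) :
    HsBound a b r (fun l => z * c l) (‖z‖ * R) :=
  h.of_norm_le (norm_nonneg z) fun _ => (norm_mul _ _).le

/-- The initial velocity is bounded in `H_s^m`, uniformly in `ε`. -/
theorem exists_hsBound_initVelocity (hab : a < b) {f : ℝ → ℝ} {m m₀ : ℕ} (hm : 2 ≤ m)
    (hmm : m ≤ m₀) (hf : ContDiffOn ℝ m f (Ici 0)) {α : ℝ} (hα : 0 ≤ α) {ψ₀ : ℝ → ℂ}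
    {ω : ℝ → ℝ → ℂ} (hA : AssumptionA a b m₀ ψ₀ ω) :
    ∃ R, HsBound a b m (sineCoeff a b ψ₀) R ∧ ∀ ε ∈ Ioc (0 : ℝ) 1, ∀ v : ℝ → ℂ,
      (∀ x ∈ Ioo a b, v x = initVelocity f α ε ψ₀ (ω ε) x) → HsBound a b m (sineCoeff a b v) R := by
  obtain ⟨huc, hfin, htr⟩ := hA.mem_init
  obtain ⟨R₀, hR₀⟩ := hA.mem_init.exists_hsBound hab (by omega)
  obtain ⟨c, C, -, hω⟩ := hA.bounds
  have hF := contDiff_nonlin hf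
  obtain ⟨v₀, hv₀, hv₀c, hv₀a, hv₀b⟩ := htr 0 (by omega)
  have hend : ψ₀ a = 0 ∧ ψ₀ b = 0 := by
    have heq := eqOn_of_isWeakDeriv_zero hab huc hv₀c hv₀
    exact ⟨(heq (left_mem_Icc.2 hab.le)).trans hv₀a, (heq (right_mem_Icc.2 hab.le)).trans hv₀b⟩
  obtain ⟨v₂, hv₂, hv₂c, -⟩ := htr 1 (by omega)
  obtain ⟨v₁, hv₁, hv₁2, -⟩ := exists_isWeakDeriv_of_semiNorm_lt
    ((semiNorm_le_sobolevNorm (by omega : 1 ≤ m₀ + 2) ψ₀).trans_lt hfin)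
  have hv₁i := integrableOn_of_memLp_two hv₁2
  set ν := mu a b 1 with hν
  have hν0 : 0 < ν := mu_pos hab one_pos
  have hb : ∀ s ≤ m₀ + 2, HsBound a b s (sineCoeff a b ψ₀) ((ν ^ (m₀ + 2 - s))⁻¹ * R₀) :=
    fun s hs => hR₀.of_le hab hs
  have hR₀0 := hR₀.nonneg
  set A : ℝ := (ν ^ (m₀ + 2 - 1))⁻¹ * R₀ + (ν ^ (m₀ + 2 - (m - 1)))⁻¹ * R₀ with hAdef
  obtain ⟨CF, hCF0, hCF⟩ := exists_hsBound_comp hab (by omega : 1 ≤ m) hF (nonlin_neg f) A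
  set RF : ℝ := CF * (1 + (ν ^ (m₀ + 2 - m))⁻¹ * R₀) with hRF
  have hFb : HsBound a b m (sineCoeff a b fun x => nonlin f (ψ₀ x)) RF :=
    hCF ψ₀ _ huc hend.1 hend.2 ((hb 1 (by omega)).mono (le_add_of_nonneg_right (by positivity)))
      ((hb (m - 1) (by omega)).mono (le_add_of_nonneg_left (by positivity))) (hb m (by omega))
  -- The second derivative of the initial value costs two orders, which is what the assumption `ψ₀ ∈
  -- H_s^{m₀+2}` provides for.
  have h2 : HsBound a b m (sineCoeff a b v₂) ((ν ^ (m₀ - m))⁻¹ * R₀) := by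
    have hm2 := hb (m + 2) (by omega)
    rw [show m₀ + 2 - (m + 2) = m₀ - m by omega] at hm2
    intro N
    refine le_trans (le_of_eq (l2_congr fun l _ => ?_)) (hm2 N)
    rw [sineCoeff_weakDeriv_two hab huc hend.1 hend.2 hv₁i
      (hv₂c.integrableOn_Icc.mono_set Ioo_subset_Icc_self) hv₁ hv₂ l, norm_smul, norm_smul, norm_mul,
      norm_neg, norm_pow, norm_pow, norm_pow, Complex.norm_real, pow_add]
    ring
  have hωb : ∀ ε ∈ Ioc (0 : ℝ) 1, HsBound a b m (sineCoeff a b (ω ε)) ((ν ^ (m₀ - m))⁻¹ * |C|) :=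
    fun ε hε => (hsBound_of_hsNorm_le hab (hω ε hε).2).of_le hab hmm
  set R1 : ℝ := 1 * ((ν ^ (m₀ - m))⁻¹ * R₀ + RF) + 1 * ((ν ^ (m₀ - m))⁻¹ * |C|) with hR1
  have hRF0 : 0 ≤ RF := by positivity
  refine ⟨(ν ^ (m₀ + 2 - m))⁻¹ * R₀ + R1, (hb m (by omega)).mono
    (le_add_of_nonneg_right (by positivity)), fun ε hε v hv => ?_⟩
  have hωc := (hA.mem_pert ε hε).1
  have hFc : ContinuousOn (fun x => nonlin f (ψ₀ x)) (Icc a b) := hF.continuous.comp_continuousOn huc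
  have hcoef : ∀ l, Complex.I * (sineCoeff a b v₂ l + sineCoeff a b (fun x => nonlin f (ψ₀ x)) l)
      + ((ε ^ α : ℝ) : ℂ) * sineCoeff a b (ω ε) l = sineCoeff a b v l := by
    intro l
    rw [← sineCoeff_add hab hv₂c hFc, ← sineCoeff_const_mul, ← sineCoeff_const_mul,
      ← sineCoeff_add hab (u := fun x => Complex.I * (v₂ x + nonlin f (ψ₀ x)))
        (v := fun x => ((ε ^ α : ℝ) : ℂ) * ω ε x)
        (continuousOn_const.mul (hv₂c.add hFc)) (continuousOn_const.mul hωc)]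
    -- On the open interval the classical second derivative in `initVelocity` coincides with the
    -- continuous weak derivative `v₂`.
    refine sineCoeff_congr (fun x hx => ?_) l
    rw [hv x hx, initVelocity, iteratedDeriv_two_eq hab huc hv₁i hv₂c hv₁ hv₂ hx]
  have hε1 : ‖((ε ^ α : ℝ) : ℂ)‖ ≤ 1 := by
    rw [Complex.norm_real, Real.norm_of_nonneg (Real.rpow_nonneg hε.1.le _)]
    exact Real.rpow_le_one hε.1.le hε.2 hα
  refine ((((h2.add hFb).const_mul Complex.I).add ((hωb ε hε).const_mul _)).congr hcoef).mono ?_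
  rw [Complex.norm_I]
  have h3 : ‖((ε ^ α : ℝ) : ℂ)‖ * ((ν ^ (m₀ - m))⁻¹ * |C|) ≤ 1 * ((ν ^ (m₀ - m))⁻¹ * |C|) := by
    gcongr
  have h4 : 0 ≤ (ν ^ (m₀ + 2 - m))⁻¹ * R₀ := by positivity
  linarith

end Initial

/-! ### The scheme in terms of the two oscillation frequencies -/

section Scheme

theorem cis_neg_mul_cis (θ : ℝ) : cis (-θ) * cis θ = 1 := by
  rw [← cis_add, neg_add_cancel, cis_zero]

theorem cis_eq (θ : ℝ) : cis θ = Real.cos θ + Complex.I * Real.sin θ := by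
  rw [cis, mul_comm, Complex.exp_mul_I, Complex.ofReal_cos, Complex.ofReal_sin]
  ring

theorem conj_cis (θ : ℝ) : (starRingEnd ℂ) (cis θ) = cis (-θ) := by
  rw [cis_eq, cis_eq, map_add, map_mul, Complex.conj_ofReal, Complex.conj_ofReal, Complex.conj_I,
    Real.cos_neg, Real.sin_neg]
  push_cast
  ring

theorem cis_add_cis_sub (A B : ℝ) : cis (A + B) + cis (A - B) = 2 * cis A * (Real.cos B : ℝ) := by
  rw [sub_eq_add_neg, cis_add, cis_add, cis_eq B, cis_eq (-B), Real.cos_neg, Real.sin_neg]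
  push_cast
  ring

theorem cis_add_sub_cis_sub (A B : ℝ) :
    cis (A + B) - cis (A - B) = 2 * Complex.I * cis A * (Real.sin B : ℝ) := by
  rw [sub_eq_add_neg A B, cis_add, cis_add, cis_eq B, cis_eq (-B), Real.cos_neg, Real.sin_neg]
  push_cast
  ring

theorem sinc_mul (x : ℝ) : Real.sinc x * x = Real.sin x := by
  by_cases hx : x = 0
  · simp [hx]
  · rw [Real.sinc_of_ne_zero hx]; field_simp

/-- `σ(s)` is the mean of `e^{iβr}` over `0 ≤ r ≤ s`. -/
theorem mul_sigma (β τ : ℝ) : Complex.I * (τ * β) * sigma β τ = cis (τ * β) - 1 := by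
  have h1 := cis_add_sub_cis_sub (τ * β / 2) (τ * β / 2)
  rw [add_halves, sub_self, cis_zero, ← sinc_mul] at h1
  rw [h1, sigma]
  push_cast
  ring

theorem conj_sigma (β τ : ℝ) : (starRingEnd ℂ) (sigma β τ) = cis (-(τ * β)) * sigma β τ := by
  rw [sigma, map_mul, conj_cis, Complex.conj_ofReal, ← mul_assoc, ← cis_add]
  congr 2
  ring

variable {ε τ μ : ℝ}

theorem gain_plus : gain ε (betaPlus ε μ) (betaMinus ε μ)
    = -Complex.I / ((ε : ℂ) ^ 2 * gap ε μ) := by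
  unfold gain gap; push_cast; rfl

theorem gain_minus : gain ε (betaMinus ε μ) (betaPlus ε μ)
    = Complex.I / ((ε : ℂ) ^ 2 * gap ε μ) := by
  unfold gain
  rw [show ε ^ 2 * (betaMinus ε μ - betaPlus ε μ) = -(ε ^ 2 * gap ε μ) by unfold gap; ring,
    Complex.ofReal_neg, neg_div_neg_eq]
  push_cast; rfl

theorem tau_mul_add (hε : 0 < ε) :
    τ * betaPlus ε μ + τ * betaMinus ε μ = τ / ε ^ 2 := by
  rw [← mul_add, betaPlus_add_betaMinus hε, mul_one_div]

theorem cis_mul_cis (hε : 0 < ε) :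
    cis (τ * betaPlus ε μ) * cis (τ * betaMinus ε μ) = cis (τ / ε ^ 2) := by
  rw [← cis_add, tau_mul_add hε]

theorem tau_mul_plus (hε : 0 < ε) :
    τ * betaPlus ε μ = τ / (2 * ε ^ 2) + τ * gap ε μ / 2 := by
  have h := tau_mul_add (τ := τ) (μ := μ) hε
  have h2 : τ / (2 * ε ^ 2) = (τ / ε ^ 2) / 2 := by rw [div_div, mul_comm (2 : ℝ)]
  rw [h2, ← h, gap]; ring

theorem tau_mul_minus (hε : 0 < ε) :
    τ * betaMinus ε μ = τ / (2 * ε ^ 2) - τ * gap ε μ / 2 := by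
  have h := tau_mul_add (τ := τ) (μ := μ) hε
  have h2 : τ / (2 * ε ^ 2) = (τ / ε ^ 2) / 2 := by rw [div_div, mul_comm (2 : ℝ)]
  rw [h2, ← h, gap]; ring

/-- With `dd_eq`, this shows that the two-step recursion has the multipliers `e^{iτβ⁺}` and
`e^{iτβ⁻}` as its characteristic roots: their sum multiplies the present value and minus their
product the previous one. -/
theorem cc_eq (hε : 0 < ε) :
    cc ε τ = -(cis (τ * betaPlus ε μ) * cis (τ * betaMinus ε μ)) := by
  rw [cis_mul_cis hε, cc]

theorem dd_eq (hε : 0 < ε) : dd ε τ μ = cis (τ * betaPlus ε μ) + cis (τ * betaMinus ε μ) := by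
  rw [tau_mul_plus hε, tau_mul_minus hε, cis_add_cis_sub, dd]

theorem d0_eq (hε : 0 < ε) :
    d0 ε τ μ = -Complex.I * (cis (τ * betaPlus ε μ) - cis (τ * betaMinus ε μ)) / gap ε μ := by
  have hg : (gap ε μ : ℂ) ≠ 0 := by exact_mod_cast (gap_pos hε μ).ne'
  rw [tau_mul_plus hε, tau_mul_minus hε, cis_add_sub_cis_sub, d0, eq_div_iff hg, ← sinc_mul]
  push_cast
  linear_combination (τ * cis (τ / (2 * ε ^ 2)) * Real.sinc (τ * gap ε μ / 2) * gap ε μ : ℂ)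
    * Complex.I_sq

/-- The linear part of the first step propagates each of the two components exactly with its own
frequency. -/
theorem c0_d0_eq (hε : 0 < ε) (p q : ℂ) : c0 ε τ μ * p + d0 ε τ μ * q
    = cis (τ * betaPlus ε μ) * mode (betaPlus ε μ) (betaMinus ε μ) p q
      + cis (τ * betaMinus ε μ) * mode (betaMinus ε μ) (betaPlus ε μ) p q := by
  have hg : (gap ε μ : ℂ) ≠ 0 := by exact_mod_cast (gap_pos hε μ).ne'
  have h1 : ((betaPlus ε μ - betaMinus ε μ : ℝ) : ℂ) = gap ε μ := rfl
  have h2 : ((betaMinus ε μ - betaPlus ε μ : ℝ) : ℂ) = -gap ε μ := by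
    rw [← h1]; push_cast; ring
  rw [d0_eq hε, c0, mode, mode, h1, h2]
  field_simp
  ring

theorem pp_eq : pp ε τ μ
    = gain ε (betaPlus ε μ) (betaMinus ε μ) * (τ * sigma (betaPlus ε μ) τ)
      + gain ε (betaMinus ε μ) (betaPlus ε μ) * (τ * sigma (betaMinus ε μ) τ) := by
  rw [gain_plus, gain_minus, pp]
  ring

theorem qq_eq : qq ε τ μ
    = gain ε (betaPlus ε μ) (betaMinus ε μ)
        * (Complex.I * τ * (1 - sigma (betaPlus ε μ) τ) / betaPlus ε μ)
      + gain ε (betaMinus ε μ) (betaPlus ε μ)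
        * (Complex.I * τ * (1 - sigma (betaMinus ε μ) τ) / betaMinus ε μ) := by
  rw [gain_plus, gain_minus, qq]
  linear_combination (τ / ((ε : ℂ) ^ 2 * gap ε μ) *
    ((1 - sigma (betaPlus ε μ) τ) / betaPlus ε μ
      - (1 - sigma (betaMinus ε μ) τ) / betaMinus ε μ)) * Complex.I_sq

/-- Each forcing contribution to one mode reappears multiplied by the propagator of the other mode.
This is exactly what remains of the older forcing when two one-step recursions are combined into one
two-step recursion. -/
theorem ppStar_eq (hε : 0 < ε) : ppStar ε τ μ
    = cis (τ * betaMinus ε μ) *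
        (gain ε (betaPlus ε μ) (betaMinus ε μ) * (τ * sigma (betaPlus ε μ) τ))
      + cis (τ * betaPlus ε μ) *
        (gain ε (betaMinus ε μ) (betaPlus ε μ) * (τ * sigma (betaMinus ε μ) τ)) := by
  have h1 := cis_neg_mul_cis (τ * betaPlus ε μ)
  have h2 := cis_neg_mul_cis (τ * betaMinus ε μ)
  rw [gain_plus, gain_minus, ppStar, conj_sigma, conj_sigma, ← cis_mul_cis (μ := μ) hε]
  linear_combination (-Complex.I * τ / ((ε : ℂ) ^ 2 * gap ε μ)) *
    (cis (τ * betaMinus ε μ) * sigma (betaPlus ε μ) τ * h1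
      - cis (τ * betaPlus ε μ) * sigma (betaMinus ε μ) τ * h2)

theorem qqStar_eq (hε : 0 < ε) : qqStar ε τ μ
    = cis (τ * betaMinus ε μ) * (gain ε (betaPlus ε μ) (betaMinus ε μ)
        * (Complex.I * τ * (1 - sigma (betaPlus ε μ) τ) / betaPlus ε μ))
      + cis (τ * betaPlus ε μ) * (gain ε (betaMinus ε μ) (betaPlus ε μ)
        * (Complex.I * τ * (1 - sigma (betaMinus ε μ) τ) / betaMinus ε μ)) := by
  have h1 := cis_ne_zero (τ * betaPlus ε μ)
  have h2 := cis_ne_zero (τ * betaMinus ε μ)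
  have e1 : ∀ z w : ℂ, z / (cis (τ * betaPlus ε μ) * w)
      = (cis (τ * betaPlus ε μ))⁻¹ * (z / w) := fun z w => by
    rw [div_mul_eq_div_div_swap, div_eq_inv_mul]
  have e2 : ∀ z w : ℂ, z / (cis (τ * betaMinus ε μ) * w)
      = (cis (τ * betaMinus ε μ))⁻¹ * (z / w) := fun z w => by
    rw [div_mul_eq_div_div_swap, div_eq_inv_mul]
  rw [gain_plus, gain_minus, qqStar, ← cis_mul_cis (μ := μ) hε, e1, e2]
  have h3 := mul_inv_cancel₀ h1
  have h4 := mul_inv_cancel₀ h2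
  linear_combination (τ / ((ε : ℂ) ^ 2 * gap ε μ)) *
    ((cis (τ * betaMinus ε μ) * ((1 - sigma (betaPlus ε μ) τ) / betaPlus ε μ)) * h3
      - (cis (τ * betaPlus ε μ) * ((1 - sigma (betaMinus ε μ) τ) / betaMinus ε μ)) * h4
      + (cis (τ * betaMinus ε μ) * ((1 - sigma (betaPlus ε μ) τ) / betaPlus ε μ)
        - cis (τ * betaPlus ε μ) * ((1 - sigma (betaMinus ε μ) τ) / betaMinus ε μ)) * Complex.I_sq)

/-- The component of frequency `β` computed by the exponential integrator with time step `τ`, where the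
forcing between `t_n` and `t_{n+1}` is approximated by `Φ n + (t - t_n) D n`. -/
noncomputable def numMode (ε τ β β' : ℝ) (p q : ℂ) (Φ D : ℕ → ℂ) : ℕ → ℂ
  | 0 => mode β β' p q
  | n + 1 => cis (τ * β) * numMode ε τ β β' p q Φ D n
      + gain ε β β' * (τ * sigma β τ * Φ n + Complex.I * τ * (1 - sigma β τ) / β * D n)

/-- The two-step scheme is the sum of two one-step schemes. -/
theorem eq_numMode_add_numMode (hε : 0 < ε) {X Φ D : ℕ → ℂ} {q : ℂ}
    (h1 : X 1 = c0 ε τ μ * X 0 + d0 ε τ μ * q + pp ε τ μ * Φ 0 + qq ε τ μ * D 0)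
    (h2 : ∀ n, 1 ≤ n → X (n + 1) = cc ε τ * X (n - 1) + dd ε τ μ * X n + pp ε τ μ * Φ n
      + qq ε τ μ * D n - ppStar ε τ μ * Φ (n - 1) - qqStar ε τ μ * D (n - 1)) (n : ℕ) :
    X n = numMode ε τ (betaPlus ε μ) (betaMinus ε μ) (X 0) q Φ D n
      + numMode ε τ (betaMinus ε μ) (betaPlus ε μ) (X 0) q Φ D n := by
  induction n using Nat.twoStepInduction with
  | zero =>
    exact (mode_add_mode (isRootPair_plus hε μ).sub_ne _ _).symm
  | one =>
    rw [h1, c0_d0_eq hε, pp_eq, qq_eq]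
    simp only [numMode]
    ring
  | more n ih0 ih1 =>
    -- Each one-step sequence satisfies the homogeneous two-step recursion up to its forcing. Once
    -- the weights are written in terms of the roots, the identity is purely algebraic.
    have h := h2 (n + 1) (Nat.le_add_left 1 n)
    rw [Nat.add_sub_cancel, ih0, ih1] at h
    rw [h, cc_eq (μ := μ) hε, dd_eq hε, pp_eq, qq_eq, ppStar_eq hε, qqStar_eq hε]
    simp only [numMode]
    ring

variable {a b T : ℝ}

theorem IsEWISP.dst_eq {f : ℝ → ℝ} {M : ℕ} {ψ₀ ψ₁ : ℝ → ℂ} {Ψ : ℕ → ℕ → ℂ} (hε : 0 < ε)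
    (h : IsEWISP a b f ε τ M ψ₀ ψ₁ Ψ) {l : ℕ} (hl : l ∈ Finset.Ioo 0 M) (n : ℕ) :
    dst M (Ψ n) l
      = numMode ε τ (betaPlus ε (mu a b l)) (betaMinus ε (mu a b l)) (dst M (Ψ 0) l)
          (dst M (fun i => ψ₁ (grid a b M i)) l) (fun n => dst M (fun i => nonlin f (Ψ n i)) l)
          (fun n => dst M (nonlinRate a b f τ M ψ₀ ψ₁ Ψ n) l) n
        + numMode ε τ (betaMinus ε (mu a b l)) (betaPlus ε (mu a b l)) (dst M (Ψ 0) l)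
          (dst M (fun i => ψ₁ (grid a b M i)) l) (fun n => dst M (fun i => nonlin f (Ψ n i)) l)
          (fun n => dst M (nonlinRate a b f τ M ψ₀ ψ₁ Ψ n) l) n := by
  refine eq_numMode_add_numMode (X := fun n => dst M (Ψ n) l) hε ?_ (fun n hn => ?_) n
  · simp only [dst_congr h.first l, dst_sum_sin _ hl]
  · simp only [dst_congr (h.step n hn) l, dst_sum_sin _ hl]

/-- The error of the component of frequency `β` in one step. -/
theorem IsModalSolution.l2_mode_sub_numMode_succ_le (hab : a < b) (hε : 0 < ε) (hτ : 0 ≤ τ)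
    {p q g : ℝ → ℕ → ℂ} (h : IsModalSolution a b T ε p q g) {β β' : ℕ → ℝ}
    (hβ : ∀ l, 0 < l → IsRootPair ε (mu a b l) (β l) (β' l)) {P Q : ℕ → ℂ} {Φ D : ℕ → ℕ → ℂ}
    {M n s : ℕ} (hn : (n + 1 : ℕ) * τ ≤ T) {R : ℝ}
    (hR : ∀ r ∈ Icc 0 τ, l2 (Finset.Ioo 0 M)
      (fun l => mu a b l ^ s • (g (n * τ + r) l - Φ n l - r * D n l)) ≤ R) :
    l2 (Finset.Ioo 0 M) (fun l => mu a b l ^ s •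
      (mode (β l) (β' l) (p ((n + 1 : ℕ) * τ) l) (q ((n + 1 : ℕ) * τ) l)
        - numMode ε τ (β l) (β' l) (P l) (Q l) (fun n => Φ n l) (fun n => D n l) (n + 1)))
    ≤ l2 (Finset.Ioo 0 M) (fun l => mu a b l ^ s •
      (mode (β l) (β' l) (p (n * τ) l) (q (n * τ) l)
        - numMode ε τ (β l) (β' l) (P l) (Q l) (fun n => Φ n l) (fun n => D n l) n)) + τ * R := by
  set t₀ : ℝ := n * τ with ht₀
  have ht₀0 : 0 ≤ t₀ := by positivity
  have ht₁ : ((n + 1 : ℕ) : ℝ) * τ = t₀ + τ := by rw [ht₀]; push_cast; ring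
  rw [ht₁] at hn ⊢
  set K : Set ℝ := Icc t₀ (t₀ + τ) with hK
  have hKT : K ⊆ Icc 0 T := Icc_subset_Icc ht₀0 hn
  set w : ℝ → ℕ → ℂ := fun t l => mode (β l) (β' l) (p t l) (q t l) with hw
  set U : ℕ → ℕ → ℂ := fun n l =>
    numMode ε τ (β l) (β' l) (P l) (Q l) (fun n => Φ n l) (fun n => D n l) n with hU
  -- `A` and `B` are the primitives of `e^{-iβr}` and `r e^{-iβr}` that vanish at `0`; at `r = τ`
  -- they yield the weights of the integrator.
  set A : ℕ → ℝ → ℂ := fun l r => (1 - cis (-β l * r)) / (Complex.I * β l) with hA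
  set B : ℕ → ℝ → ℂ := fun l r =>
    Complex.I * r * cis (-β l * r) / β l + (cis (-β l * r) - 1) / (β l : ℂ) ^ 2 with hB
  have hβ0 : ∀ l, 0 < l → (β l : ℂ) ≠ 0 := fun l hl => by
    exact_mod_cast (hβ l hl).ne_zero hε (mu_pos hab hl)
  have hcis : ∀ l r, HasDerivAt (fun r => cis (-β l * r)) (-(Complex.I * β l) * cis (-β l * r)) r :=
    fun l r => (hasDerivAt_cis_mul (-β l) r).congr_deriv (by push_cast; ring)
  have hdA : ∀ l, 0 < l → ∀ r, HasDerivAt (A l) (cis (-β l * r)) r := fun l hl r => by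
    refine (((hcis l r).const_sub 1).div_const (Complex.I * β l)).congr_deriv ?_
    have := hβ0 l hl
    field_simp
  have hdB : ∀ l, 0 < l → ∀ r : ℝ, HasDerivAt (B l) (r * cis (-β l * r)) r := fun l hl r => by
    have h1 : HasDerivAt (fun r : ℝ => Complex.I * (r : ℂ)) Complex.I r := by
      simpa using ((hasDerivAt_id r).ofReal_comp).const_mul Complex.I
    refine (((h1.mul (hcis l r)).div_const (β l : ℂ)).add
      (((hcis l r).sub_const 1).div_const ((β l : ℂ) ^ 2))).congr_deriv ?_
    have hb := hβ0 l hl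
    rw [div_add_div _ _ hb (pow_ne_zero 2 hb), div_eq_iff (mul_ne_zero hb (pow_ne_zero 2 hb))]
    linear_combination (-(r : ℂ) * (β l : ℂ) ^ 3 * cis (-β l * r)) * Complex.I_sq
  -- `y` is the filtered exact mode minus the exact response to the affine approximation of the
  -- forcing, so its derivative is the filtered defect alone.
  set y : ℝ → ℕ → ℂ := fun t l => mu a b l ^ s • (cis (-β l * t) * w t l
    - gain ε (β l) (β' l) * cis (-β l * t₀) * (Φ n l * A l (t - t₀) + D n l * B l (t - t₀))) with hy
  have hdy : ∀ t ∈ K, ∀ l ∈ Finset.Ioo 0 M, HasDerivWithinAt (fun r => y r l)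
      (mu a b l ^ s • (gain ε (β l) (β' l) * cis (-β l * t)
        * (g t l - Φ n l - ((t - t₀ : ℝ) : ℂ) * D n l))) K t := by
    intro t ht l hl
    have hl0 := (Finset.mem_Ioo.1 hl).1
    have h1 := ((hβ l hl0).hasDerivWithinAt_filtered hε.ne' (p := fun s => p s l)
      (q := fun s => q s l) (g := g t l) (h.hasDeriv l t (hKT ht))
      (h.hasDeriv_two l t (hKT ht))).mono hKT
    have hA1 : HasDerivAt (fun t => A l (t - t₀)) (cis (-β l * (t - t₀))) t :=
      HasDerivAt.comp_sub_const t t₀ (hdA l hl0 (t - t₀))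
    have hB1 : HasDerivAt (fun t => B l (t - t₀)) (((t - t₀ : ℝ) : ℂ) * cis (-β l * (t - t₀))) t :=
      HasDerivAt.comp_sub_const t t₀ (hdB l hl0 (t - t₀))
    have h2 := (((hA1.const_mul (Φ n l)).add (hB1.const_mul (D n l))).const_mul
      (gain ε (β l) (β' l) * cis (-β l * t₀))).hasDerivWithinAt (s := K)
    refine ((h1.sub h2).const_smul (mu a b l ^ s)).congr_deriv ?_
    congr 1
    have h3 : cis (-β l * t) = cis (-β l * t₀) * cis (-β l * (t - t₀)) := by
      rw [← cis_add]; congr 1; ring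
    rw [h3]
    ring
  have hbound : ∀ t ∈ K, l2 (Finset.Ioo 0 M) (fun l => mu a b l ^ s • (gain ε (β l) (β' l)
      * cis (-β l * t) * (g t l - Φ n l - ((t - t₀ : ℝ) : ℂ) * D n l))) ≤ R := by
    intro t ht
    have h1 := hR (t - t₀) ⟨sub_nonneg.2 ht.1, by linarith [ht.2]⟩
    rw [add_sub_cancel] at h1
    refine (l2_mono fun l hl => ?_).trans h1
    rw [norm_smul, norm_smul, norm_mul, norm_mul, norm_cis, mul_one]
    exact mul_le_mul_of_nonneg_left (mul_le_of_le_one_left (norm_nonneg _)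
      (hβ l (Finset.mem_Ioo.1 hl).1).norm_gain_le) (norm_nonneg _)
  have hmem0 : t₀ ∈ K := left_mem_Icc.2 (by linarith)
  have hmem1 : t₀ + τ ∈ K := right_mem_Icc.2 (by linarith)
  have key := l2_sub_le_of_hasDerivWithinAt (convex_Icc t₀ (t₀ + τ)) hdy hbound hmem0 hmem1
  rw [add_sub_cancel_left, abs_of_nonneg hτ, mul_comm] at key
  -- The increment of `y` over the step equals the increment of the filtered error of the
  -- integrator. Since the filter factors have modulus one, the error norms differ by at most the
  -- increment of `y`.
  have hdiff : ∀ l ∈ Finset.Ioo 0 M, y (t₀ + τ) l - y t₀ l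
      = mu a b l ^ s • (cis (-β l * (t₀ + τ)) * (w (t₀ + τ) l - U (n + 1) l)
        - cis (-β l * t₀) * (w t₀ l - U n l)) := by
    intro l hl
    have hl0 := (Finset.mem_Ioo.1 hl).1
    have hb := hβ0 l hl0
    have hc1 : cis (-β l * (t₀ + τ)) = cis (-β l * t₀) * cis (-β l * τ) := by
      rw [← cis_add]; congr 1; ring
    have hc2 : cis (-β l * τ) * cis (τ * β l) = 1 := by
      rw [← cis_add, ← cis_zero]; congr 1; ring
    have hσ := mul_sigma (β l) τ
    have hAτ : A l τ = cis (-β l * τ) * (τ * sigma (β l) τ) := by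
      rw [hA]
      simp only
      rw [div_eq_iff (mul_ne_zero Complex.I_ne_zero hb)]
      linear_combination -hc2 - cis (-β l * τ) * hσ
    have hBτ : B l τ = cis (-β l * τ) * (Complex.I * τ * (1 - sigma (β l) τ) / β l) := by
      rw [hB]
      simp only
      rw [div_add_div _ _ hb (pow_ne_zero 2 hb), mul_div_assoc',
        div_eq_div_iff (mul_ne_zero hb (pow_ne_zero 2 hb)) hb]
      linear_combination (β l : ℂ) ^ 2 * hc2 + (β l : ℂ) ^ 2 * cis (-β l * τ) * hσ
    have hA0 : A l (t₀ - t₀) = 0 := by simp [hA, cis_zero]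
    have hB0 : B l (t₀ - t₀) = 0 := by simp [hB, cis_zero]
    have hU1 : U (n + 1) l = cis (τ * β l) * U n l + gain ε (β l) (β' l) *
        (τ * sigma (β l) τ * Φ n l + Complex.I * τ * (1 - sigma (β l) τ) / β l * D n l) := rfl
    rw [hy]
    simp only
    rw [← smul_sub, add_sub_cancel_left, hA0, hB0, hAτ, hBτ, hU1, hc1]
    congr 1
    linear_combination (cis (-β l * t₀) * U n l) * hc2
  calc l2 (Finset.Ioo 0 M) (fun l => mu a b l ^ s • (w (t₀ + τ) l - U (n + 1) l))
      = l2 (Finset.Ioo 0 M) (fun l => mu a b l ^ s •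
          (cis (-β l * (t₀ + τ)) * (w (t₀ + τ) l - U (n + 1) l))) := by
        refine l2_congr fun l _ => ?_
        rw [norm_smul, norm_smul, norm_mul, norm_cis, one_mul]
    _ = l2 (Finset.Ioo 0 M) (fun l => mu a b l ^ s • (cis (-β l * t₀) * (w t₀ l - U n l))
          + (y (t₀ + τ) l - y t₀ l)) := by
        refine l2_congr fun l hl => ?_
        rw [hdiff l hl, ← smul_add, add_sub_cancel]
    _ ≤ l2 (Finset.Ioo 0 M) (fun l => mu a b l ^ s • (cis (-β l * t₀) * (w t₀ l - U n l)))
          + τ * R := (l2_add_le _ _ _).trans (add_le_add_right key _)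
    _ = _ := by
        congr 1
        refine l2_congr fun l _ => ?_
        rw [norm_smul, norm_smul, norm_mul, norm_cis, one_mul]

end Scheme

/-! ### Discrete norms -/

section GridNorm

variable {a b : ℝ} {M : ℕ}

/-- The norm of the discrete sine coefficients with weights `μ_l^s`. -/
noncomputable def gridNorm (a b : ℝ) (M s : ℕ) (u : ℕ → ℂ) : ℝ :=
  l2 (Finset.Ioo 0 M) (fun l => mu a b l ^ s • dst M u l)

theorem gridNorm_nonneg (s : ℕ) (u : ℕ → ℂ) : 0 ≤ gridNorm a b M s u := l2_nonneg _ _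

theorem gridNorm_add_le (s : ℕ) (u v : ℕ → ℂ) :
    gridNorm a b M s (fun j => u j + v j) ≤ gridNorm a b M s u + gridNorm a b M s v := by
  refine le_trans (le_of_eq (l2_congr fun l _ => ?_)) (l2_add_le _ _ _)
  rw [dst_add, smul_add]

theorem gridNorm_sub_le (s : ℕ) (u v : ℕ → ℂ) :
    gridNorm a b M s (fun j => u j - v j) ≤ gridNorm a b M s u + gridNorm a b M s v := by
  refine le_trans (le_of_eq (l2_congr fun l _ => ?_)) (l2_sub_le _ _ _)
  rw [dst_sub, smul_sub]

theorem gridNorm_const_mul (s : ℕ) (c : ℂ) (u : ℕ → ℂ) :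
    gridNorm a b M s (fun j => c * u j) = ‖c‖ * gridNorm a b M s u := by
  refine l2_mul_eq (norm_nonneg c) fun l _ => ?_
  rw [dst_const_mul, norm_smul, norm_smul, norm_mul]
  ring

theorem gridH1_le_gridNorm (hab : a < b) (hM : 1 ≤ M) (u : ℕ → ℂ) (h0 : u 0 = 0) (hu : u M = 0) :
    gridH1 a b M u ≤ √((b - a) / 2) * gridNorm a b M 1 u := by
  have := gridH1_le_mu_dst hab hM u h0 hu
  simpa only [gridNorm, pow_one] using this

theorem gridNorm_zero_le (hab : a < b) (u : ℕ → ℂ) :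
    gridNorm a b M 0 u ≤ (mu a b 1)⁻¹ * gridNorm a b M 1 u := by
  have h1 : 0 < mu a b 1 := mu_pos hab one_pos
  refine l2_le_mul (by positivity) fun l hl => ?_
  have hl := (Finset.mem_Ioo.1 hl).1
  rw [pow_zero, one_smul, pow_one, norm_smul, Real.norm_of_nonneg (mu_nonneg hab l), ← mul_assoc]
  refine le_mul_of_one_le_left (norm_nonneg _) ?_
  rw [← div_eq_inv_mul, one_le_div h1]
  exact mu_one_le hab hl

theorem exists_gridNorm_le_gridH1 (hab : a < b) : ∃ c : ℝ, 0 ≤ c ∧ ∀ M, 1 ≤ M → ∀ s ≤ 1,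
    ∀ u : ℕ → ℂ, u 0 = 0 → u M = 0 → gridNorm a b M s u ≤ c * gridH1 a b M u := by
  have h1 : 0 < mu a b 1 := mu_pos hab one_pos
  have hπ := Real.pi_pos
  set κ : ℝ := Real.pi / 2 * √(2 / (b - a)) with hκ
  refine ⟨(1 + (mu a b 1)⁻¹) * κ, by positivity, fun M hM s hs u h0 hu => ?_⟩
  have hN1 : gridNorm a b M 1 u ≤ κ * gridH1 a b M u := by
    have := mu_dst_le_gridH1 hab hM u h0 hu
    simpa only [gridNorm, pow_one] using this
  have hN0 := gridNorm_zero_le (M := M) hab u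
  have hG := gridH1_nonneg (a := a) (b := b) (M := M) u
  have h2 : (mu a b 1)⁻¹ * gridNorm a b M 1 u ≤ (mu a b 1)⁻¹ * (κ * gridH1 a b M u) := by gcongr
  have h3 : 0 ≤ (mu a b 1)⁻¹ * (κ * gridH1 a b M u) := by positivity
  have h4 : 0 ≤ κ * gridH1 a b M u := by positivity
  interval_cases s
  · linarith
  · linarith

/-- Composition with a smooth function is Lipschitz in the discrete norms. -/
theorem exists_gridNorm_comp_sub_le (hab : a < b) {F : ℂ → ℂ} (hF : ContDiff ℝ 2 F) (R K : ℝ) :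
    ∃ C : ℝ, 0 ≤ C ∧ ∀ M, 1 ≤ M → ∀ s ≤ 1, ∀ u v : ℕ → ℂ, (∀ j ≤ M, ‖u j‖ ≤ R) →
      (∀ j ≤ M, ‖v j‖ ≤ R) → gridH1 a b M v ≤ K → u 0 = v 0 → u M = v M →
      gridNorm a b M s (fun j => F (u j) - F (v j)) ≤ C * gridNorm a b M s (fun j => u j - v j) := by
  obtain ⟨C₁, hC₁0, hC₁⟩ := exists_gridH1_comp_sub_le hab hF R K
  obtain ⟨C₀, hC₀0, hC₀⟩ := exists_norm_comp_sub_le hF R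
  obtain ⟨c, hc0, hc⟩ := exists_gridNorm_le_gridH1 hab
  refine ⟨c * (C₁ * √((b - a) / 2)) + C₀, by positivity, fun M hM s hs u v hu hv hK h0 hb => ?_⟩
  have hN := gridNorm_nonneg (a := a) (b := b) (M := M) s (fun j => u j - v j)
  rw [add_mul]
  -- For `s = 0` the pointwise Lipschitz bound passes through Parseval. For `s = 1` the passage is
  -- through finite differences, where compositions can be estimated, and back.
  obtain rfl | rfl : s = 0 ∨ s = 1 := by omega
  · refine le_add_of_nonneg_of_le (by positivity) ?_
    simp only [gridNorm, pow_zero, one_smul]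
    rw [l2_dst hM, l2_dst hM, mul_left_comm]
    refine mul_le_mul_of_nonneg_left (l2_le_mul hC₀0 fun j hj => ?_) (Real.sqrt_nonneg _)
    have := (Finset.mem_Ioo.1 hj).2.le
    exact hC₀ _ _ (hu j this) (hv j this)
  · refine le_add_of_le_of_nonneg ?_ (by positivity)
    calc gridNorm a b M 1 (fun j => F (u j) - F (v j))
        ≤ c * gridH1 a b M (fun j => F (u j) - F (v j)) :=
          hc M hM 1 le_rfl _ (by rw [h0, sub_self]) (by rw [hb, sub_self])
      _ ≤ c * (C₁ * (√((b - a) / 2) * gridNorm a b M 1 (fun j => u j - v j))) := by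
          gcongr
          refine (hC₁ M u v hu hv hK h0).trans ?_
          gcongr
          exact gridH1_le_gridNorm hab hM _ (by rw [h0, sub_self]) (by rw [hb, sub_self])
      _ = _ := by ring

theorem l2_alias_le (hab : a < b) {m s : ℕ} (hM : 1 ≤ M) (hm : 2 ≤ m) (hs : s ≤ 1) {u : ℝ → ℂ}
    (hu : ContinuousOn u (Icc a b)) (ha : u a = 0) (hb : u b = 0) {R : ℝ}
    (h : HsBound a b m (sineCoeff a b u) R) :
    l2 (Finset.Ioo 0 M)
      (fun l => mu a b l ^ s • (sineCoeff a b u l - dst M (fun j => u (grid a b M j)) l))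
      ≤ 2 * Real.pi * (mesh a b M ^ (m - s) * R) := by
  obtain rfl | rfl : s = 0 ∨ s = 1 := by omega
  · simp only [pow_zero, one_smul]
    refine (l2_sineCoeff_sub_dst_le hab hM hm hu ha hb h).trans ?_
    have h1 := h.nonneg
    have h2 := mesh_pos hab hM
    refine mul_le_mul_of_nonneg_right ?_ (by positivity)
    linarith [Real.pi_gt_three]
  · simpa only [pow_one] using l2_mu_sineCoeff_sub_dst_le hab hM hm hu ha hb h

end GridNorm

/-! ### Taylor expansion in time -/

section Taylor

variable {a b T : ℝ} {M : ℕ}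

theorem gridH1_sub_le_of_hasDerivWithinAt {V V' : ℝ → ℕ → ℂ} {K : Set ℝ} (hK : Convex ℝ K) {C : ℝ}
    (h : ∀ t ∈ K, ∀ j ≤ M, HasDerivWithinAt (fun r => V r j) (V' t j) K t)
    (hC : ∀ t ∈ K, gridH1 a b M (V' t) ≤ C) (hm : 0 < mesh a b M) {s t : ℝ} (hs : s ∈ K)
    (ht : t ∈ K) : gridH1 a b M (fun j => V t j - V s j) ≤ C * |t - s| := by
  have hm' : 0 < √(mesh a b M) := Real.sqrt_pos.2 hm
  have key := l2_sub_le_of_hasDerivWithinAt (s := Finset.range M)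
    (V := fun r j => V r (j + 1) - V r j) (V' := fun r j => V' r (j + 1) - V' r j) hK
    (C := √(mesh a b M) * C) (fun t ht j hj =>
      (h t ht _ (Finset.mem_range.1 hj)).sub (h t ht _ (Finset.mem_range.1 hj).le))
    (fun t ht => by
      have := hC t ht
      unfold gridH1 at this
      rwa [inv_mul_le_iff₀ hm'] at this) hs ht
  unfold gridH1
  rw [inv_mul_le_iff₀ hm', ← mul_assoc]
  refine le_trans (le_of_eq (l2_congr fun j _ => ?_)) key
  rw [sub_sub_sub_comm]

/-- The mean value inequality applied to `V` minus its tangent: the derivative of the difference is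
`V' r - V' s`. Lipschitz continuity of `V'` replaces a second derivative. -/
theorem gridH1_taylor_le {V V' : ℝ → ℕ → ℂ} {L : ℝ} (hm : 0 < mesh a b M)
    (h : ∀ t ∈ Icc 0 T, ∀ j ≤ M, HasDerivWithinAt (fun r => V r j) (V' t j) (Icc 0 T) t)
    (hL : ∀ s ∈ Icc 0 T, ∀ t ∈ Icc 0 T, gridH1 a b M (fun j => V' t j - V' s j) ≤ L * |t - s|)
    (hL0 : 0 ≤ L) {s t : ℝ} (hs : s ∈ Icc 0 T) (ht : t ∈ Icc 0 T) :
    gridH1 a b M (fun j => V t j - V s j - (t - s) • V' s j) ≤ L * (t - s) ^ 2 := by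
  have hsub : uIcc s t ⊆ Icc 0 T := uIcc_subset_Icc hs ht
  have key := gridH1_sub_le_of_hasDerivWithinAt (a := a) (b := b) (M := M)
    (V := fun r j => V r j - (r - s) • V' s j) (V' := fun r j => V' r j - V' s j)
    (convex_uIcc s t) (C := L * |t - s|) (fun r hr j hj => ?_) (fun r hr => ?_) hm left_mem_uIcc
    right_mem_uIcc
  · rw [mul_assoc, ← sq, sq_abs] at key
    refine le_trans (le_of_eq (gridH1_congr fun j _ => ?_)) key
    rw [sub_self, zero_smul, sub_zero, sub_right_comm]
  · have h1 : HasDerivWithinAt (fun r : ℝ => (r - s) • V' s j) ((1 : ℝ) • V' s j) (uIcc s t) r :=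
      (((hasDerivAt_id r).sub_const s).smul_const (V' s j)).hasDerivWithinAt
    rw [one_smul] at h1
    exact ((h r (hsub hr) j hj).mono hsub).sub h1
  · refine (hL s hs r (hsub hr)).trans (mul_le_mul_of_nonneg_left ?_ hL0)
    exact abs_sub_left_of_mem_uIcc hr

/-- Expansions about `t`, forward by `r` and backward by `τ` with weight `r/τ ≤ 1`, have linear
terms that cancel, leaving two remainders of order `L τ²`. -/
theorem gridH1_second_difference_le {V V' : ℝ → ℕ → ℂ} {L : ℝ} (hm : 0 < mesh a b M)
    (h : ∀ t ∈ Icc 0 T, ∀ j ≤ M, HasDerivWithinAt (fun r => V r j) (V' t j) (Icc 0 T) t)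
    (hL : ∀ s ∈ Icc 0 T, ∀ t ∈ Icc 0 T, gridH1 a b M (fun j => V' t j - V' s j) ≤ L * |t - s|)
    (hL0 : 0 ≤ L) {t r τ : ℝ} (ht : t ∈ Icc 0 T) (htr : t + r ∈ Icc 0 T) (htτ : t - τ ∈ Icc 0 T)
    (hτ : 0 < τ) (hr : r ∈ Icc 0 τ) :
    gridH1 a b M (fun j => V (t + r) j - V t j - (r / τ) • (V t j - V (t - τ) j))
      ≤ 2 * L * τ ^ 2 := by
  have h1 := gridH1_taylor_le hm h hL hL0 ht htr
  have h2 := gridH1_taylor_le hm h hL hL0 ht htτ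
  have hrτ : 0 ≤ r / τ := div_nonneg hr.1 hτ.le
  have hrτ1 : r / τ ≤ 1 := (div_le_one hτ).2 hr.2
  have h3 := gridH1_add_le (a := a) (b := b) (M := M)
    (fun j => V (t + r) j - V t j - (t + r - t) • V' t j)
    (fun j => (r / τ) • (V (t - τ) j - V t j - (t - τ - t) • V' t j))
  rw [gridH1_smul, abs_of_nonneg hrτ] at h3
  refine le_trans (le_of_eq (gridH1_congr fun j _ => ?_)) (h3.trans ?_)
  · have e1 : (r / τ) • ((t - τ - t) • V' t j) = -(r • V' t j) := by
      rw [smul_smul, ← neg_smul]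
      congr 1
      field_simp
      ring
    have e2 : (r / τ) • (V t j - V (t - τ) j) = -((r / τ) • (V (t - τ) j - V t j)) := by
      rw [← smul_neg, neg_sub]
    rw [smul_sub (r / τ) (V (t - τ) j - V t j), e1, e2, add_sub_cancel_left]
    abel
  · rw [add_sub_cancel_left] at h1
    have h4 : (t - τ - t) ^ 2 = τ ^ 2 := by ring
    rw [h4] at h2
    have h5 : r ^ 2 ≤ τ ^ 2 := pow_le_pow_left₀ hr.1 hr.2 2
    have h6 : L * r ^ 2 ≤ L * τ ^ 2 := mul_le_mul_of_nonneg_left h5 hL0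
    have h7 := gridH1_nonneg (a := a) (b := b) (M := M)
      (fun j => V (t - τ) j - V t j - (t - τ - t) • V' t j)
    have h8 := mul_le_of_le_one_left h7 hrτ1
    simp only [add_sub_cancel_left] at *
    linarith

/-- The time derivative of `F ∘ u` and its Lipschitz constant in the discrete `H¹` norm. -/
theorem exists_gridH1_fderiv_le (hab : a < b) {k : ℕ} (hk : 3 ≤ k) {F : ℂ → ℂ} (hF : ContDiff ℝ k F)
    (K : ℝ) : ∃ C : ℝ, 0 ≤ C ∧ ∀ (T L : ℝ) (u v : ℝ → ℝ → ℂ), 0 ≤ L → IsRegular a b T K L u v →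
      ∀ M, 1 ≤ M →
      (∀ t ∈ Icc 0 T, gridH1 a b M
        (fun j => fderiv ℝ F (u t (grid a b M j)) (v t (grid a b M j))) ≤ C) ∧
      ∀ s ∈ Icc 0 T, ∀ t ∈ Icc 0 T, gridH1 a b M
        (fun j => fderiv ℝ F (u t (grid a b M j)) (v t (grid a b M j))
          - fderiv ℝ F (u s (grid a b M j)) (v s (grid a b M j))) ≤ C * (1 + L) * |t - s| := by
  -- The time derivative of `F ∘ u` is the map `(z, v) ↦ F'(z) v` composed with the pair `(u, ∂ₜu)`,
  -- so the Lipschitz estimate for compositions is applied to pairs.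
  obtain ⟨C, hC0, hC⟩ := exists_gridH1_comp_sub_le hab (contDiff_fderiv_apply hk hF)
    (√(b - a) * |K|) (2 * |K|)
  refine ⟨C * (2 * |K|) + C * (|K| + 1), by positivity, fun T L u v hL h M hM => ?_⟩
  have hK := le_abs_self K
  have hsup : ∀ t ∈ Icc 0 T, ∀ j ≤ M, ‖(u t (grid a b M j), v t (grid a b M j))‖ ≤ √(b - a) * |K| := by
    intro t ht j hj
    have hj' := grid_mem_Icc hab hM hj
    rw [Prod.norm_mk]
    exact max_le ((h.norm_le t ht _ hj').trans (by gcongr))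
      ((h.norm_deriv_le t ht _ hj').trans (by gcongr))
  have hH1 : ∀ t ∈ Icc 0 T, gridH1 a b M (fun j => (u t (grid a b M j), v t (grid a b M j)))
      ≤ 2 * |K| := fun t ht => (gridH1_prodMk_le _ _).trans
    (by linarith [h.gridH1_le M hM t ht, h.gridH1_deriv_le M hM t ht])
  refine ⟨fun t ht => ?_, fun s hs t ht => ?_⟩
  · have h0 : gridH1 a b M (fun _ => (0 : ℂ × ℂ)) = 0 := by
      unfold gridH1; simp only [sub_self, l2_zero, mul_zero]
    have h1 := hC M (fun j => (u t (grid a b M j), v t (grid a b M j))) (fun _ => 0) (hsup t ht)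
      (fun _ _ => by rw [norm_zero]; positivity) (h0.trans_le (by positivity)) (by
        simp only [grid_zero, (h.boundary t ht).1, (h.boundary_deriv t ht).1, Prod.mk_zero_zero])
    simp only [Prod.fst_zero, Prod.snd_zero, map_zero, sub_zero] at h1
    refine h1.trans ?_
    have h2 := mul_le_mul_of_nonneg_left (hH1 t ht) hC0
    have : 0 ≤ C * (|K| + 1) := by positivity
    linarith
  · have h1 := hC M (fun j => (u t (grid a b M j), v t (grid a b M j)))
      (fun j => (u s (grid a b M j), v s (grid a b M j))) (hsup t ht) (hsup s hs) (hH1 s hs) (by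
        simp only [grid_zero, (h.boundary t ht).1, (h.boundary_deriv t ht).1, (h.boundary s hs).1,
          (h.boundary_deriv s hs).1])
    refine h1.trans ?_
    have h2 : gridH1 a b M (fun j => u t (grid a b M j) - u s (grid a b M j)) ≤ |K| * |t - s| := by
      refine gridH1_sub_le_of_hasDerivWithinAt (V := fun r j => u r (grid a b M j))
        (V' := fun r j => v r (grid a b M j)) (convex_Icc 0 T)
        (fun r hr j hj => h.hasDeriv _ (grid_mem_Icc hab hM hj) r hr)
        (fun r hr => (h.gridH1_deriv_le M hM r hr).trans hK) (mesh_pos hab hM) hs ht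
    have h3 := h.gridH1_deriv_sub_le M hM s hs t ht
    have h4 : gridH1 a b M (fun j => (u t (grid a b M j), v t (grid a b M j))
        - (u s (grid a b M j), v s (grid a b M j))) ≤ (|K| + L) * |t - s| := by
      simp only [Prod.mk_sub_mk]
      refine (gridH1_prodMk_le _ _).trans ?_
      linarith
    have h5 : |K| + L ≤ (|K| + 1) * (1 + L) := by nlinarith [abs_nonneg K]
    calc _ ≤ C * ((|K| + 1) * (1 + L) * |t - s|) := by
          refine mul_le_mul_of_nonneg_left (h4.trans ?_) hC0
          exact mul_le_mul_of_nonneg_right h5 (abs_nonneg _)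
      _ = C * (|K| + 1) * ((1 + L) * |t - s|) := by ring
      _ ≤ (C * (2 * |K|) + C * (|K| + 1)) * ((1 + L) * |t - s|) := by
          refine mul_le_mul_of_nonneg_right ?_ (by positivity)
          exact le_add_of_nonneg_left (by positivity)
      _ = _ := by ring

theorem IsRegular.hasDerivWithinAt_comp (hab : a < b) {K L : ℝ} {u v : ℝ → ℝ → ℂ}
    (h : IsRegular a b T K L u v) {F : ℂ → ℂ} (hF : Differentiable ℝ F) (hM : 1 ≤ M) :
    ∀ t ∈ Icc 0 T, ∀ j ≤ M, HasDerivWithinAt (fun r => F (u r (grid a b M j)))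
      (fderiv ℝ F (u t (grid a b M j)) (v t (grid a b M j))) (Icc 0 T) t := fun t ht _ hj =>
  (hF _).hasFDerivAt.comp_hasDerivWithinAt t (h.hasDeriv _ (grid_mem_Icc hab hM hj) t ht)

end Taylor

/-! ### Local errors -/

section LocalError

variable {a b T : ℝ}

/-- The bounds on the solution `ψ` of the equation with wave operator and on the limit `ψs` from which
the error estimates follow. -/
structure IsBoundedSolution (a b T : ℝ) (F : ℂ → ℂ) (m : ℕ) (K B ε κ : ℝ)
    (ψ ψt ψs ψst : ℝ → ℝ → ℂ) : Prop where
  regular : IsRegular a b T K (K / κ) ψ ψt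
  regular_limit : IsRegular a b T K K ψs ψst
  close : ∀ M, 1 ≤ M → ∀ t ∈ Icc 0 T,
    gridH1 a b M (fun j => ψ t (grid a b M j) - ψs t (grid a b M j)) ≤ K * ε ^ 2
  modal : IsModalSolution a b T ε (fun t => sineCoeff a b (ψ t)) (fun t => sineCoeff a b (ψt t))
    (fun t => sineCoeff a b (fun x => F (ψ t x)))
  continuousOn_velocity : ContinuousOn (ψt 0) (Icc a b)
  hsBound : ∀ t ∈ Icc 0 T, HsBound a b m (sineCoeff a b (ψ t)) B
  hsBound_comp : ∀ t ∈ Icc 0 T, HsBound a b m (sineCoeff a b (fun x => F (ψ t x))) B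
  hsBound_velocity : HsBound a b m (sineCoeff a b (ψt 0)) B

/-- The first bound in the minimum uses the large Lipschitz constant `K/κ` of `∂ₜψ` directly. The
second replaces `ψ` by the limit `ψs`, whose velocity has a Lipschitz constant independent of `ε`,
at the cost of the distance `ε²`. -/
theorem exists_gridH1_second_difference_le (hab : a < b) {k : ℕ} (hk : 3 ≤ k) {F : ℂ → ℂ}
    (hF : ContDiff ℝ k F) {K : ℝ} (hK : 0 ≤ K) : ∃ C : ℝ, 0 ≤ C ∧
      ∀ (m : ℕ) (B ε κ : ℝ) (ψ ψt ψs ψst : ℝ → ℝ → ℂ), 0 < κ → κ ≤ 1 →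
      IsBoundedSolution a b T F m K B ε κ ψ ψt ψs ψst → ∀ M, 1 ≤ M → ∀ t r τ : ℝ, t ∈ Icc 0 T →
      t + r ∈ Icc 0 T → t - τ ∈ Icc 0 T → 0 < τ → r ∈ Icc 0 τ →
      gridH1 a b M (fun j => F (ψ (t + r) (grid a b M j)) - F (ψ t (grid a b M j))
        - (r / τ) • (F (ψ t (grid a b M j)) - F (ψ (t - τ) (grid a b M j))))
        ≤ C * min (τ ^ 2 / κ) (τ ^ 2 + ε ^ 2) := by
  have hk2 : (2 : WithTop ℕ∞) ≤ (k : WithTop ℕ∞) := by exact_mod_cast (by omega : 2 ≤ k)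
  have hFd : Differentiable ℝ F := (hF.of_le hk2).differentiable (by norm_num)
  obtain ⟨C₁, hC₁0, hC₁⟩ := exists_gridH1_fderiv_le hab hk hF K
  obtain ⟨C₂, hC₂0, hC₂⟩ := exists_gridH1_comp_sub_le hab (hF.of_le hk2) (√(b - a) * K) K
  refine ⟨2 * (C₁ * (1 + K)) + 4 * (C₂ * K), by positivity,
    fun m B ε κ ψ ψt ψs ψst hκ hκ1 h M hM t r τ ht htr htτ hτ hr => ?_⟩
  have hm := mesh_pos hab hM
  rw [mul_min_of_nonneg _ _ (by positivity)]
  refine le_min ?_ ?_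
  · refine (gridH1_second_difference_le hm (h.regular.hasDerivWithinAt_comp hab hFd hM)
      ((hC₁ T (K / κ) ψ ψt (by positivity) h.regular M hM).2) (by positivity) ht htr htτ hτ hr).trans
      ?_
    have h1 : 1 + K / κ ≤ (1 + K) / κ := by
      rw [add_div]
      have := (one_le_div hκ).2 hκ1
      linarith
    calc 2 * (C₁ * (1 + K / κ)) * τ ^ 2 ≤ 2 * (C₁ * ((1 + K) / κ)) * τ ^ 2 := by gcongr
      _ = 2 * (C₁ * (1 + K)) * (τ ^ 2 / κ) := by ring
      _ ≤ _ := mul_le_mul_of_nonneg_right (le_add_of_nonneg_right (by positivity)) (by positivity)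
  · have hrτ : 0 ≤ r / τ := div_nonneg hr.1 hτ.le
    have hrτ1 : r / τ ≤ 1 := (div_le_one hτ).2 hr.2
    have h1 := gridH1_second_difference_le hm (h.regular_limit.hasDerivWithinAt_comp hab hFd hM)
      ((hC₁ T K ψs ψst hK h.regular_limit M hM).2) (by positivity) ht htr htτ hτ hr
    -- Only values of the forcing are compared, never time derivatives, so closeness of `ψ` and `ψs`
    -- is enough. The second difference of `δ` involves at most four values, each of order `ε²`.
    set δ : ℝ → ℕ → ℂ := fun t j => F (ψ t (grid a b M j)) - F (ψs t (grid a b M j)) with hδ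
    have hδb : ∀ t ∈ Icc 0 T, gridH1 a b M (δ t) ≤ C₂ * (K * ε ^ 2) := fun t ht =>
      (hC₂ M (fun j => ψ t (grid a b M j)) (fun j => ψs t (grid a b M j))
        (fun j hj => h.regular.norm_le t ht _ (grid_mem_Icc hab hM hj))
        (fun j hj => h.regular_limit.norm_le t ht _ (grid_mem_Icc hab hM hj))
        (h.regular_limit.gridH1_le M hM t ht) (by
          simp only [grid_zero, (h.regular.boundary t ht).1, (h.regular_limit.boundary t ht).1])).trans
        (mul_le_mul_of_nonneg_left (h.close M hM t ht) hC₂0)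
    have h2 := gridH1_sub_le (a := a) (b := b) (M := M) (δ (t + r)) (δ t)
    have h3 := gridH1_sub_le (a := a) (b := b) (M := M) (δ t) (δ (t - τ))
    have h4 := gridH1_sub_le (a := a) (b := b) (M := M) (fun j => δ (t + r) j - δ t j)
      (fun j => (r / τ) • (δ t j - δ (t - τ) j))
    rw [gridH1_smul, abs_of_nonneg hrτ] at h4
    have h5 := mul_le_of_le_one_left
      (gridH1_nonneg (a := a) (b := b) (M := M) (fun j => δ t j - δ (t - τ) j)) hrτ1
    have h6 := gridH1_add_le (a := a) (b := b) (M := M)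
      (fun j => F (ψs (t + r) (grid a b M j)) - F (ψs t (grid a b M j))
        - (r / τ) • (F (ψs t (grid a b M j)) - F (ψs (t - τ) (grid a b M j))))
      (fun j => δ (t + r) j - δ t j - (r / τ) • (δ t j - δ (t - τ) j))
    have h7 := hδb _ ht
    have h8 := hδb _ htr
    have h9 := hδb _ htτ
    calc _ = gridH1 a b M (fun j => F (ψs (t + r) (grid a b M j)) - F (ψs t (grid a b M j))
        - (r / τ) • (F (ψs t (grid a b M j)) - F (ψs (t - τ) (grid a b M j)))
        + (δ (t + r) j - δ t j - (r / τ) • (δ t j - δ (t - τ) j))) := by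
          refine gridH1_congr fun j _ => ?_
          simp only [hδ, Complex.real_smul]
          ring
      _ ≤ 2 * (C₁ * (1 + K)) * τ ^ 2 + 4 * (C₂ * K) * ε ^ 2 := by linarith
      _ ≤ _ := by
          have e1 : 0 ≤ 2 * (C₁ * (1 + K)) * ε ^ 2 := by positivity
          have e2 : 0 ≤ 4 * (C₂ * K) * τ ^ 2 := by positivity
          linarith

/-- In the first step the slope is a true derivative at time zero, and closeness of `ψ` to `ψs` says
nothing about velocities. The alternative to the Taylor bound is therefore only the order `τ` that
follows from a bounded derivative. -/
theorem exists_gridH1_first_difference_le (hab : a < b) {k : ℕ} (hk : 3 ≤ k) {F : ℂ → ℂ}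
    (hF : ContDiff ℝ k F) {K : ℝ} (hK : 0 ≤ K) : ∃ C : ℝ, 0 ≤ C ∧
      ∀ (m : ℕ) (B ε κ : ℝ) (ψ ψt ψs ψst : ℝ → ℝ → ℂ), 0 < κ → κ ≤ 1 →
      IsBoundedSolution a b T F m K B ε κ ψ ψt ψs ψst → ∀ M, 1 ≤ M → ∀ r τ : ℝ, r ∈ Icc 0 T →
      r ∈ Icc 0 τ →
      gridH1 a b M (fun j => F (ψ r (grid a b M j)) - F (ψ 0 (grid a b M j))
        - r • fderiv ℝ F (ψ 0 (grid a b M j)) (ψt 0 (grid a b M j)))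
        ≤ C * min (τ ^ 2 / κ) τ := by
  have hk2 : (2 : WithTop ℕ∞) ≤ (k : WithTop ℕ∞) := by exact_mod_cast (by omega : 2 ≤ k)
  have hFd : Differentiable ℝ F := (hF.of_le hk2).differentiable (by norm_num)
  obtain ⟨C₁, hC₁0, hC₁⟩ := exists_gridH1_fderiv_le hab hk hF K
  refine ⟨C₁ * (1 + K) + 2 * C₁, by positivity,
    fun m B ε κ ψ ψt ψs ψst hκ hκ1 h M hM r τ hrT hr => ?_⟩
  have hm := mesh_pos hab hM
  have h0 : (0 : ℝ) ∈ Icc 0 T := left_mem_Icc.2 (hrT.1.trans hrT.2)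
  have hτ : 0 ≤ τ := hr.1.trans hr.2
  obtain ⟨hb1, hb2⟩ := hC₁ T (K / κ) ψ ψt (by positivity) h.regular M hM
  have hd := h.regular.hasDerivWithinAt_comp hab hFd hM
  rw [mul_min_of_nonneg _ _ (by positivity)]
  refine le_min ?_ ?_
  · have h1 := gridH1_taylor_le hm hd hb2 (by positivity) h0 hrT
    simp only [sub_zero] at h1
    refine h1.trans ?_
    have h2 : 1 + K / κ ≤ (1 + K) / κ := by
      rw [add_div]
      have := (one_le_div hκ).2 hκ1
      linarith
    have h3 : r ^ 2 ≤ τ ^ 2 := pow_le_pow_left₀ hr.1 hr.2 2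
    calc C₁ * (1 + K / κ) * r ^ 2 ≤ C₁ * ((1 + K) / κ) * τ ^ 2 := by gcongr
      _ = C₁ * (1 + K) * (τ ^ 2 / κ) := by ring
      _ ≤ _ := mul_le_mul_of_nonneg_right (le_add_of_nonneg_right (by positivity)) (by positivity)
  · have h1 := gridH1_sub_le_of_hasDerivWithinAt (convex_Icc 0 T) hd hb1 hm h0 hrT
    rw [sub_zero, abs_of_nonneg hr.1] at h1
    have h2 := gridH1_sub_le (a := a) (b := b) (M := M)
      (fun j => F (ψ r (grid a b M j)) - F (ψ 0 (grid a b M j)))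
      (fun j => r • fderiv ℝ F (ψ 0 (grid a b M j)) (ψt 0 (grid a b M j)))
    rw [gridH1_smul, abs_of_nonneg hr.1] at h2
    have h3 := mul_le_mul_of_nonneg_left (hb1 0 h0) hr.1
    have h4 := mul_le_mul_of_nonneg_left hr.2 hC₁0
    have h5 : 0 ≤ C₁ * (1 + K) * τ := by positivity
    linarith

/-- The error of the discrete sine coefficients of a grid function. -/
noncomputable def coeffErr (a b : ℝ) (M s : ℕ) (u : ℝ → ℂ) (w : ℕ → ℂ) : ℝ :=
  l2 (Finset.Ioo 0 M) (fun l => mu a b l ^ s • (sineCoeff a b u l - dst M w l))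

theorem coeffErr_nonneg (M s : ℕ) (u : ℝ → ℂ) (w : ℕ → ℂ) : 0 ≤ coeffErr a b M s u w :=
  l2_nonneg _ _

theorem gridNorm_sub_le_coeffErr (hab : a < b) {M m s : ℕ} (hM : 1 ≤ M) (hm : 2 ≤ m) (hs : s ≤ 1)
    {u : ℝ → ℂ} (hu : ContinuousOn u (Icc a b)) (ha : u a = 0) (hb : u b = 0) {B : ℝ}
    (h : HsBound a b m (sineCoeff a b u) B) (w : ℕ → ℂ) :
    gridNorm a b M s (fun j => w j - u (grid a b M j))
      ≤ 2 * Real.pi * (mesh a b M ^ (m - s) * B) + coeffErr a b M s u w := by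
  refine le_trans (le_of_eq (l2_congr fun l _ => ?_)) ((l2_sub_le _ _ _).trans
    (add_le_add_left (l2_alias_le hab hM hm hs hu ha hb h) _))
  rw [dst_sub, ← smul_sub, sub_sub_sub_cancel_left]

variable {f : ℝ → ℝ}

theorem exists_gridNorm_nonlin_sub_le (hab : a < b) {k m : ℕ} (hk : 3 ≤ k) (hm : 2 ≤ m)
    (hf : ContDiffOn ℝ k f (Ici 0)) {K B R : ℝ} (hB : 0 ≤ B) (hR : √(b - a) * K ≤ R) :
    ∃ C : ℝ, 0 ≤ C ∧ ∀ (ε κ : ℝ) (ψ ψt ψs ψst : ℝ → ℝ → ℂ),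
      IsBoundedSolution a b T (nonlin f) m K B ε κ ψ ψt ψs ψst → ∀ M, 1 ≤ M → ∀ s ≤ 1, ∀ t ∈ Icc 0 T,
      ∀ w : ℕ → ℂ, w 0 = 0 → w M = 0 → (∀ j ≤ M, ‖w j‖ ≤ R) →
      gridNorm a b M s (fun j => nonlin f (ψ t (grid a b M j)) - nonlin f (w j))
        ≤ C * (mesh a b M ^ (m - s) + coeffErr a b M s (ψ t) w) := by
  have hk2 : (2 : WithTop ℕ∞) ≤ (k : WithTop ℕ∞) := by exact_mod_cast (by omega : 2 ≤ k)
  have hF := contDiff_nonlin hf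
  obtain ⟨C, hC0, hC⟩ := exists_gridNorm_comp_sub_le hab (hF.of_le hk2) R K
  have hπ := Real.pi_pos
  refine ⟨C * (2 * Real.pi * B + 1), by positivity,
    fun ε κ ψ ψt ψs ψst h M hM s hs t ht w h0 hwM hw => ?_⟩
  obtain ⟨hb0, hb1⟩ := h.regular.boundary t ht
  have h1 := hC M hM s hs w (fun j => ψ t (grid a b M j)) hw
    (fun j hj => (h.regular.norm_le t ht _ (grid_mem_Icc hab hM hj)).trans hR)
    (h.regular.gridH1_le M hM t ht) (by rw [grid_zero, hb0, h0]) (by rw [grid_last hM, hb1, hwM])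
  have h2 := gridNorm_sub_le_coeffErr hab hM hm hs (h.regular.continuousOn t ht) hb0 hb1
    (h.hsBound t ht) w
  have h3 : gridNorm a b M s (fun j => nonlin f (ψ t (grid a b M j)) - nonlin f (w j))
      = gridNorm a b M s (fun j => nonlin f (w j) - nonlin f (ψ t (grid a b M j))) :=
    l2_congr fun l _ => by rw [dst_sub, dst_sub, norm_smul, norm_smul, norm_sub_rev]
  have hmesh := (pow_pos (mesh_pos hab hM) (m - s)).le
  have he := coeffErr_nonneg (a := a) (b := b) M s (ψ t) w
  rw [h3]
  calc _ ≤ C * (2 * Real.pi * (mesh a b M ^ (m - s) * B) + coeffErr a b M s (ψ t) w) :=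
        h1.trans (mul_le_mul_of_nonneg_left h2 hC0)
    _ ≤ C * ((2 * Real.pi * B + 1) * (mesh a b M ^ (m - s) + coeffErr a b M s (ψ t) w)) := by
        refine mul_le_mul_of_nonneg_left ?_ hC0
        have : 0 ≤ 2 * Real.pi * B * coeffErr a b M s (ψ t) w := by positivity
        linarith
    _ = _ := by ring

/-- The error in the approximation of the forcing in a step of the scheme after the first one. -/
theorem exists_forcing_error_le (hab : a < b) {k m : ℕ} (hk : 3 ≤ k) (hm : 2 ≤ m)
    (hf : ContDiffOn ℝ k f (Ici 0)) {K B R : ℝ} (hK : 0 ≤ K) (hB : 0 ≤ B) (hR : √(b - a) * K ≤ R) :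
    ∃ C : ℝ, 0 ≤ C ∧ ∀ (ε κ τ : ℝ) (ψ ψt ψs ψst : ℝ → ℝ → ℂ) (ψ₀ ψ₁ : ℝ → ℂ) (Ψ : ℕ → ℕ → ℂ) (M : ℕ),
      0 < κ → κ ≤ 1 → IsBoundedSolution a b T (nonlin f) m K B ε κ ψ ψt ψs ψst → 1 ≤ M → 0 < τ →
      (∀ n, Ψ n 0 = 0 ∧ Ψ n M = 0) → ∀ s ≤ 1, ∀ n, (n + 1 + 1 : ℕ) * τ ≤ T →
      (∀ j ≤ M, ‖Ψ n j‖ ≤ R) → (∀ j ≤ M, ‖Ψ (n + 1) j‖ ≤ R) → ∀ r ∈ Icc 0 τ,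
      l2 (Finset.Ioo 0 M) (fun l => mu a b l ^ s •
        (sineCoeff a b (fun x => nonlin f (ψ ((n + 1 : ℕ) * τ + r) x)) l
          - dst M (fun i => nonlin f (Ψ (n + 1) i)) l
          - r * dst M (nonlinRate a b f τ M ψ₀ ψ₁ Ψ (n + 1)) l))
      ≤ C * (mesh a b M ^ (m - s) + min (τ ^ 2 / κ) (τ ^ 2 + ε ^ 2)
        + coeffErr a b M s (ψ ((n + 1 : ℕ) * τ)) (Ψ (n + 1)) + coeffErr a b M s (ψ (n * τ)) (Ψ n)) := by
  have hF := contDiff_nonlin hf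
  obtain ⟨C₁, hC₁0, hC₁⟩ := exists_gridH1_second_difference_le (T := T) hab hk hF hK
  obtain ⟨C₂, hC₂0, hC₂⟩ := exists_gridNorm_nonlin_sub_le (T := T) hab hk hm hf hB hR
  obtain ⟨c, hc0, hc⟩ := exists_gridNorm_le_gridH1 hab
  have hπ := Real.pi_pos
  refine ⟨2 * Real.pi * B + c * C₁ + 3 * C₂, by positivity,
    fun ε κ τ ψ ψt ψs ψst ψ₀ ψ₁ Ψ M hκ hκ1 h hM hτ hΨ s hs n hn hΨ0 hΨ1 r hr => ?_⟩
  set t : ℝ := (n + 1 : ℕ) * τ with htdef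
  have hnτ : (n : ℝ) * τ = t - τ := by rw [htdef]; push_cast; ring
  have hn2 : ((n + 1 + 1 : ℕ) : ℝ) * τ = t + τ := by rw [htdef]; push_cast; ring
  have hn0 : 0 ≤ (n : ℝ) * τ := by positivity
  rw [hn2] at hn
  rw [hnτ] at hn0 ⊢
  have ht : t ∈ Icc 0 T := ⟨by linarith, by linarith⟩
  have htτ : t - τ ∈ Icc 0 T := ⟨hn0, by linarith⟩
  have htr : t + r ∈ Icc 0 T := ⟨by linarith [hr.1], by linarith [hr.2]⟩
  have hrτ : 0 ≤ r / τ := div_nonneg hr.1 hτ.le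
  have hrτ1 : r / τ ≤ 1 := (div_le_one hτ).2 hr.2
  set Y : ℝ → ℕ → ℂ := fun t j => nonlin f (ψ t (grid a b M j)) with hY
  set G : ℕ → ℕ → ℂ := fun n j => nonlin f (Ψ n j) with hG
  have hYb : ∀ t ∈ Icc 0 T, Y t 0 = 0 ∧ Y t M = 0 := fun t ht => by
    simp only [hY, grid_zero, grid_last hM, (h.regular.boundary t ht).1, (h.regular.boundary t ht).2,
      nonlin_zero, and_self]
  set Λ := min (τ ^ 2 / κ) (τ ^ 2 + ε ^ 2) with hΛ
  have hΛ0 : 0 ≤ Λ := le_min (by positivity) (by positivity)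
  set η := mesh a b M ^ (m - s) with hη
  have hη0 : 0 ≤ η := (pow_pos (mesh_pos hab hM) _).le
  set e₁ := coeffErr a b M s (ψ t) (Ψ (n + 1)) with he₁
  set e₀ := coeffErr a b M s (ψ (t - τ)) (Ψ n) with he₀
  have he₁0 : 0 ≤ e₁ := coeffErr_nonneg _ _ _ _
  have he₀0 : 0 ≤ e₀ := coeffErr_nonneg _ _ _ _
  have hsecond : gridNorm a b M s (fun j => Y (t + r) j - Y t j - (r / τ) • (Y t j - Y (t - τ) j))
      ≤ c * (C₁ * Λ) := by
    refine (hc M hM s hs _ ?_ ?_).trans (mul_le_mul_of_nonneg_left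
      (hC₁ m B ε κ ψ ψt ψs ψst hκ hκ1 h M hM t r τ ht htr htτ hτ hr) hc0)
    · simp only [(hYb _ ht).1, (hYb _ htr).1, (hYb _ htτ).1, sub_self, smul_zero]
    · simp only [(hYb _ ht).2, (hYb _ htr).2, (hYb _ htτ).2, sub_self, smul_zero]
  have hd1 : gridNorm a b M s (fun j => Y t j - G (n + 1) j) ≤ C₂ * (η + e₁) :=
    hC₂ ε κ ψ ψt ψs ψst h M hM s hs t ht _ (hΨ _).1 (hΨ _).2 hΨ1
  have hd0 : gridNorm a b M s (fun j => Y (t - τ) j - G n j) ≤ C₂ * (η + e₀) :=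
    hC₂ ε κ ψ ψt ψs ψst h M hM s hs _ htτ _ (hΨ _).1 (hΨ _).2 hΨ0
  have hgrid : gridNorm a b M s (fun j => Y (t + r) j - G (n + 1) j
      - (r : ℂ) * nonlinRate a b f τ M ψ₀ ψ₁ Ψ (n + 1) j)
      ≤ c * (C₁ * Λ) + (C₂ * (η + e₁) + (C₂ * (η + e₁) + C₂ * (η + e₀))) := by
    have hτC : (τ : ℂ) ≠ 0 := by exact_mod_cast hτ.ne'
    -- The defect is the extrapolation error of the exact forcing plus the errors of the forcing at
    -- the two levels, the latter with weights bounded because `r/τ ≤ 1`; the division by `τ` in the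
    -- difference quotient does no harm.
    have e1 : (fun j => Y (t + r) j - G (n + 1) j
        - (r : ℂ) * nonlinRate a b f τ M ψ₀ ψ₁ Ψ (n + 1) j)
        = fun j => (Y (t + r) j - Y t j - (r / τ) • (Y t j - Y (t - τ) j))
          + ((Y t j - G (n + 1) j) + ((r / τ : ℝ) : ℂ) *
            ((Y t j - G (n + 1) j) - (Y (t - τ) j - G n j))) := by
      funext j
      simp only [nonlinRate, Complex.real_smul, hG]
      push_cast
      field_simp
      ring
    rw [e1]
    refine (gridNorm_add_le _ _ _).trans (add_le_add hsecond ((gridNorm_add_le _ _ _).trans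
      (add_le_add hd1 ?_)))
    rw [gridNorm_const_mul, Complex.norm_real, Real.norm_of_nonneg hrτ]
    exact (mul_le_of_le_one_left (gridNorm_nonneg _ _) hrτ1).trans
      ((gridNorm_sub_le _ _ _).trans (add_le_add hd1 hd0))
  have halias := l2_alias_le (s := s) hab hM hm hs
    (hF.continuous.comp_continuousOn (h.regular.continuousOn _ htr))
    (by simp [(h.regular.boundary _ htr).1, nonlin_zero])
    (by simp [(h.regular.boundary _ htr).2, nonlin_zero]) (h.hsBound_comp _ htr)
  calc l2 (Finset.Ioo 0 M) (fun l => mu a b l ^ s •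
        (sineCoeff a b (fun x => nonlin f (ψ (t + r) x)) l - dst M (G (n + 1)) l
          - r * dst M (nonlinRate a b f τ M ψ₀ ψ₁ Ψ (n + 1)) l))
      = l2 (Finset.Ioo 0 M) (fun l => mu a b l ^ s •
          (sineCoeff a b (fun x => nonlin f (ψ (t + r) x)) l - dst M (Y (t + r)) l)
          + mu a b l ^ s • dst M (fun j => Y (t + r) j - G (n + 1) j
            - (r : ℂ) * nonlinRate a b f τ M ψ₀ ψ₁ Ψ (n + 1) j) l) := by
        refine l2_congr fun l _ => ?_
        rw [← smul_add, dst_sub (fun j => Y (t + r) j - G (n + 1) j), dst_sub, dst_const_mul]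
        congr 2
        ring
    _ ≤ 2 * Real.pi * (η * B)
        + (c * (C₁ * Λ) + (C₂ * (η + e₁) + (C₂ * (η + e₁) + C₂ * (η + e₀)))) :=
        (l2_add_le _ _ _).trans (add_le_add halias hgrid)
    _ ≤ _ := by
        have p1 : 0 ≤ 2 * Real.pi * B * (Λ + e₁ + e₀) := by positivity
        have p2 : 0 ≤ c * C₁ * (η + e₁ + e₀) := by positivity
        have p3 : 0 ≤ C₂ * (3 * Λ + e₁ + 2 * e₀) := by positivity
        linarith

/-- The error in the approximation of the forcing in the first step of the scheme. -/
theorem exists_forcing_error_zero_le (hab : a < b) {k m : ℕ} (hk : 3 ≤ k) (hm : 2 ≤ m)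
    (hf : ContDiffOn ℝ k f (Ici 0)) {K B : ℝ} (hK : 0 ≤ K) (hB : 0 ≤ B) :
    ∃ C : ℝ, 0 ≤ C ∧ ∀ (ε κ τ : ℝ) (ψ ψt ψs ψst : ℝ → ℝ → ℂ) (ψ₀ ψ₁ : ℝ → ℂ) (Ψ : ℕ → ℕ → ℂ) (M : ℕ),
      0 < κ → κ ≤ 1 → IsBoundedSolution a b T (nonlin f) m K B ε κ ψ ψt ψs ψst → 1 ≤ M → 0 < τ →
      (∀ j ∈ Finset.Ioo 0 M, Ψ 0 j = ψ₀ (grid a b M j)) →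
      (∀ x ∈ Icc a b, ψ 0 x = ψ₀ x) → (∀ x ∈ Ioo a b, ψt 0 x = ψ₁ x) →
      ∀ s ≤ 1, τ ≤ T → ∀ r ∈ Icc 0 τ,
      l2 (Finset.Ioo 0 M) (fun l => mu a b l ^ s •
        (sineCoeff a b (fun x => nonlin f (ψ r x)) l - dst M (fun i => nonlin f (Ψ 0 i)) l
          - r * dst M (nonlinRate a b f τ M ψ₀ ψ₁ Ψ 0) l))
      ≤ C * (mesh a b M ^ (m - s) + min (τ ^ 2 / κ) τ) := by
  have hF := contDiff_nonlin hf
  obtain ⟨C₁, hC₁0, hC₁⟩ := exists_gridH1_first_difference_le (T := T) hab hk hF hK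
  obtain ⟨c, hc0, hc⟩ := exists_gridNorm_le_gridH1 hab
  have hπ := Real.pi_pos
  refine ⟨2 * Real.pi * B + c * C₁, by positivity,
    fun ε κ τ ψ ψt ψs ψst ψ₀ ψ₁ Ψ M hκ hκ1 h hM hτ hΨ hi hi' s hs hτT r hr => ?_⟩
  have hrT : r ∈ Icc 0 T := ⟨hr.1, hr.2.trans hτT⟩
  have h0 : (0 : ℝ) ∈ Icc 0 T := left_mem_Icc.2 (hτ.le.trans hτT)
  set Y : ℝ → ℕ → ℂ := fun t j => nonlin f (ψ t (grid a b M j)) with hY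
  set D : ℕ → ℂ := fun j => fderiv ℝ (nonlin f) (ψ 0 (grid a b M j)) (ψt 0 (grid a b M j)) with hD
  have hYb : ∀ t ∈ Icc 0 T, Y t 0 = 0 ∧ Y t M = 0 := fun t ht => by
    simp only [hY, grid_zero, grid_last hM, (h.regular.boundary t ht).1, (h.regular.boundary t ht).2,
      nonlin_zero, and_self]
  have hDb : D 0 = 0 ∧ D M = 0 := by
    simp only [hD, grid_zero, grid_last hM, (h.regular.boundary_deriv 0 h0).1,
      (h.regular.boundary_deriv 0 h0).2, map_zero, and_self]
  set Λ := min (τ ^ 2 / κ) τ with hΛ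
  have hΛ0 : 0 ≤ Λ := le_min (by positivity) hτ.le
  set η := mesh a b M ^ (m - s) with hη
  have hη0 : 0 ≤ η := (pow_pos (mesh_pos hab hM) _).le
  have hΦ : ∀ l, dst M (fun i => nonlin f (Ψ 0 i)) l = dst M (Y 0) l := dst_congr fun j hj => by
    simp only [hY, hΨ j hj, hi _ (Ioo_subset_Icc_self (grid_mem_Ioo hab hj))]
  -- The slope in the first step is the exact time derivative of the forcing, since the initial
  -- value and velocity are sampled without error.
  have hR : ∀ l, dst M (nonlinRate a b f τ M ψ₀ ψ₁ Ψ 0) l = dst M D l := dst_congr fun j hj => by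
    have hj' := grid_mem_Ioo hab hj
    simp only [hD, nonlinRate, hi _ (Ioo_subset_Icc_self hj'), hi' _ hj',
      nonlinDeriv_eq_fderiv (by omega : 1 ≤ k) hf]
  have hfirst : gridNorm a b M s (fun j => Y r j - Y 0 j - r • D j) ≤ c * (C₁ * Λ) := by
    refine (hc M hM s hs _ ?_ ?_).trans (mul_le_mul_of_nonneg_left
      (hC₁ m B ε κ ψ ψt ψs ψst hκ hκ1 h M hM r τ hrT hr) hc0)
    · simp only [(hYb _ h0).1, (hYb _ hrT).1, hDb.1, sub_self, smul_zero]
    · simp only [(hYb _ h0).2, (hYb _ hrT).2, hDb.2, sub_self, smul_zero]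
  simp_rw [Complex.real_smul] at hfirst
  have halias := l2_alias_le (s := s) hab hM hm hs
    (hF.continuous.comp_continuousOn (h.regular.continuousOn _ hrT))
    (by simp [(h.regular.boundary _ hrT).1, nonlin_zero])
    (by simp [(h.regular.boundary _ hrT).2, nonlin_zero]) (h.hsBound_comp _ hrT)
  calc _ = l2 (Finset.Ioo 0 M) (fun l => mu a b l ^ s •
          (sineCoeff a b (fun x => nonlin f (ψ r x)) l - dst M (Y r) l)
          + mu a b l ^ s • dst M (fun j => Y r j - Y 0 j - (r : ℂ) * D j) l) := by
        refine l2_congr fun l _ => ?_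
        rw [← smul_add, dst_sub (fun j => Y r j - Y 0 j), dst_sub, dst_const_mul, hΦ, hR]
        congr 2
        ring
    _ ≤ 2 * Real.pi * (η * B) + c * (C₁ * Λ) :=
        (l2_add_le _ _ _).trans (add_le_add halias hfirst)
    _ ≤ _ := by
        have p1 : 0 ≤ 2 * Real.pi * B * Λ := by positivity
        have p2 : 0 ≤ c * C₁ * η := by positivity
        linarith

end LocalError

/-! ### Stability and convergence of the scheme -/

section Convergence

variable {a b T : ℝ} {f : ℝ → ℝ}

/-- The weighted `ℓ²` distance between one of the two modes of the solution and its approximation. -/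
noncomputable def modeErr (a b : ℝ) (f : ℝ → ℝ) (ε τ : ℝ) (ψ ψt : ℝ → ℝ → ℂ) (ψ₀ ψ₁ : ℝ → ℂ)
    (Ψ : ℕ → ℕ → ℂ) (M s : ℕ) (β β' : ℝ → ℝ → ℝ) (n : ℕ) : ℝ :=
  l2 (Finset.Ioo 0 M) (fun l => mu a b l ^ s •
    (mode (β ε (mu a b l)) (β' ε (mu a b l)) (sineCoeff a b (ψ (n * τ)) l)
        (sineCoeff a b (ψt (n * τ)) l)
      - numMode ε τ (β ε (mu a b l)) (β' ε (mu a b l)) (dst M (Ψ 0) l)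
        (dst M (fun i => ψ₁ (grid a b M i)) l) (fun n => dst M (fun i => nonlin f (Ψ n i)) l)
        (fun n => dst M (nonlinRate a b f τ M ψ₀ ψ₁ Ψ n) l) n))

theorem coeffErr_le_modeErr {ε τ : ℝ} {M : ℕ} {ψ₀ ψ₁ : ℝ → ℂ} {Ψ : ℕ → ℕ → ℂ} (hε : 0 < ε)
    (h : IsEWISP a b f ε τ M ψ₀ ψ₁ Ψ) (ψ ψt : ℝ → ℝ → ℂ) (s n : ℕ) :
    coeffErr a b M s (ψ (n * τ)) (Ψ n)
      ≤ modeErr a b f ε τ ψ ψt ψ₀ ψ₁ Ψ M s betaPlus betaMinus n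
        + modeErr a b f ε τ ψ ψt ψ₀ ψ₁ Ψ M s betaMinus betaPlus n := by
  refine le_trans (le_of_eq ?_) (l2_add_le _ _ _)
  refine l2_congr fun l hl => ?_
  rw [h.dst_eq hε hl n, ← smul_add]
  have e := mode_add_mode (isRootPair_plus hε (mu a b l)).sub_ne (sineCoeff a b (ψ (n * τ)) l)
    (sineCoeff a b (ψt (n * τ)) l)
  nth_rewrite 1 [← e]
  congr 2
  ring

/-- The initial value and velocity agree with the solution at the grid points, so the starting error
is the aliasing error of these two functions. -/
theorem modeErr_zero_le (hab : a < b) {m M s : ℕ} (hM : 1 ≤ M) (hm : 2 ≤ m) (hs : s ≤ 1) (hT : 0 ≤ T)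
    {F : ℂ → ℂ} {K B ε κ τ : ℝ} (hε : 0 < ε) (hε1 : ε ≤ 1) {ψ ψt ψs ψst : ℝ → ℝ → ℂ}
    (h : IsBoundedSolution a b T F m K B ε κ ψ ψt ψs ψst) {ψ₀ ψ₁ : ℝ → ℂ} {Ψ : ℕ → ℕ → ℂ}
    (hΨ : ∀ j ∈ Finset.Ioo 0 M, Ψ 0 j = ψ₀ (grid a b M j))
    (hi : ∀ x ∈ Icc a b, ψ 0 x = ψ₀ x) (hi' : ∀ x ∈ Ioo a b, ψt 0 x = ψ₁ x)
    {β β' : ℝ → ℝ → ℝ} (hβ : ∀ μ, IsRootPair ε μ (β ε μ) (β' ε μ)) :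
    modeErr a b f ε τ ψ ψt ψ₀ ψ₁ Ψ M s β β' 0 ≤ 4 * Real.pi * B * mesh a b M ^ (m - s) := by
  have h0 : (0 : ℝ) ∈ Icc 0 T := left_mem_Icc.2 hT
  have hΦ : ∀ l, dst M (Ψ 0) l = dst M (fun j => ψ 0 (grid a b M j)) l := dst_congr fun j hj => by
    simp only [hΨ j hj, hi _ (Ioo_subset_Icc_self (grid_mem_Ioo hab hj))]
  have hR : ∀ l, dst M (fun j => ψ₁ (grid a b M j)) l = dst M (fun j => ψt 0 (grid a b M j)) l :=
    dst_congr fun j hj => by simp only [hi' _ (grid_mem_Ioo hab hj)]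
  have a1 := l2_alias_le (s := s) hab hM hm hs (h.regular.continuousOn 0 h0)
    (h.regular.boundary 0 h0).1 (h.regular.boundary 0 h0).2 (h.hsBound 0 h0)
  have a2 := l2_alias_le (s := s) hab hM hm hs h.continuousOn_velocity
    (h.regular.boundary_deriv 0 h0).1 (h.regular.boundary_deriv 0 h0).2 h.hsBound_velocity
  calc modeErr a b f ε τ ψ ψt ψ₀ ψ₁ Ψ M s β β' 0
      ≤ l2 (Finset.Ioo 0 M) (fun l =>
          ‖mu a b l ^ s • (sineCoeff a b (ψ 0) l - dst M (fun j => ψ 0 (grid a b M j)) l)‖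
          + ‖mu a b l ^ s • (sineCoeff a b (ψt 0) l - dst M (fun j => ψt 0 (grid a b M j)) l)‖) := by
        refine l2_mono fun l _ => ?_
        refine le_trans ?_ (Real.le_norm_self _)
        simp only [numMode, Nat.cast_zero, zero_mul, mode_sub, hΦ, hR, norm_smul, ← mul_add]
        exact mul_le_mul_of_nonneg_left ((hβ _).norm_mode_le hε hε1 _ _) (norm_nonneg _)
    _ ≤ 2 * Real.pi * (mesh a b M ^ (m - s) * B) + 2 * Real.pi * (mesh a b M ^ (m - s) * B) :=
        (l2_add_le _ _ _).trans (add_le_add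
          ((l2_congr fun l _ => norm_norm _).trans_le a1) ((l2_congr fun l _ => norm_norm _).trans_le a2))
    _ = _ := by ring

theorem modeErr_succ_le (hab : a < b) {m M s n : ℕ} {K B ε κ τ R : ℝ} (hε : 0 < ε) (hτ : 0 ≤ τ)
    {ψ ψt ψs ψst : ℝ → ℝ → ℂ}
    (h : IsBoundedSolution a b T (nonlin f) m K B ε κ ψ ψt ψs ψst) {ψ₀ ψ₁ : ℝ → ℂ} {Ψ : ℕ → ℕ → ℂ}
    {β β' : ℝ → ℝ → ℝ} (hβ : ∀ μ, IsRootPair ε μ (β ε μ) (β' ε μ)) (hn : (n + 1 : ℕ) * τ ≤ T)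
    (hR : ∀ r ∈ Icc 0 τ, l2 (Finset.Ioo 0 M) (fun l => mu a b l ^ s •
      (sineCoeff a b (fun x => nonlin f (ψ (n * τ + r) x)) l - dst M (fun i => nonlin f (Ψ n i)) l
        - r * dst M (nonlinRate a b f τ M ψ₀ ψ₁ Ψ n) l)) ≤ R) :
    modeErr a b f ε τ ψ ψt ψ₀ ψ₁ Ψ M s β β' (n + 1)
      ≤ modeErr a b f ε τ ψ ψt ψ₀ ψ₁ Ψ M s β β' n + τ * R :=
  h.modal.l2_mode_sub_numMode_succ_le hab hε hτ (β := fun l => β ε (mu a b l))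
    (β' := fun l => β' ε (mu a b l)) (fun _ _ => hβ _) (P := fun l => dst M (Ψ 0) l)
    (Q := fun l => dst M (fun i => ψ₁ (grid a b M i)) l)
    (Φ := fun n => dst M (fun i => nonlin f (Ψ n i)))
    (D := fun n => dst M (nonlinRate a b f τ M ψ₀ ψ₁ Ψ n)) hn hR

/-- If `τ ≤ κ` the first entry is at most `τ`; otherwise `ε² ≤ κ ≤ τ` makes the second at most `2τ`.
Thus a small `τ` makes the temporal error small independently of `ε`, as the maximum norm bound
requires. -/
theorem min_le_two_mul {ε κ τ : ℝ} (hκ : 0 < κ) (hεκ : ε ^ 2 ≤ κ) (hτ : 0 < τ) (hτ1 : τ ≤ 1) :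
    min (τ ^ 2 / κ) (τ ^ 2 + ε ^ 2) ≤ 2 * τ := by
  rcases le_total τ κ with h | h
  · refine (min_le_left _ _).trans ((div_le_iff₀ hκ).2 ?_)
    nlinarith
  · exact (min_le_right _ _).trans (by nlinarith)

/-- The defect of the first step enters with a factor `τ` and is not summed over the steps, which
raises it to the order of the accumulated error of the later ones. -/
theorem mul_min_le {ε κ τ : ℝ} (hκ : 0 < κ) (hτ : 0 < τ) (hτ1 : τ ≤ 1) :
    τ * min (τ ^ 2 / κ) τ ≤ min (τ ^ 2 / κ) (τ ^ 2 + ε ^ 2) := by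
  refine le_min ?_ ?_
  · exact (mul_le_of_le_one_left (le_min (by positivity) hτ.le) hτ1).trans (min_le_left _ _)
  · calc τ * min (τ ^ 2 / κ) τ ≤ τ * τ := mul_le_mul_of_nonneg_left (min_le_right _ _) hτ.le
      _ ≤ τ ^ 2 + ε ^ 2 := by nlinarith [sq_nonneg ε]

/-- The error of the scheme, for a solution with given bounds. -/
theorem exists_convergence (hab : a < b) (hT : 0 < T) {k m : ℕ} (hk : 3 ≤ k) (hm : 2 ≤ m)
    (hf : ContDiffOn ℝ k f (Ici 0)) {K B : ℝ} (hK : 0 ≤ K) (hB : 0 ≤ B) :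
    ∃ C δ : ℝ, 0 ≤ C ∧ 0 < δ ∧ δ ≤ 1 ∧ ∀ (ε κ τ : ℝ) (ψ ψt ψs ψst : ℝ → ℝ → ℂ) (ψ₀ ψ₁ : ℝ → ℂ)
      (Ψ : ℕ → ℕ → ℂ) (M : ℕ), ε ∈ Ioc (0 : ℝ) 1 → ε ^ 2 ≤ κ → κ ≤ 1 →
      IsBoundedSolution a b T (nonlin f) m K B ε κ ψ ψt ψs ψst → IsEWISP a b f ε τ M ψ₀ ψ₁ Ψ →
      (∀ x ∈ Icc a b, ψ 0 x = ψ₀ x) → (∀ x ∈ Ioo a b, ψt 0 x = ψ₁ x) →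
      1 ≤ M → mesh a b M ≤ δ → 0 < τ → τ ≤ δ → ∀ n : ℕ, n * τ ≤ T →
      (∀ s ≤ 1, coeffErr a b M s (ψ (n * τ)) (Ψ n)
        ≤ C * (mesh a b M ^ (m - s) + min (τ ^ 2 / κ) (τ ^ 2 + ε ^ 2))) ∧
      ∀ j ≤ M, ‖Ψ n j - ψ (n * τ) (grid a b M j)‖ ≤ 1 := by
  obtain ⟨C₁, hC₁0, hC₁⟩ := exists_forcing_error_le (T := T) hab hk hm hf hK hB
    (R := √(b - a) * K + 1) (by linarith)
  obtain ⟨C₂, hC₂0, hC₂⟩ := exists_forcing_error_zero_le (T := T) hab hk hm hf hK hB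
  have hπ := Real.pi_pos
  -- `1` stands for `X s` itself, `8πB` for the initial aliasing errors of the two modes, and the
  -- multiple of `C₂` leaves room for the first step.
  set D : ℝ := 1 + 8 * Real.pi * B + 4 * C₂ with hD
  have hD0 : 0 ≤ D := by positivity
  set C : ℝ := D * Real.exp (4 * C₁ * T) with hC
  have hC0 : 0 ≤ C := by positivity
  set S : ℝ := √(b - a) * (√((b - a) / 2) * (2 * Real.pi * B + C)) with hS
  have hS0 : 0 ≤ S := by positivity
  -- `S` converts `X 1` into a maximum norm. With `h ≤ δ` and the temporal part at most `2τ ≤ 2δ`,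
  -- one gets `X 1 ≤ 3/(3S + 1)`, hence a maximum error at most one.
  refine ⟨C, min 1 (1 / (3 * S + 1)), hC0, by positivity, min_le_left _ _,
    fun ε κ τ ψ ψt ψs ψst ψ₀ ψ₁ Ψ M hε hεκ hκ1 h hE hi hi' hM hh hτ hτδ => ?_⟩
  have hκ : 0 < κ := lt_of_lt_of_le (by have := hε.1; positivity) hεκ
  have hτ1 : τ ≤ 1 := hτδ.trans (min_le_left _ _)
  have hm0 := mesh_pos hab hM
  set Λ := min (τ ^ 2 / κ) (τ ^ 2 + ε ^ 2) with hΛ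
  have hΛ0 : 0 ≤ Λ := le_min (by positivity) (by positivity)
  have hΛτ : Λ ≤ 2 * τ := min_le_two_mul hκ hεκ hτ hτ1
  set X : ℕ → ℝ := fun s => mesh a b M ^ (m - s) + Λ with hX
  have hη0 : ∀ s, 0 ≤ mesh a b M ^ (m - s) := fun s => (pow_pos hm0 _).le
  have hX0 : ∀ s, 0 ≤ X s := fun s => add_nonneg (hη0 s) hΛ0
  set e : ℕ → ℕ → ℝ := fun s n => modeErr a b f ε τ ψ ψt ψ₀ ψ₁ Ψ M s betaPlus betaMinus n
    + modeErr a b f ε τ ψ ψt ψ₀ ψ₁ Ψ M s betaMinus betaPlus n with he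
  have hce : ∀ s n : ℕ, coeffErr a b M s (ψ (n * τ)) (Ψ n) ≤ e s n :=
    fun s n => coeffErr_le_modeErr hε.1 hE ψ ψt s n
  set g : ℝ := 1 + 4 * C₁ * τ with hg
  have hg1 : 1 ≤ g := le_add_of_nonneg_right (by positivity)
  have htime : ∀ n : ℕ, n * τ ≤ T → (n * τ : ℝ) ∈ Icc 0 T := fun n hn => ⟨by positivity, hn⟩
  have hcoeff : ∀ n : ℕ, n * τ ≤ T → (∀ s ≤ 1, X s + e s n ≤ D * X s * g ^ n) →
      ∀ s ≤ 1, coeffErr a b M s (ψ (n * τ)) (Ψ n) ≤ C * X s := by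
    intro n hn hq s hs
    have h1 : g ^ n ≤ Real.exp (4 * C₁ * T) := by
      calc g ^ n ≤ Real.exp (4 * C₁ * τ) ^ n :=
            pow_le_pow_left₀ (by linarith) (by
              have := Real.add_one_le_exp (4 * C₁ * τ)
              linarith) n
        _ = Real.exp (4 * C₁ * (n * τ)) := by rw [← Real.exp_nat_mul]; congr 1; ring
        _ ≤ _ := Real.exp_le_exp.2 (mul_le_mul_of_nonneg_left hn (by positivity))
    calc coeffErr a b M s (ψ (n * τ)) (Ψ n) ≤ X s + e s n := by linarith [hce s n, hX0 s]
      _ ≤ D * X s * g ^ n := hq s hs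
      _ ≤ D * X s * Real.exp (4 * C₁ * T) :=
        mul_le_mul_of_nonneg_left h1 (mul_nonneg hD0 (hX0 s))
      _ = C * X s := by rw [hC]; ring
  -- The maximum norm bound follows from the `H¹` estimate at the same time level, with constants
  -- that do not deteriorate with `n`; this lets the induction proceed without an inverse inequality
  -- coupling `τ` and `h`.
  have hsup : ∀ n : ℕ, n * τ ≤ T → (∀ s ≤ 1, X s + e s n ≤ D * X s * g ^ n) →
      ∀ j ≤ M, ‖Ψ n j - ψ (n * τ) (grid a b M j)‖ ≤ 1 := by
    intro n hn hq j hj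
    have ht := htime n hn
    have hb0 : Ψ n 0 - ψ (n * τ) (grid a b M 0) = 0 := by
      rw [grid_zero, (h.regular.boundary _ ht).1, (hE.boundary n).1, sub_zero]
    have hb1 : Ψ n M - ψ (n * τ) (grid a b M M) = 0 := by
      rw [grid_last hM, (h.regular.boundary _ ht).2, (hE.boundary n).2, sub_zero]
    have h1 := gridNorm_sub_le_coeffErr (s := 1) hab hM hm le_rfl (h.regular.continuousOn _ ht)
      (h.regular.boundary _ ht).1 (h.regular.boundary _ ht).2 (h.hsBound _ ht) (Ψ n)
    have h2 : gridNorm a b M 1 (fun j => Ψ n j - ψ (n * τ) (grid a b M j))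
        ≤ (2 * Real.pi * B + C) * X 1 := by
      have h3 := hcoeff n hn hq 1 le_rfl
      have h4 : 0 ≤ 2 * Real.pi * B * Λ := by positivity
      simp only [hX] at h3 ⊢
      linarith
    have h5 : X 1 ≤ 3 / (3 * S + 1) := by
      have h6 : mesh a b M ^ (m - 1) ≤ mesh a b M :=
        pow_le_of_le_one hm0.le (hh.trans (min_le_left _ _)) (by omega)
      have h7 := hh.trans (min_le_right _ _)
      have h8 := hτδ.trans (min_le_right _ _)
      have h9 : 3 / (3 * S + 1) = 1 / (3 * S + 1) + 2 * (1 / (3 * S + 1)) := by ring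
      simp only [hX]
      linarith
    calc ‖Ψ n j - ψ (n * τ) (grid a b M j)‖
        ≤ √(b - a) * gridH1 a b M (fun j => Ψ n j - ψ (n * τ) (grid a b M j)) :=
          norm_le_gridH1 hab (w := fun j => Ψ n j - ψ (n * τ) (grid a b M j)) hb0 hj
      _ ≤ √(b - a) * (√((b - a) / 2) * ((2 * Real.pi * B + C) * X 1)) := by
          gcongr
          exact (gridH1_le_gridNorm hab hM _ hb0 hb1).trans (by gcongr)
      _ = S * X 1 := by rw [hS]; ring
      _ ≤ S * (3 / (3 * S + 1)) := by gcongr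
      _ ≤ 1 := by
          rw [mul_div_assoc', div_le_one (by positivity)]
          linarith
  have hbound : ∀ n : ℕ, n * τ ≤ T → (∀ s ≤ 1, X s + e s n ≤ D * X s * g ^ n) →
      ∀ j ≤ M, ‖Ψ n j‖ ≤ √(b - a) * K + 1 := by
    intro n hn hq j hj
    have h1 := hsup n hn hq j hj
    have h2 := h.regular.norm_le _ (htime n hn) _ (grid_mem_Icc hab hM hj)
    linarith [norm_le_norm_sub_add (Ψ n j) (ψ (n * τ) (grid a b M j))]
  have hstep : ∀ s n : ℕ, ∀ R, (n + 1 : ℕ) * τ ≤ T →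
      (∀ r ∈ Icc 0 τ, l2 (Finset.Ioo 0 M) (fun l => mu a b l ^ s •
        (sineCoeff a b (fun x => nonlin f (ψ (n * τ + r) x)) l - dst M (fun i => nonlin f (Ψ n i)) l
          - r * dst M (nonlinRate a b f τ M ψ₀ ψ₁ Ψ n) l)) ≤ R) → e s (n + 1) ≤ e s n + 2 * (τ * R) := by
    intro s n R hn hR
    have h1 := modeErr_succ_le hab hε.1 hτ.le h (isRootPair_plus hε.1) hn hR
    have h2 := modeErr_succ_le hab hε.1 hτ.le h (isRootPair_minus hε.1) hn hR
    simp only [he]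
    linarith
  have hzero : ∀ s ≤ 1, e s 0 ≤ 8 * Real.pi * B * mesh a b M ^ (m - s) := by
    intro s hs
    have h1 := modeErr_zero_le (f := f) (τ := τ) hab hM hm hs hT.le hε.1 hε.2 h hE.init hi hi'
      (isRootPair_plus hε.1)
    have h2 := modeErr_zero_le (f := f) (τ := τ) hab hM hm hs hT.le hε.1 hε.2 h hE.init hi hi'
      (isRootPair_minus hε.1)
    simp only [he]
    linarith
  have hmono : ∀ n : ℕ, (n + 1 : ℕ) * τ ≤ T → (n : ℝ) * τ ≤ T := fun n hn => by
    push_cast at hn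
    linarith
  have hone : τ ≤ T → ∀ s ≤ 1, X s + e s 1 ≤ D * X s := by
    intro hτT s hs
    have h1 := hstep s 0 (C₂ * (mesh a b M ^ (m - s) + min (τ ^ 2 / κ) τ)) (by simpa using hτT)
      (fun r hr => by
        simpa using hC₂ ε κ τ ψ ψt ψs ψst ψ₀ ψ₁ Ψ M hκ hκ1 h hM hτ hE.init hi hi' s hs hτT r hr)
    have h2 : τ * (C₂ * (mesh a b M ^ (m - s) + min (τ ^ 2 / κ) τ)) ≤ C₂ * X s := by
      calc _ = C₂ * (τ * mesh a b M ^ (m - s) + τ * min (τ ^ 2 / κ) τ) := by ring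
        _ ≤ C₂ * X s := by
          refine mul_le_mul_of_nonneg_left (add_le_add ?_ (mul_min_le hκ hτ hτ1)) hC₂0
          exact mul_le_of_le_one_left (hη0 s) hτ1
    have h3 := hzero s hs
    have h4 : 0 ≤ 8 * Real.pi * B * Λ := by positivity
    have h5 := mul_nonneg hC₂0 (hX0 s)
    simp only [hD, hX] at *
    linarith
  -- Two consecutive levels are carried along, because the defect of a step involves the errors at
  -- both of the preceding levels.
  have hmain : ∀ n : ℕ, (n * τ ≤ T → ∀ s ≤ 1, X s + e s n ≤ D * X s * g ^ n) ∧
      ((n + 1 : ℕ) * τ ≤ T → ∀ s ≤ 1, X s + e s (n + 1) ≤ D * X s * g ^ (n + 1)) := by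
    intro n
    induction n with
    | zero =>
      refine ⟨fun _ s hs => ?_, fun hn s hs => ?_⟩
      · have h3 := hzero s hs
        have h4 : 0 ≤ 8 * Real.pi * B * Λ := by positivity
        have h5 := mul_nonneg hC₂0 (hX0 s)
        simp only [pow_zero, mul_one, hD, hX] at *
        linarith
      · refine (hone (by simpa using hn) s hs).trans ?_
        rw [zero_add, pow_one]
        exact le_mul_of_one_le_right (mul_nonneg hD0 (hX0 s)) hg1
    | succ n ih =>
      refine ⟨ih.2, fun hn s hs => ?_⟩
      have hn1 := hmono _ hn
      have hn0 := hmono _ hn1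
      have h1 := hstep s (n + 1) _ hn (hC₁ ε κ τ ψ ψt ψs ψst ψ₀ ψ₁ Ψ M hκ hκ1 h hM hτ hE.boundary s hs n hn
        (hbound n hn0 (ih.1 hn0)) (hbound (n + 1) hn1 (ih.2 hn1)))
      have h2 := ih.1 hn0 s hs
      have h3 := ih.2 hn1 s hs
      have h4 := hce s n
      have h5 := hce s (n + 1)
      have hDX := mul_nonneg hD0 (hX0 s)
      have h6 : D * X s * g ^ n ≤ D * X s * g ^ (n + 1) :=
        mul_le_mul_of_nonneg_left (pow_le_pow_right₀ hg1 (Nat.le_succ n)) hDX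
      have h7 : mesh a b M ^ (m - s) + Λ + coeffErr a b M s (ψ ((n + 1 : ℕ) * τ)) (Ψ (n + 1))
          + coeffErr a b M s (ψ (n * τ)) (Ψ n) ≤ 2 * (D * X s * g ^ (n + 1)) := by
        have := hX0 s
        simp only [hX] at h2 h3 h6 this ⊢
        linarith
      -- Two modes and two time levels give the growth factor `1 + 4 C₁ τ`, which is `g`.
      calc X s + e s (n + 1 + 1)
          ≤ (X s + e s (n + 1)) + 2 * (τ * (C₁ * (mesh a b M ^ (m - s) + Λ
            + coeffErr a b M s (ψ ((n + 1 : ℕ) * τ)) (Ψ (n + 1))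
            + coeffErr a b M s (ψ (n * τ)) (Ψ n)))) := by linarith
        _ ≤ D * X s * g ^ (n + 1) + 2 * (τ * (C₁ * (2 * (D * X s * g ^ (n + 1))))) := by gcongr
        _ = D * X s * g ^ (n + 1 + 1) := by rw [pow_succ g (n + 1), hg]; ring
  exact fun n hn => ⟨hcoeff n hn ((hmain n).1 hn), hsup n hn ((hmain n).1 hn)⟩

end Convergence

/-! ### Uniform bounds on the solutions -/

section UniformBounds

variable {a b T : ℝ} {f : ℝ → ℝ}

theorem timeSup_le_of_add {N N' : ℝ → ENNReal} {X : ENNReal} (h : timeSup T (fun t => N t + N' t) ≤ X) :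
    timeSup T N' ≤ X :=
  (essSup_mono_ae (Filter.Eventually.of_forall fun _ => le_add_self)).trans h

theorem rpow_le_one_of_mem {ε α : ℝ} (hε : ε ∈ Ioc (0 : ℝ) 1) (hα : α < 2) : ε ^ (2 - α) ≤ 1 :=
  Real.rpow_le_one hε.1.le hε.2 (by linarith)

theorem sq_le_rpow {ε α : ℝ} (hε : ε ∈ Ioc (0 : ℝ) 1) (hα : 0 ≤ α) : ε ^ 2 ≤ ε ^ (2 - α) := by
  rw [← Real.rpow_natCast]
  exact Real.rpow_le_rpow_of_exponent_ge hε.1 hε.2 (by push_cast; linarith)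

/-- The assumptions give bounds on the solutions that are uniform in `ε`. -/
theorem exists_isBoundedSolution (hab : a < b) {k : ℕ} (hk : 3 ≤ k) (hf : ContDiffOn ℝ k f (Ici 0))
    {m₀ : ℕ} (hm₀ : 2 ≤ m₀) {α : ℝ} (hα₀ : 0 ≤ α) (hα₂ : α < 2) (hT : 0 < T) {ψ₀ : ℝ → ℂ}
    {ω : ℝ → ℝ → ℂ} {ψ ψt ψtt : ℝ → ℝ → ℝ → ℂ} {ψs ψst ψstt : ℝ → ℝ → ℂ}
    (hψ : ∀ ε ∈ Ioc (0 : ℝ) 1,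
      IsNLSWSolution a b T f ε ψ₀ (initVelocity f α ε ψ₀ (ω ε)) (ψ ε) (ψt ε) (ψtt ε))
    (hψs : IsNLSSolution a b T f ψ₀ ψs ψst) (hψstt : IsTimeDeriv a b T ψst ψstt)
    (hA : AssumptionA a b m₀ ψ₀ ω) (hB : AssumptionB a b T α m₀ ψ ψt ψtt ψs ψst ψstt) :
    ∃ K B : ℝ, 0 ≤ K ∧ 0 ≤ B ∧ ∀ ε ∈ Ioc (0 : ℝ) 1, IsBoundedSolution a b T (nonlin f) (min m₀ k) K B ε
      (ε ^ (2 - α)) (ψ ε) (ψt ε) ψs ψst := by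
  obtain ⟨C₁, h₁⟩ := hB.bounds
  obtain ⟨C₂, h₂, h₂', h₂''⟩ := hB.bounds_limit
  rw [min_eq_left hα₂.le] at h₁
  have hm1 : 1 ≤ m₀ := by omega
  set m := min m₀ k with hm
  have hm2 : 2 ≤ m := le_min hm₀ (by omega)
  have hfm : ContDiffOn ℝ m f (Ici 0) := hf.of_le (by exact_mod_cast min_le_right m₀ k)
  have hF : ContDiff ℝ m (nonlin f) := contDiff_nonlin hfm
  -- `K` strictly exceeds both constants, as is required for selecting weak derivatives out of the
  -- infimum in the norms.
  set K : ℝ := |C₁| + |C₂| + 1 with hK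
  have hK0 : 0 < K := by positivity
  have hC₁ : C₁ < K := by linarith [le_abs_self C₁, abs_nonneg C₂]
  have hC₂ : C₂ < K := by linarith [le_abs_self C₂, abs_nonneg C₁]
  have hκ0 : ∀ ε ∈ Ioc (0 : ℝ) 1, 0 < ε ^ (2 - α) := fun ε hε => Real.rpow_pos_of_pos hε.1 _
  have hcont : ∀ {u : ℝ → ℝ → ℂ}, (∀ t ∈ Icc 0 T, ContinuousOn (u t) (Icc a b)) →
      ∀ᵐ t ∂volume.restrict (Icc 0 T), ContinuousOn (u t) (Icc a b) := fun hu =>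
    (ae_restrict_mem measurableSet_Icc).mono hu
  have hs : IsRegular a b T K K ψs ψst :=
    isRegular_of_isTimeDeriv hab hT hK0.le hK0.le hψs.continuousOn hψs.boundary hψs.timeDeriv hψstt
      (ae_isH1_of_timeSup_le hab hm1 (timeSup_le_of_add h₂) hC₂ hK0 (hcont hψs.continuousOn))
      (ae_isH1_of_timeSup_le hab le_rfl h₂' hC₂ hK0 hψs.timeDeriv.continuousOn)
      (ae_isH1_of_timeSup_le hab le_rfl h₂'' hC₂ hK0 hψstt.continuousOn)
  have htt : ∀ ε ∈ Ioc (0 : ℝ) 1,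
      ∀ᵐ t ∂volume.restrict (Icc 0 T), IsH1 a b (ψtt ε t) (K / ε ^ (2 - α)) := fun ε hε =>
    ae_isH1_of_timeSup_le hab le_rfl (h₁ ε hε).2.2.1 (div_lt_div_of_pos_right hC₁ (hκ0 ε hε))
      (div_pos hK0 (hκ0 ε hε)) (hψ ε hε).timeDeriv_two.continuousOn
  have hreg : ∀ ε ∈ Ioc (0 : ℝ) 1, IsRegular a b T K (K / ε ^ (2 - α)) (ψ ε) (ψt ε) := fun ε hε =>
    isRegular_of_isTimeDeriv hab hT hK0.le (div_pos hK0 (hκ0 ε hε)).le (hψ ε hε).continuousOn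
      (hψ ε hε).boundary (hψ ε hε).timeDeriv (hψ ε hε).timeDeriv_two
      (ae_isH1_of_timeSup_le hab hm1 (timeSup_le_of_add (h₁ ε hε).1) hC₁ hK0
        (hcont (hψ ε hε).continuousOn))
      (ae_isH1_of_timeSup_le hab le_rfl (h₁ ε hε).2.1 hC₁ hK0 (hcont (hψ ε hε).continuousOn_deriv))
      (htt ε hε)
  have hmodal : ∀ ε ∈ Ioc (0 : ℝ) 1, IsModalSolution a b T ε (fun t => sineCoeff a b (ψ ε t))
      (fun t => sineCoeff a b (ψt ε t)) (fun t => sineCoeff a b (fun x => nonlin f (ψ ε t x))) := by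
    intro ε hε
    have hweak : ∀ᵐ t ∂volume.restrict (Icc 0 T), ∃ v, IsWeakDeriv a b 1 (ψ ε t) v ∧
        IntegrableOn v (Ioo a b) := by
      filter_upwards [ae_of_timeSup_le (timeSup_le_of_add (h₁ ε hε).1)] with t ht
      obtain ⟨v, hv, hv2, _⟩ := exists_isWeakDeriv_of_semiNorm_lt (K := ⊤)
        (((semiNorm_le_sobolevNorm hm1 _).trans ht).trans_lt ENNReal.ofReal_lt_top)
      exact ⟨v, hv, hv2.integrable (by norm_num)⟩
    have h := fun l t ht => hasDerivWithinAt_sineCoeff hab hT (div_pos hK0 (hκ0 ε hε)).le hk hf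
      hε.1.ne' (hψ ε hε) (hreg ε hε) hweak (htt ε hε) l (t := t) ht
    exact ⟨fun l t ht => (h l t ht).1, fun l t ht => (h l t ht).2⟩
  obtain ⟨R, hR, hR'⟩ := exists_hsBound_initVelocity hab hm2 (min_le_left _ _) hfm hα₀ hA
  obtain ⟨B₁, hB₁⟩ := exists_hsBound_solution hab hT (by omega : 1 ≤ m) hF (nonlin_neg f) R
    (√(2 / (b - a)) * K)
  have hsol : ∀ ε ∈ Ioc (0 : ℝ) 1, ∀ t ∈ Icc 0 T, HsBound a b m (sineCoeff a b (ψ ε t)) B₁ := by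
    intro ε hε
    refine hB₁ ε hε _ _ (hψ ε hε).continuousOn (hψ ε hε).boundary (hmodal ε hε) ?_
      (hR' ε hε _ (hψ ε hε).initial_deriv) (hreg ε hε).hsBound
    exact hR.congr fun l => sineCoeff_congr
      (fun x hx => ((hψ ε hε).initial x (Ioo_subset_Icc_self hx)).symm) l
  set A : ℝ := max (√(2 / (b - a)) * K) ((mu a b 1 ^ (m - (m - 1)))⁻¹ * B₁) with hAdef
  obtain ⟨C₃, hC₃, hcomp⟩ := exists_hsBound_comp hab (by omega : 1 ≤ m) hF (nonlin_neg f) A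
  refine ⟨K, max (max |B₁| |C₃ * (1 + B₁)|) |R|, hK0.le, by positivity, fun ε hε => ?_⟩
  exact
    { regular := hreg ε hε
      regular_limit := hs
      close := by
        intro M hM
        have hε2 : 0 < ε ^ 2 := by have := hε.1; positivity
        refine le_of_ae_le_of_continuousOn hT (continuousOn_gridH1 fun j hj => ?_) ?_
        · exact ((hψ ε hε).timeDeriv.continuousOn_time hT.le (grid_mem_Icc hab hM hj)).sub
            (hψs.timeDeriv.continuousOn_time hT.le (grid_mem_Icc hab hM hj))
        · filter_upwards [ae_isH1_of_timeSup_le hab le_rfl (h₁ ε hε).2.2.2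
            (mul_lt_mul_of_pos_right hC₁ hε2) (mul_pos hK0 hε2) (hcont fun t ht =>
              ((hψ ε hε).continuousOn t ht).sub (hψs.continuousOn t ht))] with t ht
          exact ht.gridH1_le hab (by positivity) hM
      modal := hmodal ε hε
      continuousOn_velocity := (hψ ε hε).continuousOn_deriv 0 (left_mem_Icc.2 hT.le)
      hsBound := fun t ht => (hsol ε hε t ht).mono
        ((le_abs_self _).trans ((le_max_left _ _).trans (le_max_left _ _)))
      hsBound_comp := fun t ht => (hcomp _ _ ((hψ ε hε).continuousOn t ht) ((hψ ε hε).boundary t ht).1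
        ((hψ ε hε).boundary t ht).2 (((hreg ε hε).hsBound t ht).mono (le_max_left _ _))
        (((hsol ε hε t ht).of_le hab (Nat.sub_le m 1)).mono (le_max_right _ _)) (hsol ε hε t ht)).mono
        ((le_abs_self _).trans ((le_max_right _ _).trans (le_max_left _ _)))
      hsBound_velocity := (hR' ε hε _ (hψ ε hε).initial_deriv).mono
        ((le_abs_self _).trans (le_max_right _ _)) }

/-- A continuous function dominated almost everywhere is dominated at every point of a set contained
in the closure of its interior. It gives meaning to the essential supremum at single grid points. -/
theorem enorm_le_eLpNorm_top {g : ℝ × ℝ → ℂ} {s : Set (ℝ × ℝ)} (hg : ContinuousOn g s)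
    (hs : s ⊆ closure (interior s)) {p : ℝ × ℝ} (hp : p ∈ s) :
    ‖g p‖ₑ ≤ eLpNorm g ⊤ (volume.restrict s) := by
  have h := Measure.eqOn_of_ae_eq (μ := volume) (s := s)
    (f := fun q => max ‖g q‖ₑ (eLpNorm g ⊤ (volume.restrict s)))
    (g := fun _ => eLpNorm g ⊤ (volume.restrict s)) ?_ (hg.enorm.sup continuousOn_const)
    continuousOn_const hs hp
  · exact max_eq_right_iff.1 h
  · rw [eLpNorm_exponent_top]
    filter_upwards [ae_le_eLpNormEssSup (f := g) (μ := volume.restrict s)] with q hq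
    exact max_eq_right hq

theorem IsRegular.continuousOn_prod {K L : ℝ} {u v : ℝ → ℝ → ℂ} (h : IsRegular a b T K L u v) :
    ContinuousOn (fun p : ℝ × ℝ => u p.1 p.2) (Icc 0 T ×ˢ Icc a b) := by
  refine continuousOn_prod_of_continuousOn_lipschitzOnWith _ (Real.toNNReal (√(b - a) * K))
    h.continuousOn (fun x hx => ?_)
  refine LipschitzOnWith.of_dist_le_mul fun s hs t ht => ?_
  rw [dist_eq_norm, dist_eq_norm, Real.norm_eq_abs]
  exact (h.norm_sub_le hx ht hs).trans
    (mul_le_mul_of_nonneg_right (Real.le_coe_toNNReal _) (abs_nonneg _))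

theorem IsRegular.enorm_le {K L : ℝ} {u v : ℝ → ℝ → ℂ} (hab : a < b) (hT : 0 < T)
    (h : IsRegular a b T K L u v) {t x : ℝ} (ht : t ∈ Icc 0 T) (hx : x ∈ Ioo a b) :
    ‖u t x‖ₑ ≤ eLpNorm (fun p : ℝ × ℝ => u p.1 p.2) ⊤ (volume.restrict (Icc 0 T ×ˢ Ioo a b)) := by
  refine enorm_le_eLpNorm_top (p := (t, x))
    (h.continuousOn_prod.mono (prod_mono_right Ioo_subset_Icc_self)) ?_ ⟨ht, hx⟩
  rw [interior_prod_eq, closure_prod_eq, interior_Icc, interior_Ioo, closure_Ioo hT.ne,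
    closure_Ioo hab.ne]
  exact prod_mono_right Ioo_subset_Icc_self

/-- The uniform rate of the temporal error. -/
theorem min_le_rpow {ε τ α : ℝ} (hε : 0 < ε) (hτ : 0 < τ) (hτ1 : τ ≤ 1) (hα₂ : α < 2) :
    min (τ ^ 2 / ε ^ (2 - α)) (τ ^ 2 + ε ^ 2) ≤ 2 * τ ^ (4 / (4 - α)) := by
  have h4 : 0 < 4 - α := by linarith
  have hp : 0 < τ ^ (4 / (4 - α)) := Real.rpow_pos_of_pos hτ _
  -- The threshold `ε = τ^{2/(4-α)}` is where `τ²/ε^{2-α}` and `ε²` are equal; both then have the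
  -- value `τ^{4/(4-α)}`.
  rcases le_total (τ ^ (2 / (4 - α))) ε with h | h
  · refine (min_le_left _ _).trans ?_
    have h1 : τ ^ (2 / (4 - α) * (2 - α)) ≤ ε ^ (2 - α) := by
      rw [Real.rpow_mul hτ.le]
      exact Real.rpow_le_rpow (Real.rpow_nonneg hτ.le _) h (by linarith)
    have h2 : τ ^ 2 = τ ^ (4 / (4 - α)) * τ ^ (2 / (4 - α) * (2 - α)) := by
      rw [← Real.rpow_add hτ, ← Real.rpow_natCast]
      congr 1
      push_cast
      field_simp
      ring
    rw [div_le_iff₀ (Real.rpow_pos_of_pos hε _), h2]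
    have := mul_le_mul_of_nonneg_left h1 hp.le
    have := mul_pos hp (Real.rpow_pos_of_pos hε (2 - α))
    linarith
  · refine (min_le_right _ _).trans ?_
    have h1 : ε ^ 2 ≤ τ ^ (4 / (4 - α)) := by
      calc ε ^ 2 ≤ (τ ^ (2 / (4 - α))) ^ 2 := pow_le_pow_left₀ hε.le h 2
        _ = τ ^ (4 / (4 - α)) := by
          rw [← Real.rpow_natCast, ← Real.rpow_mul hτ.le]
          congr 1
          push_cast
          ring
    have h2 : τ ^ 2 ≤ τ ^ (4 / (4 - α)) := by
      rw [← Real.rpow_natCast]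
      refine Real.rpow_le_rpow_of_exponent_ge hτ hτ1 ?_
      rw [div_le_iff₀ h4]
      push_cast
      linarith
    linarith

theorem linfNorm_le {M : ℕ} {u : ℕ → ℂ} {X : ENNReal} (h : ∀ j ∈ Finset.Ioo 0 M, ‖u j‖ₑ ≤ X) :
    (linfNorm M u : ENNReal) ≤ X := by
  induction X using ENNReal.recTopCoe with
  | top => exact le_top
  | coe X =>
    rw [ENNReal.coe_le_coe]
    exact Finset.sup_le fun j hj => by simpa [enorm_eq_nnnorm] using h j hj

end UniformBounds

end EWISP

theorem theorem2
    (a b : ℝ) (hab : a < b)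
    (f : ℝ → ℝ) (k : ℕ) (hk : 3 ≤ k) (hf : ContDiffOn ℝ k f (Set.Ici 0))
    (m₀ : ℕ) (hm₀ : 2 ≤ m₀)
    (α : ℝ) (hα₀ : 0 ≤ α) (hα₂ : α < 2)
    (T : ℝ) (hT : 0 < T)
    (ψ₀ : ℝ → ℂ) (ω : ℝ → ℝ → ℂ)
    (ψ ψt ψtt : ℝ → ℝ → ℝ → ℂ) (ψs ψst ψstt : ℝ → ℝ → ℂ)
    (hψ : ∀ ε ∈ Set.Ioc (0 : ℝ) 1,
      EWISP.IsNLSWSolution a b T f ε ψ₀ (EWISP.initVelocity f α ε ψ₀ (ω ε)) (ψ ε) (ψt ε) (ψtt ε))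
    (hψs : EWISP.IsNLSSolution a b T f ψ₀ ψs ψst)
    (hψstt : EWISP.IsTimeDeriv a b T ψst ψstt)
    (hA : EWISP.AssumptionA a b m₀ ψ₀ ω)
    (hB : EWISP.AssumptionB a b T α m₀ ψ ψt ψtt ψs ψst ψstt) :
    ∃ τ₀ h₀ C : ℝ, 0 < τ₀ ∧ τ₀ ≤ 1 ∧ 0 < h₀ ∧ h₀ / Real.pi ≤ 1 ∧ 0 < C ∧
      ∀ ε ∈ Set.Ioc (0 : ℝ) 1, ∀ M : ℕ, 1 ≤ M → ∀ h : ℝ, h = EWISP.mesh a b M → h ≤ h₀ →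
      ∀ τ : ℝ, 0 < τ → τ ≤ τ₀ →
      ∀ Ψ : ℕ → ℕ → ℂ,
        EWISP.IsEWISP a b f ε τ M ψ₀ (EWISP.initVelocity f α ε ψ₀ (ω ε)) Ψ →
      ∀ n : ℕ, (n : ℝ) ≤ T / τ → ∀ m : ℕ, m = min m₀ k →
        (EWISP.errL2 a b M (ψ ε (n * τ)) (Ψ n)
            ≤ ENNReal.ofReal (C * (h ^ m + τ ^ 2 / ε ^ (2 - α))) ∧
          EWISP.errH1 a b M (ψ ε (n * τ)) (Ψ n)
            ≤ ENNReal.ofReal (C * (h ^ (m - 1) + τ ^ 2 / ε ^ (2 - α)))) ∧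
        (EWISP.errL2 a b M (ψ ε (n * τ)) (Ψ n)
            ≤ ENNReal.ofReal (C * (h ^ m + τ ^ 2 + ε ^ 2)) ∧
          EWISP.errH1 a b M (ψ ε (n * τ)) (Ψ n)
            ≤ ENNReal.ofReal (C * (h ^ (m - 1) + τ ^ 2 + ε ^ 2))) ∧
        (EWISP.linfNorm M (Ψ n) : ENNReal) ≤ EWISP.M₁ a b T ψ ψs + 1 ∧
        (EWISP.errL2 a b M (ψ ε (n * τ)) (Ψ n)
            ≤ ENNReal.ofReal (C * (h ^ m + τ ^ (4 / (4 - α)))) ∧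
          EWISP.errH1 a b M (ψ ε (n * τ)) (Ψ n)
            ≤ ENNReal.ofReal (C * (h ^ (m - 1) + τ ^ (4 / (4 - α))))) := by
  obtain ⟨K, B, hK, hB0, hsol⟩ :=
    EWISP.exists_isBoundedSolution hab hk hf hm₀ hα₀ hα₂ hT hψ hψs hψstt hA hB
  have hm2 : 2 ≤ min m₀ k := le_min hm₀ (by omega)
  obtain ⟨C, δ, hC, hδ, hδ1, hconv⟩ :=
    EWISP.exists_convergence hab hT hk hm2 hf hK hB0
  set c : ℝ := √((b - a) / 2) with hc
  have hc0 : 0 ≤ c := Real.sqrt_nonneg _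
  -- `c` comes from Parseval, `C` from convergence of the coefficients and `B` from the truncated
  -- tail; the factor `2` allows for `Λ ≤ 2 X` below, and `1` ensures positivity.
  refine ⟨δ, δ, 1 + 2 * (c * (C + B)), hδ, hδ1, hδ,
    (div_le_one Real.pi_pos).2 (by linarith [Real.two_le_pi]), by positivity, ?_⟩
  rintro ε hε M hM h rfl hh τ hτ hτδ Ψ hΨ n hn m rfl
  have hnT : (n : ℝ) * τ ≤ T := (le_div_iff₀ hτ).1 hn
  have ht : (n : ℝ) * τ ∈ Set.Icc 0 T := ⟨by positivity, hnT⟩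
  have hS := hsol ε hε
  obtain ⟨herr, hsup⟩ := hconv ε _ τ _ _ _ _ _ _ Ψ M hε (EWISP.sq_le_rpow hε hα₀)
    (EWISP.rpow_le_one_of_mem hε hα₂) hS hΨ (hψ ε hε).initial (hψ ε hε).initial_deriv hM hh hτ hτδ n hnT
  set Λ : ℝ := min (τ ^ 2 / ε ^ (2 - α)) (τ ^ 2 + ε ^ 2) with hΛ
  have hmesh := EWISP.mesh_pos hab hM
  have h0 := herr 0 zero_le_one
  have h1 := herr 1 le_rfl
  simp only [EWISP.coeffErr, pow_zero, one_smul, pow_one, Nat.sub_zero] at h0 h1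
  have e0 := EWISP.errL2_le hab hM hm2 (hS.regular.continuousOn _ ht) (hS.regular.boundary _ ht).1
    (hS.regular.boundary _ ht).2 (hS.hsBound _ ht) h0
  have e1 := EWISP.errH1_le hab hM hm2 (hS.regular.continuousOn _ ht) (hS.regular.boundary _ ht).1
    (hS.regular.boundary _ ht).2 (hS.hsBound _ ht) h1
  -- One bound in terms of the minimum `Λ` implies all three pairs of error estimates; they differ
  -- only in the quantity `X` that dominates `Λ`.
  have hle : ∀ η X : ℝ, 0 ≤ η → 0 ≤ X → Λ ≤ 2 * X →
      ENNReal.ofReal (c * (C * (η + Λ) + η * B))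
        ≤ ENNReal.ofReal ((1 + 2 * (c * (C + B))) * (η + X)) := by
    intro η X hη hX hΛX
    refine ENNReal.ofReal_le_ofReal ?_
    have p1 : c * C * Λ ≤ c * C * (2 * X) := mul_le_mul_of_nonneg_left hΛX (by positivity)
    have p2 : 0 ≤ c * C * η := by positivity
    have p3 : 0 ≤ c * B * η := by positivity
    have p4 : 0 ≤ c * B * X := by positivity
    linarith
  have hη : ∀ s : ℕ, 0 ≤ EWISP.mesh a b M ^ s := fun s => (pow_pos hmesh s).le
  have hX1 : 0 ≤ τ ^ 2 / ε ^ (2 - α) := div_nonneg (sq_nonneg _) (Real.rpow_nonneg hε.1.le _)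
  have hX2 : 0 ≤ τ ^ 2 + ε ^ 2 := by positivity
  have hX3 : 0 ≤ τ ^ (4 / (4 - α)) := Real.rpow_nonneg hτ.le _
  have hΛ1 : Λ ≤ 2 * (τ ^ 2 / ε ^ (2 - α)) := (min_le_left _ _).trans (by linarith)
  have hΛ2 : Λ ≤ 2 * (τ ^ 2 + ε ^ 2) := (min_le_right _ _).trans (by linarith)
  have hΛ3 := EWISP.min_le_rpow hε.1 hτ (hτδ.trans hδ1) hα₂
  simp only [add_assoc]
  refine ⟨⟨e0.trans (hle _ _ (hη _) hX1 hΛ1), e1.trans (hle _ _ (hη _) hX1 hΛ1)⟩,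
    ⟨e0.trans (hle _ _ (hη _) hX2 hΛ2), e1.trans (hle _ _ (hη _) hX2 hΛ2)⟩, ?_,
    e0.trans (hle _ _ (hη _) hX3 hΛ3), e1.trans (hle _ _ (hη _) hX3 hΛ3)⟩
  -- At a grid point the solution is at most its essential supremum, by continuity, and the
  -- numerical value lies within distance one of it.
  refine EWISP.linfNorm_le fun j hj => ?_
  have hj' : j ≤ M := (Finset.mem_Ioo.1 hj).2.le
  have hx := EWISP.grid_mem_Ioo hab hj
  calc ‖Ψ n j‖ₑ ≤ ‖ψ ε (n * τ) (EWISP.grid a b M j)‖ₑ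
        + ‖Ψ n j - ψ ε (n * τ) (EWISP.grid a b M j)‖ₑ := by
        refine le_trans (le_of_eq ?_) (enorm_add_le _ _)
        rw [add_sub_cancel]
    _ ≤ EWISP.M₁ a b T ψ ψs + 1 := by
        refine add_le_add ?_ ?_
        · refine (hS.regular.enorm_le hab hT ht hx).trans (le_max_of_le_left ?_)
          exact le_iSup₂ (f := fun ε _ => eLpNorm (fun p : ℝ × ℝ => ψ ε p.1 p.2) ⊤
            (volume.restrict (Set.Icc 0 T ×ˢ Set.Ioo a b))) ε hε
        · rw [← ofReal_norm]
          exact ENNReal.ofReal_le_one.2 (hsup j hj')
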